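/- Let $k$ be a field, let $F,G$ be abelian groups, $\tau_0:F\times G\to k^\times$ a bimultiplicative map, $I$ a set, and $f_i\in F$, $g_i\in G$ for $i\in I$. We write $fg$ for $(f,g)\in F\times G$, and $\widehat g_i(f)=\tau_0(f,g_i)$, $\widehat f_i(g)=\tau_0(f_i,g)$; these are characters of $F$ and $G$, and $\widehat g_i\widehat f_i$ is the character $fg\mapsto\tau_0(f,g_i)\tau_0(f_i,g)$ of $F\times G$. For an abelian group $\Gamma$, a character $\chi$ and $\gamma\in\Gamma$, $(kv;\chi,\gamma)$ is the one-dimensional Yetter–Drinfeld module over $k\Gamma$ with action $h\cdot v=\chi(h)v$ and coaction $v\mapsto\gamma\otimes v$. Let $$V=\bigoplus_{i\in I}(kv_i;\widehat g_i,f_i)\ \text{ over } F,\qquad W=\bigoplus_{i\in I}(kw_i;\widehat f_i^{-1},g_i)\ \text{ over } G .$$ For a Yetter–Drinfeld module $M$ over $k\Gamma$, $\mathfrak B(M)$ is its Nichols algebra (the quotient of the tensor algebra $T(M)$ by its largest homogeneous braided Hopf ideal that meets $M$ trivially), and $\mathfrak B(M)\rtimes\Gamma$ is its bosonization. Let $B=\mathfrak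 B(V)\rtimes F$ and $H=\mathfrak B(W)\rtimes G$. The generalized quantum double $\mathcal D$ is the Hopf algebra generated by the Hopf subalgebras $B$ and $H$ with the relations ($f\in F$, $g\in G$, $i,j\in I$) $$gf=fg,\quad gv_i=\tau_0(f_i,g)v_ig,\quad w_if=\tau_0(f,g_i)fw_i,\quad w_jv_i=\tau_0(f_i,g_j)v_iw_j+\delta_{ij}(f_ig_i-1).$$ A Hopf ideal $\mathfrak a$ of $\mathcal D$ is called thin if $V\cap\mathfrak a=0=W\cap\mathfrak a$. Let $C=\{t\in F\times G\mid(\widehat g_i\widehat f_i)(t)=1\text{ for all }i\in I\}$. For a subgroup $T\subset C$ let $\Gamma=(F\times G)/T$, $I_T=\{i\in I\mid f_ig_i\in T\}$, $V_T=\bigoplus_{i\in I_T}kv_i$, $W_T=\bigoplus_{i\in I_T}kw_i$. The characters $\widehat g_i\widehat f_i$ factor through $\Gamma$, and $V=\bigoplus_i(kv_i;\widehat g_i\widehat f_i,\bar f_i)$, $W=\bigoplus_i(kw_i;(\widehat g_i\widehat f_i)^{-1},\bar g_i)$ are Yetter–Drinfeld modules over $k\Gamma$, where $\bar f_i,\bar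 g_i$ are the images of $f_i,g_i$ in $\Gamma$. Given $T$, a Yetter–Drinfeld submodule $Z\subset V_T$ over $k\Gamma$ and an injective morphism $\zeta:Z\to W_T$ of Yetter–Drinfeld modules over $k\Gamma$, let $\mathfrak a(T,Z,\zeta)$ be the two-sided ideal of $\mathcal D$ generated by all $t-1$ ($t\in T$) and all $z-\zeta(z)$ ($z\in Z$). Let $U=(V\oplus W)/\{z-\zeta(z)\mid z\in Z\}$. The Hopf algebra $\mathcal A(T,Z,\zeta)$ is a deformation of $\mathfrak B(U)\rtimes\Gamma$ by a $2$-cocycle $\sigma$ (same coalgebra, product $x\cdot_\sigma y=\sigma(x_1,y_1)\,x_2y_2\,\sigma^{-1}(x_3,y_3)$) such that, for all $i,j\in I\setminus I_T$, the relation $w_jv_i=\tau_0(f_i,g_j)v_iw_j$ is deformed to $$w_jv_i=\tau_0(f_i,g_j)v_iw_j+\delta_{ij}(\bar f_i\bar g_i-1).$$ **Theorem 5.4.** Assume that for every $i\in I$, $\widehat f_i\neq1$ or $\widehat g_i\neq1$ (that is, $\widehat g_i\widehat f_i\neq1$ as a character of $F\times G$). Then every thin Hopf ideal $\mathfrak a$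 of $\mathcal D$ is of the form $\mathfrak a=\mathfrak a(T,Z,\zeta)$ for some $T,Z,\zeta$ as above. Moreover, whenever $\mathfrak a=\mathfrak a(T,Z,\zeta)$, there are a $2$-cocycle $\sigma$ for $\mathfrak B(U)\rtimes\Gamma$ as above, with deformed Hopf algebra $\mathcal A(T,Z,\zeta)$, and an isomorphism of Hopf algebras $\mathcal D/\mathfrak a\cong\mathcal A(T,Z,\zeta)$ that is induced by the natural maps $F\times G\to\Gamma$ and $V\oplus W\to U$. -/

import Mathlib

open scoped TensorProduct

noncomputable section

/-- A Yetter-Drinfeld module over the group algebra `k Γ` of a commutative group `Γ`, on the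
vector space `M`: a `k Γ`-module (a representation of `Γ`) that is also a left `k Γ`-comodule
`ρ : M → k Γ ⊗ M`.  The compatibility `ρ (h ▷ v) = h v₋₁ h⁻¹ ⊗ h ▷ v₀` reads
`ρ (h ▷ v) = v₋₁ ⊗ h ▷ v₀`, since `Γ` is commutative. -/
structure YetterDrinfeld (k Γ M : Type*) [Field k] [CommGroup Γ] [AddCommGroup M]
    [Module k M] where
  /-- the action `h ▷ v` -/
  act : Representation k Γ M
  /-- the coaction `ρ v = v₋₁ ⊗ v₀` -/
  coact : M →ₗ[k] MonoidAlgebra k Γ ⊗[k] M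
  coassoc : (TensorProduct.assoc k (MonoidAlgebra k Γ) (MonoidAlgebra k Γ) M).toLinearMap ∘ₗ
      (Coalgebra.comul (R := k) (A := MonoidAlgebra k Γ)).rTensor M ∘ₗ coact =
    coact.lTensor (MonoidAlgebra k Γ) ∘ₗ coact
  counit : (TensorProduct.lid k M).toLinearMap ∘ₗ
      (Coalgebra.counit (R := k) (A := MonoidAlgebra k Γ)).rTensor M ∘ₗ coact = LinearMap.id
  compat : ∀ h : Γ, coact ∘ₗ act h = (act h).lTensor (MonoidAlgebra k Γ) ∘ₗ coact

namespace YetterDrinfeld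

section General

variable {k Γ M N : Type*} [Field k] [CommGroup Γ] [AddCommGroup M] [Module k M]
  [AddCommGroup N] [Module k N]

/-- The action of the whole group algebra. -/
def actLin (Y : YetterDrinfeld k Γ M) : MonoidAlgebra k Γ →ₗ[k] Module.End k M :=
  (MonoidAlgebra.lift k (Module.End k M) Γ Y.act).toLinearMap

@[simp] lemma actLin_single (Y : YetterDrinfeld k Γ M) (g : Γ) :
    Y.actLin (MonoidAlgebra.single g 1) = Y.act g := by
  simp [actLin]

/-- `N` is a subobject: a submodule stable under action and coaction. -/
structure IsSubobject (Y : YetterDrinfeld k Γ M) (N : Submodule k M) : Prop where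
  act_mem : ∀ (g : Γ), ∀ x ∈ N, Y.act g x ∈ N
  coact_mem : ∀ x ∈ N,
    Y.coact x ∈ LinearMap.range (N.subtype.lTensor (MonoidAlgebra k Γ))

/-- `v` is homogeneous of degree `γ` for the `Γ`-grading given by the coaction. -/
def IsHomog (Y : YetterDrinfeld k Γ M) (γ : Γ) (v : M) : Prop :=
  Y.coact v = MonoidAlgebra.single γ 1 ⊗ₜ[k] v

/-- the coefficient functional of a group algebra -/
def coeffFun (k : Type*) {Γ : Type*} [Field k] (γ : Γ) : MonoidAlgebra k Γ →ₗ[k] k :=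
  Finsupp.lapply γ ∘ₗ (MonoidAlgebra.coeffLinearEquiv k).toLinearMap

/-- the degree `γ` component of an element of `k Γ ⊗ M` -/
def slice (k M : Type*) {Γ : Type*} [Field k] [AddCommGroup M] [Module k M] (γ : Γ) :
    MonoidAlgebra k Γ ⊗[k] M →ₗ[k] M :=
  (TensorProduct.lid k M).toLinearMap ∘ₗ (coeffFun k γ).rTensor M

@[simp] lemma coeffFun_single {Γ : Type*} [DecidableEq Γ] (γ δ : Γ) (r : k) :
    coeffFun k γ (MonoidAlgebra.single δ r) = if δ = γ then r else 0 := by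
  simp [coeffFun, Finsupp.single_apply]

lemma slice_coact_homog (Y : YetterDrinfeld k Γ M) (v : M) (γ : Γ) :
    Y.IsHomog γ (slice k M γ (Y.coact v)) := by
  classical
  have h := congr($(Y.coassoc) v)
  simp only [LinearMap.comp_apply, LinearEquiv.coe_coe] at h
  have h2 := congr(slice k (MonoidAlgebra k Γ ⊗[k] M) γ $h)
  have e1 : ∀ t : MonoidAlgebra k Γ ⊗[k] M,
      slice k (MonoidAlgebra k Γ ⊗[k] M) γ (Y.coact.lTensor _ t) = Y.coact (slice k M γ t) := by
    intro t
    induction t with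
    | zero => simp
    | tmul a b => simp [slice]
    | add a b ha hb => simp only [map_add, ha, hb]
  have e2 : ∀ t : MonoidAlgebra k Γ ⊗[k] M,
      slice k (MonoidAlgebra k Γ ⊗[k] M) γ (TensorProduct.assoc k _ _ M
        ((Coalgebra.comul (R := k) (A := MonoidAlgebra k Γ)).rTensor M t)) =
      MonoidAlgebra.single γ 1 ⊗ₜ slice k M γ t := by
    intro t
    induction t with
    | zero => simp
    | tmul a b =>
      induction a using MonoidAlgebra.induction_linear with
      | zero => simp
      | single δ r =>
        by_cases hd : δ = γ
        · subst hd
          have : (MonoidAlgebra.single δ r : MonoidAlgebra k Γ) = r • MonoidAlgebra.single δ 1 := by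
            simp
          rw [this]
          simp only [← TensorProduct.smul_tmul', map_smul, TensorProduct.tmul_smul]
          simp [slice, TensorProduct.smul_tmul']
        · simp [slice, hd]
      | add x y hx hy =>
        simp only [TensorProduct.add_tmul, map_add, hx, hy, TensorProduct.tmul_add]
    | add a b ha hb => simp only [map_add, ha, hb, TensorProduct.tmul_add]
  rw [e1, e2] at h2
  exact h2.symm

/-- Every element is a sum of homogeneous ones. -/
lemma homog_induction (Y : YetterDrinfeld k Γ M) {p : M → Prop}
    (hom : ∀ γ v, Y.IsHomog γ v → p v) (add : ∀ v w, p v → p w → p (v + w)) (v : M) : p v := by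
  classical
  have zero : p 0 := hom 1 0 (by simp [IsHomog])
  have h := congr($(Y.counit) v)
  simp only [LinearMap.comp_apply, LinearEquiv.coe_coe, LinearMap.id_apply] at h
  have e : ∀ t : MonoidAlgebra k Γ ⊗[k] M, ∃ s : Finset Γ, ∀ s', s ⊆ s' →
      TensorProduct.lid k M ((Coalgebra.counit (R := k) (A := MonoidAlgebra k Γ)).rTensor M t) =
      ∑ γ ∈ s', slice k M γ t := by
    intro t
    induction t with
    | zero => exact ⟨∅, by simp⟩
    | tmul a b =>
      induction a using MonoidAlgebra.induction_linear with
      | zero => exact ⟨∅, by simp⟩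
      | single δ r =>
        refine ⟨{δ}, fun s' hs => ?_⟩
        have hd : δ ∈ s' := by simpa using hs
        simp [slice, ite_smul, hd]
      | add x y hx hy =>
        obtain ⟨s, hs⟩ := hx
        obtain ⟨s2, hs2⟩ := hy
        refine ⟨s ∪ s2, fun s' h => ?_⟩
        simp only [TensorProduct.add_tmul, map_add, Finset.sum_add_distrib]
        rw [hs s' (Finset.union_subset_left h), hs2 s' (Finset.union_subset_right h)]
    | add a b ha hb =>
      obtain ⟨s, hs⟩ := ha
      obtain ⟨s2, hs2⟩ := hb
      refine ⟨s ∪ s2, fun s' h => ?_⟩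
      simp only [map_add, Finset.sum_add_distrib]
      rw [hs s' (Finset.union_subset_left h), hs2 s' (Finset.union_subset_right h)]
  obtain ⟨s, hs⟩ := e (Y.coact v)
  rw [← h, hs s subset_rfl]
  exact Finset.sum_induction _ p (fun _ _ => add _ _) zero
    (fun γ _ => hom γ _ (Y.slice_coact_homog v γ))

lemma IsHomog.act {Y : YetterDrinfeld k Γ M} {γ : Γ} {v : M} (hv : Y.IsHomog γ v) (g : Γ) :
    Y.IsHomog γ (Y.act g v) := by
  have := congr($(Y.compat g) v)
  simp only [LinearMap.comp_apply] at this
  rw [IsHomog, this, hv]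
  simp

/-! ### The tensor algebra as an object of the category -/

/-- The extension of the action of `g` to an algebra automorphism of `T(M)`. -/
def actAlg (Y : YetterDrinfeld k Γ M) (g : Γ) : TensorAlgebra k M →ₐ[k] TensorAlgebra k M :=
  TensorAlgebra.lift k (TensorAlgebra.ι k ∘ₗ Y.act g)

/-- The extension of the coaction to an algebra map `T(M) → k Γ ⊗ T(M)`. -/
def coactAlg (Y : YetterDrinfeld k Γ M) :
    TensorAlgebra k M →ₐ[k] MonoidAlgebra k Γ ⊗[k] TensorAlgebra k M :=
  TensorAlgebra.lift k ((TensorAlgebra.ι k).lTensor (MonoidAlgebra k Γ) ∘ₗ Y.coact)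

@[simp] lemma actAlg_ι (Y : YetterDrinfeld k Γ M) (g : Γ) (v : M) :
    Y.actAlg g (TensorAlgebra.ι k v) = TensorAlgebra.ι k (Y.act g v) := by
  simp [actAlg]

@[simp] lemma coactAlg_ι (Y : YetterDrinfeld k Γ M) (v : M) :
    Y.coactAlg (TensorAlgebra.ι k v) =
      (TensorAlgebra.ι k).lTensor (MonoidAlgebra k Γ) (Y.coact v) := by
  simp [coactAlg]

lemma actAlg_one (Y : YetterDrinfeld k Γ M) : Y.actAlg 1 = AlgHom.id k _ := by
  ext v; simp

lemma actAlg_mul (Y : YetterDrinfeld k Γ M) (g h : Γ) :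
    Y.actAlg (g * h) = (Y.actAlg g).comp (Y.actAlg h) := by
  ext v; simp

/-- The tensor algebra `T(M)` as a Yetter-Drinfeld module; action and coaction are
multiplicative. -/
def tensor (Y : YetterDrinfeld k Γ M) : YetterDrinfeld k Γ (TensorAlgebra k M) where
  act :=
    { toFun := fun g => (Y.actAlg g).toLinearMap
      map_one' := by rw [Y.actAlg_one]; rfl
      map_mul' := fun g h => by rw [Y.actAlg_mul]; rfl }
  coact := Y.coactAlg.toLinearMap
  coassoc := by
    have : (Algebra.TensorProduct.assoc k k k (MonoidAlgebra k Γ) (MonoidAlgebra k Γ)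
        (TensorAlgebra k M)).toAlgHom.comp ((Algebra.TensorProduct.map
          (Bialgebra.comulAlgHom k (MonoidAlgebra k Γ)) (AlgHom.id k _)).comp Y.coactAlg) =
        (Algebra.TensorProduct.map (AlgHom.id k _) Y.coactAlg).comp Y.coactAlg := by
      ext v
      induction v using Y.homog_induction with
      | hom γ v hv =>
        rw [IsHomog] at hv
        simp [hv]
      | add v w h1 h2 => simp only [map_add, h1, h2]
    exact congr(($this).toLinearMap)
  counit := by
    have : (Algebra.TensorProduct.lid k (TensorAlgebra k M)).toAlgHom.comp
        ((Algebra.TensorProduct.map (Bialgebra.counitAlgHom k (MonoidAlgebra k Γ))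
          (AlgHom.id k _)).comp Y.coactAlg) = AlgHom.id k _ := by
      ext v
      induction v using Y.homog_induction with
      | hom γ v hv =>
        rw [IsHomog] at hv
        simp [hv]
      | add v w h1 h2 => simp only [map_add, h1, h2]
    exact congr(($this).toLinearMap)
  compat := fun g => by
    have : Y.coactAlg.comp (Y.actAlg g) =
        (Algebra.TensorProduct.map (AlgHom.id k _) (Y.actAlg g)).comp Y.coactAlg := by
      ext v
      induction v using Y.homog_induction with
      | hom γ v hv =>
        have h2 := hv.act g
        rw [IsHomog] at hv h2
        simp [hv, h2]
      | add v w h1 h2 => simp only [map_add, h1, h2]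
    exact congr(($this).toLinearMap)

lemma tensor_act_apply (Y : YetterDrinfeld k Γ M) (g : Γ) (x : TensorAlgebra k M) :
    Y.tensor.act g x = Y.actAlg g x := rfl

lemma tensor_coact_apply (Y : YetterDrinfeld k Γ M) (x : TensorAlgebra k M) :
    Y.tensor.coact x = Y.coactAlg x := rfl

/-! ### The braided Hopf algebra structure of the tensor algebra -/

/-- Left multiplication by `v ⊗ 1 + 1 ⊗ v` in the braided tensor product algebra
`T(M) ⊗ T(M)`, for `v : M`.  The braided product is
`(a ⊗ b) (a' ⊗ b') = a (b₋₁ ▷ a') ⊗ b₀ b'`, so the operator is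
`a ⊗ b ↦ v a ⊗ b + (v₋₁ ▷ a) ⊗ v₀ b`. -/
def primLeftMul (Y : YetterDrinfeld k Γ M) :
    M →ₗ[k] Module.End k (TensorAlgebra k M ⊗[k] TensorAlgebra k M) :=
  LinearMap.rTensorHom (TensorAlgebra k M) ∘ₗ LinearMap.mul k (TensorAlgebra k M) ∘ₗ
      TensorAlgebra.ι k +
    TensorProduct.homTensorHomMap (RingHom.id k) _ _ _ _ ∘ₗ
      TensorProduct.map Y.tensor.actLin (LinearMap.mul k (TensorAlgebra k M) ∘ₗ TensorAlgebra.ι k) ∘ₗ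
      Y.coact

/-- The braided coproduct of `T(M)`: the algebra map into the braided tensor product algebra
`T(M) ⊗ T(M)` with `v ↦ v ⊗ 1 + 1 ⊗ v` for `v : M`.  It is written through left
multiplication operators: the product `v₁ ⋯ vₙ` goes to
`(v₁ ⊗ 1 + 1 ⊗ v₁) ⋯ (vₙ ⊗ 1 + 1 ⊗ vₙ) (1 ⊗ 1)`. -/
def braidedComul (Y : YetterDrinfeld k Γ M) :
    TensorAlgebra k M →ₗ[k] TensorAlgebra k M ⊗[k] TensorAlgebra k M :=
  (LinearMap.applyₗ (1 ⊗ₜ[k] 1)) ∘ₗ (TensorAlgebra.lift k Y.primLeftMul).toLinearMap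

/-- The operator `a ↦ - (v₋₁ ▷ a) v₀` on `T(M)`, for `v : M`. -/
def antipodeOp (Y : YetterDrinfeld k Γ M) : M →ₗ[k] Module.End k (TensorAlgebra k M) :=
  - (TensorProduct.lift ((LinearMap.llcomp k _ _ _).flip ∘ₗ Y.tensor.actLin) ∘ₗ
      TensorProduct.map LinearMap.id
        ((LinearMap.mul k (TensorAlgebra k M)).flip ∘ₗ TensorAlgebra.ι k) ∘ₗ Y.coact)

/-- The braided antipode of `T(M)`: the map with `v ↦ -v` for `v : M` and
`S (x y) = S (x₋₁ ▷ y) S (x₀)`, whence `S (v x) = - (v₋₁ ▷ S x) v₀` and `S 1 = 1`. -/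
def braidedAntipode (Y : YetterDrinfeld k Γ M) : TensorAlgebra k M →ₗ[k] TensorAlgebra k M :=
  (LinearMap.applyₗ 1) ∘ₗ (TensorAlgebra.lift k Y.antipodeOp).toLinearMap

variable {Y : YetterDrinfeld k Γ M}

lemma primLeftMul_homog {γ : Γ} {v : M} (hv : Y.IsHomog γ v) (a b : TensorAlgebra k M) :
    Y.primLeftMul v (a ⊗ₜ b) =
      (TensorAlgebra.ι k v * a) ⊗ₜ b + Y.actAlg γ a ⊗ₜ (TensorAlgebra.ι k v * b) := by
  rw [IsHomog] at hv
  simp [primLeftMul, hv, tensor_act_apply]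

lemma antipodeOp_homog {γ : Γ} {v : M} (hv : Y.IsHomog γ v) (a : TensorAlgebra k M) :
    Y.antipodeOp v a = - (Y.actAlg γ a * TensorAlgebra.ι k v) := by
  rw [IsHomog] at hv
  simp [antipodeOp, hv, tensor_act_apply]

@[simp] lemma braidedComul_one (Y : YetterDrinfeld k Γ M) : Y.braidedComul 1 = 1 ⊗ₜ 1 := by
  simp [braidedComul]

lemma braidedComul_ι_mul (Y : YetterDrinfeld k Γ M) (v : M) (x : TensorAlgebra k M) :
    Y.braidedComul (TensorAlgebra.ι k v * x) = Y.primLeftMul v (Y.braidedComul x) := by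
  simp [braidedComul]

@[simp] lemma braidedAntipode_one (Y : YetterDrinfeld k Γ M) : Y.braidedAntipode 1 = 1 := by
  simp [braidedAntipode]

lemma braidedAntipode_ι_mul (Y : YetterDrinfeld k Γ M) (v : M) (x : TensorAlgebra k M) :
    Y.braidedAntipode (TensorAlgebra.ι k v * x) = Y.antipodeOp v (Y.braidedAntipode x) := by
  simp [braidedAntipode]

/-- Induction on the length of a tensor, adding homogeneous factors on the left. -/
lemma tensor_induction (Y : YetterDrinfeld k Γ M) {p : TensorAlgebra k M → Prop} (one : p 1)
    (smul : ∀ (r : k) x, p x → p (r • x)) (add : ∀ x y, p x → p y → p (x + y))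
    (mul : ∀ γ v x, Y.IsHomog γ v → p x → p (TensorAlgebra.ι k v * x)) (x) : p x := by
  suffices h : ∀ y, p y → p (x * y) by simpa using h 1 one
  induction x using TensorAlgebra.induction with
  | algebraMap r => intro y hy; rw [← Algebra.smul_def]; exact smul _ _ hy
  | ι v =>
    intro y hy
    induction v using Y.homog_induction with
    | hom γ v hv => exact mul γ v y hv hy
    | add v w h1 h2 => rw [map_add, add_mul]; exact add _ _ h1 h2
  | mul a b ha hb => intro y hy; rw [mul_assoc]; exact ha _ (hb _ hy)
  | add a b ha hb => intro y hy; rw [add_mul]; exact add _ _ (ha _ hy) (hb _ hy)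

/-- `I` is a braided Hopf ideal of `T(M)`: a two-sided ideal that is a subobject, a coideal
for the braided coproduct, and stable under the braided antipode. -/
structure IsBraidedHopfIdeal (Y : YetterDrinfeld k Γ M) (I : Ideal (TensorAlgebra k M)) :
    Prop where
  mul_mem_right : ∀ x ∈ I, ∀ b, x * b ∈ I
  subobject : Y.tensor.IsSubobject (I.restrictScalars k)
  counit_eq_zero : ∀ x ∈ I, TensorAlgebra.algebraMapInv (R := k) x = 0
  comul_mem : ∀ x ∈ I, Y.braidedComul x ∈
    LinearMap.range ((I.restrictScalars k).subtype.lTensor (TensorAlgebra k M)) ⊔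
    LinearMap.range ((I.restrictScalars k).subtype.rTensor (TensorAlgebra k M))
  antipode_mem : ∀ x ∈ I, Y.braidedAntipode x ∈ I

/-- The defining ideals of the pre-Nichols algebras of `M`: the braided Hopf ideals of `T(M)`
that are homogeneous for the grading of `T(M)` by tensor degree and meet `M` trivially. -/
structure IsPreNicholsIdeal (Y : YetterDrinfeld k Γ M) (I : Ideal (TensorAlgebra k M)) :
    Prop extends Y.IsBraidedHopfIdeal I where
  homogeneous : I.IsHomogeneous (fun n : ℕ =>
    (LinearMap.range (TensorAlgebra.ι k : M →ₗ[k] TensorAlgebra k M)) ^ n)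
  inf_eq_bot : I.restrictScalars k ⊓ LinearMap.range (TensorAlgebra.ι k) = ⊥

/-- The defining ideal of the Nichols algebra of `M`: the largest (that is, the sum of all)
of the ideals that define pre-Nichols algebras. -/
def nicholsIdeal (Y : YetterDrinfeld k Γ M) : Ideal (TensorAlgebra k M) :=
  ⨆ I : {I : Ideal (TensorAlgebra k M) // Y.IsPreNicholsIdeal I}, I.1

@[elab_as_elim]
lemma nicholsIdeal_induction {p : TensorAlgebra k M → Prop}
    (mem : ∀ I, Y.IsPreNicholsIdeal I → ∀ x ∈ I, p x) (zero : p 0)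
    (add : ∀ x y, p x → p y → p (x + y)) {x} (hx : x ∈ Y.nicholsIdeal) : p x :=
  Submodule.iSup_induction (motive := p) _ hx (fun I => mem I.1 I.2) zero add

lemma le_nicholsIdeal {I} (hI : Y.IsPreNicholsIdeal I) : I ≤ Y.nicholsIdeal :=
  le_iSup (fun I : {I : Ideal (TensorAlgebra k M) // Y.IsPreNicholsIdeal I} => I.1) ⟨I, hI⟩

lemma range_lTensor_mono (X : Type*) [AddCommGroup X] [Module k X] {A B : Submodule k M}
    (h : A ≤ B) : LinearMap.range (A.subtype.lTensor X) ≤ LinearMap.range (B.subtype.lTensor X) := by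
  rw [← Submodule.subtype_comp_inclusion A B h, LinearMap.lTensor_comp]
  exact LinearMap.range_comp_le_range _ _

lemma range_rTensor_mono (X : Type*) [AddCommGroup X] [Module k X] {A B : Submodule k M}
    (h : A ≤ B) : LinearMap.range (A.subtype.rTensor X) ≤ LinearMap.range (B.subtype.rTensor X) := by
  rw [← Submodule.subtype_comp_inclusion A B h, LinearMap.rTensor_comp]
  exact LinearMap.range_comp_le_range _ _

theorem isBraidedHopfIdeal_nicholsIdeal (Y : YetterDrinfeld k Γ M) :
    Y.IsBraidedHopfIdeal Y.nicholsIdeal where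
  mul_mem_right := fun x hx b => by
    refine nicholsIdeal_induction (fun I hI x hx => ?_) ?_ (fun x y hx hy => ?_) hx
    · exact le_nicholsIdeal hI (hI.mul_mem_right x hx b)
    · simp
    · rw [add_mul]; exact add_mem hx hy
  subobject := by
    refine ⟨fun g x hx => ?_, fun x hx => ?_⟩
    · replace hx : x ∈ Y.nicholsIdeal := hx
      change Y.tensor.act g x ∈ Y.nicholsIdeal
      refine nicholsIdeal_induction (fun I hI x hx => ?_) ?_ (fun x y hx hy => ?_) hx
      · exact le_nicholsIdeal hI (hI.subobject.act_mem g x hx)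
      · simp
      · rw [map_add]; exact add_mem hx hy
    · replace hx : x ∈ Y.nicholsIdeal := hx
      refine nicholsIdeal_induction (fun I hI x hx => ?_) ?_ (fun x y hx hy => ?_) hx
      · exact range_lTensor_mono _ (B := Y.nicholsIdeal.restrictScalars k) (fun _ h => le_nicholsIdeal hI h)
          (hI.subobject.coact_mem x hx)
      · simp
      · rw [map_add]; exact add_mem hx hy
  counit_eq_zero := fun x hx => by
    refine nicholsIdeal_induction (fun I hI x hx => ?_) ?_ (fun x y hx hy => ?_) hx
    · exact hI.counit_eq_zero x hx
    · simp
    · rw [map_add, hx, hy, add_zero]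
  comul_mem := fun x hx => by
    refine nicholsIdeal_induction (fun I hI x hx => ?_) ?_ (fun x y hx hy => ?_) hx
    · exact (sup_le_sup
        (range_lTensor_mono _ (A := I.restrictScalars k) (B := Y.nicholsIdeal.restrictScalars k) (fun _ h => le_nicholsIdeal hI h))
        (range_rTensor_mono _ (A := I.restrictScalars k) (B := Y.nicholsIdeal.restrictScalars k) (fun _ h => le_nicholsIdeal hI h)) :)
          (hI.comul_mem x hx)
    · rw [map_zero]; exact zero_mem _
    · rw [map_add]; exact add_mem hx hy
  antipode_mem := fun x hx => by
    refine nicholsIdeal_induction (fun I hI x hx => ?_) ?_ (fun x y hx hy => ?_) hx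
    · exact le_nicholsIdeal hI (hI.antipode_mem x hx)
    · simp
    · rw [map_add]; exact add_mem hx hy

instance (Y : YetterDrinfeld k Γ M) : Y.nicholsIdeal.IsTwoSided :=
  ⟨fun b h => Y.isBraidedHopfIdeal_nicholsIdeal.mul_mem_right _ h b⟩

end General

end YetterDrinfeld

/-- A bialgebra with an antimultiplicative map `S` that satisfies the antipode axioms on
generators is a Hopf algebra with antipode `S`. -/
abbrev HopfAlgebra.ofGenerators {k A : Type*} [Field k] [Ring A] [Bialgebra k A]
    (S : A →ₐ[k] Aᵐᵒᵖ) (s : Set A) (hs : Algebra.adjoin k s = ⊤)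
    (hl : ∀ x ∈ s, LinearMap.mul' k A (((MulOpposite.opLinearEquiv k).symm.toLinearMap ∘ₗ
      S.toLinearMap).rTensor A (Coalgebra.comul x)) = algebraMap k A (Coalgebra.counit x))
    (hr : ∀ x ∈ s, LinearMap.mul' k A (((MulOpposite.opLinearEquiv k).symm.toLinearMap ∘ₗ
      S.toLinearMap).lTensor A (Coalgebra.comul x)) = algebraMap k A (Coalgebra.counit x)) :
    HopfAlgebra k A where
  antipode := (MulOpposite.opLinearEquiv k).symm.toLinearMap ∘ₗ S.toLinearMap
  mul_antipode_rTensor_comul := by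
    ext x
    have hx : x ∈ Algebra.adjoin k s := hs ▸ trivial
    simp only [LinearMap.comp_apply, Algebra.linearMap_apply]
    induction hx using Algebra.adjoin_induction with
    | mem x hx => exact hl x hx
    | algebraMap r => simp [Algebra.TensorProduct.algebraMap_apply]
    | add x y _ _ hx hy => simp only [map_add, hx, hy]
    | mul x y _ _ hx hy =>
      have key : ∀ t u : A ⊗[k] A, LinearMap.mul' k A
          (((MulOpposite.opLinearEquiv k).symm.toLinearMap ∘ₗ S.toLinearMap).rTensor A t) =
            algebraMap k A (Coalgebra.counit x) → LinearMap.mul' k A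
          (((MulOpposite.opLinearEquiv k).symm.toLinearMap ∘ₗ S.toLinearMap).rTensor A (t * u)) =
          Coalgebra.counit (R := k) x • LinearMap.mul' k A
          (((MulOpposite.opLinearEquiv k).symm.toLinearMap ∘ₗ S.toLinearMap).rTensor A u) := by
        intro t u ht
        induction u with
        | zero => simp
        | add u v hu hv => simp only [mul_add, map_add, hu, hv, smul_add]
        | tmul a b =>
          have : ∀ t : A ⊗[k] A, LinearMap.mul' k A
              (((MulOpposite.opLinearEquiv k).symm.toLinearMap ∘ₗ S.toLinearMap).rTensor A
                (t * a ⊗ₜ b)) = (S a).unop * LinearMap.mul' k A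
              (((MulOpposite.opLinearEquiv k).symm.toLinearMap ∘ₗ S.toLinearMap).rTensor A t) *
                b := by
            intro t
            induction t with
            | zero => simp
            | add u v hu hv => simp only [add_mul, map_add, hu, hv, mul_add]
            | tmul p q => simp [mul_assoc]
          rw [this, ht, ← Algebra.commutes, ← Algebra.smul_def]
          simp
      rw [Bialgebra.comul_mul, key _ _ hx, hy, Bialgebra.counit_mul, map_mul, Algebra.smul_def]
  mul_antipode_lTensor_comul := by
    ext x
    have hx : x ∈ Algebra.adjoin k s := hs ▸ trivial
    simp only [LinearMap.comp_apply, Algebra.linearMap_apply]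
    induction hx using Algebra.adjoin_induction with
    | mem x hx => exact hr x hx
    | algebraMap r => simp [Algebra.TensorProduct.algebraMap_apply]
    | add x y _ _ hx hy => simp only [map_add, hx, hy]
    | mul x y _ _ hx hy =>
      have key : ∀ t u : A ⊗[k] A, LinearMap.mul' k A
          (((MulOpposite.opLinearEquiv k).symm.toLinearMap ∘ₗ S.toLinearMap).lTensor A u) =
            algebraMap k A (Coalgebra.counit y) → LinearMap.mul' k A
          (((MulOpposite.opLinearEquiv k).symm.toLinearMap ∘ₗ S.toLinearMap).lTensor A (t * u)) =
          Coalgebra.counit (R := k) y • LinearMap.mul' k A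
          (((MulOpposite.opLinearEquiv k).symm.toLinearMap ∘ₗ S.toLinearMap).lTensor A t) := by
        intro t u hu
        induction t with
        | zero => simp
        | add u v hu hv => simp only [add_mul, map_add, hu, hv, smul_add]
        | tmul a b =>
          have : ∀ u : A ⊗[k] A, LinearMap.mul' k A
              (((MulOpposite.opLinearEquiv k).symm.toLinearMap ∘ₗ S.toLinearMap).lTensor A
                (a ⊗ₜ b * u)) = a * LinearMap.mul' k A
              (((MulOpposite.opLinearEquiv k).symm.toLinearMap ∘ₗ S.toLinearMap).lTensor A u) *
                (S b).unop := by
            intro u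
            induction u with
            | zero => simp
            | add u v hu hv => simp only [add_mul, map_add, hu, hv, mul_add]
            | tmul p q => simp [mul_assoc]
          rw [this, hu, ← Algebra.commutes, ← Algebra.smul_def]
          simp
      rw [Bialgebra.comul_mul, key _ _ hy, hx, Bialgebra.counit_mul, map_mul, Algebra.smul_def,
        Algebra.commutes]

namespace YetterDrinfeld
section Boson

variable {k Γ M : Type*} [Field k] [CommGroup Γ] [AddCommGroup M] [Module k M]

/-- The Nichols algebra `𝔅(M)`. -/
def Nichols (Y : YetterDrinfeld k Γ M) : Type _ := TensorAlgebra k M ⧸ Y.nicholsIdeal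

namespace Nichols

variable (Y : YetterDrinfeld k Γ M)

instance : Ring Y.Nichols := inferInstanceAs (Ring (TensorAlgebra k M ⧸ Y.nicholsIdeal))

instance : Algebra k Y.Nichols :=
  inferInstanceAs (Algebra k (TensorAlgebra k M ⧸ Y.nicholsIdeal))

/-- the quotient map `T(M) → 𝔅(M)` -/
def mk : TensorAlgebra k M →ₐ[k] Y.Nichols := Ideal.Quotient.mkₐ k Y.nicholsIdeal

lemma mk_surjective : Function.Surjective (mk Y) := Ideal.Quotient.mkₐ_surjective k _

variable {Y} in
lemma mk_eq_zero {x : TensorAlgebra k M} : mk Y x = 0 ↔ x ∈ Y.nicholsIdeal :=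
  Ideal.Quotient.eq_zero_iff_mem

/-- algebra maps out of `𝔅(M)` -/
def lift {A : Type*} [Ring A] [Algebra k A] (f : TensorAlgebra k M →ₐ[k] A)
    (hf : ∀ x ∈ Y.nicholsIdeal, f x = 0) : Y.Nichols →ₐ[k] A :=
  Ideal.Quotient.liftₐ Y.nicholsIdeal f hf

@[simp] lemma lift_mk {A : Type*} [Ring A] [Algebra k A] (f : TensorAlgebra k M →ₐ[k] A)
    (hf : ∀ x ∈ Y.nicholsIdeal, f x = 0) (x : TensorAlgebra k M) :
    lift Y f hf (mk Y x) = f x := rfl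

variable {Y} in
lemma algHom_ext {A : Type*} [Ring A] [Algebra k A] {f g : Y.Nichols →ₐ[k] A}
    (h : ∀ v, f (mk Y (TensorAlgebra.ι k v)) = g (mk Y (TensorAlgebra.ι k v))) : f = g := by
  have : f.comp (mk Y) = g.comp (mk Y) := by ext v; exact h v
  ext x
  obtain ⟨x, rfl⟩ := mk_surjective Y x
  exact congr($this x)

/-- the action of `g` on `𝔅(M)` -/
def actAlg (g : Γ) : Y.Nichols →ₐ[k] Y.Nichols :=
  lift Y ((mk Y).comp (Y.actAlg g))
    (fun x hx => mk_eq_zero.2 (Y.isBraidedHopfIdeal_nicholsIdeal.subobject.act_mem g x hx))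

instance : MulSemiringAction Γ Y.Nichols where
  smul g x := actAlg Y g x
  one_smul x := by
    change actAlg Y 1 x = x
    obtain ⟨x, rfl⟩ := mk_surjective Y x
    simp [actAlg, Y.actAlg_one]
  mul_smul g h x := by
    change actAlg Y (g * h) x = actAlg Y g (actAlg Y h x)
    obtain ⟨x, rfl⟩ := mk_surjective Y x
    simp only [actAlg, Y.actAlg_mul, lift_mk, AlgHom.comp_apply]
    rfl
  smul_zero g := map_zero (actAlg Y g)
  smul_add g := map_add (actAlg Y g)
  smul_one g := map_one (actAlg Y g)
  smul_mul g := map_mul (actAlg Y g)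

lemma smul_def (g : Γ) (x : Y.Nichols) : g • x = actAlg Y g x := rfl

@[simp] lemma smul_mk (g : Γ) (x : TensorAlgebra k M) : g • mk Y x = mk Y (Y.actAlg g x) := rfl

instance : SMulCommClass Γ k Y.Nichols :=
  ⟨fun g c x => map_smul (actAlg Y g) c x⟩

end Nichols

/-- The bosonization `𝔅(M) ⋊ Γ` as an algebra: the smash product of `𝔅(M)` and `k Γ`, spanned
by the `a γ` (`a ∈ 𝔅(M)`, `γ ∈ Γ`), with `γ a = (γ ▷ a) γ`. -/
abbrev Boson (Y : YetterDrinfeld k Γ M) : Type _ := SkewMonoidAlgebra Y.Nichols Γ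

namespace Boson

variable (Y : YetterDrinfeld k Γ M)

/-- the inclusion of `𝔅(M)` -/
def inc : Y.Nichols →ₐ[k] Y.Boson where
  toRingHom := SkewMonoidAlgebra.singleOneRingHom
  commutes' _ := rfl

/-- the inclusion of `Γ` -/
def of : Γ →* Y.Boson := SkewMonoidAlgebra.of Y.Nichols Γ

/-- the inclusion of `M` -/
def ι : M →ₗ[k] Y.Boson := (inc Y).toLinearMap ∘ₗ (Nichols.mk Y).toLinearMap ∘ₗ TensorAlgebra.ι k

/-- the inclusion of `k Γ` -/
def ofAlg : MonoidAlgebra k Γ →ₐ[k] Y.Boson := MonoidAlgebra.lift k _ Γ (of Y)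

@[simp] lemma ofAlg_single (g : Γ) : ofAlg Y (MonoidAlgebra.single g 1) = of Y g := by
  simp [ofAlg]

lemma single_eq (g : Γ) (x : Y.Nichols) : SkewMonoidAlgebra.single g x = inc Y x * of Y g := by
  change _ = SkewMonoidAlgebra.single 1 x * SkewMonoidAlgebra.single g 1
  rw [SkewMonoidAlgebra.single_mul_single]
  simp

lemma of_mul_inc (g : Γ) (x : Y.Nichols) : of Y g * inc Y x = inc Y (g • x) * of Y g := by
  rw [← single_eq]
  change SkewMonoidAlgebra.single g 1 * SkewMonoidAlgebra.single 1 x = _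
  rw [SkewMonoidAlgebra.single_mul_single]
  simp

lemma of_mul_ι (g : Γ) (v : M) : of Y g * ι Y v = ι Y (Y.act g v) * of Y g := by
  simp [ι, of_mul_inc]

section lift

variable {Y} {A : Type*} [Ring A] [Algebra k A]

/-- Algebra maps out of `𝔅(M) ⋊ Γ`. -/
def lift (f : Y.Nichols →ₐ[k] A) (φ : Γ →* A)
    (h : ∀ g v, f (Nichols.mk Y (TensorAlgebra.ι k (Y.act g v))) * φ g =
      φ g * f (Nichols.mk Y (TensorAlgebra.ι k v))) : Y.Boson →ₐ[k] A :=
  SkewMonoidAlgebra.liftNCAlgHom f φ (by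
    intro x g
    obtain ⟨x, rfl⟩ := Nichols.mk_surjective Y x
    rw [Nichols.smul_mk]
    induction x using TensorAlgebra.induction with
    | algebraMap r => simp [Algebra.commutes]
    | ι v => rw [actAlg_ι]; exact h g v
    | mul a b ha hb => simp only [map_mul, mul_assoc, hb]; simp only [← mul_assoc, ha]
    | add a b ha hb => simp only [map_add, add_mul, mul_add, ha, hb])

variable (f : Y.Nichols →ₐ[k] A) (φ : Γ →* A)
    (h : ∀ g v, f (Nichols.mk Y (TensorAlgebra.ι k (Y.act g v))) * φ g =
      φ g * f (Nichols.mk Y (TensorAlgebra.ι k v)))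

@[simp] lemma lift_inc (x : Y.Nichols) : lift f φ h (inc Y x) = f x := by
  change SkewMonoidAlgebra.liftNC _ _ (SkewMonoidAlgebra.single 1 x) = _
  simp

@[simp] lemma lift_of (g : Γ) : lift f φ h (of Y g) = φ g := by
  change SkewMonoidAlgebra.liftNC _ _ (SkewMonoidAlgebra.single g 1) = _
  simp

@[simp] lemma lift_ι (v : M) : lift f φ h (ι Y v) = f (Nichols.mk Y (TensorAlgebra.ι k v)) := by
  simp [ι]

lemma algHom_ext {p q : Y.Boson →ₐ[k] A} (h1 : ∀ v, p (ι Y v) = q (ι Y v))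
    (h2 : ∀ g, p (of Y g) = q (of Y g)) : p = q := by
  have h3 : p.comp (inc Y) = q.comp (inc Y) := Nichols.algHom_ext h1
  apply AlgHom.toLinearMap_injective
  refine SkewMonoidAlgebra.lhom_ext' fun g => LinearMap.ext fun x => ?_
  change p (SkewMonoidAlgebra.single g x) = q (SkewMonoidAlgebra.single g x)
  rw [single_eq, map_mul, map_mul, h2]
  congr 1
  exact congr($h3 x)

/-- `𝔅(M) ⋊ Γ` is generated by `M` and `Γ`. -/
lemma adjoin_eq_top (Y : YetterDrinfeld k Γ M) :
    Algebra.adjoin k (Set.range (ι Y) ∪ Set.range (of Y)) = ⊤ := by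
  set S := Algebra.adjoin k (Set.range (ι Y) ∪ Set.range (of Y))
  rw [eq_top_iff]
  have h1 : ∀ x, inc Y x ∈ S := by
    intro x
    obtain ⟨x, rfl⟩ := Nichols.mk_surjective Y x
    induction x using TensorAlgebra.induction with
    | algebraMap r => simpa using S.algebraMap_mem r
    | ι v => exact Algebra.subset_adjoin (Or.inl ⟨v, rfl⟩)
    | mul a b ha hb => simpa using S.mul_mem ha hb
    | add a b ha hb => simpa using S.add_mem ha hb
  intro x _
  induction x using SkewMonoidAlgebra.induction_on with
  | zero => exact S.zero_mem
  | single g a =>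
    rw [single_eq]
    exact S.mul_mem (h1 a) (Algebra.subset_adjoin (Or.inr ⟨g, rfl⟩))
  | add x y hx hy => exact S.add_mem (hx trivial) (hy trivial)

end lift

/-! ### The coproduct: `v ↦ v ⊗ 1 + v₋₁ ⊗ v₀` for `v ∈ M` and `γ ↦ γ ⊗ γ` for `γ ∈ Γ` -/

/-- the coproduct on `M` -/
def comulι : M →ₗ[k] Y.Boson ⊗[k] Y.Boson :=
  (TensorProduct.mk k Y.Boson Y.Boson).flip 1 ∘ₗ ι Y +
    TensorProduct.map (ofAlg Y).toLinearMap (ι Y) ∘ₗ Y.coact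

/-- the coproduct on `T(M)` -/
def comulT : TensorAlgebra k M →ₐ[k] Y.Boson ⊗[k] Y.Boson := TensorAlgebra.lift k (comulι Y)

variable {Y} in
lemma comulι_homog {γ : Γ} {v : M} (hv : Y.IsHomog γ v) :
    comulι Y v = ι Y v ⊗ₜ 1 + of Y γ ⊗ₜ ι Y v := by
  rw [IsHomog] at hv
  simp [comulι, hv]

/-- `T(M) → 𝔅(M) ⋊ Γ` -/
def incT : TensorAlgebra k M →ₐ[k] Y.Boson := (inc Y).comp (Nichols.mk Y)

@[simp] lemma incT_ι (v : M) : incT Y (TensorAlgebra.ι k v) = ι Y v := rfl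

variable {Y} in
lemma incT_eq_zero {x} (hx : x ∈ Y.nicholsIdeal) : incT Y x = 0 := by
  simp [incT, Nichols.mk_eq_zero.2 hx]

lemma of_mul_incT (g : Γ) (x) : of Y g * incT Y x = incT Y (Y.actAlg g x) * of Y g := by
  simp [incT, of_mul_inc]

/-- `a ⊗ b ↦ a b₋₁ ⊗ b₀` -/
def twist : TensorAlgebra k M ⊗[k] TensorAlgebra k M →ₗ[k] Y.Boson ⊗[k] Y.Boson :=
  TensorProduct.lift ((LinearMap.mul k (Y.Boson ⊗[k] Y.Boson)).compl₁₂
    ((TensorProduct.mk k Y.Boson Y.Boson).flip 1 ∘ₗ (incT Y).toLinearMap)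
    (TensorProduct.map (ofAlg Y).toLinearMap (incT Y).toLinearMap ∘ₗ Y.coactAlg.toLinearMap))

@[simp] lemma twist_tmul (a b : TensorAlgebra k M) : twist Y (a ⊗ₜ b) =
    (incT Y a ⊗ₜ 1) * TensorProduct.map (ofAlg Y).toLinearMap (incT Y).toLinearMap
      (Y.coactAlg b) := rfl

lemma twist_primLeftMul (γ : Γ) (v : M) (hv : Y.IsHomog γ v) (t) :
    twist Y (Y.primLeftMul v t) = comulι Y v * twist Y t := by
  induction t with
  | zero => simp
  | add x y hx hy => simp only [map_add, hx, hy, mul_add]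
  | tmul a b =>
    have e : ∀ t : MonoidAlgebra k Γ ⊗[k] TensorAlgebra k M,
        TensorProduct.map (ofAlg Y).toLinearMap (incT Y).toLinearMap
          ((MonoidAlgebra.single γ 1 ⊗ₜ TensorAlgebra.ι k v) * t) =
        (of Y γ ⊗ₜ ι Y v) *
          TensorProduct.map (ofAlg Y).toLinearMap (incT Y).toLinearMap t := by
      intro t
      induction t with
      | zero => simp
      | add x y hx hy => simp only [map_add, hx, hy, mul_add]
      | tmul x y => simp
    rw [primLeftMul_homog hv, comulι_homog hv, map_add, twist_tmul, twist_tmul, twist_tmul]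
    have h2 : Y.coactAlg (TensorAlgebra.ι k v * b) =
        (MonoidAlgebra.single γ 1 ⊗ₜ TensorAlgebra.ι k v) * Y.coactAlg b := by
      rw [IsHomog] at hv
      simp [hv]
    rw [h2, e, add_mul]
    simp only [← mul_assoc, Algebra.TensorProduct.tmul_mul_tmul, map_mul, incT_ι, one_mul,
      mul_one, of_mul_incT]

lemma comulT_eq (x : TensorAlgebra k M) : comulT Y x = twist Y (Y.braidedComul x) := by
  induction x using Y.tensor_induction with
  | one => simp [Algebra.TensorProduct.one_def]
  | smul r x hx => simp only [map_smul, hx]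
  | add x y hx hy => simp only [map_add, hx, hy]
  | mul γ v x hv hx =>
    rw [map_mul, braidedComul_ι_mul, twist_primLeftMul Y γ v hv, hx]
    simp [comulT]

lemma comulT_eq_zero (x) (hx : x ∈ Y.nicholsIdeal) : comulT Y x = 0 := by
  rw [comulT_eq]
  have hI := Y.isBraidedHopfIdeal_nicholsIdeal
  have h := hI.comul_mem x hx
  suffices h : LinearMap.range
        ((Y.nicholsIdeal.restrictScalars k).subtype.lTensor (TensorAlgebra k M)) ⊔
      LinearMap.range
        ((Y.nicholsIdeal.restrictScalars k).subtype.rTensor (TensorAlgebra k M)) ≤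
      LinearMap.ker (twist Y) from h (hI.comul_mem x hx)
  refine sup_le ?_ ?_
  · rintro _ ⟨t, rfl⟩
    rw [LinearMap.mem_ker]
    induction t with
    | zero => simp
    | add x y hx hy => simp only [map_add, hx, hy, add_zero]
    | tmul a b =>
      obtain ⟨u, hu⟩ := hI.subobject.coact_mem b.1 b.2
      have hz : TensorProduct.map (ofAlg Y).toLinearMap (incT Y).toLinearMap
          (Y.coactAlg b.1) = 0 := by
        rw [← tensor_coact_apply, ← hu]
        clear hu
        induction u with
        | zero => simp
        | add x y hx hy => simp only [map_add, hx, hy, add_zero]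
        | tmul p q =>
          have : incT Y (q : TensorAlgebra k M) = 0 := incT_eq_zero q.2
          simp [this]
      simp only [LinearMap.lTensor_tmul, Submodule.subtype_apply, twist_tmul, hz, mul_zero]
  · rintro _ ⟨t, rfl⟩
    rw [LinearMap.mem_ker]
    induction t with
    | zero => simp
    | add x y hx hy => simp only [map_add, hx, hy, add_zero]
    | tmul a b =>
      have : incT Y (a : TensorAlgebra k M) = 0 := incT_eq_zero a.2
      simp [this]

/-- the coproduct on `Γ` -/
def comulOf : Γ →* Y.Boson ⊗[k] Y.Boson where
  toFun g := of Y g ⊗ₜ of Y g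
  map_one' := by simp [Algebra.TensorProduct.one_def]
  map_mul' g h := by simp

lemma comulOf_apply (g : Γ) : comulOf Y g = of Y g ⊗ₜ of Y g := rfl

/-- the coproduct of `𝔅(M) ⋊ Γ` -/
def comulAlg : Y.Boson →ₐ[k] Y.Boson ⊗[k] Y.Boson :=
  lift (Nichols.lift Y (comulT Y) (comulT_eq_zero Y)) (comulOf Y)
    (fun g v => by
      simp only [Nichols.lift_mk, comulT, TensorAlgebra.lift_ι_apply, comulOf_apply]
      induction v using Y.homog_induction with
      | add v w h1 h2 => simp only [map_add, add_mul, mul_add, h1, h2]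
      | hom γ v hv =>
        rw [comulι_homog hv, comulι_homog (hv.act g)]
        simp only [add_mul, mul_add, Algebra.TensorProduct.tmul_mul_tmul, of_mul_ι, one_mul,
          mul_one, ← map_mul, mul_comm γ g])

@[simp] lemma comulAlg_of (g : Γ) : comulAlg Y (of Y g) = of Y g ⊗ₜ of Y g := by
  simp [comulAlg, comulOf_apply]

lemma comulAlg_ι {γ : Γ} {v : M} (hv : Y.IsHomog γ v) :
    comulAlg Y (ι Y v) = ι Y v ⊗ₜ 1 + of Y γ ⊗ₜ ι Y v := by
  simp [comulAlg, comulT, comulι_homog hv]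

/-- the counit of `𝔅(M) ⋊ Γ`: `v ↦ 0` for `v ∈ M` and `γ ↦ 1` for `γ ∈ Γ` -/
def counitAlg : Y.Boson →ₐ[k] k :=
  lift (Nichols.lift Y TensorAlgebra.algebraMapInv
    (Y.isBraidedHopfIdeal_nicholsIdeal.counit_eq_zero)) 1 (fun g v => by
      simp [TensorAlgebra.algebraMapInv])

@[simp] lemma counitAlg_of (g : Γ) : counitAlg Y (of Y g) = 1 := by
  simp [counitAlg]

@[simp] lemma counitAlg_ι (v : M) : counitAlg Y (ι Y v) = 0 := by
  simp [counitAlg, TensorAlgebra.algebraMapInv]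

instance : Bialgebra k Y.Boson :=
  Bialgebra.ofAlgHom (comulAlg Y) (counitAlg Y)
    (by
      refine algHom_ext (fun v => ?_) (fun g => by simp)
      induction v using Y.homog_induction with
      | add v w h1 h2 => simp only [map_add, h1, h2]
      | hom γ v hv =>
        simp [comulAlg_ι Y hv, TensorProduct.add_tmul, TensorProduct.tmul_add, add_assoc,
          Algebra.TensorProduct.one_def])
    (by
      refine algHom_ext (fun v => ?_) (fun g => by simp)
      induction v using Y.homog_induction with
      | add v w h1 h2 => simp only [map_add, h1, h2]
      | hom γ v hv => simp [comulAlg_ι Y hv])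
    (by
      refine algHom_ext (fun v => ?_) (fun g => by simp)
      induction v using Y.homog_induction with
      | add v w h1 h2 => simp only [map_add, h1, h2]
      | hom γ v hv => simp [comulAlg_ι Y hv])

@[simp] lemma comul_of (g : Γ) : Coalgebra.comul (R := k) (of Y g) = of Y g ⊗ₜ of Y g :=
  comulAlg_of Y g

lemma comul_ι {γ : Γ} {v : M} (hv : Y.IsHomog γ v) :
    Coalgebra.comul (R := k) (ι Y v) = ι Y v ⊗ₜ 1 + of Y γ ⊗ₜ ι Y v :=
  comulAlg_ι Y hv

@[simp] lemma counit_of (g : Γ) : Coalgebra.counit (R := k) (of Y g) = 1 := counitAlg_of Y g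

@[simp] lemma counit_ι (v : M) : Coalgebra.counit (R := k) (ι Y v) = 0 := counitAlg_ι Y v

/-! ### The antipode: `v ↦ - (v₋₁)⁻¹ v₀` for `v ∈ M` and `γ ↦ γ⁻¹` for `γ ∈ Γ` -/

/-- the antipode on `k Γ` -/
def ofInv : MonoidAlgebra k Γ →ₗ[k] Y.Boson :=
  (ofAlg Y).toLinearMap ∘ₗ HopfAlgebra.antipode k

@[simp] lemma ofInv_single (g : Γ) : ofInv Y (MonoidAlgebra.single g 1) = of Y g⁻¹ := by
  simp [ofInv]

/-- the antipode on `M` -/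
def antiι : M →ₗ[k] Y.Boson :=
  - (LinearMap.mul' k Y.Boson ∘ₗ TensorProduct.map (ofInv Y) (ι Y) ∘ₗ Y.coact)

variable {Y} in
lemma antiι_homog {γ : Γ} {v : M} (hv : Y.IsHomog γ v) :
    antiι Y v = - (of Y γ⁻¹ * ι Y v) := by
  rw [IsHomog] at hv
  simp [antiι, hv]

/-- the antipode on `T(M)` -/
def antiT : TensorAlgebra k M →ₐ[k] Y.Bosonᵐᵒᵖ :=
  TensorAlgebra.lift k ((MulOpposite.opLinearEquiv k).toLinearMap ∘ₗ antiι Y)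

lemma antiT_eq (x : TensorAlgebra k M) : (antiT Y x).unop =
    LinearMap.mul' k Y.Boson (TensorProduct.map (ofInv Y)
      ((incT Y).toLinearMap ∘ₗ Y.braidedAntipode) (Y.coactAlg x)) := by
  induction x using Y.tensor_induction with
  | one => simp [Algebra.TensorProduct.one_def, MonoidAlgebra.one_def]
  | smul r x hx => simp only [map_smul, MulOpposite.unop_smul, hx]
  | add x y hx hy => simp only [map_add, MulOpposite.unop_add, hx, hy]
  | mul γ v x hv hx =>
    have h2 : Y.coactAlg (TensorAlgebra.ι k v * x) =
        (MonoidAlgebra.single γ 1 ⊗ₜ TensorAlgebra.ι k v) * Y.coactAlg x := by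
      have hv := hv
      rw [IsHomog] at hv
      simp [hv]
    have e : ∀ t : MonoidAlgebra k Γ ⊗[k] TensorAlgebra k M,
        LinearMap.mul' k Y.Boson (TensorProduct.map (ofInv Y)
          ((incT Y).toLinearMap ∘ₗ Y.braidedAntipode)
          ((MonoidAlgebra.single γ 1 ⊗ₜ TensorAlgebra.ι k v) * t)) =
        LinearMap.mul' k Y.Boson (TensorProduct.map (ofInv Y)
          ((incT Y).toLinearMap ∘ₗ Y.braidedAntipode) t) * antiι Y v := by
      intro t
      induction t with
      | zero => simp
      | add x y hx hy => simp only [map_add, hx, hy, mul_add, add_mul]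
      | tmul p y =>
        induction p using MonoidAlgebra.induction_linear with
        | zero => simp
        | add x y hx hy => simp only [TensorProduct.add_tmul, map_add, hx, hy, mul_add, add_mul]
        | single δ r =>
          have : (MonoidAlgebra.single δ r : MonoidAlgebra k Γ) = r • MonoidAlgebra.single δ 1 := by
            simp
          rw [this, ← TensorProduct.smul_tmul', mul_smul_comm, map_smul, map_smul, map_smul, map_smul,
            smul_mul_assoc]
          congr 1
          simp only [Algebra.TensorProduct.tmul_mul_tmul, MonoidAlgebra.single_mul_single,
            one_mul, TensorProduct.map_tmul, ofInv_single, LinearMap.comp_apply,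
            AlgHom.toLinearMap_apply, LinearMap.mul'_apply, braidedAntipode_ι_mul,
            antipodeOp_homog hv, antiι_homog hv, map_neg, map_mul, incT_ι, mul_neg, mul_inv_rev]
          have h3 := of_mul_incT Y γ⁻¹ (Y.actAlg γ (Y.braidedAntipode y))
          have h4 : Y.actAlg γ⁻¹ (Y.actAlg γ (Y.braidedAntipode y)) = Y.braidedAntipode y := by
            rw [← AlgHom.comp_apply, ← actAlg_mul]
            simp [actAlg_one]
          rw [h4] at h3
          simp only [mul_assoc]
          rw [← mul_assoc (of Y γ⁻¹), h3]
          simp only [mul_assoc]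
    rw [map_mul, h2, e, ← hx]
    simp [antiT]

lemma antiT_eq_zero (x) (hx : x ∈ Y.nicholsIdeal) : antiT Y x = 0 := by
  apply MulOpposite.unop_injective
  rw [antiT_eq]
  have hI := Y.isBraidedHopfIdeal_nicholsIdeal
  obtain ⟨u, hu⟩ := hI.subobject.coact_mem x hx
  rw [← tensor_coact_apply, ← hu]
  clear hu
  induction u with
  | zero => simp
  | add x y hx hy => simp only [map_add, hx, hy, MulOpposite.unop_zero, add_zero]
  | tmul p q =>
    have : incT Y (Y.braidedAntipode (q : TensorAlgebra k M)) = 0 :=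
      incT_eq_zero (hI.antipode_mem _ q.2)
    simp [this]

/-- the antipode on `Γ` -/
def antiOf : Γ →* Y.Bosonᵐᵒᵖ where
  toFun g := MulOpposite.op (of Y g⁻¹)
  map_one' := by simp
  map_mul' g h := by rw [← MulOpposite.op_mul, ← map_mul, mul_inv_rev]

lemma antiOf_apply (g : Γ) : antiOf Y g = MulOpposite.op (of Y g⁻¹) := rfl

/-- the antipode of `𝔅(M) ⋊ Γ` -/
def antiAlg : Y.Boson →ₐ[k] Y.Bosonᵐᵒᵖ :=
  lift (Nichols.lift Y (antiT Y) (antiT_eq_zero Y)) (antiOf Y) (fun g v => by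
    simp only [Nichols.lift_mk, antiT, TensorAlgebra.lift_ι_apply, antiOf_apply,
      LinearMap.comp_apply, LinearEquiv.coe_coe, MulOpposite.coe_opLinearEquiv]
    induction v using Y.homog_induction with
    | add v w h1 h2 => simp only [map_add, MulOpposite.op_add, add_mul, mul_add, h1, h2]
    | hom γ v hv =>
      rw [antiι_homog hv, antiι_homog (hv.act g), ← MulOpposite.op_mul, ← MulOpposite.op_mul]
      congr 1
      have := of_mul_ι Y g⁻¹ (Y.act g v)
      have h4 : Y.act g⁻¹ (Y.act g v) = v := by
        rw [← Module.End.mul_apply, ← map_mul]; simp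
      rw [h4] at this
      simp only [mul_neg, neg_mul, ← mul_assoc, ← map_mul, mul_comm g⁻¹ γ⁻¹]
      rw [map_mul, mul_assoc, this, mul_assoc])

@[simp] lemma antiAlg_of (g : Γ) : antiAlg Y (of Y g) = MulOpposite.op (of Y g⁻¹) := by
  simp [antiAlg, antiOf_apply]

lemma antiAlg_ι {γ : Γ} {v : M} (hv : Y.IsHomog γ v) :
    antiAlg Y (ι Y v) = MulOpposite.op (- (of Y γ⁻¹ * ι Y v)) := by
  simp [antiAlg, antiT, antiι_homog hv]

instance : HopfAlgebra k Y.Boson :=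
  HopfAlgebra.ofGenerators (antiAlg Y) _ (adjoin_eq_top Y)
    (by
      rintro _ (⟨v, rfl⟩ | ⟨g, rfl⟩)
      · induction v using Y.homog_induction with
        | add v w h1 h2 => simp only [map_add, h1, h2]
        | hom γ v hv => simp [comul_ι Y hv, antiAlg_ι Y hv]
      · simp [← map_mul])
    (by
      rintro _ (⟨v, rfl⟩ | ⟨g, rfl⟩)
      · induction v using Y.homog_induction with
        | add v w h1 h2 => simp only [map_add, h1, h2]
        | hom γ v hv => simp [comul_ι Y hv, antiAlg_ι Y hv, ← mul_assoc, ← map_mul]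
      · simp [← map_mul])

@[simp] lemma antipode_of (g : Γ) : HopfAlgebra.antipode k (of Y g) = of Y g⁻¹ :=
  congr(MulOpposite.unop $(antiAlg_of Y g))

lemma antipode_ι {γ : Γ} {v : M} (hv : Y.IsHomog γ v) :
    HopfAlgebra.antipode k (ι Y v) = - (of Y γ⁻¹ * ι Y v) :=
  congr(MulOpposite.unop $(antiAlg_ι Y hv))

end Boson
end Boson
end YetterDrinfeld

namespace YetterDrinfeld

section Constructions

variable {k Γ M N : Type*} [Field k] [CommGroup Γ] [AddCommGroup M] [Module k M]
  [AddCommGroup N] [Module k N]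

/-- Morphisms of Yetter-Drinfeld modules: linear and colinear maps. -/
structure IsHom (Y : YetterDrinfeld k Γ M) (Y' : YetterDrinfeld k Γ N) (φ : M →ₗ[k] N) :
    Prop where
  act : ∀ g, φ ∘ₗ Y.act g = Y'.act g ∘ₗ φ
  coact : Y'.coact ∘ₗ φ = φ.lTensor (MonoidAlgebra k Γ) ∘ₗ Y.coact

/-- The object `⨁ᵢ (k vᵢ; χᵢ, γᵢ)` of diagonal type: `h ▷ vᵢ = χᵢ(h) vᵢ` and
`ρ vᵢ = γᵢ ⊗ vᵢ`, where `vᵢ` is the basis vector `single i 1` of `I →₀ k`. -/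
def diag {I : Type*} (χ : I → (Γ →* kˣ)) (γ : I → Γ) : YetterDrinfeld k Γ (I →₀ k) where
  act :=
    { toFun := fun h => Finsupp.lsum k fun i => (χ i h : k) • Finsupp.lsingle i
      map_one' := by ext i : 1; ext j; simp
      map_mul' := fun g h => by ext i : 1; ext j; simp [mul_comm] }
  coact := Finsupp.lsum k fun i =>
    TensorProduct.mk k (MonoidAlgebra k Γ) (I →₀ k) (MonoidAlgebra.single (γ i) 1) ∘ₗ
      Finsupp.lsingle i
  coassoc := by ext i : 2; simp
  counit := by ext i : 2; simp
  compat := fun h => by ext i : 2; simp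

section
variable {I : Type*} (χ : I → (Γ →* kˣ)) (γ : I → Γ)

@[simp] lemma diag_act_single (h : Γ) (i : I) (c : k) :
    (diag χ γ).act h (Finsupp.single i c) = (χ i h : k) • Finsupp.single i c := by
  simp [diag]

lemma diag_isHomog (i : I) : (diag χ γ).IsHomog (γ i) (Finsupp.single i 1) := by
  simp [diag, IsHomog]

end

/-- The direct sum of two objects. -/
def prod (Y : YetterDrinfeld k Γ M) (Y' : YetterDrinfeld k Γ N) :
    YetterDrinfeld k Γ (M × N) where
  act :=
    { toFun := fun g => (Y.act g).prodMap (Y'.act g)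
      map_one' := by simp
      map_mul' := fun g h => by simp; rfl }
  coact := ((LinearMap.inl k M N).lTensor (MonoidAlgebra k Γ) ∘ₗ Y.coact).coprod
    ((LinearMap.inr k M N).lTensor (MonoidAlgebra k Γ) ∘ₗ Y'.coact)
  coassoc := by
    ext v : 2
    · induction v using Y.homog_induction with
      | hom γ v hv =>
        rw [IsHomog] at hv
        simp [hv]
      | add v w h1 h2 => simp only [map_add, h1, h2]
    · induction v using Y'.homog_induction with
      | hom γ v hv =>
        rw [IsHomog] at hv
        simp [hv]
      | add v w h1 h2 => simp only [map_add, h1, h2]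
  counit := by
    ext v : 2
    · induction v using Y.homog_induction with
      | hom γ v hv =>
        rw [IsHomog] at hv
        simp [hv]
      | add v w h1 h2 => simp only [map_add, h1, h2]
    · induction v using Y'.homog_induction with
      | hom γ v hv =>
        rw [IsHomog] at hv
        simp [hv]
      | add v w h1 h2 => simp only [map_add, h1, h2]
  compat := fun g => by
    ext v : 2
    · induction v using Y.homog_induction with
      | hom γ v hv =>
        have h2 := hv.act g
        rw [IsHomog] at hv h2
        simp [hv, h2]
      | add v w h1 h2 => simp only [map_add, h1, h2]
    · induction v using Y'.homog_induction with
      | hom γ v hv =>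
        have h2 := hv.act g
        rw [IsHomog] at hv h2
        simp [hv, h2]
      | add v w h1 h2 => simp only [map_add, h1, h2]

lemma lTensor_subtype_injective (X : Type*) [AddCommGroup X] [Module k X] (L : Submodule k M) :
    Function.Injective (L.subtype.lTensor X) :=
  Module.Flat.lTensor_preserves_injective_linearMap _ L.subtype_injective

/-- the coaction of a subobject -/
def restrictCoact (Y : YetterDrinfeld k Γ M) (L : Submodule k M) (hL : Y.IsSubobject L) :
    L →ₗ[k] MonoidAlgebra k Γ ⊗[k] L :=
  (LinearEquiv.ofInjective _ (lTensor_subtype_injective (MonoidAlgebra k Γ) L)).symm.toLinearMap ∘ₗ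
    LinearMap.codRestrict _ (Y.coact ∘ₗ L.subtype) (fun x => hL.coact_mem x.1 x.2)

lemma lTensor_restrictCoact (Y : YetterDrinfeld k Γ M) (L : Submodule k M)
    (hL : Y.IsSubobject L) (x : L) :
    L.subtype.lTensor (MonoidAlgebra k Γ) (Y.restrictCoact L hL x) = Y.coact x := by
  have := LinearEquiv.apply_symm_apply
    (LinearEquiv.ofInjective _ (lTensor_subtype_injective (MonoidAlgebra k Γ) L))
    ⟨Y.coact x, hL.coact_mem x.1 x.2⟩
  exact congr(Subtype.val $this)

/-- A subobject as an object. -/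
def restrict (Y : YetterDrinfeld k Γ M) (L : Submodule k M) (hL : Y.IsSubobject L) :
    YetterDrinfeld k Γ L where
  act :=
    { toFun := fun g => (Y.act g).restrict (hL.act_mem g)
      map_one' := by ext; simp
      map_mul' := fun g h => by ext; simp }
  coact := Y.restrictCoact L hL
  coassoc := by
    ext x
    apply lTensor_subtype_injective (MonoidAlgebra k Γ ⊗[k] MonoidAlgebra k Γ) L |>.comp
      (TensorProduct.assoc k _ _ _).symm.injective
    have e1 : ∀ t : MonoidAlgebra k Γ ⊗[k] L,
        L.subtype.lTensor (MonoidAlgebra k Γ ⊗[k] MonoidAlgebra k Γ)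
          ((Coalgebra.comul (R := k) (A := MonoidAlgebra k Γ)).rTensor L t) =
        (Coalgebra.comul (R := k) (A := MonoidAlgebra k Γ)).rTensor M
          (L.subtype.lTensor (MonoidAlgebra k Γ) t) := by
      intro t
      rw [← LinearMap.comp_apply, ← LinearMap.comp_apply, LinearMap.lTensor_comp_rTensor,
        LinearMap.rTensor_comp_lTensor]
    have e2 : ∀ t : MonoidAlgebra k Γ ⊗[k] L,
        L.subtype.lTensor (MonoidAlgebra k Γ ⊗[k] MonoidAlgebra k Γ)
          ((TensorProduct.assoc k _ _ _).symm
            ((Y.restrictCoact L hL).lTensor (MonoidAlgebra k Γ) t)) =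
        (TensorProduct.assoc k _ _ _).symm
          (Y.coact.lTensor (MonoidAlgebra k Γ) (L.subtype.lTensor (MonoidAlgebra k Γ) t)) := by
      intro t
      induction t with
      | zero => simp
      | add a b ha hb => simp only [map_add, ha, hb]
      | tmul a b =>
        simp only [LinearMap.lTensor_tmul, Submodule.subtype_apply]
        rw [← Y.lTensor_restrictCoact L hL b]
        generalize Y.restrictCoact L hL b = u
        induction u with
        | zero => simp
        | add p q hp hq => simp only [map_add, TensorProduct.tmul_add, hp, hq]
        | tmul p q => simp
    simp only [Function.comp_apply, LinearMap.comp_apply, LinearEquiv.coe_coe,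
      LinearEquiv.symm_apply_apply, e1, e2, lTensor_restrictCoact]
    rw [LinearEquiv.eq_symm_apply]
    exact congr($(Y.coassoc) x)
  counit := by
    ext x
    have e1 : ∀ t : MonoidAlgebra k Γ ⊗[k] L,
        ((TensorProduct.lid k L
          ((Coalgebra.counit (R := k) (A := MonoidAlgebra k Γ)).rTensor L t) : L) : M) =
        TensorProduct.lid k M ((Coalgebra.counit (R := k) (A := MonoidAlgebra k Γ)).rTensor M
          (L.subtype.lTensor (MonoidAlgebra k Γ) t)) := by
      intro t
      induction t with
      | zero => simp
      | add a b ha hb => simp only [map_add, Submodule.coe_add, ha, hb]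
      | tmul a b => simp
    simp only [LinearMap.comp_apply, LinearEquiv.coe_coe, e1, lTensor_restrictCoact]
    exact congr($(Y.counit) x)
  compat := fun g => by
    ext x
    apply lTensor_subtype_injective (MonoidAlgebra k Γ) L
    simp only [LinearMap.comp_apply, MonoidHom.coe_mk, OneHom.coe_mk, lTensor_restrictCoact]
    rw [← LinearMap.lTensor_comp_apply, LinearMap.subtype_comp_restrict,
      LinearMap.domRestrict, LinearMap.lTensor_comp_apply, lTensor_restrictCoact]
    exact congr($(Y.compat g) x)

/-- The quotient of an object by a subobject. -/
def quotient (Y : YetterDrinfeld k Γ M) (L : Submodule k M) (hL : Y.IsSubobject L) :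
    YetterDrinfeld k Γ (M ⧸ L) where
  act :=
    { toFun := fun g => L.mapQ L (Y.act g) (hL.act_mem g)
      map_one' := by ext; simp
      map_mul' := fun g h => by ext; simp }
  coact := L.liftQ (L.mkQ.lTensor (MonoidAlgebra k Γ) ∘ₗ Y.coact) (fun x hx => by
    obtain ⟨u, hu⟩ := hL.coact_mem x hx
    rw [LinearMap.mem_ker, LinearMap.comp_apply, ← hu, ← LinearMap.lTensor_comp_apply]
    have : L.mkQ ∘ₗ L.subtype = 0 := by ext; simp
    simp [this])
  coassoc := by
    ext v : 2
    induction v using Y.homog_induction with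
    | hom γ v hv =>
      rw [IsHomog] at hv
      simp [hv]
    | add v w h1 h2 => simp only [map_add, h1, h2]
  counit := by
    ext v : 2
    induction v using Y.homog_induction with
    | hom γ v hv =>
      rw [IsHomog] at hv
      simp [hv]
    | add v w h1 h2 => simp only [map_add, h1, h2]
  compat := fun g => by
    ext v : 2
    induction v using Y.homog_induction with
    | hom γ v hv =>
      have h2 := hv.act g
      rw [IsHomog] at hv h2
      simp [hv, h2]
    | add v w h1 h2 => simp only [map_add, h1, h2]

end Constructions

end YetterDrinfeld

/-- The data from which the generalized quantum double is built: a bimultiplicative map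
`τ₀ : F × G → kˣ` and elements `fᵢ ∈ F`, `gᵢ ∈ G`. -/
structure DoubleData (k F G I : Type*) [Field k] [CommGroup F] [CommGroup G] where
  τ₀ : F →* G →* kˣ
  f : I → F
  g : I → G

namespace DoubleData

variable {k F G I : Type*} [Field k] [CommGroup F] [CommGroup G] (D : DoubleData k F G I)

/-- `V = ⨁ᵢ (k vᵢ; ĝᵢ, fᵢ)` over `F`, where `ĝᵢ(f) = τ₀(f, gᵢ)`. -/
def V : YetterDrinfeld k F (I →₀ k) := .diag (fun i => D.τ₀.flip (D.g i)) D.f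

/-- `W = ⨁ᵢ (k wᵢ; f̂ᵢ⁻¹, gᵢ)` over `G`, where `f̂ᵢ(g) = τ₀(fᵢ, g)`. -/
def W : YetterDrinfeld k G (I →₀ k) := .diag (fun i => (D.τ₀ (D.f i))⁻¹) D.g

/-- the Hopf algebra `B = 𝔅(V) ⋊ F` -/
abbrev B : Type _ := D.V.Boson

/-- the Hopf algebra `H = 𝔅(W) ⋊ G` -/
abbrev H : Type _ := D.W.Boson

/-- the element `vᵢ` of `B` -/
def vB (i : I) : D.B := YetterDrinfeld.Boson.ι D.V (Finsupp.single i 1)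

/-- the element `wᵢ` of `H` -/
def wH (i : I) : D.H := YetterDrinfeld.Boson.ι D.W (Finsupp.single i 1)

/-- the elements `f ∈ F` of `B` -/
def ofB : F →* D.B := YetterDrinfeld.Boson.of D.V

/-- the elements `g ∈ G` of `H` -/
def ofH : G →* D.H := YetterDrinfeld.Boson.of D.W

/-- The cross relations of the generalized quantum double, for a pair of algebra maps `p`, `q`
from `B` and `H` to an algebra:
`g f = f g`, `g vᵢ = τ₀(fᵢ, g) vᵢ g`, `wᵢ f = τ₀(f, gᵢ) f wᵢ` and
`wⱼ vᵢ = τ₀(fᵢ, gⱼ) vᵢ wⱼ + δᵢⱼ (fᵢ gᵢ - 1)`. -/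
structure CrossRel {A : Type*} [Ring A] [Algebra k A] (p : D.B → A) (q : D.H → A) : Prop where
  gf : ∀ f g, q (D.ofH g) * p (D.ofB f) = p (D.ofB f) * q (D.ofH g)
  gv : ∀ i g, q (D.ofH g) * p (D.vB i) =
    (D.τ₀ (D.f i) g : k) • (p (D.vB i) * q (D.ofH g))
  wf : ∀ i f, q (D.wH i) * p (D.ofB f) =
    (D.τ₀ f (D.g i) : k) • (p (D.ofB f) * q (D.wH i))
  wv_ne : ∀ i j, i ≠ j → q (D.wH j) * p (D.vB i) =
    (D.τ₀ (D.f i) (D.g j) : k) • (p (D.vB i) * q (D.wH j))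
  wv_eq : ∀ i, q (D.wH i) * p (D.vB i) =
    (D.τ₀ (D.f i) (D.g i) : k) • (p (D.vB i) * q (D.wH i)) +
      (p (D.ofB (D.f i)) * q (D.ofH (D.g i)) - 1)

/-- the generator given by an element of `B` -/
def genB (x : D.B) : TensorAlgebra k (D.B × D.H) := TensorAlgebra.ι k (x, 0)

/-- the generator given by an element of `H` -/
def genH (y : D.H) : TensorAlgebra k (D.B × D.H) := TensorAlgebra.ι k (0, y)

/-- The defining relations of the generalized quantum double: the relations of `B`, the
relations of `H`, and the cross relations. -/
inductive Rel : TensorAlgebra k (D.B × D.H) → TensorAlgebra k (D.B × D.H) → Prop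
  | oneB : Rel (D.genB 1) 1
  | mulB (x y : D.B) : Rel (D.genB (x * y)) (D.genB x * D.genB y)
  | oneH : Rel (D.genH 1) 1
  | mulH (x y : D.H) : Rel (D.genH (x * y)) (D.genH x * D.genH y)
  | gf (f : F) (g : G) :
      Rel (D.genH (D.ofH g) * D.genB (D.ofB f)) (D.genB (D.ofB f) * D.genH (D.ofH g))
  | gv (i : I) (g : G) : Rel (D.genH (D.ofH g) * D.genB (D.vB i))
      ((D.τ₀ (D.f i) g : k) • (D.genB (D.vB i) * D.genH (D.ofH g)))
  | wf (i : I) (f : F) : Rel (D.genH (D.wH i) * D.genB (D.ofB f))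
      ((D.τ₀ f (D.g i) : k) • (D.genB (D.ofB f) * D.genH (D.wH i)))
  | wv_ne (i j : I) (hij : i ≠ j) : Rel (D.genH (D.wH j) * D.genB (D.vB i))
      ((D.τ₀ (D.f i) (D.g j) : k) • (D.genB (D.vB i) * D.genH (D.wH j)))
  | wv_eq (i : I) : Rel (D.genH (D.wH i) * D.genB (D.vB i))
      ((D.τ₀ (D.f i) (D.g i) : k) • (D.genB (D.vB i) * D.genH (D.wH i)) +
        (D.genB (D.ofB (D.f i)) * D.genH (D.ofH (D.g i)) - 1))

/-- The generalized quantum double `𝒟 = B ⋈ H`: the algebra generated by the algebras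
`B = 𝔅(V) ⋊ F` and `H = 𝔅(W) ⋊ G` subject to the cross relations. -/
def Double : Type _ := RingQuot D.Rel

namespace Double

instance : Ring D.Double := inferInstanceAs (Ring (RingQuot D.Rel))

instance : Algebra k D.Double := inferInstanceAs (Algebra k (RingQuot D.Rel))

/-- the quotient map onto `𝒟` -/
def mk : TensorAlgebra k (D.B × D.H) →ₐ[k] D.Double := RingQuot.mkAlgHom k D.Rel

lemma mk_rel {x y} (h : D.Rel x y) : mk D x = mk D y := RingQuot.mkAlgHom_rel k h

/-- the map `B → 𝒟` -/
def inB : D.B →ₐ[k] D.Double :=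
  AlgHom.ofLinearMap ((mk D).toLinearMap ∘ₗ TensorAlgebra.ι k ∘ₗ LinearMap.inl k D.B D.H)
    ((mk_rel D .oneB).trans (map_one _))
    (fun x y => (mk_rel D (.mulB x y)).trans (map_mul _ _ _))

/-- the map `H → 𝒟` -/
def inH : D.H →ₐ[k] D.Double :=
  AlgHom.ofLinearMap ((mk D).toLinearMap ∘ₗ TensorAlgebra.ι k ∘ₗ LinearMap.inr k D.B D.H)
    ((mk_rel D .oneH).trans (map_one _))
    (fun x y => (mk_rel D (.mulH x y)).trans (map_mul _ _ _))

lemma mk_genB (x : D.B) : mk D (D.genB x) = inB D x := rfl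

lemma mk_genH (x : D.H) : mk D (D.genH x) = inH D x := rfl

lemma crossRel : D.CrossRel (inB D) (inH D) where
  gf f g := by simpa [mk_genB, mk_genH] using mk_rel D (.gf f g)
  gv i g := by simpa [mk_genB, mk_genH] using mk_rel D (.gv i g)
  wf i f := by simpa [mk_genB, mk_genH] using mk_rel D (.wf i f)
  wv_ne i j h := by simpa [mk_genB, mk_genH] using mk_rel D (.wv_ne i j h)
  wv_eq i := by simpa [mk_genB, mk_genH] using mk_rel D (.wv_eq i)

section lift

variable {D} {A : Type*} [Ring A] [Algebra k A]

/-- Algebra maps out of `𝒟`. -/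
def lift (p : D.B →ₐ[k] A) (q : D.H →ₐ[k] A) (h : D.CrossRel p q) : D.Double →ₐ[k] A :=
  RingQuot.liftAlgHom k ⟨TensorAlgebra.lift k (p.toLinearMap.coprod q.toLinearMap), by
    intro x y hxy
    induction hxy with
    | oneB => simp [genB]
    | mulB x y => simp [genB]
    | oneH => simp [genH]
    | mulH x y => simp [genH]
    | gf f g => simpa [genB, genH] using h.gf f g
    | gv i g => simpa [genB, genH] using h.gv i g
    | wf i f => simpa [genB, genH] using h.wf i f
    | wv_ne i j hij => simpa [genB, genH] using h.wv_ne i j hij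
    | wv_eq i => simpa [genB, genH] using h.wv_eq i⟩

@[simp] lemma lift_inB (p : D.B →ₐ[k] A) (q : D.H →ₐ[k] A) (h : D.CrossRel p q) (x : D.B) :
    lift p q h (inB D x) = p x := by
  change RingQuot.liftAlgHom k _ (RingQuot.mkAlgHom k D.Rel (TensorAlgebra.ι k (x, 0))) = _
  rw [RingQuot.liftAlgHom_mkAlgHom_apply]
  simp

@[simp] lemma lift_inH (p : D.B →ₐ[k] A) (q : D.H →ₐ[k] A) (h : D.CrossRel p q) (x : D.H) :
    lift p q h (inH D x) = q x := by
  change RingQuot.liftAlgHom k _ (RingQuot.mkAlgHom k D.Rel (TensorAlgebra.ι k (0, x))) = _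
  rw [RingQuot.liftAlgHom_mkAlgHom_apply]
  simp

lemma algHom_ext {p q : D.Double →ₐ[k] A} (h1 : ∀ x, p (inB D x) = q (inB D x))
    (h2 : ∀ x, p (inH D x) = q (inH D x)) : p = q := by
  refine RingQuot.ringQuot_ext' k _ _ (TensorAlgebra.hom_ext (LinearMap.prod_ext ?_ ?_))
  · exact LinearMap.ext h1
  · exact LinearMap.ext h2

end lift

/-- `𝒟` is generated by `B` and `H`. -/
lemma adjoin_eq_top : Algebra.adjoin k (Set.range (inB D) ∪ Set.range (inH D)) = ⊤ := by
  set S := Algebra.adjoin k (Set.range (inB D) ∪ Set.range (inH D))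
  rw [eq_top_iff]
  rintro x -
  obtain ⟨x, rfl⟩ := RingQuot.mkAlgHom_surjective k D.Rel x
  change mk D x ∈ S
  induction x using TensorAlgebra.induction with
  | algebraMap r => simp
  | ι v =>
    have : TensorAlgebra.ι k v = D.genB v.1 + D.genH v.2 := by
      simp [genB, genH, ← map_add]
    rw [this, map_add]
    exact S.add_mem (Algebra.subset_adjoin (Or.inl ⟨v.1, rfl⟩))
      (Algebra.subset_adjoin (Or.inr ⟨v.2, rfl⟩))
  | mul a b ha hb => simpa using S.mul_mem ha hb
  | add a b ha hb => simpa using S.add_mem ha hb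

/-! ### The Hopf algebra structure, for which `B` and `H` are Hopf subalgebras -/

@[simp] lemma comul_ofB (f : F) :
    Coalgebra.comul (R := k) (D.ofB f) = D.ofB f ⊗ₜ D.ofB f :=
  YetterDrinfeld.Boson.comul_of _ f

@[simp] lemma comul_ofH (g : G) :
    Coalgebra.comul (R := k) (D.ofH g) = D.ofH g ⊗ₜ D.ofH g :=
  YetterDrinfeld.Boson.comul_of _ g

@[simp] lemma comul_vB (i : I) :
    Coalgebra.comul (R := k) (D.vB i) = D.vB i ⊗ₜ 1 + D.ofB (D.f i) ⊗ₜ D.vB i :=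
  YetterDrinfeld.Boson.comul_ι _ (YetterDrinfeld.diag_isHomog _ _ i)

@[simp] lemma comul_wH (i : I) :
    Coalgebra.comul (R := k) (D.wH i) = D.wH i ⊗ₜ 1 + D.ofH (D.g i) ⊗ₜ D.wH i :=
  YetterDrinfeld.Boson.comul_ι _ (YetterDrinfeld.diag_isHomog _ _ i)

@[simp] lemma counit_ofB (f : F) : Coalgebra.counit (R := k) (D.ofB f) = 1 :=
  YetterDrinfeld.Boson.counit_of _ f

@[simp] lemma counit_ofH (g : G) : Coalgebra.counit (R := k) (D.ofH g) = 1 :=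
  YetterDrinfeld.Boson.counit_of _ g

@[simp] lemma counit_vB (i : I) : Coalgebra.counit (R := k) (D.vB i) = 0 :=
  YetterDrinfeld.Boson.counit_ι _ _

@[simp] lemma counit_wH (i : I) : Coalgebra.counit (R := k) (D.wH i) = 0 :=
  YetterDrinfeld.Boson.counit_ι _ _

@[simp] lemma antipode_ofB (f : F) : HopfAlgebra.antipode k (D.ofB f) = D.ofB f⁻¹ :=
  YetterDrinfeld.Boson.antipode_of _ f

@[simp] lemma antipode_ofH (g : G) : HopfAlgebra.antipode k (D.ofH g) = D.ofH g⁻¹ :=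
  YetterDrinfeld.Boson.antipode_of _ g

@[simp] lemma antipode_vB (i : I) :
    HopfAlgebra.antipode k (D.vB i) = - (D.ofB (D.f i)⁻¹ * D.vB i) :=
  YetterDrinfeld.Boson.antipode_ι _ (YetterDrinfeld.diag_isHomog _ _ i)

@[simp] lemma antipode_wH (i : I) :
    HopfAlgebra.antipode k (D.wH i) = - (D.ofH (D.g i)⁻¹ * D.wH i) :=
  YetterDrinfeld.Boson.antipode_ι _ (YetterDrinfeld.diag_isHomog _ _ i)

/-- the coproduct on `B` -/
def comulB : D.B →ₐ[k] D.Double ⊗[k] D.Double :=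
  (Algebra.TensorProduct.map (inB D) (inB D)).comp (Bialgebra.comulAlgHom k D.B)

/-- the coproduct on `H` -/
def comulH : D.H →ₐ[k] D.Double ⊗[k] D.Double :=
  (Algebra.TensorProduct.map (inH D) (inH D)).comp (Bialgebra.comulAlgHom k D.H)

lemma crossRel_comul : D.CrossRel (comulB D) (comulH D) where
  gf f g := by simp [comulB, comulH, (crossRel D).gf]
  gv i g := by
    simp [comulB, comulH, (crossRel D).gf, (crossRel D).gv, mul_add, add_mul,
      TensorProduct.smul_tmul', TensorProduct.tmul_smul]
  wf i f := by
    simp [comulB, comulH, (crossRel D).gf, (crossRel D).wf, mul_add, add_mul,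
      TensorProduct.smul_tmul', TensorProduct.tmul_smul]
  wv_ne i j hij := by
    simp [comulB, comulH, (crossRel D).gf, (crossRel D).wf, (crossRel D).gv,
      (crossRel D).wv_ne i j hij, mul_add, add_mul,
      TensorProduct.smul_tmul', TensorProduct.tmul_smul]
    abel
  wv_eq i := by
    simp [comulB, comulH, (crossRel D).gf, (crossRel D).wf, (crossRel D).gv,
      (crossRel D).wv_eq, mul_add, add_mul, TensorProduct.tmul_add, TensorProduct.add_tmul,
      TensorProduct.tmul_sub, TensorProduct.sub_tmul, Algebra.TensorProduct.one_def,
      TensorProduct.smul_tmul', TensorProduct.tmul_smul]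
    abel

/-- the coproduct of `𝒟` -/
def comulAlg : D.Double →ₐ[k] D.Double ⊗[k] D.Double := lift _ _ (crossRel_comul D)

/-- the counit of `𝒟` -/
def counitAlg : D.Double →ₐ[k] k :=
  lift (Bialgebra.counitAlgHom k D.B) (Bialgebra.counitAlgHom k D.H)
    { gf := fun f g => by simp
      gv := fun i g => by simp
      wf := fun i f => by simp
      wv_ne := fun i j _ => by simp
      wv_eq := fun i => by simp }

lemma comulAlg_inB (x : D.B) : comulAlg D (inB D x) =
    TensorProduct.map (inB D).toLinearMap (inB D).toLinearMap (Coalgebra.comul (R := k) x) := by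
  simp [comulAlg, comulB]; rfl

lemma comulAlg_inH (x : D.H) : comulAlg D (inH D x) =
    TensorProduct.map (inH D).toLinearMap (inH D).toLinearMap (Coalgebra.comul (R := k) x) := by
  simp [comulAlg, comulH]; rfl

@[simp] lemma counitAlg_inB (x : D.B) :
    counitAlg D (inB D x) = Coalgebra.counit (R := k) x := by
  simp [counitAlg]

@[simp] lemma counitAlg_inH (x : D.H) :
    counitAlg D (inH D x) = Coalgebra.counit (R := k) x := by
  simp [counitAlg]

/-- A check of the coalgebra axioms on the generators of `B` and `H`. -/
lemma algHom_ext' {A : Type*} [Ring A] [Algebra k A] {p q : D.Double →ₐ[k] A}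
    (h1 : ∀ f, p (inB D (D.ofB f)) = q (inB D (D.ofB f)))
    (h2 : ∀ i, p (inB D (D.vB i)) = q (inB D (D.vB i)))
    (h3 : ∀ g, p (inH D (D.ofH g)) = q (inH D (D.ofH g)))
    (h4 : ∀ i, p (inH D (D.wH i)) = q (inH D (D.wH i))) : p = q := by
  have e1 : p.comp (inB D) = q.comp (inB D) := by
    refine YetterDrinfeld.Boson.algHom_ext (fun v => ?_) h1
    induction v using Finsupp.induction_linear with
    | zero => simp
    | add a b ha hb => simp only [map_add, ha, hb]
    | single i c =>
      rw [← mul_one c, ← smul_eq_mul, ← Finsupp.smul_single, map_smul, map_smul, map_smul]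
      congr 1
      exact h2 i
  have e2 : p.comp (inH D) = q.comp (inH D) := by
    refine YetterDrinfeld.Boson.algHom_ext (fun v => ?_) h3
    induction v using Finsupp.induction_linear with
    | zero => simp
    | add a b ha hb => simp only [map_add, ha, hb]
    | single i c =>
      rw [← mul_one c, ← smul_eq_mul, ← Finsupp.smul_single, map_smul, map_smul, map_smul]
      congr 1
      exact h4 i
  exact algHom_ext (fun x => congr($e1 x)) (fun x => congr($e2 x))

instance : Bialgebra k D.Double :=
  Bialgebra.ofAlgHom (comulAlg D) (counitAlg D)
    (by
      apply algHom_ext' <;> intro i <;>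
      simp [comulAlg_inB, comulAlg_inH, TensorProduct.add_tmul, TensorProduct.tmul_add,
        Algebra.TensorProduct.one_def, add_assoc])
    (by apply algHom_ext' <;> intro i <;> simp [comulAlg_inB, comulAlg_inH])
    (by apply algHom_ext' <;> intro i <;> simp [comulAlg_inB, comulAlg_inH])

lemma comul_inB (x : D.B) : Coalgebra.comul (R := k) (inB D x) =
    TensorProduct.map (inB D).toLinearMap (inB D).toLinearMap (Coalgebra.comul (R := k) x) :=
  comulAlg_inB D x

lemma comul_inH (x : D.H) : Coalgebra.comul (R := k) (inH D x) =
    TensorProduct.map (inH D).toLinearMap (inH D).toLinearMap (Coalgebra.comul (R := k) x) :=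
  comulAlg_inH D x

@[simp] lemma counit_inB (x : D.B) :
    Coalgebra.counit (R := k) (inB D x) = Coalgebra.counit (R := k) x :=
  counitAlg_inB D x

@[simp] lemma counit_inH (x : D.H) :
    Coalgebra.counit (R := k) (inH D x) = Coalgebra.counit (R := k) x :=
  counitAlg_inH D x

/-- the antipode on `B` -/
def antiB : D.B →ₐ[k] D.Doubleᵐᵒᵖ := (inB D).op.comp (HopfAlgebra.antipodeAlgHomOp k D.B)

/-- the antipode on `H` -/
def antiH : D.H →ₐ[k] D.Doubleᵐᵒᵖ := (inH D).op.comp (HopfAlgebra.antipodeAlgHomOp k D.H)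

lemma antiB_apply (x : D.B) :
    antiB D x = MulOpposite.op (inB D (HopfAlgebra.antipode k x)) := rfl

lemma antiH_apply (x : D.H) :
    antiH D x = MulOpposite.op (inH D (HopfAlgebra.antipode k x)) := rfl

lemma antipode_vw (i j : I) :
    inB D (-(D.ofB (D.f i)⁻¹ * D.vB i)) * inH D (-(D.ofH (D.g j)⁻¹ * D.wH j)) =
      (D.τ₀ (D.f i) (D.g j) : k) • (inB D (D.ofB (D.f i)⁻¹) * inH D (D.ofH (D.g j)⁻¹) *
        (inB D (D.vB i) * inH D (D.wH j))) := by
  have h := (crossRel D).gv i (D.g j)⁻¹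
  rw [map_neg, map_neg, neg_mul_neg, map_mul, map_mul, mul_assoc, mul_assoc,
    ← mul_assoc (inH D (D.ofH _)), h]
  simp [mul_assoc]

lemma antipode_wv (i j : I) :
    inH D (-(D.ofH (D.g j)⁻¹ * D.wH j)) * inB D (-(D.ofB (D.f i)⁻¹ * D.vB i)) =
      (D.τ₀ (D.f i) (D.g j) : k)⁻¹ • (inB D (D.ofB (D.f i)⁻¹) * inH D (D.ofH (D.g j)⁻¹) *
        (inH D (D.wH j) * inB D (D.vB i))) := by
  have h := (crossRel D).wf j (D.f i)⁻¹
  rw [map_neg, map_neg, neg_mul_neg, map_mul, map_mul, mul_assoc, ← mul_assoc (inH D (D.wH j)), h,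
    ← (crossRel D).gf]
  simp [mul_assoc]

lemma crossRel_anti : D.CrossRel (antiB D) (antiH D) where
  gf f g := by
    rw [antiB_apply, antiH_apply, ← MulOpposite.op_mul, ← MulOpposite.op_mul, antipode_ofB,
      antipode_ofH, (crossRel D).gf]
  gv i g := by
    rw [antiB_apply, antiH_apply, ← MulOpposite.op_mul, ← MulOpposite.op_mul, antipode_vB,
      antipode_ofH, ← MulOpposite.op_smul]
    congr 1
    rw [map_neg, map_mul, neg_mul, mul_neg, smul_neg, mul_assoc, ← mul_assoc (inH D _),
      (crossRel D).gf, mul_assoc, (crossRel D).gv, mul_smul_comm, smul_smul]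
    simp
  wf i f := by
    rw [antiB_apply, antiH_apply, ← MulOpposite.op_mul, ← MulOpposite.op_mul, antipode_wH,
      antipode_ofB, ← MulOpposite.op_smul]
    congr 1
    rw [map_neg, map_mul, neg_mul, mul_neg, smul_neg, mul_assoc, (crossRel D).wf, mul_smul_comm,
      smul_smul, ← mul_assoc, ← mul_assoc, (crossRel D).gf]
    simp
  wv_ne i j hij := by
    rw [antiB_apply, antiH_apply, ← MulOpposite.op_mul, ← MulOpposite.op_mul, antipode_vB,
      antipode_wH, ← MulOpposite.op_smul]
    congr 1
    rw [antipode_vw, antipode_wv, (crossRel D).wv_ne i j hij, smul_inv_smul₀ (Units.ne_zero _),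
      mul_smul_comm]
  wv_eq i := by
    rw [antiB_apply, antiH_apply, antiB_apply, antiH_apply, ← MulOpposite.op_mul,
      ← MulOpposite.op_mul, ← MulOpposite.op_mul, antipode_vB,
      antipode_wH, ← MulOpposite.op_smul, ← MulOpposite.op_one, ← MulOpposite.op_sub,
      ← MulOpposite.op_add]
    congr 1
    rw [antipode_vw, antipode_wv, (crossRel D).wv_eq i, smul_inv_smul₀ (Units.ne_zero _), mul_add,
      mul_smul_comm,
      mul_sub, antipode_ofB, antipode_ofH, (crossRel D).gf]
    have e : inB D (D.ofB (D.f i)⁻¹) * inH D (D.ofH (D.g i)⁻¹) *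
        (inB D (D.ofB (D.f i)) * inH D (D.ofH (D.g i))) = 1 := by
      rw [← (crossRel D).gf, mul_assoc, ← mul_assoc (inB D _) (inB D _), ← map_mul, ← map_mul]
      simp [← map_mul]
    rw [e, mul_one]
    abel

/-- the antipode of `𝒟` -/
def antiAlg : D.Double →ₐ[k] D.Doubleᵐᵒᵖ := lift _ _ (crossRel_anti D)

@[simp] lemma antiAlg_inB (x : D.B) :
    antiAlg D (inB D x) = MulOpposite.op (inB D (HopfAlgebra.antipode k x)) := by
  simp [antiAlg, antiB_apply]

@[simp] lemma antiAlg_inH (x : D.H) :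
    antiAlg D (inH D x) = MulOpposite.op (inH D (HopfAlgebra.antipode k x)) := by
  simp [antiAlg, antiH_apply]

instance : HopfAlgebra k D.Double :=
  HopfAlgebra.ofGenerators (antiAlg D) _ (adjoin_eq_top D)
    (by
      rintro _ (⟨x, rfl⟩ | ⟨x, rfl⟩)
      · rw [comul_inB, counit_inB, ← AlgHom.commutes (inB D),
          ← HopfAlgebra.mul_antipode_rTensor_comul_apply]
        generalize Coalgebra.comul (R := k) x = t
        induction t with
        | zero => simp
        | add a b ha hb => simp only [map_add, ha, hb]
        | tmul a b => simp
      · rw [comul_inH, counit_inH, ← AlgHom.commutes (inH D),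
          ← HopfAlgebra.mul_antipode_rTensor_comul_apply]
        generalize Coalgebra.comul (R := k) x = t
        induction t with
        | zero => simp
        | add a b ha hb => simp only [map_add, ha, hb]
        | tmul a b => simp)
    (by
      rintro _ (⟨x, rfl⟩ | ⟨x, rfl⟩)
      · rw [comul_inB, counit_inB, ← AlgHom.commutes (inB D),
          ← HopfAlgebra.mul_antipode_lTensor_comul_apply]
        generalize Coalgebra.comul (R := k) x = t
        induction t with
        | zero => simp
        | add a b ha hb => simp only [map_add, ha, hb]
        | tmul a b => simp
      · rw [comul_inH, counit_inH, ← AlgHom.commutes (inH D),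
          ← HopfAlgebra.mul_antipode_lTensor_comul_apply]
        generalize Coalgebra.comul (R := k) x = t
        induction t with
        | zero => simp
        | add a b ha hb => simp only [map_add, ha, hb]
        | tmul a b => simp)

end Double
end DoubleData

/-! ### Cocycle deformations -/

/-- A (normalized) 2-cocycle for the bialgebra `E`: a convolution invertible linear form `σ` on
`E ⊗ E` with `σ(x, 1) = ε(x) = σ(1, x)` and
`σ(x₁, y₁) σ(x₂ y₂, z) = σ(y₁, z₁) σ(x, y₂ z₂)`.  The cocycle identity is an equality of
convolution products of linear forms on `(E ⊗ E) ⊗ E`. -/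
structure IsTwoCocycle {k E : Type*} [Field k] [Ring E] [Bialgebra k E]
    (σ : (WithConv (E ⊗[k] E →ₗ[k] k))ˣ) : Prop where
  one_left : ∀ x : E, σ.val.ofConv (1 ⊗ₜ x) = Coalgebra.counit x
  one_right : ∀ x : E, σ.val.ofConv (x ⊗ₜ 1) = Coalgebra.counit x
  cocycle :
    WithConv.toConv (LinearMap.mul' k k ∘ₗ
        TensorProduct.map σ.val.ofConv (Coalgebra.counit (R := k) (A := E))) *
      WithConv.toConv (σ.val.ofConv ∘ₗ (LinearMap.mul' k E).rTensor E) =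
    WithConv.toConv (LinearMap.mul' k k ∘ₗ
        TensorProduct.map (Coalgebra.counit (R := k) (A := E)) σ.val.ofConv ∘ₗ
        (TensorProduct.assoc k E E E).toLinearMap) *
      WithConv.toConv (σ.val.ofConv ∘ₗ (LinearMap.mul' k E).lTensor E ∘ₗ
        (TensorProduct.assoc k E E E).toLinearMap)

/-- The product of the cocycle deformation `E^σ`,
`x ⊗ y ↦ σ(x₁, y₁) x₂ y₂ σ⁻¹(x₃, y₃)`, where `σ⁻¹` is the convolution inverse. -/
def deformedMul {k E : Type*} [Field k] [Ring E] [Bialgebra k E]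
    (σ : (WithConv (E ⊗[k] E →ₗ[k] k))ˣ) : E ⊗[k] E →ₗ[k] E :=
  (WithConv.toConv (Algebra.linearMap k E ∘ₗ σ.val.ofConv) *
    WithConv.toConv (LinearMap.mul' k E) *
    WithConv.toConv (Algebra.linearMap k E ∘ₗ σ⁻¹.val.ofConv)).ofConv

namespace DoubleData

variable {k F G I : Type*} [Field k] [CommGroup F] [CommGroup G] (D : DoubleData k F G I)

/-! ### Thin Hopf ideals -/

/-- the inclusion of `V` into `𝒟` -/
def v : (I →₀ k) →ₗ[k] D.Double :=
  (Double.inB D).toLinearMap ∘ₗ YetterDrinfeld.Boson.ι D.V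

/-- the inclusion of `W` into `𝒟` -/
def w : (I →₀ k) →ₗ[k] D.Double :=
  (Double.inH D).toLinearMap ∘ₗ YetterDrinfeld.Boson.ι D.W

/-- the grouplike `f g` of `𝒟` given by `(f, g) ∈ F × G` -/
def grp (t : F × G) : D.Double := Double.inB D (D.ofB t.1) * Double.inH D (D.ofH t.2)

/-- `𝔞` is thin: `V ∩ 𝔞 = 0 = W ∩ 𝔞`. -/
def IsThin (𝔞 : Ideal D.Double) : Prop :=
  LinearMap.range D.v ⊓ 𝔞.restrictScalars k = ⊥ ∧
  LinearMap.range D.w ⊓ 𝔞.restrictScalars k = ⊥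

/-- the character `ĝᵢ f̂ᵢ` of `F × G`: `(f, g) ↦ τ₀(f, gᵢ) τ₀(fᵢ, g)` -/
def chi (i : I) : F × G →* kˣ := (D.τ₀.flip (D.g i)).coprod (D.τ₀ (D.f i))

/-- the subgroup `C` of all `f g` with `τ₀(f, gᵢ) τ₀(fᵢ, g) = 1` for all `i` -/
def C : Subgroup (F × G) := ⨅ i, (D.chi i).ker

lemma chi_eq_one {t : F × G} (ht : t ∈ D.C) (i : I) : D.chi i t = 1 := by
  rw [C, Subgroup.mem_iInf] at ht
  exact ht i

section Gamma

variable (T : Subgroup (F × G)) (hT : T ≤ D.C)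

/-- `ĝᵢ f̂ᵢ` as a character of `Γ = (F × G) / T` -/
def chiBar (i : I) : (F × G) ⧸ T →* kˣ :=
  QuotientGroup.lift T (D.chi i) (fun _ ht => D.chi_eq_one (hT ht) i)

/-- `V = ⨁ᵢ (k vᵢ; ĝᵢ f̂ᵢ, fᵢ)` over `Γ` -/
def VΓ : YetterDrinfeld k ((F × G) ⧸ T) (I →₀ k) :=
  .diag (D.chiBar T hT) (fun i => QuotientGroup.mk (D.f i, 1))

/-- `W = ⨁ᵢ (k wᵢ; (ĝᵢ f̂ᵢ)⁻¹, gᵢ)` over `Γ` -/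
def WΓ : YetterDrinfeld k ((F × G) ⧸ T) (I →₀ k) :=
  .diag (fun i => (D.chiBar T hT i)⁻¹) (fun i => QuotientGroup.mk (1, D.g i))

/-- `I_T = {i | fᵢ gᵢ ∈ T}` -/
def IT : Set I := {i | (D.f i, D.g i) ∈ T}

end Gamma

/-- The data `T`, `Z`, `ζ`: a subgroup `T ⊆ C`, a subobject `Z` of
`V_T = ⨁_{i ∈ I_T} k vᵢ` and a monomorphism `ζ` from `Z` into `W_T = ⨁_{i ∈ I_T} k wᵢ`, both in
the category of Yetter-Drinfeld modules over `Γ = (F × G) / T`. -/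
structure ThinData where
  T : Subgroup (F × G)
  T_le : T ≤ D.C
  Z : Submodule k (I →₀ k)
  Z_le : Z ≤ Finsupp.supported k k (D.IT T)
  Z_sub : (D.VΓ T T_le).IsSubobject Z
  ζ : Z →ₗ[k] (I →₀ k)
  ζ_mem : ∀ z, ζ z ∈ Finsupp.supported k k (D.IT T)
  ζ_injective : Function.Injective ζ
  ζ_hom : ((D.VΓ T T_le).restrict Z Z_sub).IsHom (D.WΓ T T_le) ζ

namespace ThinData

variable {D} (P : D.ThinData)

/-- The ideal `𝔞(T, Z, ζ)` of `𝒟` generated by all `t - 1` (`t ∈ T`) and all `z - ζ(z)`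
(`z ∈ Z`). -/
def ideal : Ideal D.Double :=
  (TwoSidedIdeal.span ({x | ∃ t ∈ P.T, x = D.grp t - 1} ∪
    {x | ∃ z : P.Z, x = D.v z - D.w (P.ζ z)})).asIdeal

/-- the group `Γ = (F × G) / T` -/
abbrev Γ : Type _ := (F × G) ⧸ P.T

/-- the object `V ⊕ W` over `Γ` -/
def VW : YetterDrinfeld k P.Γ ((I →₀ k) × (I →₀ k)) := (D.VΓ P.T P.T_le).prod (D.WΓ P.T P.T_le)

/-- the subspace of all `z - ζ(z)` (`z ∈ Z`) in `V ⊕ W` -/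
def K : Submodule k ((I →₀ k) × (I →₀ k)) := LinearMap.range (P.Z.subtype.prod (-P.ζ))

lemma K_sub : P.VW.IsSubobject P.K where
  act_mem := by
    rintro g _ ⟨z, rfl⟩
    refine ⟨((D.VΓ P.T P.T_le).restrict P.Z P.Z_sub).act g z, ?_⟩
    have h := congr($(P.ζ_hom.act g) z)
    simp only [LinearMap.comp_apply] at h
    refine Prod.ext rfl ?_
    change -(P.ζ _) = (D.WΓ P.T P.T_le).act g (-(P.ζ z))
    rw [map_neg, h]
  coact_mem := by
    rintro _ ⟨z, rfl⟩
    have h := congr($(P.ζ_hom.coact) z)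
    have h2 := (D.VΓ P.T P.T_le).lTensor_restrictCoact P.Z P.Z_sub z
    simp only [LinearMap.comp_apply] at h
    have h3 : P.VW.coact (P.Z.subtype.prod (-P.ζ) z) =
        (P.Z.subtype.prod (-P.ζ)).lTensor (MonoidAlgebra k P.Γ)
          (((D.VΓ P.T P.T_le).restrict P.Z P.Z_sub).coact z) := by
      have e : P.Z.subtype.prod (-P.ζ) = LinearMap.inl k _ _ ∘ₗ P.Z.subtype -
          LinearMap.inr k _ _ ∘ₗ P.ζ := by ext <;> simp
      have e2 : P.VW.coact (P.Z.subtype.prod (-P.ζ) z) =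
          (LinearMap.inl k (I →₀ k) (I →₀ k)).lTensor (MonoidAlgebra k P.Γ)
            ((D.VΓ P.T P.T_le).coact z) +
          (LinearMap.inr k (I →₀ k) (I →₀ k)).lTensor (MonoidAlgebra k P.Γ)
            ((D.WΓ P.T P.T_le).coact (-P.ζ z)) := rfl
      rw [e2, ← h2, map_neg, h, e, LinearMap.lTensor_sub, LinearMap.sub_apply,
        LinearMap.lTensor_comp_apply, LinearMap.lTensor_comp_apply, map_neg, sub_eq_add_neg]
      rfl
    rw [h3]
    have e4 : P.Z.subtype.prod (-P.ζ) = P.K.subtype ∘ₗ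
        LinearMap.codRestrict P.K (P.Z.subtype.prod (-P.ζ)) (fun z => ⟨z, rfl⟩) := rfl
    rw [e4, LinearMap.lTensor_comp_apply]
    exact ⟨_, rfl⟩

/-- the object `U = (V ⊕ W) / {z - ζ(z)}` over `Γ` -/
def U : YetterDrinfeld k P.Γ (((I →₀ k) × (I →₀ k)) ⧸ P.K) := P.VW.quotient P.K P.K_sub

/-- the image of `V` in `𝔅(U) ⋊ Γ` -/
def vU : (I →₀ k) →ₗ[k] P.U.Boson :=
  YetterDrinfeld.Boson.ι P.U ∘ₗ P.K.mkQ ∘ₗ LinearMap.inl k _ _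

/-- the image of `W` in `𝔅(U) ⋊ Γ` -/
def wU : (I →₀ k) →ₗ[k] P.U.Boson :=
  YetterDrinfeld.Boson.ι P.U ∘ₗ P.K.mkQ ∘ₗ LinearMap.inr k _ _

/-- the image of `F × G` in `𝔅(U) ⋊ Γ` -/
def ofU (t : F × G) : P.U.Boson := YetterDrinfeld.Boson.of P.U (QuotientGroup.mk t)

/-- `σ` is a 2-cocycle for `𝔅(U) ⋊ Γ` whose deformation is `𝒜(T, Z, ζ)`: for `i, j ∉ I_T` the
relation `wⱼ vᵢ = τ₀(fᵢ, gⱼ) vᵢ wⱼ` becomes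
`wⱼ vᵢ = τ₀(fᵢ, gⱼ) vᵢ wⱼ + δᵢⱼ (fᵢ gᵢ - 1)` in the deformed algebra. -/
structure IsLinkingCocycle (σ : (WithConv (P.U.Boson ⊗[k] P.U.Boson →ₗ[k] k))ˣ) : Prop
    extends IsTwoCocycle σ where
  linking_ne : ∀ i j, i ∉ D.IT P.T → j ∉ D.IT P.T → i ≠ j →
    deformedMul σ (P.wU (Finsupp.single j 1) ⊗ₜ P.vU (Finsupp.single i 1)) =
      (D.τ₀ (D.f i) (D.g j) : k) •
        deformedMul σ (P.vU (Finsupp.single i 1) ⊗ₜ P.wU (Finsupp.single j 1))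
  linking_eq : ∀ i, i ∉ D.IT P.T →
    deformedMul σ (P.wU (Finsupp.single i 1) ⊗ₜ P.vU (Finsupp.single i 1)) =
      (D.τ₀ (D.f i) (D.g i) : k) •
        deformedMul σ (P.vU (Finsupp.single i 1) ⊗ₜ P.wU (Finsupp.single i 1)) +
      (P.ofU (D.f i, D.g i) - 1)

end ThinData
end DoubleData

end

/-! A quotient of `𝒟` is compared with `𝔅(U) ⋊ Γ` through one coalgebra map, and every question
about that map is reduced to degree at most one.

Cocycle. Some of the `w_j` span a complement `W'` of `ζ(Z)` in `W`, so `U ≅ V ⊕ W'` is of diagonal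
type, and `V` and `W'` have trivial double braiding. Consider algebras that receive `𝔅(V) ⋊ Γ` and
`𝔅(W') ⋊ Γ`, with the same image of `Γ` and with `w_j v_i = χ_i(g_j) v_i w_j + β_{ji} (l₀ - l₁ g_j
f_i)`. Type `(0, 0)` is realized by `𝔅(U) ⋊ Γ`, type `(1, 1)` with `β = -1` by quotients of `𝒟`, and
type `(1, 0)` by a universal algebra `Q`. Coproducts compose types: `(l₀, l₁)` and `(l₁, l₂)` give
`(l₀, l₂)` on the tensor product (`IsLink.tensor`). Hence `𝔅(U) ⋊ Γ` coacts on `Q`. The map `b c ↦ b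
c` is a colinear, convolution invertible section (`cleft_mul`, `isUnit_cleft`, `coaction_cleft`), so
`Q` is cleft and yields a 2-cocycle (`Cleft.isTwoCocycle`). The augmentation of `Q` is the vacuum
expectation of a representation on `𝔅(V)` in which `w_j` acts by a multiple of a braided derivation.
The relations of `𝔅(W')` hold for these operators (`opW_eq_zero`) because the Nichols ideal is the
largest derivation-stable subspace of the augmentation ideal (`mem_nicholsIdeal`). For an algebra
`E` of type `(1, 1)`, the composite type `(1, 1)(1, 0) = (1, 0)` gives `Q → E ⊗ Q`, and from it a
linear map `𝔅(U) ⋊ Γ → E` that turns the deformed product into the product of `E`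
(`descend_deformedMul`).

Injectivity. A coalgebra map out of `𝔅(U) ⋊ Γ` is injective once it is injective on the span of all
`g` and `u g` with `u ∈ U` (`injective_of_filt_two`). There the hypothesis on characters enters:
conjugation by `Γ` acts on the `u g` by nontrivial characters and fixes the `g`, which separates the
two kinds of terms (`toQuot_injective`).

Classification. For a thin Hopf ideal `𝔞`, let `T` be the group of all `t` with `t - 1 ∈ 𝔞`. The
relations that hold between `V` and `W` modulo `𝔞` form, by thinness, the graph of an injective map
on a subspace `Z` of `V`. These relations split by degree and character. Commuting a homogeneous one
with the linked partner of one of its basis vectors leaves a multiple of `f_l g_l - 1`, which forces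
`l ∈ I_T` (`mem_kerT_of_homog`). So `𝔞(T, Z, ζ) ⊆ 𝔞`, and injectivity of the map to `𝒟 / 𝔞` gives
equality (`eq_ideal`).

Conversely, for `𝔞 = 𝔞(T, Z, ζ)` the ideal must contain no further `t - 1` and no further element of
`V + W`. Two representations show it: one built from the types `(1, 0)`, `(0, 0)`, `(0, 1)` for the
indices outside `I_T`, and one with zero products for the indices in `I_T`
(`mem_T_of_grp_sub_one_mem`, `mem_K_of_add_mem`). -/

open scoped TensorProduct

noncomputable section

/-! ### Components of degree zero and one in a tensor algebra. -/

namespace TensorAlgebra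

variable {k M : Type*} [Field k] [AddCommGroup M] [Module k M]

/-- The operators `(c, m) ↦ (0, c v)` on `k × M`, for `v : M`. -/
def degOneOp (k M : Type*) [Field k] [AddCommGroup M] [Module k M] :
    M →ₗ[k] Module.End k (k × M) where
  toFun v := LinearMap.inr k k M ∘ₗ (LinearMap.toSpanSingleton k M v) ∘ₗ LinearMap.fst k k M
  map_add' v w := by ext <;> simp
  map_smul' c v := by ext <;> simp

/-- The projection of `T(M)` onto its homogeneous component `M` of degree one. -/
def degOne (k M : Type*) [Field k] [AddCommGroup M] [Module k M] : TensorAlgebra k M →ₗ[k] M :=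
  LinearMap.snd k k M ∘ₗ LinearMap.applyₗ (1, 0) ∘ₗ
    (TensorAlgebra.lift k (degOneOp k M)).toLinearMap

/-- Induction adding factors on the left. -/
lemma induction_left {p : TensorAlgebra k M → Prop} (one : p 1)
    (smul : ∀ (r : k) x, p x → p (r • x)) (add : ∀ x y, p x → p y → p (x + y))
    (mul : ∀ v x, p x → p (TensorAlgebra.ι k v * x)) (x) : p x := by
  suffices h : ∀ y, p y → p (x * y) by simpa using h 1 one
  induction x using TensorAlgebra.induction with
  | algebraMap r => intro y hy; rw [← Algebra.smul_def]; exact smul _ _ hy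
  | ι v => intro y hy; exact mul v y hy
  | mul a b ha hb => intro y hy; rw [mul_assoc]; exact ha _ (hb _ hy)
  | add a b ha hb => intro y hy; rw [add_mul]; exact add _ _ (ha _ hy) (hb _ hy)

/-- Two of the operators compose to zero, so the operator of `x` sends `(1, 0)` to the pair formed
by the components of degree zero and one. -/
lemma lift_degOneOp_fst (x : TensorAlgebra k M) :
    (TensorAlgebra.lift k (degOneOp k M) x (1, 0)).1 = algebraMapInv x := by
  induction x using induction_left with
  | one => simp
  | smul r x hx => simp [hx]
  | add x y hx hy => simp [hx, hy]
  | mul v x hx => simp [degOneOp, algebraMapInv]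

@[simp] lemma degOne_one : degOne k M 1 = 0 := by simp [degOne]

@[simp] lemma degOne_ι_mul (v : M) (x : TensorAlgebra k M) :
    degOne k M (ι k v * x) = algebraMapInv (R := k) x • v := by
  have h := lift_degOneOp_fst x
  rw [← h]
  simp only [degOne, LinearMap.comp_apply, AlgHom.toLinearMap_apply, map_mul,
    LinearMap.applyₗ_apply_apply, Module.End.mul_apply, TensorAlgebra.lift_ι_apply]
  rfl

@[simp] lemma degOne_ι (v : M) : degOne k M (ι k v) = v := by
  have := degOne_ι_mul v (1 : TensorAlgebra k M)
  simpa using this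

@[simp] lemma algebraMapInv_ι_mul (v : M) (x : TensorAlgebra k M) :
    algebraMapInv (R := k) (ι k v * x) = 0 := by
  simp [algebraMapInv]

/-- Words of length at least two die, so only the two lowest components survive. This is what makes
square zero representations of Nichols algebras available, since Nichols ideals have no such
components. -/
lemma lift_eq_of_mul_eq_zero {A : Type*} [Ring A] [Algebra k A] (f : M →ₗ[k] A)
    (hf : ∀ v w, f v * f w = 0) (x : TensorAlgebra k M) :
    lift k f x = algebraMap k A (algebraMapInv x) + f (degOne k M x) := by
  induction x using induction_left with
  | one => simp
  | smul r x hx => rw [map_smul, hx, map_smul algebraMapInv, map_smul (degOne k M), map_smul f,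
    smul_add,
      smul_eq_mul, map_mul, ← Algebra.smul_def]
  | add x y hx hy => simp only [map_add, hx, hy]; abel
  | mul v x hx =>
    rw [map_mul, hx, mul_add, lift_ι_apply, hf]
    simp [Algebra.smul_def, Algebra.commutes]

/-- Translates the grading by powers of the range of `ι`, in which homogeneity of ideals is phrased,
into the counit; `proj_one_eq` does the same for `degOne`. -/
lemma proj_zero_eq (x : TensorAlgebra k M) :
    (DirectSum.decompose (fun n : ℕ => LinearMap.range (ι k : M →ₗ[k] TensorAlgebra k M) ^ n) x 0 :
    TensorAlgebra k M) = algebraMap k _ (algebraMapInv x) := by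
  induction x using induction_left with
  | one =>
    rw [DirectSum.decompose_of_mem_same _ (i := 0) (by simp)]
    simp
  | smul r x hx =>
    rw [DirectSum.decompose_smul, DirectSum.smul_apply, Submodule.coe_smul, hx, map_smul,
      smul_eq_mul, map_mul, ← Algebra.smul_def]
  | add x y hx hy => simp [DirectSum.decompose_add, hx, hy]
  | mul v x hx =>
    rw [DirectSum.coe_decompose_mul_of_left_mem_of_not_le (i := 1) _ (by simp) (by simp)]
    simp

lemma proj_one_eq (x : TensorAlgebra k M) :
    (DirectSum.decompose (fun n : ℕ => LinearMap.range (ι k : M →ₗ[k] TensorAlgebra k M) ^ n) x 1 :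
      TensorAlgebra k M) = ι k (degOne k M x) := by
  induction x using induction_left with
  | one =>
    rw [DirectSum.decompose_of_mem_ne _ (i := 0) (by simp) (by simp)]
    simp
  | smul r x hx =>
    rw [DirectSum.decompose_smul, DirectSum.smul_apply, Submodule.coe_smul, hx, map_smul, map_smul]
  | add x y hx hy => simp [DirectSum.decompose_add, hx, hy]
  | mul v x hx =>
    rw [DirectSum.coe_decompose_mul_of_left_mem_of_le (i := 1) _ (by simp) le_rfl]
    simp [proj_zero_eq, Algebra.smul_def, Algebra.commutes]

end TensorAlgebra

/-! ### Braided derivations of the tensor algebra. -/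

namespace YetterDrinfeld

section Derivations

open TensorAlgebra

variable {k Γ M : Type*} [Field k] [CommGroup Γ] [AddCommGroup M] [Module k M]
  (Y : YetterDrinfeld k Γ M)

lemma algebraMapInv_actAlg (g : Γ) (x : TensorAlgebra k M) :
    algebraMapInv (R := k) (Y.actAlg g x) = algebraMapInv x := by
  induction x using induction_left with
  | one => simp
  | smul r x hx => simp [hx]
  | add x y hx hy => simp [hx, hy]
  | mul v x hx => rw [map_mul, actAlg_ι]; simp

lemma degOne_actAlg (g : Γ) (x : TensorAlgebra k M) :
    degOne k M (Y.actAlg g x) = Y.act g (degOne k M x) := by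
  induction x using induction_left with
  | one => simp
  | smul r x hx => simp [hx]
  | add x y hx hy => simp [hx, hy]
  | mul v x hx => rw [map_mul, actAlg_ι]; simp [algebraMapInv_actAlg]

/-- the counit law `ε(x₁) x₂ = x` in `T(M)` -/
lemma counit_braidedComul (x : TensorAlgebra k M) :
    TensorProduct.lid k _ ((algebraMapInv (R := k) (M := M)).toLinearMap.rTensor _
      (Y.braidedComul x)) = x := by
  induction x using Y.tensor_induction with
  | one => simp
  | smul r x hx => simp only [map_smul, hx]
  | add x y hx hy => simp only [map_add, hx, hy]
  | mul γ v x hv hx =>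
    have : ∀ t, TensorProduct.lid k _ ((algebraMapInv (R := k) (M := M)).toLinearMap.rTensor _
        (Y.primLeftMul v t)) = ι k v * TensorProduct.lid k _
          ((algebraMapInv (R := k) (M := M)).toLinearMap.rTensor _ t) := by
      intro t
      induction t with
      | zero => simp
      | add a b ha hb => simp only [map_add, ha, hb, mul_add]
      | tmul a b => simp [primLeftMul_homog hv, algebraMapInv_actAlg]
    rw [braidedComul_ι_mul, this, hx]

/-- The braided derivation `(φ ⊗ id) Δ` of `T(M)`, for a linear form `φ` on `M`, which is
extended by zero to the components of degree `≠ 1`. -/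
def der (φ : M →ₗ[k] k) : TensorAlgebra k M →ₗ[k] TensorAlgebra k M :=
  (TensorProduct.lid k _).toLinearMap ∘ₗ (φ ∘ₗ degOne k M).rTensor _ ∘ₗ Y.braidedComul

/-- The braided derivation `(id ⊗ φ) Δ` of `T(M)`. -/
def derR (φ : M →ₗ[k] k) : TensorAlgebra k M →ₗ[k] TensorAlgebra k M :=
  (TensorProduct.rid k _).toLinearMap ∘ₗ (φ ∘ₗ degOne k M).lTensor _ ∘ₗ Y.braidedComul

@[simp] lemma der_one (φ : M →ₗ[k] k) : Y.der φ 1 = 0 := by simp [der]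

@[simp] lemma derR_one (φ : M →ₗ[k] k) : Y.derR φ 1 = 0 := by simp [derR]

variable {Y}

/-- The braided Leibniz rule. A degree one factor taken out of `x` must first be acted on by the
degree `γ` of `v`, which changes `φ` into `φ ∘ γ`. Together with the value at `1` this recursion
replaces the coproduct in later inductions. -/
lemma der_ι_mul {γ : Γ} {v : M} (hv : Y.IsHomog γ v) (φ : M →ₗ[k] k) (x : TensorAlgebra k M) :
    Y.der φ (ι k v * x) = φ v • x + ι k v * Y.der (φ ∘ₗ Y.act γ) x := by
  have : ∀ t, TensorProduct.lid k _ ((φ ∘ₗ degOne k M).rTensor _ (Y.primLeftMul v t)) =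
      φ v • TensorProduct.lid k _ ((algebraMapInv (R := k) (M := M)).toLinearMap.rTensor _ t) +
      ι k v * TensorProduct.lid k _ (((φ ∘ₗ Y.act γ) ∘ₗ degOne k M).rTensor _ t) := by
    intro t
    induction t with
    | zero => simp
    | add a b ha hb => simp only [map_add, ha, hb, mul_add, smul_add]; abel
    | tmul a b => simp [primLeftMul_homog hv, degOne_actAlg, smul_smul, mul_comm]
  simp only [der, LinearMap.comp_apply, LinearEquiv.coe_coe, braidedComul_ι_mul, this,
    counit_braidedComul]

/-- Here the factor is taken out on the right, so when it is `v` itself all of `x` is acted on by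
`γ`. -/
lemma derR_ι_mul {γ : Γ} {v : M} (hv : Y.IsHomog γ v) (φ : M →ₗ[k] k) (x : TensorAlgebra k M) :
    Y.derR φ (ι k v * x) = ι k v * Y.derR φ x + φ v • Y.actAlg γ x := by
  have h1 : ∀ t, TensorProduct.rid k _ ((φ ∘ₗ degOne k M).lTensor _ (Y.primLeftMul v t)) =
      ι k v * TensorProduct.rid k _ ((φ ∘ₗ degOne k M).lTensor _ t) +
      φ v • Y.actAlg γ (TensorProduct.rid k _
        ((algebraMapInv (R := k) (M := M)).toLinearMap.lTensor _ t)) := by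
    intro t
    induction t with
    | zero => simp
    | add a b ha hb => simp only [map_add, ha, hb, mul_add, smul_add]; abel
    | tmul a b => simp [primLeftMul_homog hv, smul_smul, mul_comm]
  have h2 : TensorProduct.rid k _ ((algebraMapInv (R := k) (M := M)).toLinearMap.lTensor _
      (Y.braidedComul x)) = x := by
    clear h1
    induction x using Y.tensor_induction with
    | one => simp
    | smul r x hx => simp only [map_smul, hx]
    | add x y hx hy => simp only [map_add, hx, hy]
    | mul γ v x hv hx =>
      have : ∀ t, TensorProduct.rid k _ ((algebraMapInv (R := k) (M := M)).toLinearMap.lTensor _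
          (Y.primLeftMul v t)) = ι k v * TensorProduct.rid k _
            ((algebraMapInv (R := k) (M := M)).toLinearMap.lTensor _ t) := by
        intro t
        induction t with
        | zero => simp
        | add a b ha hb => simp only [map_add, ha, hb, mul_add]
        | tmul a b => simp [primLeftMul_homog hv]
      rw [braidedComul_ι_mul, this, hx]
  simp only [derR, LinearMap.comp_apply, LinearEquiv.coe_coe, braidedComul_ι_mul, h1, h2]

variable (Y) in
lemma der_smul (c : k) (φ : M →ₗ[k] k) : Y.der (c • φ) = c • Y.der φ := by
  simp [der, LinearMap.smul_comp, LinearMap.comp_smul]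

/-- Since `φ` extends by zero off degree one, following a derivation by the counit reads off a
coordinate of the component of degree one. -/
lemma algebraMapInv_der (φ : M →ₗ[k] k) (x : TensorAlgebra k M) :
    algebraMapInv (R := k) (Y.der φ x) = φ (degOne k M x) := by
  induction x using Y.tensor_induction generalizing φ with
  | one => simp
  | smul r x hx => simp only [map_smul, hx]
  | add x y hx hy => simp only [map_add, hx, hy]
  | mul γ v x hv hx =>
    rw [der_ι_mul hv, map_add, map_smul, algebraMapInv_ι_mul, degOne_ι_mul, map_smul, add_zero,
      smul_eq_mul, smul_eq_mul, mul_comm]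

/-- Commutativity of `Γ` lets `g` pass the degrees that appear in the Leibniz rule. -/
lemma der_actAlg (g : Γ) (φ : M →ₗ[k] k) (x : TensorAlgebra k M) :
    Y.der φ (Y.actAlg g x) = Y.actAlg g (Y.der (φ ∘ₗ Y.act g) x) := by
  induction x using Y.tensor_induction generalizing φ with
  | one => simp
  | smul r x hx => simp only [map_smul, hx]
  | add x y hx hy => simp only [map_add, hx, hy]
  | mul γ v x hv hx =>
    have e : (φ ∘ₗ Y.act g) ∘ₗ Y.act γ = (φ ∘ₗ Y.act γ) ∘ₗ Y.act g := by
      rw [LinearMap.comp_assoc, LinearMap.comp_assoc, ← Module.End.mul_eq_comp,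
        ← Module.End.mul_eq_comp, ← map_mul, ← map_mul, mul_comm]
    rw [map_mul, actAlg_ι, der_ι_mul (hv.act g), hx, der_ι_mul hv, map_add, map_mul, actAlg_ι,
      map_smul, e]
    rfl

/-- A pre-Nichols ideal has no component of degree one. -/
lemma IsPreNicholsIdeal.degOne_eq_zero {J : Ideal (TensorAlgebra k M)}
    (hJ : Y.IsPreNicholsIdeal J) {x} (hx : x ∈ J) : degOne k M x = 0 := by
  have h := hJ.homogeneous 1 hx
  rw [proj_one_eq] at h
  have h2 : ι k (degOne k M x) ∈ J.restrictScalars k ⊓ LinearMap.range (ι k) := ⟨h, ⟨_, rfl⟩⟩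
  rw [hJ.inf_eq_bot, Submodule.mem_bot] at h2
  simpa using congr(degOne k M $h2)

/-- Apply the form to the first tensorand of the coproduct: the part in `J ⊗ T(M)` is killed,
because `J` has no component of degree one, and the part in `T(M) ⊗ J` lands in `J`. -/
lemma IsPreNicholsIdeal.der_mem {J : Ideal (TensorAlgebra k M)}
    (hJ : Y.IsPreNicholsIdeal J) (φ : M →ₗ[k] k) {x} (hx : x ∈ J) : Y.der φ x ∈ J := by
  have h := hJ.comul_mem x hx
  rw [der, LinearMap.comp_apply, LinearMap.comp_apply]
  suffices h : LinearMap.range ((J.restrictScalars k).subtype.lTensor (TensorAlgebra k M)) ⊔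
      LinearMap.range ((J.restrictScalars k).subtype.rTensor (TensorAlgebra k M)) ≤
      (J.restrictScalars k).comap ((TensorProduct.lid k _).toLinearMap ∘ₗ
        (φ ∘ₗ degOne k M).rTensor _) from h (hJ.comul_mem x hx)
  refine sup_le ?_ ?_
  · rintro _ ⟨t, rfl⟩
    induction t with
    | zero => simp
    | add a b ha hb => rw [map_add]; exact add_mem ha hb
    | tmul a b => simpa using J.smul_of_tower_mem (φ (degOne k M a)) b.2
  · rintro _ ⟨t, rfl⟩
    induction t with
    | zero => simp
    | add a b ha hb => rw [map_add]; exact add_mem ha hb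
    | tmul a b => simp [hJ.degOne_eq_zero (x := a) a.2]

lemma der_mem_nicholsIdeal (φ : M →ₗ[k] k) {x} (hx : x ∈ Y.nicholsIdeal) :
    Y.der φ x ∈ Y.nicholsIdeal := by
  refine nicholsIdeal_induction (fun I hI x hx => ?_) ?_ (fun x y hx hy => ?_) hx
  · exact le_nicholsIdeal hI (hI.der_mem φ hx)
  · simp
  · rw [map_add]; exact add_mem hx hy

lemma degOne_nicholsIdeal {x} (hx : x ∈ Y.nicholsIdeal) : degOne k M x = 0 := by
  refine nicholsIdeal_induction (fun I hI x hx => ?_) ?_ (fun x y hx hy => ?_) hx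
  · exact hI.degOne_eq_zero hx
  · simp
  · rw [map_add, hx, hy, add_zero]

end Derivations
end YetterDrinfeld

/-! ### The Nichols ideal of an object of diagonal type in terms of derivations. -/

namespace YetterDrinfeld

open TensorAlgebra

variable {k Γ M : Type*} [Field k] [CommGroup Γ] [AddCommGroup M] [Module k M]

/-- A basis of a Yetter-Drinfeld module consisting of homogeneous eigenvectors. -/
structure DiagBasis (Y : YetterDrinfeld k Γ M) (κ : Type*) where
  b : Module.Basis κ k M
  χ : κ → Γ →* kˣ
  γ : κ → Γ
  act_b : ∀ g i, Y.act g (b i) = (χ i g : k) • b i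
  homog : ∀ i, Y.IsHomog (γ i) (b i)

variable (Y : YetterDrinfeld k Γ M) in
lemma algebraMapInv_braidedAntipode (x : TensorAlgebra k M) :
    algebraMapInv (R := k) (Y.braidedAntipode x) = algebraMapInv x := by
  induction x using Y.tensor_induction with
  | one => simp
  | smul r x hx => simp [hx]
  | add x y hx hy => simp [hx, hy]
  | mul γ v x hv hx =>
    rw [braidedAntipode_ι_mul, antipodeOp_homog hv]
    simp [algebraMapInv]

variable (Y : YetterDrinfeld k Γ M) in
lemma braidedAntipode_actAlg (g : Γ) (x : TensorAlgebra k M) :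
    Y.braidedAntipode (Y.actAlg g x) = Y.actAlg g (Y.braidedAntipode x) := by
  induction x using Y.tensor_induction with
  | one => simp
  | smul r x hx => simp only [map_smul, hx]
  | add x y hx hy => simp only [map_add, hx, hy]
  | mul γ v x hv hx =>
    rw [map_mul, actAlg_ι, braidedAntipode_ι_mul, antipodeOp_homog (hv.act g),
      braidedAntipode_ι_mul, antipodeOp_homog hv, hx, map_neg, map_mul, actAlg_ι,
      ← AlgHom.comp_apply, ← AlgHom.comp_apply, ← actAlg_mul, ← actAlg_mul, mul_comm]

namespace DiagBasis

variable {Y : YetterDrinfeld k Γ M} {κ : Type*} (D : Y.DiagBasis κ)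

/-- Coordinates are eigenvectors for the transposed action. Hence the twisted forms in the Leibniz
rule are scalar multiples of the original one, and the derivations `D.der i` are closed under the
rule. -/
lemma coord_comp_act (i : κ) (g : Γ) : D.b.coord i ∘ₗ Y.act g = (D.χ i g : k) • D.b.coord i := by
  classical
  refine D.b.ext fun j => ?_
  rw [LinearMap.comp_apply, D.act_b, map_smul, LinearMap.smul_apply]
  by_cases h : j = i
  · rw [h]
  · simp [Finsupp.single_apply, h]

/-- Induction adding basis elements on the left. -/
lemma induction {p : TensorAlgebra k M → Prop} (one : p 1)
    (smul : ∀ (r : k) x, p x → p (r • x)) (add : ∀ x y, p x → p y → p (x + y))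
    (mul : ∀ i x, p x → p (TensorAlgebra.ι k (D.b i) * x)) (x) : p x := by
  have zero : p 0 := by simpa using smul 0 1 one
  refine induction_left one smul add (fun v x hx => ?_) x
  rw [← D.b.linearCombination_repr v, Finsupp.linearCombination_apply, Finsupp.sum, map_sum,
    Finset.sum_mul]
  refine Finset.sum_induction _ p add zero (fun i _ => ?_)
  rw [map_smul, smul_mul_assoc]
  exact smul _ _ (mul i x hx)

/-- the braided derivation of `T(M)` dual to the basis element `i` -/
def der (i : κ) : TensorAlgebra k M →ₗ[k] TensorAlgebra k M := Y.der (D.b.coord i)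

@[simp] lemma der_one (i : κ) : D.der i 1 = 0 := Y.der_one _

lemma der_b_mul (i j : κ) (x : TensorAlgebra k M) : D.der i (ι k (D.b j) * x) =
    (Finsupp.single j (1 : k) i) • x + (D.χ i (D.γ j) : k) • (ι k (D.b j) * D.der i x) := by
  rw [der, der_ι_mul (D.homog j), coord_comp_act, der_smul]
  simp

@[simp] lemma der_b (i j : κ) : D.der i (ι k (D.b j)) =
    algebraMap k _ (Finsupp.single j (1 : k) i) := by
  have := D.der_b_mul i j 1
  simpa [Algebra.algebraMap_eq_smul_one] using this

lemma der_actAlg (i : κ) (g : Γ) (x : TensorAlgebra k M) :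
    D.der i (Y.actAlg g x) = (D.χ i g : k) • Y.actAlg g (D.der i x) := by
  rw [der, YetterDrinfeld.der_actAlg, coord_comp_act, der_smul]
  simp

/-- The diagonal endomorphism `bᵢ ↦ cᵢ bᵢ` of the algebra `T(M)`. -/
def diagAlg (c : κ → k) : TensorAlgebra k M →ₐ[k] TensorAlgebra k M :=
  TensorAlgebra.lift k (TensorAlgebra.ι k ∘ₗ D.b.constr k fun i => c i • D.b i)

@[simp] lemma diagAlg_b (c : κ → k) (i : κ) :
    D.diagAlg c (TensorAlgebra.ι k (D.b i)) = c i • TensorAlgebra.ι k (D.b i) := by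
  simp [diagAlg]

lemma algebraMapInv_diagAlg (c : κ → k) (x : TensorAlgebra k M) :
    algebraMapInv (R := k) (D.diagAlg c x) = algebraMapInv x := by
  induction x using D.induction with
  | one => simp
  | smul r x hx => simp [hx]
  | add x y hx hy => simp [hx, hy]
  | mul v x hx => rw [map_mul, diagAlg_b]; simp

lemma der_diagAlg (c : κ → k) (i : κ) (x : TensorAlgebra k M) :
    D.der i (D.diagAlg c x) = c i • D.diagAlg c (D.der i x) := by
  classical
  induction x using D.induction with
  | one => simp
  | smul r x hx => simp only [map_smul, hx, smul_comm r]
  | add x y hx hy => simp only [map_add, hx, hy, smul_add]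
  | mul j x hx =>
    rw [map_mul, diagAlg_b, smul_mul_assoc, map_smul, der_b_mul, der_b_mul, map_add, map_smul,
      map_smul, map_mul, diagAlg_b, hx, smul_add, smul_add]
    congr 1
    · by_cases h : j = i
      · simp [h]
      · simp [Finsupp.single_apply, h]
    · simp only [smul_mul_assoc, mul_smul_comm, smul_smul]
      ring_nf

lemma diagAlg_actAlg (c : κ → k) (g : Γ) (x : TensorAlgebra k M) :
    D.diagAlg c (Y.actAlg g x) = Y.actAlg g (D.diagAlg c x) := by
  induction x using D.induction with
  | one => simp
  | smul r x hx => simp only [map_smul, hx]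
  | add x y hx hy => simp only [map_add, hx, hy]
  | mul j x hx =>
    rw [map_mul, map_mul, map_mul, map_mul, hx, actAlg_ι, D.act_b, map_smul, map_smul, diagAlg_b,
      map_smul, actAlg_ι, D.act_b, map_smul, smul_comm]

/-- When the derivation acts on the last letter it has passed every letter of `x`, each time picking
up the scalar `χ_i(γ_l)`; this is the diagonal twist of `x`. -/
lemma der_mul_b (i j : κ) (x : TensorAlgebra k M) : D.der i (x * ι k (D.b j)) =
    D.der i x * ι k (D.b j) +
      (Finsupp.single j (1 : k) i) • D.diagAlg (fun l => D.χ i (D.γ l)) x := by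
  induction x using D.induction with
  | one => simp [Algebra.algebraMap_eq_smul_one]
  | smul r x hx => simp only [map_smul, smul_mul_assoc, hx, smul_add, smul_comm r]
  | add x y hx hy => simp only [map_add, add_mul, hx, hy, smul_add]; abel
  | mul l x hx =>
    rw [mul_assoc, der_b_mul, hx, der_b_mul, map_mul, diagAlg_b]
    simp only [add_mul, mul_add, smul_add, smul_mul_assoc, mul_smul_comm, mul_assoc, add_assoc]
    rw [smul_comm]

/-- The product of the derivations dual to a list of basis elements. -/
def derList : List κ → TensorAlgebra k M →ₗ[k] TensorAlgebra k M
  | [] => LinearMap.id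
  | i :: l => derList l ∘ₗ D.der i

/-- The elements killed by all products of derivations followed by the counit. -/
def kernel : Submodule k (TensorAlgebra k M) :=
  ⨅ l, LinearMap.ker ((algebraMapInv (R := k) (M := M)).toLinearMap ∘ₗ D.derList l)

lemma mem_kernel {x} : x ∈ D.kernel ↔ ∀ l, algebraMapInv (R := k) (D.derList l x) = 0 := by
  simp [kernel]

lemma mem_kernel_iff {x} : x ∈ D.kernel ↔
    algebraMapInv (R := k) x = 0 ∧ ∀ i, D.der i x ∈ D.kernel := by
  simp only [mem_kernel]
  refine ⟨fun h => ⟨h [], fun i l => h (i :: l)⟩, fun h l => ?_⟩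
  cases l with
  | nil => exact h.1
  | cons i l => exact h.2 i l

/-- The kernel is the largest subspace of the augmentation ideal that is stable under the
derivations. -/
lemma le_kernel {N : Submodule k (TensorAlgebra k M)} (h0 : ∀ x ∈ N, algebraMapInv (R := k) x = 0)
    (h1 : ∀ i, ∀ x ∈ N, D.der i x ∈ N) : N ≤ D.kernel := by
  intro x hx
  rw [mem_kernel]
  intro l
  induction l generalizing x with
  | nil => exact h0 x hx
  | cons i l ih => exact ih (h1 i x hx)

lemma der_mem_kernel {x} (hx : x ∈ D.kernel) (i : κ) : D.der i x ∈ D.kernel :=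
  (D.mem_kernel_iff.1 hx).2 i

/-- The image of the kernel is again a derivation-stable subspace of the augmentation ideal, so
maximality applies. -/
lemma kernel_map {x} (hx : x ∈ D.kernel) (f : TensorAlgebra k M →ₗ[k] TensorAlgebra k M)
    (h0 : ∀ x ∈ D.kernel, algebraMapInv (R := k) (f x) = 0)
    (h1 : ∀ i, ∀ x ∈ D.kernel, D.der i (f x) ∈ D.kernel.map f) : f x ∈ D.kernel := by
  have : D.kernel.map f ≤ D.kernel := by
    refine D.le_kernel ?_ ?_
    · rintro _ ⟨x, hx, rfl⟩; exact h0 x hx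
    · rintro i _ ⟨x, hx, rfl⟩; exact h1 i x hx
  exact this ⟨x, hx, rfl⟩

lemma actAlg_mem_kernel {x} (hx : x ∈ D.kernel) (g : Γ) : Y.actAlg g x ∈ D.kernel := by
  refine D.kernel_map hx (Y.actAlg g).toLinearMap (fun x hx => ?_) (fun i x hx => ?_)
  · exact (Y.algebraMapInv_actAlg g x).trans (D.mem_kernel_iff.1 hx).1
  · exact ⟨(D.χ i g : k) • D.der i x, D.kernel.smul_mem _ (D.der_mem_kernel hx i), by
      simp [der_actAlg]⟩

lemma diagAlg_mem_kernel {x} (hx : x ∈ D.kernel) (c : κ → k) : D.diagAlg c x ∈ D.kernel := by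
  refine D.kernel_map hx (D.diagAlg c).toLinearMap (fun x hx => ?_) (fun i x hx => ?_)
  · exact (D.algebraMapInv_diagAlg c x).trans (D.mem_kernel_iff.1 hx).1
  · exact ⟨c i • D.der i x, D.kernel.smul_mem _ (D.der_mem_kernel hx i), by simp [der_diagAlg]⟩

/-- By the Leibniz rule a derivation of `b_j x` is a combination of `x` and `b_j` times a derivation
of `x`; induction on the list of derivations finishes. -/
lemma b_mul_mem_kernel {x} (hx : x ∈ D.kernel) (j : κ) : ι k (D.b j) * x ∈ D.kernel := by
  rw [mem_kernel]
  intro l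
  induction l generalizing x with
  | nil => simp [derList]
  | cons i l ih =>
    simp only [derList, LinearMap.comp_apply, der_b_mul, map_add, map_smul,
      ih (D.der_mem_kernel hx i), D.mem_kernel.1 hx l]
    simp

lemma mul_b_mem_kernel {x} (hx : x ∈ D.kernel) (j : κ) : x * ι k (D.b j) ∈ D.kernel := by
  rw [mem_kernel]
  intro l
  induction l generalizing x with
  | nil => simp [derList, algebraMapInv]
  | cons i l ih =>
    simp only [derList, LinearMap.comp_apply, der_mul_b, map_add, map_smul,
      ih (D.der_mem_kernel hx i), D.mem_kernel.1 (D.diagAlg_mem_kernel hx _) l]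
    simp

lemma mul_mem_kernel_left (y : TensorAlgebra k M) {x} (hx : x ∈ D.kernel) : y * x ∈ D.kernel := by
  induction y using D.induction with
  | one => simpa
  | smul r y hy => rw [smul_mul_assoc]; exact D.kernel.smul_mem _ hy
  | add y z hy hz => rw [add_mul]; exact add_mem hy hz
  | mul j y hy => rw [mul_assoc]; exact D.b_mul_mem_kernel hy j

lemma mul_mem_kernel_right (y : TensorAlgebra k M) {x} (hx : x ∈ D.kernel) : x * y ∈ D.kernel := by
  induction y using D.induction generalizing x with
  | one => simpa
  | smul r y hy => rw [mul_smul_comm]; exact D.kernel.smul_mem _ (hy hx)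
  | add y z hy hz => rw [mul_add]; exact add_mem (hy hx) (hz hx)
  | mul j y hy => rw [← mul_assoc]; exact hy (D.mul_b_mem_kernel hx j)

/-- The kernel as an ideal. -/
def kernelIdeal : Ideal (TensorAlgebra k M) where
  carrier := D.kernel
  add_mem' := add_mem
  zero_mem' := zero_mem _
  smul_mem' y _ hx := D.mul_mem_kernel_left y hx

/-- The coordinates of the component of degree one are the counits of the derivations, which vanish
on the kernel. -/
lemma degOne_kernel {x} (hx : x ∈ D.kernel) : degOne k M x = 0 := by
  refine D.b.ext_elem fun i => ?_
  have h := (D.mem_kernel_iff.1 (D.der_mem_kernel hx i)).1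
  rw [der, algebraMapInv_der] at h
  simpa using h

/-! ### The kernel is a pre-Nichols ideal -/

/-- This is coassociativity: the derivation is a slice of the coproduct on the left, so it acts on
the first tensorand only. -/
lemma braidedComul_der (i : κ) (x : TensorAlgebra k M) :
    Y.braidedComul (D.der i x) = (D.der i).rTensor _ (Y.braidedComul x) := by
  induction x using D.induction with
  | one => simp
  | smul r x hx => simp only [map_smul, hx]
  | add x y hx hy => simp only [map_add, hx, hy]
  | mul j x hx =>
    have : ∀ t, (D.der i).rTensor _ (Y.primLeftMul (D.b j) t) =
        (Finsupp.single j (1 : k) i) • t + (D.χ i (D.γ j) : k) •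
          Y.primLeftMul (D.b j) ((D.der i).rTensor _ t) := by
      intro t
      induction t with
      | zero => simp
      | add a b ha hb => simp only [map_add, ha, hb, smul_add]; abel
      | tmul a b =>
        simp only [primLeftMul_homog (D.homog j), map_add, LinearMap.rTensor_tmul, der_b_mul,
          der_actAlg, TensorProduct.add_tmul, TensorProduct.smul_tmul', smul_add, add_assoc]
    rw [der_b_mul, map_add, map_smul, map_smul, braidedComul_ι_mul, braidedComul_ι_mul, hx, this]

lemma braidedComul_derList (l : List κ) (x : TensorAlgebra k M) :
    Y.braidedComul (D.derList l x) = (D.derList l).rTensor _ (Y.braidedComul x) := by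
  induction l generalizing x with
  | nil => simp [derList]
  | cons i l ih => rw [derList, LinearMap.comp_apply, ih, braidedComul_der,
      LinearMap.rTensor_comp_apply]

/-- Every iterated derivation of `x` lies in the kernel. By `braidedComul_derList` the first
tensorands of the coproduct of `x`, taken modulo the kernel in the second one, are then killed by
all iterated derivations followed by the counit, so they lie in the kernel. -/
lemma comul_mem_kernel {x} (hx : x ∈ D.kernel) : Y.braidedComul x ∈
    LinearMap.range (D.kernel.subtype.lTensor (TensorAlgebra k M)) ⊔
    LinearMap.range (D.kernel.subtype.rTensor (TensorAlgebra k M)) := by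
  -- The sum of the two ranges is the kernel of the map onto the tensor square of the quotient.
  rw [← TensorProduct.map_ker (LinearMap.exact_subtype_mkQ _) (Submodule.mkQ_surjective _)
    (LinearMap.exact_subtype_mkQ _) (Submodule.mkQ_surjective _), LinearMap.mem_ker]
  have e : TensorProduct.map D.kernel.mkQ D.kernel.mkQ (Y.braidedComul x) =
      D.kernel.mkQ.rTensor _ (D.kernel.mkQ.lTensor _ (Y.braidedComul x)) := by
    change _ = (D.kernel.mkQ.rTensor _ ∘ₗ D.kernel.mkQ.lTensor _) _
    rw [LinearMap.rTensor_comp_lTensor]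
  rw [e]
  set t := D.kernel.mkQ.lTensor _ (Y.braidedComul x) with ht
  have h : ∀ l, ((algebraMapInv (R := k) (M := M)).toLinearMap ∘ₗ D.derList l).rTensor _ t = 0 := by
    intro l
    apply (TensorProduct.lid k _).injective
    have e2 : ∀ u : TensorAlgebra k M ⊗[k] TensorAlgebra k M, TensorProduct.lid k _
        (((algebraMapInv (R := k) (M := M)).toLinearMap ∘ₗ D.derList l).rTensor _
          (D.kernel.mkQ.lTensor _ u)) =
        D.kernel.mkQ (TensorProduct.lid k _ ((algebraMapInv (R := k) (M := M)).toLinearMap.rTensor _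
          ((D.derList l).rTensor _ u))) := by
      intro u
      induction u with
      | zero => simp
      | add a b ha hb => simp only [map_add, ha, hb]
      | tmul a b => simp
    rw [ht, e2, ← braidedComul_derList, counit_braidedComul, map_zero]
    have : D.derList l x ∈ D.kernel := by
      clear ht e2 e t
      induction l generalizing x with
      | nil => exact hx
      | cons i l ih => exact ih (D.der_mem_kernel hx i)
    simpa using this
  clear_value t
  -- Expanding the second tensorand in a basis of the quotient turns the vanishing of the slices `h
  -- l` into a condition on each coefficient.
  let b := Module.Basis.ofVectorSpace k (TensorAlgebra k M ⧸ D.kernel)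
  obtain ⟨c, hc⟩ := TensorProduct.eq_repr_basis_right b t
  have hm : ∀ i, c i ∈ D.kernel := by
    intro i
    rw [mem_kernel]
    intro l
    have h1 := congr(TensorProduct.lid k k ((b.coord i).lTensor k $(h l)))
    rw [← hc] at h1
    simp only [Finsupp.sum, map_sum, LinearMap.rTensor_tmul, LinearMap.lTensor_tmul] at h1
    classical
    simp only [LinearMap.comp_apply, Module.Basis.coord_apply, Module.Basis.repr_self,
      TensorProduct.lid_tmul, Finsupp.single_apply, smul_eq_mul, mul_ite, mul_one, mul_zero,
      Finset.sum_ite_eq', map_zero] at h1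
    by_cases hi : i ∈ c.support
    · simpa [hi] using h1
    · simp [Finsupp.notMem_support_iff.1 hi]
  rw [← hc]
  simp only [Finsupp.sum, map_sum, LinearMap.rTensor_tmul]
  refine Finset.sum_eq_zero fun i _ => ?_
  have : D.kernel.mkQ (c i) = 0 := by simpa using hm i
  rw [this, TensorProduct.zero_tmul]

lemma braidedAntipode_diagAlg (c : κ → k) (x : TensorAlgebra k M) :
    Y.braidedAntipode (D.diagAlg c x) = D.diagAlg c (Y.braidedAntipode x) := by
  induction x using D.induction with
  | one => simp
  | smul r x hx => simp only [map_smul, hx]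
  | add x y hx hy => simp only [map_add, hx, hy]
  | mul j x hx =>
    rw [map_mul, diagAlg_b, smul_mul_assoc, map_smul, braidedAntipode_ι_mul,
      antipodeOp_homog (D.homog j), braidedAntipode_ι_mul, antipodeOp_homog (D.homog j), hx,
      map_neg, map_mul, diagAlg_b, mul_smul_comm, smul_neg, diagAlg_actAlg]

/-- The antipode reverses the order of factors, so it exchanges left and right derivations up to a
sign and a diagonal twist. -/
lemma der_braidedAntipode (i : κ) (x : TensorAlgebra k M) :
    D.der i (Y.braidedAntipode x) =
      - Y.braidedAntipode (D.diagAlg (fun l => D.χ i (D.γ l)) (Y.derR (D.b.coord i) x)) := by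
  classical
  induction x using D.induction with
  | one => simp
  | smul r x hx => simp only [map_smul, hx, smul_neg]
  | add x y hx hy => simp only [map_add, hx, hy, neg_add]
  | mul j x hx =>
    rw [braidedAntipode_ι_mul, antipodeOp_homog (D.homog j), map_neg, der_mul_b, der_actAlg, hx,
      derR_ι_mul (D.homog j)]
    simp only [map_add, map_mul, diagAlg_b, smul_mul_assoc, map_smul, braidedAntipode_ι_mul,
      antipodeOp_homog (D.homog j), diagAlg_actAlg, braidedAntipode_actAlg,
      braidedAntipode_diagAlg, map_neg, smul_neg, neg_mul, neg_add, neg_neg]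
    simp

/-- Right derivations were not imposed in the definition of the kernel; they preserve it because it
is a coideal without component of degree one. -/
lemma derR_mem_kernel {x} (hx : x ∈ D.kernel) (φ : M →ₗ[k] k) : Y.derR φ x ∈ D.kernel := by
  rw [derR, LinearMap.comp_apply, LinearMap.comp_apply]
  suffices h : LinearMap.range (D.kernel.subtype.lTensor (TensorAlgebra k M)) ⊔
      LinearMap.range (D.kernel.subtype.rTensor (TensorAlgebra k M)) ≤
      D.kernel.comap ((TensorProduct.rid k _).toLinearMap ∘ₗ
        (φ ∘ₗ degOne k M).lTensor _) from h (D.comul_mem_kernel hx)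
  refine sup_le ?_ ?_
  · rintro _ ⟨t, rfl⟩
    induction t with
    | zero => simp
    | add a b ha hb => rw [map_add]; exact add_mem ha hb
    | tmul a b => simp [D.degOne_kernel b.2]
  · rintro _ ⟨t, rfl⟩
    induction t with
    | zero => simp
    | add a b ha hb => rw [map_add]; exact add_mem ha hb
    | tmul a b => simpa using D.kernel.smul_mem (φ (degOne k M b)) a.2

lemma antipode_mem_kernel {x} (hx : x ∈ D.kernel) : Y.braidedAntipode x ∈ D.kernel := by
  refine D.kernel_map hx Y.braidedAntipode (fun x hx => ?_) (fun i x hx => ?_)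
  · exact (Y.algebraMapInv_braidedAntipode x).trans (D.mem_kernel_iff.1 hx).1
  · rw [der_braidedAntipode, ← map_neg]
    exact ⟨_, neg_mem (D.diagAlg_mem_kernel (D.derR_mem_kernel hx _) _), rfl⟩

/-- the degree `g` component of an element of `T(M)` for the `Γ`-grading -/
def comp (Y : YetterDrinfeld k Γ M) (g : Γ) : TensorAlgebra k M →ₗ[k] TensorAlgebra k M :=
  slice k _ g ∘ₗ Y.tensor.coact

end DiagBasis

section slice

variable {N : Type*} [AddCommGroup N] [Module k N]

/-- The finite set may be enlarged freely so that two such expressions can be added over a common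
set. -/
lemma exists_eq_sum_slice (t : MonoidAlgebra k Γ ⊗[k] N) : ∃ s : Finset Γ, ∀ s', s ⊆ s' →
    t = ∑ g ∈ s', MonoidAlgebra.single g 1 ⊗ₜ slice k N g t := by
  classical
  induction t with
  | zero => exact ⟨∅, by simp⟩
  | tmul a b =>
    induction a using MonoidAlgebra.induction_linear with
    | zero => exact ⟨∅, by simp⟩
    | single δ r =>
      refine ⟨{δ}, fun s' hs => ?_⟩
      have hd : δ ∈ s' := by simpa using hs
      rw [Finset.sum_eq_single_of_mem δ hd]
      · simp [slice, TensorProduct.tmul_smul, TensorProduct.smul_tmul']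
      · intro g _ hg
        simp [slice, hg.symm]
    | add x y hx hy =>
      obtain ⟨s, hs⟩ := hx
      obtain ⟨s2, hs2⟩ := hy
      refine ⟨s ∪ s2, fun s' h => ?_⟩
      simp only [TensorProduct.add_tmul, map_add, TensorProduct.tmul_add, Finset.sum_add_distrib]
      rw [← hs s' (Finset.union_subset_left h), ← hs2 s' (Finset.union_subset_right h)]
  | add a b ha hb =>
    obtain ⟨s, hs⟩ := ha
    obtain ⟨s2, hs2⟩ := hb
    refine ⟨s ∪ s2, fun s' h => ?_⟩
    simp only [map_add, TensorProduct.tmul_add, Finset.sum_add_distrib]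
    rw [← hs s' (Finset.union_subset_left h), ← hs2 s' (Finset.union_subset_right h)]

lemma mem_range_lTensor_of_slice {t : MonoidAlgebra k Γ ⊗[k] N} {L : Submodule k N}
    (h : ∀ g, slice k N g t ∈ L) :
    t ∈ LinearMap.range (L.subtype.lTensor (MonoidAlgebra k Γ)) := by
  obtain ⟨s, hs⟩ := exists_eq_sum_slice t
  rw [hs s subset_rfl]
  exact Submodule.sum_mem _ fun g _ => ⟨MonoidAlgebra.single g 1 ⊗ₜ ⟨_, h g⟩, by simp⟩

lemma slice_single_mul {A : Type*} [Ring A] [Algebra k A] (g h : Γ) (a : A)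
    (t : MonoidAlgebra k Γ ⊗[k] A) :
    slice k A g ((MonoidAlgebra.single h 1 ⊗ₜ a) * t) = a * slice k A (h⁻¹ * g) t := by
  classical
  induction t with
  | zero => simp
  | add x y hx hy => simp only [mul_add, map_add, hx, hy]
  | tmul x b =>
    induction x using MonoidAlgebra.induction_linear with
    | zero => simp
    | add x y hx hy => simp only [TensorProduct.add_tmul, mul_add, map_add, hx, hy]
    | single δ r =>
      by_cases hd : δ = h⁻¹ * g
      · have : h * δ = g := by rw [hd]; simp
        simp [slice, hd]
      · have : ¬ h * δ = g := fun e => hd (by rw [← e]; simp)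
        simp [slice, hd, this]

end slice

namespace DiagBasis

variable {Y : YetterDrinfeld k Γ M} {κ : Type*} (D : Y.DiagBasis κ)

lemma comp_b_mul (g : Γ) (j : κ) (x : TensorAlgebra k M) :
    comp Y g (ι k (D.b j) * x) = ι k (D.b j) * comp Y ((D.γ j)⁻¹ * g) x := by
  have h := D.homog j
  rw [IsHomog] at h
  simp only [comp, LinearMap.comp_apply, tensor_coact_apply, map_mul, coactAlg_ι, h,
    LinearMap.lTensor_tmul, slice_single_mul]

lemma algebraMapInv_comp {Y : YetterDrinfeld k Γ M} (D : Y.DiagBasis κ) (g : Γ)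
    (x : TensorAlgebra k M) :
    algebraMapInv (R := k) (comp Y g x) =
      algebraMapInv (R := k) x * coeffFun k g (MonoidAlgebra.single (1 : Γ) 1) := by
  induction x using D.induction with
  | one => simp [comp, tensor_coact_apply, slice, Algebra.TensorProduct.one_def,
      MonoidAlgebra.one_def]
  | smul r x hx => simp only [map_smul, hx, smul_mul_assoc]
  | add x y hx hy => simp only [map_add, hx, hy, add_mul]
  | mul j x hx => rw [comp_b_mul]; simp

/-- Removing the letter `b_i` divides the `Γ`-degree by `γ_i`. -/
lemma der_comp (i : κ) (g : Γ) (x : TensorAlgebra k M) :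
    D.der i (comp Y g x) = comp Y ((D.γ i)⁻¹ * g) (D.der i x) := by
  classical
  induction x using D.induction generalizing g with
  | one =>
    simp only [comp, tensor_coact_apply, slice, Algebra.TensorProduct.one_def,
      MonoidAlgebra.one_def, map_one, LinearMap.comp_apply, LinearMap.rTensor_tmul,
      coeffFun_single, LinearEquiv.coe_coe, TensorProduct.lid_tmul, map_smul, der_one,
      smul_zero, map_zero]
  | smul r x hx => simp only [map_smul, hx]
  | add x y hx hy => simp only [map_add, hx, hy]
  | mul j x hx =>
    rw [comp_b_mul, der_b_mul, der_b_mul, hx, map_add, map_smul, map_smul, comp_b_mul]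
    congr 1
    · by_cases h : j = i
      · rw [h]
      · simp [Finsupp.single_apply, h]
    · rw [← mul_assoc, ← mul_assoc, mul_comm (D.γ i)⁻¹]

lemma comp_mem_kernel {x} (hx : x ∈ D.kernel) (g : Γ) : comp Y g x ∈ D.kernel := by
  rw [mem_kernel]
  intro l
  induction l generalizing g x with
  | nil =>
    change algebraMapInv (R := k) (comp Y g x) = 0
    rw [D.algebraMapInv_comp, (D.mem_kernel_iff.1 hx).1, zero_mul]
  | cons i l ih =>
    rw [derList, LinearMap.comp_apply, der_comp]
    exact ih (D.der_mem_kernel hx i) _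

/-- Removing one letter lowers the tensor degree by one. -/
lemma der_decompose (i : κ) (n : ℕ) (x : TensorAlgebra k M) :
    D.der i (DirectSum.decompose (fun n : ℕ =>
      LinearMap.range (TensorAlgebra.ι k : M →ₗ[k] TensorAlgebra k M) ^ n) x (n + 1) :
      TensorAlgebra k M) = (DirectSum.decompose (fun n : ℕ =>
      LinearMap.range (TensorAlgebra.ι k : M →ₗ[k] TensorAlgebra k M) ^ n) (D.der i x) n :
      TensorAlgebra k M) := by
  induction x using D.induction generalizing n with
  | one =>
    rw [DirectSum.decompose_of_mem_ne _ (i := 0) (by simp) (by simp)]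
    simp
  | smul r x hx => simp only [DirectSum.decompose_smul, DirectSum.smul_apply, Submodule.coe_smul,
      map_smul, hx]
  | add x y hx hy => simp only [DirectSum.decompose_add, DirectSum.add_apply, Submodule.coe_add,
      map_add, hx, hy]
  | mul j x hx =>
    rw [DirectSum.coe_decompose_mul_of_left_mem_of_le (i := 1) _ (by simp) (by simp), der_b_mul,
      der_b_mul, DirectSum.decompose_add, DirectSum.add_apply, Submodule.coe_add,
      DirectSum.decompose_smul, DirectSum.smul_apply, Submodule.coe_smul,
      DirectSum.decompose_smul, DirectSum.smul_apply, Submodule.coe_smul]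
    simp only [Nat.add_sub_cancel]
    congr 2
    cases n with
    | zero =>
      rw [DirectSum.coe_decompose_mul_of_left_mem_of_not_le (i := 1) _ (by simp) (by simp)]
      have h0 : ∀ y : TensorAlgebra k M, D.der i (DirectSum.decompose (fun n : ℕ =>
          LinearMap.range (TensorAlgebra.ι k : M →ₗ[k] TensorAlgebra k M) ^ n) y 0 :
          TensorAlgebra k M) = 0 := by
        intro y
        rw [proj_zero_eq, Algebra.algebraMap_eq_smul_one, map_smul, der_one, smul_zero]
      rw [h0, mul_zero]
    | succ n =>
      rw [DirectSum.coe_decompose_mul_of_left_mem_of_le (i := 1) _ (by simp) (by simp)]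
      exact congrArg (ι k (D.b j) * ·) (hx n)

/-- Induction on the degree: derivations carry the component of degree `n + 1` to the component of
degree `n` of the derivative, and the counit vanishes in positive degree. -/
lemma decompose_mem_kernel {x} (hx : x ∈ D.kernel) (n : ℕ) :
    (DirectSum.decompose (fun n : ℕ =>
      LinearMap.range (TensorAlgebra.ι k : M →ₗ[k] TensorAlgebra k M) ^ n) x n :
      TensorAlgebra k M) ∈ D.kernel := by
  induction n generalizing x with
  | zero =>
    rw [proj_zero_eq, (D.mem_kernel_iff.1 hx).1, map_zero]
    exact zero_mem _
  | succ n ih =>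
    rw [mem_kernel_iff]
    refine ⟨?_, fun i => ?_⟩
    · have h : ((DirectSum.decompose (fun n : ℕ =>
        LinearMap.range (TensorAlgebra.ι k : M →ₗ[k] TensorAlgebra k M) ^ n) x (n + 1) :
          TensorAlgebra k M)) ∈ LinearMap.range (TensorAlgebra.ι k : M →ₗ[k] TensorAlgebra k M) *
            LinearMap.range (TensorAlgebra.ι k : M →ₗ[k] TensorAlgebra k M) ^ n := by
        rw [← pow_succ']
        exact Subtype.property _
      refine Submodule.mul_induction_on h ?_ ?_
      · rintro _ ⟨v, rfl⟩ y _
        simp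
      · intro a b ha hb
        rw [map_add, ha, hb, add_zero]
    · rw [der_decompose]
      exact ih (D.der_mem_kernel hx i)

/-- This gives one inclusion of `mem_nicholsIdeal`; the other holds since the Nichols ideal is
stable under derivations and lies in the augmentation ideal. -/
lemma isPreNicholsIdeal_kernelIdeal : Y.IsPreNicholsIdeal D.kernelIdeal where
  mul_mem_right x hx b := D.mul_mem_kernel_right b hx
  subobject := ⟨fun g x hx => D.actAlg_mem_kernel hx g, fun x hx =>
    mem_range_lTensor_of_slice fun g => D.comp_mem_kernel hx g⟩
  counit_eq_zero x hx := (D.mem_kernel_iff.1 hx).1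
  comul_mem x hx := D.comul_mem_kernel hx
  antipode_mem x hx := D.antipode_mem_kernel hx
  homogeneous n x hx := D.decompose_mem_kernel hx n
  inf_eq_bot := by
    rw [eq_bot_iff]
    rintro _ ⟨hx, v, rfl⟩
    have := D.degOne_kernel hx
    rw [degOne_ι] at this
    simp [this]

/-- The defining ideal of the Nichols algebra is the largest subspace of the augmentation ideal
that is stable under the braided derivations. -/
theorem mem_nicholsIdeal {x} : x ∈ Y.nicholsIdeal ↔ x ∈ D.kernel := by
  refine ⟨fun hx => ?_, fun hx => le_nicholsIdeal D.isPreNicholsIdeal_kernelIdeal hx⟩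
  exact D.le_kernel (N := Y.nicholsIdeal.restrictScalars k)
    (fun x hx => Y.isBraidedHopfIdeal_nicholsIdeal.counit_eq_zero x hx)
    (fun i x hx => der_mem_nicholsIdeal _ hx) hx

end DiagBasis
end YetterDrinfeld

namespace YetterDrinfeld

open TensorAlgebra

/-! ### Functoriality -/

section Functoriality

variable {k Γ Γ' M N κ κ' : Type*} [Field k] [CommGroup Γ] [CommGroup Γ'] [AddCommGroup M]
  [Module k M] [AddCommGroup N] [Module k N] {Y : YetterDrinfeld k Γ M}
  {Y' : YetterDrinfeld k Γ' N}

/-- A linear map that sends each vector of a diagonal basis to zero or to a homogeneous vector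
which induces the same braiding. -/
def IsBraidedMap (D : Y.DiagBasis κ) (Y' : YetterDrinfeld k Γ' N) (m : M →ₗ[k] N) : Prop :=
  ∀ j, m (D.b j) = 0 ∨
    ∃ γ', Y'.IsHomog γ' (m (D.b j)) ∧ Y'.act γ' ∘ₗ m = m ∘ₗ Y.act (D.γ j)

/-- The algebra map `T(m)`. -/
def mapT (m : M →ₗ[k] N) : TensorAlgebra k M →ₐ[k] TensorAlgebra k N :=
  TensorAlgebra.lift k (TensorAlgebra.ι k ∘ₗ m)

@[simp] lemma mapT_ι (m : M →ₗ[k] N) (v : M) : mapT m (ι k v) = ι k (m v) := by simp [mapT]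

lemma algebraMapInv_mapT (m : M →ₗ[k] N) (x : TensorAlgebra k M) :
    algebraMapInv (R := k) (mapT m x) = algebraMapInv x := by
  induction x using induction_left with
  | one => simp
  | smul r x hx => simp [hx]
  | add x y hx hy => simp [hx, hy]
  | mul v x hx => rw [map_mul, mapT_ι]; simp

/-- A derivation sees the group only through the way degrees act, so the two groups may differ as
long as `γ'` acts on the image as `γ_j` does on the source. A basis vector sent to zero contributes
nothing to either side. -/
lemma IsBraidedMap.der_mapT {D : Y.DiagBasis κ} {m : M →ₗ[k] N} (hm : IsBraidedMap D Y' m)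
    (φ : N →ₗ[k] k) (x : TensorAlgebra k M) :
    Y'.der φ (mapT m x) = mapT m (Y.der (φ ∘ₗ m) x) := by
  induction x using D.induction generalizing φ with
  | one => simp
  | smul r x hx => simp only [map_smul, hx]
  | add x y hx hy => simp only [map_add, hx, hy]
  | mul j x hx =>
    rw [Y.der_ι_mul (D.homog j), map_mul, mapT_ι]
    rcases hm j with h | ⟨γ', h1, h2⟩
    · simp [h]
    · rw [Y'.der_ι_mul h1, hx, LinearMap.comp_assoc, h2]
      simp [LinearMap.comp_assoc]

/-- The image of the Nichols ideal is stable under the derivations of the target and lies in its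
augmentation ideal; maximality concludes, with no injectivity or surjectivity of `m`. -/
lemma IsBraidedMap.mapT_mem {D : Y.DiagBasis κ} {m : M →ₗ[k] N} (hm : IsBraidedMap D Y' m)
    (D' : Y'.DiagBasis κ') {x : TensorAlgebra k M} (hx : x ∈ Y.nicholsIdeal) :
    mapT m x ∈ Y'.nicholsIdeal := by
  rw [D'.mem_nicholsIdeal]
  have : (Y.nicholsIdeal.restrictScalars k).map (mapT m).toLinearMap ≤ D'.kernel := by
    refine D'.le_kernel ?_ ?_
    · rintro _ ⟨x, hx, rfl⟩
      exact (algebraMapInv_mapT m x).trans (Y.isBraidedHopfIdeal_nicholsIdeal.counit_eq_zero x hx)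
    · rintro i _ ⟨x, hx, rfl⟩
      exact ⟨_, Y.der_mem_nicholsIdeal _ hx, (hm.der_mapT _ x).symm⟩
  exact this ⟨x, hx, rfl⟩

/-- The algebra map between Nichols algebras induced by a braided map. -/
def Nichols.map {D : Y.DiagBasis κ} {m : M →ₗ[k] N} (hm : IsBraidedMap D Y' m)
    (D' : Y'.DiagBasis κ') : Y.Nichols →ₐ[k] Y'.Nichols :=
  Nichols.lift Y ((Nichols.mk Y').comp (mapT m)) fun _ hx =>
    Nichols.mk_eq_zero.2 (hm.mapT_mem D' hx)

@[simp] lemma Nichols.map_mk {D : Y.DiagBasis κ} {m : M →ₗ[k] N} (hm : IsBraidedMap D Y' m)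
    (D' : Y'.DiagBasis κ') (x) :
    Nichols.map hm D' (Nichols.mk Y x) = Nichols.mk Y' (mapT m x) := rfl

lemma IsHom.isBraidedMap {Y'' : YetterDrinfeld k Γ N} {m : M →ₗ[k] N} (hm : Y.IsHom Y'' m)
    (D : Y.DiagBasis κ) : IsBraidedMap D Y'' m := by
  intro j
  refine Or.inr ⟨D.γ j, ?_, (hm.act _).symm⟩
  have h1 := congr($(hm.coact) (D.b j))
  have h := D.homog j
  rw [IsHomog] at h ⊢
  rw [LinearMap.comp_apply] at h1
  rw [h1, LinearMap.comp_apply, h]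
  simp

lemma IsHom.isHomog {Y'' : YetterDrinfeld k Γ N} {m : M →ₗ[k] N} (hm : Y.IsHom Y'' m)
    {γ : Γ} {v : M} (h : Y.IsHomog γ v) : Y''.IsHomog γ (m v) := by
  have h1 := congr($(hm.coact) v)
  rw [IsHomog] at h ⊢
  rw [LinearMap.comp_apply] at h1
  rw [h1, LinearMap.comp_apply, h]
  simp

end Functoriality

/-! ### Bosonizations of diagonal type: induction, commutation and functoriality. -/

namespace Boson

section Tools

variable {k Γ M κ : Type*} [Field k] [CommGroup Γ] [AddCommGroup M] [Module k M]
  {Y : YetterDrinfeld k Γ M}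

lemma span_induction {p : Y.Boson → Prop} (add : ∀ x y, p x → p y → p (x + y))
    (mul : ∀ x g, p (incT Y x * of Y g)) (x) : p x := by
  induction x using SkewMonoidAlgebra.induction_on with
  | zero => simpa using mul 0 1
  | add x y hx hy => exact add _ _ hx hy
  | single g a =>
    obtain ⟨a, rfl⟩ := Nichols.mk_surjective Y a
    rw [single_eq]
    exact mul a g

/-- Induction adding factors on the left. -/
lemma left_induction (D : Y.DiagBasis κ) {p : Y.Boson → Prop} (one : p 1)
    (smul : ∀ (r : k) x, p x → p (r • x)) (add : ∀ x y, p x → p y → p (x + y))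
    (mul : ∀ i x, p x → p (ι Y (D.b i) * x)) (of_mul : ∀ g x, p x → p (of Y g * x)) (x) : p x := by
  induction x using span_induction with
  | add x y hx hy => exact add _ _ hx hy
  | mul x g =>
    induction x using D.induction with
    | one => simpa using of_mul g 1 one
    | smul r x hx => rw [map_smul, smul_mul_assoc]; exact smul _ _ hx
    | add x y hx hy => rw [map_add, add_mul]; exact add _ _ hx hy
    | mul j x hx => rw [map_mul, mul_assoc]; exact mul _ _ hx

variable (D : Y.DiagBasis κ)

lemma of_mul_ι_b (g : Γ) (i : κ) :
    of Y g * ι Y (D.b i) = (D.χ i g : k) • (ι Y (D.b i) * of Y g) := by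
  rw [of_mul_ι, D.act_b, map_smul, smul_mul_assoc]

lemma comul_ι_b (i : κ) : Coalgebra.comul (R := k) (ι Y (D.b i)) =
    ι Y (D.b i) ⊗ₜ 1 + of Y (D.γ i) ⊗ₜ ι Y (D.b i) := comul_ι Y (D.homog i)

/-- Vectors with trivial double braiding commute up to the braiding. -/
lemma ι_mul_ι (i j : κ) (h : (D.χ j (D.γ i) : k) * D.χ i (D.γ j) = 1) :
    ι Y (D.b i) * ι Y (D.b j) = (D.χ j (D.γ i) : k) • (ι Y (D.b j) * ι Y (D.b i)) := by
  classical
  have key : TensorAlgebra.ι k (D.b i) * TensorAlgebra.ι k (D.b j) -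
      (D.χ j (D.γ i) : k) • (TensorAlgebra.ι k (D.b j) * TensorAlgebra.ι k (D.b i)) ∈
        Y.nicholsIdeal := by
    rw [D.mem_nicholsIdeal, D.mem_kernel_iff]
    refine ⟨by simp, fun l => ?_⟩
    -- Every derivation kills the braided commutator: the Leibniz terms cancel because the product
    -- of the two braiding scalars is `1`.
    have : D.der l (TensorAlgebra.ι k (D.b i) * TensorAlgebra.ι k (D.b j) -
      (D.χ j (D.γ i) : k) • (TensorAlgebra.ι k (D.b j) * TensorAlgebra.ι k (D.b i))) = 0 := by
      rw [map_sub, map_smul, D.der_b_mul, D.der_b_mul, D.der_b, D.der_b]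
      simp only [Finsupp.single_apply]
      by_cases hi : i = l <;> by_cases hj : j = l
      · subst hi; subst hj
        simp only [if_true, one_smul, smul_add, smul_smul, h, map_one, mul_one]
        abel
      · subst hi; simp [hj, smul_smul, h]
      · subst hj; simp [hi, smul_smul, h]
      · simp [hi, hj]
    rw [this]
    exact zero_mem _
  have := incT_eq_zero key
  rw [map_sub, sub_eq_zero, map_smul, map_mul, map_mul] at this
  exact this

end Tools

section Map

variable {k Γ M N κ κ' : Type*} [Field k] [CommGroup Γ] [AddCommGroup M] [Module k M]
  [AddCommGroup N] [Module k N] {Y : YetterDrinfeld k Γ M} {Y' : YetterDrinfeld k Γ N}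
  (D : Y.DiagBasis κ) (D' : Y'.DiagBasis κ') {m : M →ₗ[k] N} (hm : Y.IsHom Y' m)

/-- The algebra map between bosonizations induced by a morphism. -/
def mapAlg : Y.Boson →ₐ[k] Y'.Boson :=
  lift ((inc Y').comp (Nichols.map (hm.isBraidedMap D) D')) (of Y') (fun g v => by
    have := congr($(hm.act g) v)
    simp only [LinearMap.comp_apply] at this
    simp [of_mul_inc, this])

@[simp] lemma mapAlg_ι (v : M) : mapAlg D D' hm (ι Y v) = ι Y' (m v) := by
  simp [mapAlg, ι]

@[simp] lemma mapAlg_of (g : Γ) : mapAlg D D' hm (of Y g) = of Y' g := by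
  simp [mapAlg]

/-- The bialgebra map between bosonizations induced by a morphism. -/
def map : Y.Boson →ₐc[k] Y'.Boson :=
  BialgHom.ofAlgHom (mapAlg D D' hm)
    (by
      refine algHom_ext (fun v => ?_) (fun g => ?_)
      · simp
      · simp)
    (by
      refine algHom_ext (fun v => ?_) (fun g => ?_)
      · induction v using Y.homog_induction with
        | add v w h1 h2 => simp only [map_add, h1, h2]
        | hom γ v hv =>
          simp [comul_ι Y hv, comul_ι Y' (hm.isHomog hv)]
      · simp)

@[simp] lemma map_ι (v : M) : map D D' hm (ι Y v) = ι Y' (m v) := mapAlg_ι D D' hm v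

@[simp] lemma map_of (g : Γ) : map D D' hm (of Y g) = of Y' g := mapAlg_of D D' hm g

end Map

end Boson

end YetterDrinfeld

/-! ### Slices of a coproduct by linear forms. -/

namespace Convolution

open Coalgebra (comul counit)

variable {k A E : Type*} [Field k] [AddCommGroup A] [Module k A] [Coalgebra k A]
  [AddCommGroup E] [Module k E] [Coalgebra k E]

/-- The operator `x ↦ θ(x₁) x₂`. -/
def leftSlice (θ : A →ₗ[k] k) : A →ₗ[k] A :=
  (TensorProduct.lid k A).toLinearMap ∘ₗ θ.rTensor A ∘ₗ comul

/-- The operator `x ↦ x₁ θ(x₂)`. -/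
def rightSlice (θ : A →ₗ[k] k) : A →ₗ[k] A :=
  (TensorProduct.rid k A).toLinearMap ∘ₗ θ.lTensor A ∘ₗ comul

lemma comul_leftSlice (θ : A →ₗ[k] k) (x : A) :
    comul (R := k) (leftSlice θ x) = (leftSlice θ).rTensor A (comul (R := k) x) := by
  have e1 : ∀ t : A ⊗[k] A, comul (R := k) (TensorProduct.lid k A (θ.rTensor A t)) =
      TensorProduct.lid k (A ⊗[k] A) (θ.rTensor (A ⊗[k] A) (comul.lTensor A t)) := by
    intro t
    induction t with
    | zero => simp
    | add a b ha hb => simp only [map_add, ha, hb]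
    | tmul a b => simp
  have e2 : ∀ t : A ⊗[k] A, (leftSlice θ).rTensor A t =
      TensorProduct.lid k (A ⊗[k] A) (θ.rTensor (A ⊗[k] A)
        (TensorProduct.assoc k A A A (comul.rTensor A t))) := by
    intro t
    induction t with
    | zero => simp
    | add a b ha hb => simp only [map_add, ha, hb]
    | tmul a b =>
      simp only [leftSlice, LinearMap.rTensor_tmul, LinearMap.comp_apply, LinearEquiv.coe_coe]
      generalize comul (R := k) a = s
      induction s with
      | zero => simp
      | add a b ha hb => simp only [map_add, TensorProduct.add_tmul, ha, hb]
      | tmul a c => simp [TensorProduct.smul_tmul']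
  rw [e2, Coalgebra.coassoc_apply, ← e1]
  rfl

/-- Left slices will be derivations and right slices will be pulled back from the target of a
coalgebra map, so the two kinds of operators commute. -/
lemma leftSlice_rightSlice (θ η : A →ₗ[k] k) (x : A) :
    leftSlice θ (rightSlice η x) = rightSlice η (leftSlice θ x) := by
  rw [rightSlice, LinearMap.comp_apply, LinearMap.comp_apply, LinearMap.comp_apply,
    LinearMap.comp_apply, comul_leftSlice]
  generalize comul (R := k) x = t
  induction t with
  | zero => simp
  | add a b ha hb => simp only [map_add, ha, hb]
  | tmul a b => simp

lemma counit_rightSlice (θ : A →ₗ[k] k) (x : A) :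
    counit (R := k) (rightSlice θ x) = θ x := by
  have : ∀ t : A ⊗[k] A, counit (R := k) (TensorProduct.rid k A (θ.lTensor A t)) =
      θ (TensorProduct.lid k A (counit.rTensor A t)) := by
    intro t
    induction t with
    | zero => simp
    | add a b ha hb => simp only [map_add, ha, hb]
    | tmul a b => simp [mul_comm]
  rw [rightSlice, LinearMap.comp_apply, LinearMap.comp_apply, LinearEquiv.coe_coe, this,
    Coalgebra.rTensor_counit_comul]
  simp

/-- The kernel of a coalgebra map is stable under slices by forms that factor through the map. -/
lemma map_rightSlice {j : A →ₗ[k] E} (hj : ∀ x, TensorProduct.map j j (comul (R := k) x) =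
    comul (R := k) (j x)) (θ : E →ₗ[k] k) (x : A) :
    j (rightSlice (θ ∘ₗ j) x) = rightSlice θ (j x) := by
  rw [rightSlice, rightSlice, LinearMap.comp_apply, LinearMap.comp_apply, LinearMap.comp_apply,
    LinearMap.comp_apply, ← hj]
  generalize comul (R := k) x = t
  induction t with
  | zero => simp
  | add a b ha hb => simp only [map_add, ha, hb]
  | tmul a b => simp

end Convolution

/-! ### A filtration of the bosonization and an injectivity criterion. -/

namespace YetterDrinfeld

open TensorAlgebra

variable {k Γ M κ : Type*} [Field k] [CommGroup Γ] [AddCommGroup M] [Module k M]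
  {Y : YetterDrinfeld k Γ M} (D : Y.DiagBasis κ)

namespace DiagBasis

/-- An element of `𝔅(M)` killed by all derivations is a scalar: after its counit is subtracted it
lies in the kernel. -/
lemma sub_algebraMapInv_mem {a : TensorAlgebra k M} (h : ∀ i, D.der i a ∈ Y.nicholsIdeal) :
    a - algebraMapInv (R := k) a • 1 ∈ Y.nicholsIdeal := by
  rw [D.mem_nicholsIdeal, D.mem_kernel_iff]
  refine ⟨by simp, fun i => ?_⟩
  rw [map_sub, map_smul, der_one, smul_zero, sub_zero, ← D.mem_nicholsIdeal]
  exact h i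

/-- An element of `𝔅(M)` killed by all products of two derivations has degree at most one. Its
derivatives are scalars by the previous lemma, and these scalars are the coordinates of its
component of degree one. -/
lemma sub_degOne_mem {a : TensorAlgebra k M} (h : ∀ i j, D.der i (D.der j a) ∈ Y.nicholsIdeal) :
    a - (algebraMapInv (R := k) a • 1 + TensorAlgebra.ι k (degOne k M a)) ∈ Y.nicholsIdeal := by
  rw [D.mem_nicholsIdeal, D.mem_kernel_iff]
  refine ⟨by simp [algebraMapInv], fun i => ?_⟩
  have h1 := D.sub_algebraMapInv_mem (fun l => h l i)
  have h2 : D.der i (TensorAlgebra.ι k (degOne k M a)) = (D.b.coord i (degOne k M a)) • 1 := by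
    conv_lhs => rw [← D.b.linearCombination_repr (degOne k M a), Finsupp.linearCombination_apply,
      Finsupp.sum, map_sum, map_sum]
    simp only [map_smul, D.der_b, Algebra.algebraMap_eq_smul_one]
    conv_rhs => rw [← D.b.linearCombination_repr (degOne k M a), Finsupp.linearCombination_apply,
      Finsupp.sum, map_sum, Finset.sum_smul]
    simp [smul_smul]
  rw [map_sub, map_add, map_smul, der_one, smul_zero, zero_add, h2, ← D.mem_nicholsIdeal]
  rwa [der, algebraMapInv_der, ← der] at h1

end DiagBasis

namespace Boson

section Sum

lemma exists_eq_sum (x : Y.Boson) : ∃ (s : Finset Γ) (a : Γ → TensorAlgebra k M),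
    x = ∑ g ∈ s, incT Y (a g) * of Y g := by
  choose a ha using fun g => Nichols.mk_surjective Y (x.coeff g)
  refine ⟨x.support, a, ?_⟩
  conv_lhs => rw [← SkewMonoidAlgebra.sum_single x]
  refine Finset.sum_congr rfl fun g _ => ?_
  rw [single_eq, ← ha]
  rfl

/-- The bosonization is free over `𝔅(M)` with basis `Γ`, so coefficients can be compared. -/
lemma mem_of_sum_eq_zero {s : Finset Γ} {a : Γ → TensorAlgebra k M}
    (h : ∑ g ∈ s, incT Y (a g) * of Y g = 0) {g : Γ} (hg : g ∈ s) : a g ∈ Y.nicholsIdeal := by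
  classical
  have h1 : ∀ g, incT Y (a g) * of Y g = SkewMonoidAlgebra.single g (Nichols.mk Y (a g)) :=
    fun g => (single_eq Y g _).symm
  simp only [h1] at h
  let c : Y.Boson →+ Y.Nichols :=
    { toFun := fun x => x.coeff g, map_zero' := rfl,
      map_add' := fun x y => by rw [SkewMonoidAlgebra.coeff_add, Finsupp.add_apply] }
  have h2 := congr(c $h)
  have h3 : ∀ g' y, c (SkewMonoidAlgebra.single g' y) = if g' = g then y else 0 := fun g' y =>
    SkewMonoidAlgebra.coeff_single_apply
  rw [← Nichols.mk_eq_zero]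
  simpa [h3, hg] using h2

end Sum

/-- The algebra map `v ↦ [0 φ(v); 0 0]`, `g ↦ diag(χ(g), 1)`. -/
def matrixRep (i : κ) : Y.Boson →ₐ[k] Matrix (Fin 2) (Fin 2) k :=
  lift (Nichols.lift Y (TensorAlgebra.lift k
      (LinearMap.toSpanSingleton k _ (Matrix.single 0 1 1) ∘ₗ D.b.coord i)) (fun x hx => by
        rw [lift_eq_of_mul_eq_zero _ (fun v w => by simp), degOne_nicholsIdeal hx,
          Y.isBraidedHopfIdeal_nicholsIdeal.counit_eq_zero x hx]
        simp))
    { toFun g := Matrix.diagonal ![(D.χ i g : k), 1]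
      map_one' := by
        ext a b; fin_cases a <;> fin_cases b <;> simp
      map_mul' g h := by
        ext a b; fin_cases a <;> fin_cases b <;> simp [Matrix.diagonal_mul_diagonal] }
    (fun g v => by
      have := congr($(D.coord_comp_act i g) v)
      simp only [LinearMap.comp_apply] at this
      ext a b
      fin_cases a <;> fin_cases b <;>
        simp [this, Matrix.single_apply])

lemma matrixRep_of (i : κ) (g : Γ) :
    matrixRep D i (of Y g) = Matrix.diagonal ![(D.χ i g : k), 1] := by
  simp [matrixRep]

lemma matrixRep_b (i j : κ) :
    matrixRep D i (ι Y (D.b j)) = (Finsupp.single j (1 : k) i) • Matrix.single 0 1 1 := by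
  simp [matrixRep]

/-- The matrices are upper triangular, so the lower right entry is a character, and it agrees with
the counit on generators. -/
lemma matrixRep_counit (i : κ) (x : Y.Boson) :
    matrixRep D i x 1 1 = Coalgebra.counit (R := k) x := by
  induction x using left_induction D with
  | one => simp
  | smul r x hx => simp [hx]
  | add x y hx hy => simp [hx, hy]
  | mul j x hx => rw [map_mul, matrixRep_b]; simp [Matrix.mul_apply, Fin.sum_univ_two]
  | of_mul g x hx => rw [map_mul, matrixRep_of]; simp [Matrix.mul_apply, Fin.sum_univ_two, hx]

/-- The linear form `a g ↦ φ(a)` where `φ` is a coordinate on the component of degree one. -/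
def coordForm (i : κ) : Y.Boson →ₗ[k] k :=
  Matrix.entryLinearMap k k 0 1 ∘ₗ (matrixRep D i).toLinearMap

lemma coordForm_b_mul (i j : κ) (x : Y.Boson) :
    coordForm D i (ι Y (D.b j) * x) =
      Finsupp.single j (1 : k) i * Coalgebra.counit (R := k) x := by
  have := matrixRep_counit D i x
  simp only [coordForm, LinearMap.comp_apply, AlgHom.toLinearMap_apply, map_mul, matrixRep_b]
  simp [Matrix.mul_apply, Fin.sum_univ_two, this]

lemma coordForm_of_mul (i : κ) (g : Γ) (x : Y.Boson) :
    coordForm D i (of Y g * x) = D.χ i g * coordForm D i x := by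
  simp only [coordForm, LinearMap.comp_apply, AlgHom.toLinearMap_apply, map_mul, matrixRep_of]
  simp [Matrix.mul_apply, Fin.sum_univ_two]

/-- The extension of the derivation `D.der i` to `𝔅(M) ⋊ Γ`. -/
def der (i : κ) : Y.Boson →ₗ[k] Y.Boson := Convolution.leftSlice (coordForm D i)

lemma der_b_mul (i j : κ) (x : Y.Boson) :
    der D i (ι Y (D.b j) * x) = (Finsupp.single j (1 : k) i) • x +
      (D.χ i (D.γ j) : k) • (ι Y (D.b j) * der D i x) := by
  have : ∀ t : Y.Boson ⊗[k] Y.Boson, TensorProduct.lid k _ ((coordForm D i).rTensor _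
      ((ι Y (D.b j) ⊗ₜ 1 + of Y (D.γ j) ⊗ₜ ι Y (D.b j)) * t)) =
      (Finsupp.single j (1 : k) i) • TensorProduct.lid k _
        ((Coalgebra.counit (R := k)).rTensor _ t) + (D.χ i (D.γ j) : k) • (ι Y (D.b j) *
          TensorProduct.lid k _ ((coordForm D i).rTensor _ t)) := by
    intro t
    induction t with
    | zero => simp
    | add a b ha hb => simp only [mul_add, map_add, ha, hb, smul_add]; abel
    | tmul a b =>
      simp [add_mul, coordForm_b_mul, coordForm_of_mul, smul_smul]
  rw [der, Convolution.leftSlice, LinearMap.comp_apply, LinearMap.comp_apply, Bialgebra.comul_mul,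
    comul_ι_b, LinearEquiv.coe_coe, this, Coalgebra.rTensor_counit_comul]
  simp

lemma der_of_mul (i : κ) (g : Γ) (x : Y.Boson) :
    der D i (of Y g * x) = (D.χ i g : k) • (of Y g * der D i x) := by
  rw [der, Convolution.leftSlice, LinearMap.comp_apply, LinearMap.comp_apply, Bialgebra.comul_mul,
    comul_of, LinearMap.comp_apply, LinearMap.comp_apply]
  generalize Coalgebra.comul (R := k) x = t
  induction t with
  | zero => simp
  | add a b ha hb => simp only [mul_add, map_add, ha, hb, smul_add]
  | tmul a b => simp [coordForm_of_mul, smul_smul]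

@[simp] lemma der_one (i : κ) : der D i 1 = 0 := by
  have : coordForm D i 1 = 0 := by simp [coordForm]
  simp [der, Convolution.leftSlice, Algebra.TensorProduct.one_def, this]

/-- The extended derivation ignores group elements on the right, so conditions on derivatives can be
checked on the `Γ`-coefficients. -/
lemma der_incT_mul (i : κ) (x : TensorAlgebra k M) (g : Γ) :
    der D i (incT Y x * of Y g) = incT Y (D.der i x) * of Y g := by
  induction x using D.induction with
  | one => simpa using der_of_mul D i g 1
  | smul r x hx => simp only [map_smul, smul_mul_assoc, hx]
  | add x y hx hy => simp only [map_add, add_mul, hx, hy]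
  | mul j x hx =>
    rw [map_mul (incT Y), mul_assoc, incT_ι, der_b_mul, hx, D.der_b_mul, map_add, map_smul, map_smul,
      map_mul, incT_ι, add_mul, smul_mul_assoc, smul_mul_assoc, mul_assoc]

/-- The elements killed by all products of `n` derivations. -/
def filt : ℕ → Submodule k Y.Boson
  | 0 => ⊥
  | n + 1 => ⨅ i, (filt n).comap (der D i)

lemma mem_filt_succ {n : ℕ} {x : Y.Boson} : x ∈ filt D (n + 1) ↔ ∀ i, der D i x ∈ filt D n := by
  simp [filt]

lemma filt_le_succ (n : ℕ) : filt D n ≤ filt D (n + 1) := by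
  induction n with
  | zero => exact bot_le
  | succ n ih => intro x hx; rw [mem_filt_succ] at hx ⊢; exact fun i => ih (hx i)

lemma filt_mono : Monotone (filt D) := monotone_nat_of_le_succ (filt_le_succ D)

lemma of_mul_mem_filt {n : ℕ} {x : Y.Boson} (hx : x ∈ filt D n) (g : Γ) :
    of Y g * x ∈ filt D n := by
  induction n generalizing x with
  | zero =>
    have : x = 0 := hx
    simp [this]
  | succ n ih =>
    rw [mem_filt_succ] at hx ⊢
    intro i
    rw [der_of_mul]
    exact (filt D n).smul_mem _ (ih (hx i))

/-- The Leibniz rule shows that each additional letter costs at most one step of the filtration, so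
the filtration is exhaustive. -/
lemma b_mul_mem_filt {n : ℕ} {x : Y.Boson} (hx : x ∈ filt D n) (j : κ) :
    ι Y (D.b j) * x ∈ filt D (n + 1) := by
  induction n generalizing x with
  | zero =>
    have : x = 0 := hx
    simp [this]
  | succ n ih =>
    rw [mem_filt_succ]
    intro i
    rw [der_b_mul]
    exact add_mem ((filt D _).smul_mem _ hx) ((filt D _).smul_mem _ (ih (mem_filt_succ D |>.1 hx i)))

lemma exists_mem_filt (x : Y.Boson) : ∃ n, x ∈ filt D n := by
  induction x using left_induction D with
  | one => exact ⟨1, by rw [mem_filt_succ]; simp⟩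
  | smul r x hx => obtain ⟨n, hn⟩ := hx; exact ⟨n, (filt D n).smul_mem _ hn⟩
  | add x y hx hy =>
    obtain ⟨n, hn⟩ := hx
    obtain ⟨m, hm⟩ := hy
    exact ⟨max n m, add_mem (filt_mono D (le_max_left _ _) hn)
      (filt_mono D (le_max_right _ _) hm)⟩
  | mul j x hx => obtain ⟨n, hn⟩ := hx; exact ⟨n + 1, b_mul_mem_filt D hn j⟩
  | of_mul g x hx => obtain ⟨n, hn⟩ := hx; exact ⟨n, of_mul_mem_filt D hn g⟩

lemma eq_sum_of_mem_filt_one {x : Y.Boson} (hx : x ∈ filt D 1) :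
    ∃ (s : Finset Γ) (c : Γ → k), x = ∑ g ∈ s, c g • of Y g := by
  obtain ⟨s, a, rfl⟩ := exists_eq_sum x
  refine ⟨s, fun g => algebraMapInv (a g), Finset.sum_congr rfl fun g hg => ?_⟩
  have h : a g - algebraMapInv (R := k) (a g) • 1 ∈ Y.nicholsIdeal := by
    refine D.sub_algebraMapInv_mem fun i => ?_
    have h1 : der D i _ = 0 := mem_filt_succ D |>.1 hx i
    rw [map_sum] at h1
    simp only [der_incT_mul] at h1
    exact mem_of_sum_eq_zero h1 hg
  have h2 := incT_eq_zero h
  rw [map_sub, sub_eq_zero, map_smul, map_one] at h2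
  rw [h2, smul_mul_assoc, one_mul]

lemma eq_sum_of_mem_filt_two {x : Y.Boson} (hx : x ∈ filt D 2) :
    ∃ (s : Finset Γ) (c : Γ → k) (u : Γ → M),
      x = ∑ g ∈ s, (c g • 1 + ι Y (u g)) * of Y g := by
  obtain ⟨s, a, rfl⟩ := exists_eq_sum x
  refine ⟨s, fun g => algebraMapInv (a g), fun g => degOne k M (a g),
    Finset.sum_congr rfl fun g hg => ?_⟩
  have h : a g - (algebraMapInv (R := k) (a g) • 1 + TensorAlgebra.ι k (degOne k M (a g))) ∈
      Y.nicholsIdeal := by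
    refine D.sub_degOne_mem fun i j => ?_
    have h1 : der D i (der D j _) = 0 := mem_filt_succ D |>.1 (mem_filt_succ D |>.1 hx j) i
    rw [map_sum, map_sum] at h1
    simp only [der_incT_mul] at h1
    exact mem_of_sum_eq_zero h1 hg
  have h2 := incT_eq_zero h
  rw [map_sub, sub_eq_zero, map_add, map_smul, map_one, incT_ι] at h2
  rw [h2]

/-- A coalgebra map out of `𝔅(M) ⋊ Γ` is injective if it is injective on the span of all `g` and
`v g` (`g ∈ Γ`, `v ∈ M`). -/
theorem injective_of_filt_two {E : Type*} [AddCommGroup E] [Module k E] [Coalgebra k E]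
    {j : Y.Boson →ₗ[k] E} (hj : ∀ x, TensorProduct.map j j (Coalgebra.comul (R := k) x) =
      Coalgebra.comul (R := k) (j x)) (h2 : ∀ x ∈ filt D 2, j x = 0 → x = 0) :
    Function.Injective j := by
  -- On `filt D 2` the map is injective by hypothesis, so it has a linear retraction there; through
  -- it, forms on `filt D 2` become forms on the target.
  have hker : LinearMap.ker (j ∘ₗ (filt D 2).subtype) = ⊥ := by
    rw [LinearMap.ker_eq_bot']
    rintro ⟨x, hx⟩ h
    exact Subtype.ext (h2 x hx h)
  obtain ⟨r, hr⟩ := LinearMap.exists_leftInverse_of_injective _ hker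
  -- functionals that factor through `j` and vanish on grouplikes
  have hsep : ∀ z ∈ filt D 2, (∀ θ : E →ₗ[k] k, (∀ g, θ (j (of Y g)) = 0) → θ (j z) = 0) →
      z ∈ filt D 1 := by
    intro z hz h
    by_contra hz1
    have hz1' : (⟨z, hz⟩ : filt D 2) ∉ (filt D 1).comap (filt D 2).subtype := hz1
    -- A form that is nonzero at `z` and vanishes on `filt D 1`, hence on all `g ∈ Γ`. Composed with
    -- the retraction it contradicts the assumption on `z`.
    obtain ⟨θ₀, hθ, hle⟩ := Submodule.exists_le_ker_of_notMem hz1'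
    have hr' : ∀ y : filt D 2, r (j y) = y := fun y => congr($hr y)
    refine hθ ?_
    have := h (θ₀ ∘ₗ r) (fun g => ?_)
    · rw [LinearMap.comp_apply] at this
      rwa [← hr' ⟨z, hz⟩]
    · have hg : of Y g ∈ filt D 1 := by
        rw [mem_filt_succ]
        intro i
        have := der_of_mul D i g 1
        rw [mul_one, der_one, mul_zero, smul_zero] at this
        rw [this]
        exact zero_mem _
      have hg2 : of Y g ∈ filt D 2 := filt_le_succ D 1 hg
      rw [LinearMap.comp_apply, hr' ⟨_, hg2⟩]
      exact hle hg
  -- Slicing on the right by a form that vanishes on `Γ` lowers the filtration. The base case is a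
  -- combination of group elements, and the induction uses that derivations are left slices.
  have hR : ∀ θ : Y.Boson →ₗ[k] k, (∀ g, θ (of Y g) = 0) → ∀ n, ∀ x ∈ filt D (n + 1),
      Convolution.rightSlice θ x ∈ filt D n := by
    intro θ hθ n
    induction n with
    | zero =>
      intro x hx
      obtain ⟨s, c, rfl⟩ := eq_sum_of_mem_filt_one D hx
      have : Convolution.rightSlice θ (∑ g ∈ s, c g • of Y g) = 0 := by
        simp [Convolution.rightSlice, hθ]
      rw [this]
      exact zero_mem _
    | succ n ih =>
      intro x hx
      rw [mem_filt_succ]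
      intro i
      rw [der, Convolution.leftSlice_rightSlice]
      exact ih _ (mem_filt_succ D |>.1 hx i)
  -- Conversely, an element all of whose slices by such forms from the target vanish drops one step.
  -- In the base case the counit of the slice is the value of the form.
  have hdesc : ∀ n, ∀ x ∈ filt D (n + 2), (∀ θ : E →ₗ[k] k, (∀ g, θ (j (of Y g)) = 0) →
      Convolution.rightSlice (θ ∘ₗ j) x = 0) → x ∈ filt D (n + 1) := by
    intro n
    induction n with
    | zero =>
      intro x hx h
      refine hsep x hx fun θ hθ => ?_
      have := Convolution.counit_rightSlice (θ ∘ₗ j) x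
      rw [h θ hθ, map_zero] at this
      exact this.symm
    | succ n ih =>
      intro x hx h
      rw [mem_filt_succ]
      intro i
      refine ih _ (mem_filt_succ D |>.1 hx i) fun θ hθ => ?_
      rw [der, ← Convolution.leftSlice_rightSlice, h θ hθ, map_zero]
  -- For `x` in the kernel of `j`, the slices lie in the kernel one step lower, so they vanish by
  -- induction; then `x` itself drops one step and induction applies again.
  have main : ∀ n, ∀ x ∈ filt D (n + 2), j x = 0 → x = 0 := by
    intro n
    induction n with
    | zero => exact h2
    | succ n ih =>
      intro x hx hjx
      refine ih x (hdesc _ x hx fun θ hθ => ?_) hjx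
      refine ih _ (hR _ hθ _ x hx) ?_
      rw [Convolution.map_rightSlice hj, hjx, map_zero]
  rw [injective_iff_map_eq_zero]
  intro x hx
  obtain ⟨n, hn⟩ := exists_mem_filt D x
  exact main n x (filt_mono D (Nat.le_add_right _ _) hn) hx

end Boson
end YetterDrinfeld

/-! ### Linked pairs of maps from two bosonizations. -/

namespace YetterDrinfeld

open TensorAlgebra

variable {k Γ M N I S : Type*} [Field k] [CommGroup Γ] [AddCommGroup M] [Module k M]
  [AddCommGroup N] [Module k N]

/-- Linking data: two objects `V`, `W` of diagonal type with trivial double braiding, with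
scalars `β j` that may link the basis vector `w_j` to `v_{s j}` if their characters are
inverse to each other. -/
structure LinkData (YV : YetterDrinfeld k Γ M) (YW : YetterDrinfeld k Γ N) (I S : Type*) where
  DV : YV.DiagBasis I
  DW : YW.DiagBasis S
  s : S → I
  β : S → k
  braid : ∀ i j, (DV.χ i (DW.γ j) : k) * DW.χ j (DV.γ i) = 1
  inv : ∀ j, β j ≠ 0 → DW.χ j = (DV.χ (s j))⁻¹

namespace LinkData

variable {YV : YetterDrinfeld k Γ M} {YW : YetterDrinfeld k Γ N} (L : LinkData YV YW I S)

/-- the linking scalar of `w_j` and `v_i` -/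
def link (j : S) (i : I) : k := Finsupp.single (L.s j) (L.β j) i

/-- A pair of algebra maps from `𝔅(V) ⋊ Γ` and `𝔅(W) ⋊ Γ` that agree on `Γ` and satisfy the
linking relations `w_j v_i = χ_i(g_j) v_i w_j + β_{ji} (l₀ - l₁ g_j f_i)`. -/
structure IsLink {R : Type*} [Ring R] [Algebra k R] (l₀ l₁ : k) (p : YV.Boson →ₐ[k] R)
    (q : YW.Boson →ₐ[k] R) : Prop where
  of_eq : ∀ g, q (Boson.of YW g) = p (Boson.of YV g)
  link : ∀ i j, q (Boson.ι YW (L.DW.b j)) * p (Boson.ι YV (L.DV.b i)) =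
    (L.DV.χ i (L.DW.γ j) : k) • (p (Boson.ι YV (L.DV.b i)) * q (Boson.ι YW (L.DW.b j))) +
      L.link j i • (l₀ • 1 - l₁ • p (Boson.of YV (L.DW.γ j * L.DV.γ i)))

namespace IsLink

variable {L} {R R' : Type*} [Ring R] [Algebra k R] [Ring R'] [Algebra k R'] {l₀ l₁ l₂ : k}
  {p : YV.Boson →ₐ[k] R} {q : YW.Boson →ₐ[k] R} {p' : YV.Boson →ₐ[k] R'} {q' : YW.Boson →ₐ[k] R'}

lemma of_mul_v (g : Γ) (i : I) : p (Boson.of YV g) * p (Boson.ι YV (L.DV.b i)) =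
    (L.DV.χ i g : k) • (p (Boson.ι YV (L.DV.b i)) * p (Boson.of YV g)) := by
  rw [← map_mul, Boson.of_mul_ι_b, map_smul, map_mul]

lemma of_mul_w (h : L.IsLink l₀ l₁ p q) (g : Γ) (j : S) :
    p (Boson.of YV g) * q (Boson.ι YW (L.DW.b j)) =
    (L.DW.χ j g : k) • (q (Boson.ι YW (L.DW.b j)) * p (Boson.of YV g)) := by
  rw [← h.of_eq, ← map_mul, Boson.of_mul_ι_b, map_smul, map_mul]

lemma w_mul_of (h : L.IsLink l₀ l₁ p q) (g : Γ) (j : S) :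
    q (Boson.ι YW (L.DW.b j)) * p (Boson.of YV g) =
    (L.DW.χ j g : k)⁻¹ • (p (Boson.of YV g) * q (Boson.ι YW (L.DW.b j))) := by
  rw [h.of_mul_w, inv_smul_smul₀ (Units.ne_zero _)]

lemma v_mul_of (g : Γ) (i : I) :
    p (Boson.ι YV (L.DV.b i)) * p (Boson.of YV g) =
    (L.DV.χ i g : k)⁻¹ • (p (Boson.of YV g) * p (Boson.ι YV (L.DV.b i))) := by
  rw [of_mul_v, inv_smul_smul₀ (Units.ne_zero _)]

lemma braid_inv (L : LinkData YV YW I S) (i : I) (j : S) :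
    (L.DW.χ j (L.DV.γ i) : k)⁻¹ = L.DV.χ i (L.DW.γ j) :=
  inv_eq_of_mul_eq_one_left (L.braid i j)

/-- The map into a tensor product of algebras given by the coproduct. -/
def tensorHom {Y : YetterDrinfeld k Γ M} (p : Y.Boson →ₐ[k] R) (p' : Y.Boson →ₐ[k] R') :
    Y.Boson →ₐ[k] R ⊗[k] R' :=
  (Algebra.TensorProduct.map p p').comp (Bialgebra.comulAlgHom k Y.Boson)

lemma tensorHom_of {Y : YetterDrinfeld k Γ M} (p : Y.Boson →ₐ[k] R) (p' : Y.Boson →ₐ[k] R')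
    (g : Γ) : tensorHom p p' (Boson.of Y g) = p (Boson.of Y g) ⊗ₜ p' (Boson.of Y g) := by
  simp [tensorHom]

lemma tensorHom_b {Y : YetterDrinfeld k Γ M} (p : Y.Boson →ₐ[k] R) (p' : Y.Boson →ₐ[k] R')
    (D : Y.DiagBasis I) (i : I) : tensorHom p p' (Boson.ι Y (D.b i)) =
      p (Boson.ι Y (D.b i)) ⊗ₜ 1 + p (Boson.of Y (D.γ i)) ⊗ₜ p' (Boson.ι Y (D.b i)) := by
  simp [tensorHom, Boson.comul_ι_b]

/-- The parameters telescope. The terms `w v ⊗ 1` contribute `l₀ - l₁ g f ⊗ 1`, the terms `g f ⊗ w'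
v'` contribute `l₁ g f ⊗ 1 - l₂ g f ⊗ g f`, and the mixed terms satisfy the unlinked relation
because the double braiding is trivial. -/
lemma tensor (h : L.IsLink l₀ l₁ p q) (h' : L.IsLink l₁ l₂ p' q') :
    L.IsLink l₀ l₂ (tensorHom p p') (tensorHom q q') where
  of_eq g := by rw [tensorHom_of, tensorHom_of, h.of_eq, h'.of_eq]
  link i j := by
    rw [tensorHom_b, tensorHom_b, tensorHom_of]
    simp only [mul_add, add_mul, Algebra.TensorProduct.tmul_mul_tmul, mul_one, one_mul, h.link,
      h'.link, h.of_eq]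
    have e1 : p (Boson.of YV (L.DW.γ j)) * p (Boson.of YV (L.DV.γ i)) =
        p (Boson.of YV (L.DW.γ j * L.DV.γ i)) := by rw [map_mul, map_mul]
    have e2 : p (Boson.of YV (L.DV.γ i)) * p (Boson.of YV (L.DW.γ j)) =
        p (Boson.of YV (L.DW.γ j * L.DV.γ i)) := by rw [mul_comm (L.DW.γ j), map_mul, map_mul]
    rw [of_mul_v, h.w_mul_of, braid_inv, e1, e2]
    simp only [TensorProduct.add_tmul, TensorProduct.tmul_add, TensorProduct.tmul_sub,
      TensorProduct.sub_tmul, TensorProduct.tmul_smul, ← TensorProduct.smul_tmul',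
      Algebra.TensorProduct.one_def]
    module

/-- Composition with the antipode. -/
def opHom {Y : YetterDrinfeld k Γ M} (p : Y.Boson →ₐ[k] R) : Y.Boson →ₐ[k] Rᵐᵒᵖ :=
  p.op.comp (HopfAlgebra.antipodeAlgHomOp k Y.Boson)

lemma opHom_apply {Y : YetterDrinfeld k Γ M} (p : Y.Boson →ₐ[k] R) (x : Y.Boson) :
    opHom p x = MulOpposite.op (p (HopfAlgebra.antipode k x)) := rfl

/-- The antipode multiplies both sides of the linking relation by `(g f)⁻¹` and reverses products.
This turns `l₀ - l₁ g f` into `l₀ (g f)⁻¹ - l₁`, and moving the terms across changes the sign, so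
the two parameters are exchanged. -/
lemma op (h : L.IsLink l₀ l₁ p q) : L.IsLink l₁ l₀ (opHom p) (opHom q) where
  of_eq g := by simp [opHom_apply, h.of_eq]
  link i j := by
    simp only [opHom_apply, Boson.antipode_ι YV (L.DV.homog i),
      Boson.antipode_ι YW (L.DW.homog j), Boson.antipode_of, ← MulOpposite.op_mul,
      ← MulOpposite.op_smul, ← MulOpposite.op_one, ← MulOpposite.op_sub, ← MulOpposite.op_add]
    congr 1
    simp only [map_neg, map_mul, neg_mul_neg, h.of_eq]
    have e1 : p (Boson.of YV (L.DV.γ i)⁻¹) * p (Boson.ι YV (L.DV.b i)) *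
        (p (Boson.of YV (L.DW.γ j)⁻¹) * q (Boson.ι YW (L.DW.b j))) =
        (L.DV.χ i (L.DW.γ j) : k) • (p (Boson.of YV (L.DW.γ j * L.DV.γ i)⁻¹) *
          (p (Boson.ι YV (L.DV.b i)) * q (Boson.ι YW (L.DW.b j)))) := by
      rw [mul_assoc, ← mul_assoc (p (Boson.ι YV _)), v_mul_of, mul_inv_rev, map_mul, map_mul]
      simp [mul_assoc]
    have e2 : p (Boson.of YV (L.DW.γ j)⁻¹) * q (Boson.ι YW (L.DW.b j)) *
        (p (Boson.of YV (L.DV.γ i)⁻¹) * p (Boson.ι YV (L.DV.b i))) =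
        (L.DV.χ i (L.DW.γ j) : k)⁻¹ • (p (Boson.of YV (L.DW.γ j * L.DV.γ i)⁻¹) *
          (q (Boson.ι YW (L.DW.b j)) * p (Boson.ι YV (L.DV.b i)))) := by
      rw [mul_assoc, ← mul_assoc (q (Boson.ι YW _)), h.w_mul_of, mul_inv, map_mul, map_mul,
        ← braid_inv]
      simp [mul_assoc]
    have e3 : p (Boson.of YV (L.DW.γ j * L.DV.γ i)⁻¹) * p (Boson.of YV (L.DW.γ j * L.DV.γ i)) =
        1 := by
      rw [← map_mul, ← map_mul]; simp
    rw [e1, e2, h.link, smul_inv_smul₀ (Units.ne_zero _), mul_add, mul_smul_comm, mul_smul_comm,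
      mul_sub, mul_smul_comm, mul_smul_comm, e3, mul_one]
    module

section Span

variable (h : L.IsLink l₀ l₁ p q)
include h

/-- Straightening: `w` moves to the right past each `v` and each `g`, and the linking terms contain
fewer letters of `V`. -/
lemma w_mul_mem (j : S) (b : YV.Boson) (c : YW.Boson) :
    q (Boson.ι YW (L.DW.b j)) * (p b * q c) ∈
      Submodule.span k (Set.range fun x : YV.Boson × YW.Boson => p x.1 * q x.2) := by
  set Sp := Submodule.span k (Set.range fun x : YV.Boson × YW.Boson => p x.1 * q x.2)
  have hmem : ∀ b c, p b * q c ∈ Sp := fun b c => Submodule.subset_span ⟨(b, c), rfl⟩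
  have hl : ∀ b, ∀ x ∈ Sp, p b * x ∈ Sp := by
    intro b x hx
    induction hx using Submodule.span_induction with
    | mem x hx => obtain ⟨⟨b', c⟩, rfl⟩ := hx; rw [← mul_assoc, ← map_mul]; exact hmem _ _
    | zero => simp
    | add x y _ _ hx hy => rw [mul_add]; exact add_mem hx hy
    | smul r x _ hx => rw [mul_smul_comm]; exact Sp.smul_mem _ hx
  induction b using Boson.left_induction L.DV with
  | one => simpa using hmem 1 (Boson.ι YW (L.DW.b j) * c)
  | smul r x hx => rw [map_smul, smul_mul_assoc, mul_smul_comm]; exact Sp.smul_mem _ hx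
  | add x y hx hy => rw [map_add, add_mul, mul_add]; exact add_mem hx hy
  | mul i x hx =>
    rw [map_mul, mul_assoc, ← mul_assoc, h.link, add_mul, smul_mul_assoc, mul_assoc,
      smul_mul_assoc, sub_mul, smul_mul_assoc, one_mul, smul_mul_assoc]
    exact add_mem (Sp.smul_mem _ (hl _ _ hx)) (Sp.smul_mem _ (sub_mem (Sp.smul_mem _ (hmem _ _))
      (Sp.smul_mem _ (hl _ _ (hmem _ _)))))
  | of_mul g x hx =>
    rw [map_mul, mul_assoc, ← mul_assoc, h.w_mul_of, smul_mul_assoc, mul_assoc]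
    exact Sp.smul_mem _ (hl _ _ hx)

/-- An algebra generated by the images of `𝔅(V) ⋊ Γ` and `𝔅(W) ⋊ Γ` is spanned by the products
of their elements. -/
lemma induction (hgen : Algebra.adjoin k (Set.range p ∪ Set.range q) = ⊤) {P : R → Prop}
    (add : ∀ x y, P x → P y → P (x + y)) (mul : ∀ b c, P (p b * q c)) (x : R) : P x := by
  set Sp := Submodule.span k (Set.range fun x : YV.Boson × YW.Boson => p x.1 * q x.2)
  have hmem : ∀ b c, p b * q c ∈ Sp := fun b c => Submodule.subset_span ⟨(b, c), rfl⟩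
  -- The left multipliers that preserve the span form a subalgebra. It contains both images, hence
  -- it is everything.
  let St : Subalgebra k R :=
    { carrier := {a | ∀ x ∈ Sp, a * x ∈ Sp}
      mul_mem' := fun {a b} ha hb x hx => by rw [mul_assoc]; exact ha _ (hb _ hx)
      add_mem' := fun {a b} ha hb x hx => by rw [add_mul]; exact add_mem (ha _ hx) (hb _ hx)
      algebraMap_mem' := fun r x hx => by rw [← Algebra.smul_def]; exact Sp.smul_mem _ hx }
  have hSt : ∀ a, (∀ b c, a * (p b * q c) ∈ Sp) → a ∈ St := by
    intro a ha x hx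
    induction hx using Submodule.span_induction with
    | mem x hx => obtain ⟨⟨b', c⟩, rfl⟩ := hx; exact ha _ _
    | zero => simp
    | add x y _ _ hx hy => rw [mul_add]; exact add_mem hx hy
    | smul r x _ hx => rw [mul_smul_comm]; exact Sp.smul_mem _ hx
  have hp : ∀ b, p b ∈ St := fun b => hSt _ fun b' c => by
    rw [← mul_assoc, ← map_mul]; exact hmem _ _
  have hq : ∀ c, q c ∈ St := by
    intro c
    induction c using Boson.left_induction L.DW with
    | one => rw [map_one]; exact St.one_mem
    | smul r x hx => rw [map_smul]; exact St.smul_mem hx r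
    | add x y hx hy => rw [map_add]; exact St.add_mem hx hy
    | mul j x hx => rw [map_mul]; exact St.mul_mem (hSt _ fun b c => h.w_mul_mem j b c) hx
    | of_mul g x hx => rw [map_mul, h.of_eq]; exact St.mul_mem (hp _) hx
  have htop : St = ⊤ := by
    rw [eq_top_iff, ← hgen, Algebra.adjoin_le_iff]
    rintro _ (⟨b, rfl⟩ | ⟨c, rfl⟩)
    · exact hp b
    · exact hq c
  have hx : x ∈ Sp := by
    have h1 : x ∈ St := htop ▸ Algebra.mem_top
    simpa using h1 1 (by simpa using hmem 1 1)
  induction hx using Submodule.span_induction with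
  | mem x hx => obtain ⟨⟨b, c⟩, rfl⟩ := hx; exact mul b c
  | zero => simpa using mul 0 0
  | add x y _ _ hx hy => exact add _ _ hx hy
  | smul r x _ hx =>
    -- `P` is not assumed stable under scalars, so the span induction is repeated for all multiples
    -- of `x`; the scalar is absorbed into `b`.
    clear hgen hSt hp hq htop
    rename_i hxs
    revert r
    refine Submodule.span_induction (p := fun x _ => ∀ r : k, P (r • x)) ?_ ?_ ?_ ?_ hxs
    · rintro _ ⟨⟨b, c⟩, rfl⟩ r
      have := mul (r • b) c
      rwa [map_smul, smul_mul_assoc] at this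
    · intro r; simpa using mul 0 0
    · intro x y _ _ hx hy r; rw [smul_add]; exact add _ _ (hx r) (hy r)
    · intro c x _ hx r; rw [smul_smul]; exact hx _

end Span

end IsLink

end LinkData

end YetterDrinfeld

/-! ### The representation of a linked pair of type `(1, 0)` on `𝔅(V)`. -/

namespace YetterDrinfeld

open TensorAlgebra

variable {k Γ M N I S : Type*} [Field k] [CommGroup Γ] [AddCommGroup M] [Module k M]
  [AddCommGroup N] [Module k N]

namespace Nichols

variable {Y : YetterDrinfeld k Γ M} (D : Y.DiagBasis I)

/-- The braided derivation of `𝔅(M)` given by a coordinate. -/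
def der (i : I) : Y.Nichols →ₗ[k] Y.Nichols :=
  (mk Y).toLinearMap ∘ₗ D.der i ∘ₗ
    ((mk Y).toLinearMap.exists_rightInverse_of_surjective
      (LinearMap.range_eq_top.2 (mk_surjective Y))).choose

-- The choice of a linear section in the definition of `der` does not matter, since derivations
-- preserve the Nichols ideal.
@[simp] lemma der_mk (i : I) (x : TensorAlgebra k M) :
    der D i (mk Y x) = mk Y (D.der i x) := by
  have h := ((mk Y).toLinearMap.exists_rightInverse_of_surjective
      (LinearMap.range_eq_top.2 (mk_surjective Y))).choose_spec
  rw [der, LinearMap.comp_apply, LinearMap.comp_apply]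
  set r := ((mk Y).toLinearMap.exists_rightInverse_of_surjective
      (LinearMap.range_eq_top.2 (mk_surjective Y))).choose
  have h1 : mk Y (r (mk Y x)) = mk Y x := congr($h (mk Y x))
  rw [← sub_eq_zero, ← map_sub, mk_eq_zero] at h1
  rw [AlgHom.toLinearMap_apply, ← sub_eq_zero, ← map_sub, mk_eq_zero, ← map_sub]
  exact der_mem_nicholsIdeal _ h1

lemma der_smul (i : I) (g : Γ) (x : Y.Nichols) :
    der D i (g • x) = (D.χ i g : k) • g • der D i x := by
  obtain ⟨x, rfl⟩ := mk_surjective Y x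
  rw [smul_mk, der_mk, D.der_actAlg, der_mk, smul_mk, map_smul]

lemma der_b_mul (i j : I) (x : Y.Nichols) : der D i (mk Y (ι k (D.b j)) * x) =
    (Finsupp.single j (1 : k) i) • x +
      (D.χ i (D.γ j) : k) • (mk Y (ι k (D.b j)) * der D i x) := by
  obtain ⟨x, rfl⟩ := mk_surjective Y x
  rw [← map_mul, der_mk, D.der_b_mul, der_mk, map_add, map_smul, map_smul, map_mul]

@[simp] lemma der_one (i : I) : der D i 1 = 0 := by
  rw [← map_one (mk Y), der_mk, D.der_one, map_zero]

variable (Y) in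
/-- the counit of `𝔅(M)` -/
def counit : Y.Nichols →ₐ[k] k :=
  lift Y algebraMapInv Y.isBraidedHopfIdeal_nicholsIdeal.counit_eq_zero

@[simp] lemma counit_ι (v : M) : counit Y (mk Y (ι k v)) = 0 := by
  simp [counit, algebraMapInv]

@[simp] lemma counit_smul (g : Γ) (x : Y.Nichols) : counit Y (g • x) = counit Y x := by
  obtain ⟨x, rfl⟩ := mk_surjective Y x
  rw [smul_mk]
  exact Y.algebraMapInv_actAlg g x

variable (Y) in
/-- The action of `Γ` on `𝔅(M)` by linear maps. -/
def actEnd : Γ →* Module.End k Y.Nichols where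
  toFun g := (actAlg Y g).toLinearMap
  map_one' := LinearMap.ext fun x => one_smul Γ x
  map_mul' g h := LinearMap.ext fun x => mul_smul g h x

@[simp] lemma actEnd_apply (g : Γ) (x : Y.Nichols) : actEnd Y g x = g • x := rfl

lemma induction {p : Y.Nichols → Prop} (one : p 1)
    (smul : ∀ (r : k) x, p x → p (r • x)) (add : ∀ x y, p x → p y → p (x + y))
    (mul : ∀ i x, p x → p (mk Y (ι k (D.b i)) * x)) (x) : p x := by
  obtain ⟨x, rfl⟩ := mk_surjective Y x
  induction x using D.induction with
  | one => simpa
  | smul r x hx => rw [map_smul]; exact smul _ _ hx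
  | add x y hx hy => rw [map_add]; exact add _ _ hx hy
  | mul j x hx => rw [map_mul]; exact mul _ _ hx

end Nichols

namespace LinkData

variable {YV : YetterDrinfeld k Γ M} {YW : YetterDrinfeld k Γ N} (L : LinkData YV YW I S)

lemma inv_apply (j : S) (hj : L.β j ≠ 0) (g : Γ) :
    (L.DW.χ j g : k) = (L.DV.χ (L.s j) g : k)⁻¹ := by
  rw [L.inv j hj]; simp

/-- The operators `w_j ↦ β_j ∂_{s j}` on `𝔅(V)`. -/
def opW : TensorAlgebra k N →ₐ[k] Module.End k YV.Nichols :=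
  TensorAlgebra.lift k (L.DW.b.constr k fun j => L.β j • Nichols.der L.DV (L.s j))

@[simp] lemma opW_b (j : S) : L.opW (ι k (L.DW.b j)) = L.β j • Nichols.der L.DV (L.s j) := by
  simp [opW]

/-- The linear form `w_j ↦ β_{ji}` on `W`. -/
def linkForm (i : I) : N →ₗ[k] k := L.DW.b.constr k fun j => L.link j i

@[simp] lemma linkForm_b (i : I) (j : S) : L.linkForm i (L.DW.b j) = L.link j i := by
  simp [linkForm]

/-- A nonzero linking scalar between `w_j` and `v_i` forces the character of `w_j` to be the inverse
of that of `v_i`, so the form is an eigenvector. -/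
lemma linkForm_act (i : I) (g : Γ) :
    L.linkForm i ∘ₗ YW.act g = (L.DV.χ i g : k)⁻¹ • L.linkForm i := by
  classical
  refine L.DW.b.ext fun j => ?_
  rw [LinearMap.comp_apply, L.DW.act_b, map_smul, LinearMap.smul_apply, linkForm_b, link,
    Finsupp.single_apply]
  split_ifs with h
  · by_cases hj : L.β j = 0
    · simp [hj]
    · rw [L.inv_apply j hj, h]
  · simp

lemma der_linkForm_b_mul (i : I) (j : S) (y : TensorAlgebra k N) :
    YW.der (L.linkForm i) (ι k (L.DW.b j) * y) = L.link j i • y +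
      (L.DV.χ i (L.DW.γ j) : k)⁻¹ • (ι k (L.DW.b j) * YW.der (L.linkForm i) y) := by
  rw [YW.der_ι_mul (L.DW.homog j), linkForm_act, YetterDrinfeld.der_smul, linkForm_b]
  simp

/-- The automorphism `w_j ↦ χ_i(g_j) w_j` of `T(W)`. -/
def twistW (i : I) : TensorAlgebra k N →ₐ[k] TensorAlgebra k N :=
  L.DW.diagAlg fun j => (L.DV.χ i (L.DW.γ j) : k)

lemma opW_one (y : TensorAlgebra k N) :
    L.opW y 1 = algebraMapInv (R := k) y • (1 : YV.Nichols) := by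
  induction y using L.DW.induction with
  | one => simp
  | smul r x hx => simp [hx, smul_smul]
  | add x y hx hy => simp [hx, hy, add_smul]
  | mul j x hx => rw [map_mul, opW_b]; simp [hx]

/-- Moves the operator of a tensor `y` past multiplication by `v_i`. Only a diagonal twist of `y`
and a derivative of `y` occur on the right, and both operations preserve the Nichols ideal of `W`.
-/
lemma opW_b_mul (i : I) (y : TensorAlgebra k N) (x : YV.Nichols) :
    L.opW y (Nichols.mk YV (ι k (L.DV.b i)) * x) =
      Nichols.mk YV (ι k (L.DV.b i)) * L.opW (L.twistW i y) x +
        L.opW (L.twistW i (YW.der (L.linkForm i) y)) x := by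
  classical
  induction y using L.DW.induction with
  | one => simp
  | smul r y hy => simp only [map_smul, LinearMap.smul_apply, hy, mul_smul_comm, smul_add]
  | add y z hy hz => simp only [map_add, LinearMap.add_apply, hy, hz, mul_add]; abel
  | mul j y hy =>
    rw [map_mul L.opW, Module.End.mul_apply, hy, opW_b, der_linkForm_b_mul]
    simp only [map_add, map_mul, map_smul, twistW, L.DW.diagAlg_b, Module.End.mul_apply,
      LinearMap.add_apply, LinearMap.smul_apply, opW_b, Nichols.der_b_mul, smul_mul_assoc,
      mul_smul_comm, smul_add]
    have hl : L.link j i = L.β j * Finsupp.single i (1 : k) (L.s j) := by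
      rw [link, Finsupp.single_apply, Finsupp.single_apply]
      by_cases h : L.s j = i
      · simp [h]
      · simp [h, Ne.symm h]
    rw [hl]
    by_cases hj : L.β j = 0
    · simp [hj]
    -- Trivial double braiding and inverse characters make the scalar in the Leibniz rule equal to
    -- the one in the linking relation.
    · have hb : (L.DV.χ (L.s j) (L.DV.γ i) : k) = L.DV.χ i (L.DW.γ j) := by
        rw [← IsLink.braid_inv, L.inv_apply j hj, inv_inv]
      have hne : (L.DV.χ i (L.DW.γ j) : k) ≠ 0 := Units.ne_zero _
      rw [hb, smul_smul _ _ (L.β j • Nichols.der L.DV (L.s j) _), inv_mul_cancel₀ hne, one_smul]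
      module

/-- The relations of `𝔅(W)` hold for the derivation operators on `𝔅(V)`: they kill `1` by the
counit, and `opW_b_mul` carries the vanishing from `x` to `v_i x`, for all relations at once. -/
lemma opW_eq_zero {y : TensorAlgebra k N} (hy : y ∈ YW.nicholsIdeal) : L.opW y = 0 := by
  ext x
  rw [LinearMap.zero_apply]
  induction x using Nichols.induction L.DV generalizing y with
  | one => rw [opW_one, YW.isBraidedHopfIdeal_nicholsIdeal.counit_eq_zero y hy, zero_smul]
  | smul r x hx => rw [map_smul, hx hy, smul_zero]
  | add x x' hx hx' => rw [map_add, hx hy, hx' hy, add_zero]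
  | mul i x hx =>
    have hd : ∀ {z}, z ∈ YW.nicholsIdeal → L.twistW i z ∈ YW.nicholsIdeal := by
      intro z hz
      rw [L.DW.mem_nicholsIdeal] at hz ⊢
      exact L.DW.diagAlg_mem_kernel hz _
    rw [opW_b_mul, hx (hd hy), hx (hd (der_mem_nicholsIdeal _ hy)), mul_zero, add_zero]

/-- The representation of `𝔅(V) ⋊ Γ` on `𝔅(V)`. -/
def repV : YV.Boson →ₐ[k] Module.End k YV.Nichols :=
  Boson.lift (Algebra.lmul k YV.Nichols) (Nichols.actEnd YV) (fun g v => by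
    ext x
    simp [smul_mul'])

lemma repV_ι (v : M) (x : YV.Nichols) :
    repV (Boson.ι YV v) x = Nichols.mk YV (ι k v) * x := by simp [repV]

lemma repV_of (g : Γ) (x : YV.Nichols) : repV (Boson.of YV g) x = g • x := by simp [repV]

/-- The representation of `𝔅(W) ⋊ Γ` on `𝔅(V)`. -/
def repW : YW.Boson →ₐ[k] Module.End k YV.Nichols :=
  Boson.lift (Nichols.lift YW L.opW fun _ hy => L.opW_eq_zero hy) (Nichols.actEnd YV) (fun g v => by
    simp only [Nichols.lift_mk]
    have hv := L.DW.b.mem_span v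
    induction hv using Submodule.span_induction with
    | zero => simp
    | add v w _ _ hv hw => simp only [map_add, add_mul, mul_add, hv, hw]
    | smul c v _ hv => simp only [map_smul, smul_mul_assoc, mul_smul_comm, hv]
    | mem v hv =>
      obtain ⟨j, rfl⟩ := hv
      rw [L.DW.act_b]
      ext x
      simp only [map_smul, opW_b, LinearMap.smul_apply, Module.End.mul_apply,
        Nichols.actEnd_apply, Nichols.der_smul]
      by_cases hj : L.β j = 0
      · simp [hj]
      · rw [L.inv_apply j hj, smul_comm (L.β j), inv_smul_smul₀ (Units.ne_zero _)])

lemma repW_b (j : S) (x : YV.Nichols) :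
    L.repW (Boson.ι YW (L.DW.b j)) x = L.β j • Nichols.der L.DV (L.s j) x := by
  simp [repW]

lemma repW_of (g : Γ) (x : YV.Nichols) : L.repW (Boson.of YW g) x = g • x := by
  simp [repW]

/-- The Leibniz rule is the linking relation with `l₀ = 1`, `l₁ = 0`. -/
lemma isLink_rep : L.IsLink 1 0 repV L.repW where
  of_eq g := by ext x; rw [repW_of, repV_of]
  link i j := by
    classical
    ext x
    simp only [Module.End.mul_apply, LinearMap.add_apply, LinearMap.smul_apply,
      repW_b, repV_ι, Nichols.der_b_mul, link, Finsupp.single_apply, one_smul, zero_smul, sub_zero,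
      Module.End.one_apply]
    by_cases hj : L.β j = 0
    · simp [hj]
    · have hb : (L.DV.χ (L.s j) (L.DV.γ i) : k) = L.DV.χ i (L.DW.γ j) := by
        rw [← IsLink.braid_inv, L.inv_apply j hj, inv_inv]
      rw [hb]
      by_cases h : L.s j = i
      · simp only [h, if_true, one_smul, mul_smul_comm]
        module
      · simp only [h, Ne.symm h, if_false, zero_smul, zero_add, add_zero, mul_smul_comm]
        module

/-- The vacuum expectation `X ↦ ε(X 1)` on `End(𝔅(V))`. -/
def vac (YV : YetterDrinfeld k Γ M) : Module.End k YV.Nichols →ₗ[k] k :=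
  (Nichols.counit YV).toLinearMap ∘ₗ LinearMap.applyₗ 1

lemma vac_apply (X : Module.End k YV.Nichols) : vac YV X = Nichols.counit YV (X 1) := rfl

lemma counit_repV (D : YV.DiagBasis I) (b : YV.Boson) (x : YV.Nichols) :
    Nichols.counit YV (repV b x) = Coalgebra.counit (R := k) b * Nichols.counit YV x := by
  induction b using Boson.left_induction D with
  | one => simp
  | smul r b hb => simp [hb, mul_assoc]
  | add b b' hb hb' => simp [hb, hb', add_mul]
  | mul i b hb => rw [map_mul, Module.End.mul_apply, repV_ι]; simp
  | of_mul g b hb => rw [map_mul, Module.End.mul_apply, repV_of]; simp [hb]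

lemma repW_one (c : YW.Boson) :
    L.repW c 1 = Coalgebra.counit (R := k) c • (1 : YV.Nichols) := by
  induction c using Boson.left_induction L.DW with
  | one => simp
  | smul r c hc => simp [hc, smul_smul]
  | add c c' hc hc' => simp [hc, hc', add_smul]
  | mul j c hc => rw [map_mul, Module.End.mul_apply, hc, map_smul, repW_b]; simp
  | of_mul g c hc => rw [map_mul, Module.End.mul_apply, hc, map_smul, repW_of]; simp

/-- The vacuum vector `1` is killed by every `w_j`, and the counit kills every multiple of a `v_i`
in `𝔅(V)`. -/
lemma vac_mul (b : YV.Boson) (X : Module.End k YV.Nichols) (c : YW.Boson) :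
    vac YV (repV b * X * L.repW c) =
      Coalgebra.counit (R := k) b * vac YV X * Coalgebra.counit (R := k) c := by
  rw [vac_apply, Module.End.mul_apply, Module.End.mul_apply, repW_one, map_smul, map_smul, map_smul,
    counit_repV L.DV, vac_apply, smul_eq_mul]
  ring

/-! ### The universal linked algebra -/

/-- The defining relations of the universal algebra with a linked pair for `l₀ = 1`, `l₁ = 0`. -/
inductive Rel : TensorAlgebra k (YV.Boson × YW.Boson) → TensorAlgebra k (YV.Boson × YW.Boson) → Prop
  | oneV : Rel (ι k (1, 0)) 1
  | mulV (x y : YV.Boson) : Rel (ι k (x * y, 0)) (ι k (x, 0) * ι k (y, 0))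
  | oneW : Rel (ι k (0, 1)) 1
  | mulW (x y : YW.Boson) : Rel (ι k (0, x * y)) (ι k (0, x) * ι k (0, y))
  | of_eq (g : Γ) : Rel (ι k (0, Boson.of YW g)) (ι k (Boson.of YV g, 0))
  | link (i : I) (j : S) :
      Rel (ι k (0, Boson.ι YW (L.DW.b j)) * ι k (Boson.ι YV (L.DV.b i), 0))
        ((L.DV.χ i (L.DW.γ j) : k) •
          (ι k (Boson.ι YV (L.DV.b i), 0) * ι k (0, Boson.ι YW (L.DW.b j))) + L.link j i • 1)

/-- The universal algebra with a linked pair for `l₀ = 1`, `l₁ = 0`. -/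
def Q : Type _ := RingQuot L.Rel

namespace Q

instance : Ring L.Q := inferInstanceAs (Ring (RingQuot L.Rel))

instance : Algebra k L.Q := inferInstanceAs (Algebra k (RingQuot L.Rel))

/-- the quotient map onto `Q` -/
def mk : TensorAlgebra k (YV.Boson × YW.Boson) →ₐ[k] L.Q := RingQuot.mkAlgHom k L.Rel

lemma mk_rel {x y} (h : L.Rel x y) : mk L x = mk L y := RingQuot.mkAlgHom_rel k h

/-- the map `𝔅(V) ⋊ Γ → Q` -/
def inV : YV.Boson →ₐ[k] L.Q :=
  AlgHom.ofLinearMap ((mk L).toLinearMap ∘ₗ ι k ∘ₗ LinearMap.inl k _ _)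
    ((mk_rel L .oneV).trans (map_one _))
    (fun x y => (mk_rel L (.mulV x y)).trans (map_mul _ _ _))

/-- the map `𝔅(W) ⋊ Γ → Q` -/
def inW : YW.Boson →ₐ[k] L.Q :=
  AlgHom.ofLinearMap ((mk L).toLinearMap ∘ₗ ι k ∘ₗ LinearMap.inr k _ _)
    ((mk_rel L .oneW).trans (map_one _))
    (fun x y => (mk_rel L (.mulW x y)).trans (map_mul _ _ _))

lemma mk_inl (x : YV.Boson) : mk L (ι k (x, 0)) = inV L x := rfl

lemma mk_inr (x : YW.Boson) : mk L (ι k (0, x)) = inW L x := rfl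

lemma isLink : L.IsLink 1 0 (inV L) (inW L) where
  of_eq g := mk_rel L (.of_eq g)
  link i j := by simpa [mk_inl, mk_inr] using mk_rel L (.link i j)

variable {L} {A : Type*} [Ring A] [Algebra k A] {p : YV.Boson →ₐ[k] A} {q : YW.Boson →ₐ[k] A}

/-- Algebra maps out of `Q`. -/
def lift (h : L.IsLink 1 0 p q) : L.Q →ₐ[k] A :=
  RingQuot.liftAlgHom k ⟨TensorAlgebra.lift k (p.toLinearMap.coprod q.toLinearMap), by
    intro x y hxy
    induction hxy with
    | oneV => simp
    | mulV x y => simp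
    | oneW => simp
    | mulW x y => simp
    | of_eq g => simpa using h.of_eq g
    | link i j => simpa using h.link i j⟩

@[simp] lemma lift_inV (h : L.IsLink 1 0 p q) (x : YV.Boson) : lift h (inV L x) = p x := by
  change RingQuot.liftAlgHom k _ (RingQuot.mkAlgHom k L.Rel (ι k (x, 0))) = _
  rw [RingQuot.liftAlgHom_mkAlgHom_apply]
  simp

@[simp] lemma lift_inW (h : L.IsLink 1 0 p q) (x : YW.Boson) : lift h (inW L x) = q x := by
  change RingQuot.liftAlgHom k _ (RingQuot.mkAlgHom k L.Rel (ι k (0, x))) = _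
  rw [RingQuot.liftAlgHom_mkAlgHom_apply]
  simp

lemma adjoin_eq_top : Algebra.adjoin k (Set.range (inV L) ∪ Set.range (inW L)) = ⊤ := by
  set S := Algebra.adjoin k (Set.range (inV L) ∪ Set.range (inW L))
  rw [eq_top_iff]
  rintro x -
  obtain ⟨x, rfl⟩ := RingQuot.mkAlgHom_surjective k L.Rel x
  change mk L x ∈ S
  induction x using TensorAlgebra.induction with
  | algebraMap r => simp
  | ι v =>
    have : ι k v = ι k (v.1, 0) + ι k (0, v.2) := by
      simp [← map_add]
    rw [this, map_add]
    exact S.add_mem (Algebra.subset_adjoin (Or.inl ⟨v.1, rfl⟩))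
      (Algebra.subset_adjoin (Or.inr ⟨v.2, rfl⟩))
  | mul a b ha hb => simpa using S.mul_mem ha hb
  | add a b ha hb => simpa using S.add_mem ha hb

variable (L) in
/-- The linear form on `Q` given by the vacuum expectation. -/
def vacForm : L.Q →ₗ[k] k := vac YV ∘ₗ (lift L.isLink_rep).toLinearMap

/-- This supplies the augmentation of `Q`: on straightened products it is the product of the
counits. In particular `1` and the counit are not lost in passing to the relations of `Q`. -/
lemma vacForm_mul (b : YV.Boson) (c : YW.Boson) : vacForm L (inV L b * inW L c) =
    Coalgebra.counit (R := k) b * Coalgebra.counit (R := k) c := by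
  have := L.vac_mul b 1 c
  rw [mul_one] at this
  simp [vacForm, this, vac_apply]

end Q

end LinkData

end YetterDrinfeld

/-! ### Units in convolution algebras. -/

namespace Convolution

open Coalgebra (comul counit)
open WithConv (toConv)

section

variable {k C B R R' : Type*} [Field k] [AddCommGroup C] [Module k C] [Coalgebra k C]
  [AddCommGroup B] [Module k B] [Coalgebra k B] [Ring R] [Algebra k R] [Ring R'] [Algebra k R']

lemma one_comp (h : B →ₗc[k] C) :
    toConv ((1 : WithConv (C →ₗ[k] R)).ofConv ∘ₗ h.toLinearMap) = 1 := by
  ext x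
  simp

lemma isUnit_comp {f : WithConv (C →ₗ[k] R)} (hf : IsUnit f) (h : B →ₗc[k] C) :
    IsUnit (toConv (f.ofConv ∘ₗ h.toLinearMap)) := by
  obtain ⟨u, rfl⟩ := hf
  refine ⟨⟨_, toConv (u⁻¹.val.ofConv ∘ₗ h.toLinearMap), ?_, ?_⟩, rfl⟩
  · have := LinearMap.convMul_comp_coalgHom_distrib u.val u⁻¹.val h
    rw [Units.mul_inv] at this
    rw [← one_comp h, this]
  · have := LinearMap.convMul_comp_coalgHom_distrib u⁻¹.val u.val h
    rw [Units.inv_mul] at this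
    rw [← one_comp h, this]

/-- The convolution inverse of an algebra map is its composite with the antipode. -/
lemma isUnit_algHom {H : Type*} [Ring H] [HopfAlgebra k H] (p : H →ₐ[k] R) :
    toConv p.toLinearMap * toConv (p.toLinearMap ∘ₗ HopfAlgebra.antipode k) = 1 ∧
    toConv (p.toLinearMap ∘ₗ HopfAlgebra.antipode k) * toConv p.toLinearMap = 1 := by
  have h1 : toConv (p.toLinearMap ∘ₗ (1 : WithConv (H →ₗ[k] H)).ofConv) = 1 := by
    ext x
    simp
  constructor
  · have := LinearMap.algHom_comp_convMul_distrib p (toConv LinearMap.id)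
      (toConv (HopfAlgebra.antipode k (A := H)))
    rw [LinearMap.id_mul_antipode] at this
    rw [← h1, this]
    rfl
  · have := LinearMap.algHom_comp_convMul_distrib p
      (toConv (HopfAlgebra.antipode k (A := H))) (toConv LinearMap.id)
    rw [LinearMap.antipode_mul_id] at this
    rw [← h1, this]
    rfl

lemma comp_scalar_mul (f : R →ₗ[k] R') (s : C →ₗ[k] k) (X : C →ₗ[k] R) :
    f ∘ₗ (toConv (Algebra.linearMap k R ∘ₗ s) * toConv X).ofConv =
      (toConv (Algebra.linearMap k R' ∘ₗ s) * toConv (f ∘ₗ X)).ofConv := by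
  ext x
  rw [LinearMap.comp_apply, LinearMap.convMul_apply, LinearMap.convMul_apply]
  generalize comul (R := k) x = t
  induction t with
  | zero => simp
  | add a b ha hb => simp only [map_add, ha, hb]
  | tmul a b => simp [← Algebra.smul_def]

lemma comp_mul_scalar (f : R →ₗ[k] R') (s : C →ₗ[k] k) (X : C →ₗ[k] R) :
    f ∘ₗ (toConv X * toConv (Algebra.linearMap k R ∘ₗ s)).ofConv =
      (toConv (f ∘ₗ X) * toConv (Algebra.linearMap k R' ∘ₗ s)).ofConv := by
  ext x
  rw [LinearMap.comp_apply, LinearMap.convMul_apply, LinearMap.convMul_apply]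
  generalize comul (R := k) x = t
  induction t with
  | zero => simp
  | add a b ha hb => simp only [map_add, ha, hb]
  | tmul a b => simp [← Algebra.commutes, ← Algebra.smul_def]

/-- A form is invertible if it is invertible as a map to an algebra `R` with a linear retraction
`R → k`. -/
lemma isUnit_of_isUnit_algebraMap {l : R →ₗ[k] k} (hl : l 1 = 1) {s : C →ₗ[k] k}
    (hs : IsUnit (toConv (Algebra.linearMap k R ∘ₗ s))) : IsUnit (toConv s) := by
  obtain ⟨u, hu⟩ := hs
  have hl1 : ∀ c : k, l (algebraMap k R c) = c := fun c => by
    rw [Algebra.algebraMap_eq_smul_one, map_smul, hl, smul_eq_mul, mul_one]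
  have h1 : toConv (l ∘ₗ (1 : WithConv (C →ₗ[k] R)).ofConv) = 1 := by
    ext x
    simp [hl1]
  have hlin : Algebra.linearMap k k ∘ₗ s = s := by ext x; simp
  refine ⟨⟨toConv s, toConv (l ∘ₗ u⁻¹.val.ofConv), ?_, ?_⟩, rfl⟩
  · have := comp_scalar_mul l s u⁻¹.val.ofConv
    rw [← hu, WithConv.toConv_ofConv, Units.mul_inv, hlin] at this
    rw [← h1, this]
  · have := comp_mul_scalar l s u⁻¹.val.ofConv
    rw [← hu, WithConv.toConv_ofConv, Units.inv_mul, hlin] at this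
    rw [← h1, this]

end

section

variable {k A R : Type*} [Field k] [Ring A] [Bialgebra k A] [Ring R] [Algebra k R]

/-- Left multiplication by a grouplike element passes through a convolution product. -/
lemma mul_grouplike {F G : WithConv (A →ₗ[k] R)} {y : A} (hy : comul (R := k) y = y ⊗ₜ y)
    {x s s' z : R} (hF : ∀ a, F.ofConv (y * a) = x * F.ofConv a * s)
    (hG : ∀ a, G.ofConv (y * a) = s' * G.ofConv a * z) (hs : s * s' = 1) (a : A) :
    (F * G).ofConv (y * a) = x * (F * G).ofConv a * z := by
  rw [LinearMap.convMul_apply, LinearMap.convMul_apply, Bialgebra.comul_mul, hy]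
  generalize comul (R := k) a = t
  induction t with
  | zero => simp
  | add a b ha hb => simp only [map_add, mul_add, add_mul, ha, hb]
  | tmul a b =>
    simp only [Algebra.TensorProduct.tmul_mul_tmul, TensorProduct.map_tmul, hF, hG,
      LinearMap.mul'_apply]
    rw [mul_assoc (x * _), ← mul_assoc s, ← mul_assoc s, hs, one_mul]
    simp only [mul_assoc]

/-- Left multiplication by a skew primitive element passes through a convolution product. -/
lemma mul_skewPrimitive {F G : WithConv (A →ₗ[k] R)} {y f : A}
    (hy : comul (R := k) y = y ⊗ₜ 1 + f ⊗ₜ y) {x : R} (hF : ∀ a, F.ofConv (y * a) = x * F.ofConv a)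
    (hG : ∀ a, G.ofConv (y * a) = 0) (a : A) :
    (F * G).ofConv (y * a) = x * (F * G).ofConv a := by
  rw [LinearMap.convMul_apply, LinearMap.convMul_apply, Bialgebra.comul_mul, hy]
  generalize comul (R := k) a = t
  induction t with
  | zero => simp
  | add a b ha hb => simp only [map_add, mul_add, ha, hb]
  | tmul a b =>
    simp [add_mul, hF, hG, mul_assoc]

end

end Convolution

/-! ### Direct sums and the bosonization of `U ≅ V ⊕ W`. -/

namespace YetterDrinfeld

section Prod

variable {k Γ M N X : Type*} [Field k] [CommGroup Γ] [AddCommGroup M] [Module k M]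
  [AddCommGroup N] [Module k N] [AddCommGroup X] [Module k X]
  {YV : YetterDrinfeld k Γ M} {YW : YetterDrinfeld k Γ N} {YU : YetterDrinfeld k Γ X}

lemma IsHom.comp {f : M →ₗ[k] N} {g : N →ₗ[k] X} (hg : YW.IsHom YU g) (hf : YV.IsHom YW f) :
    YV.IsHom YU (g ∘ₗ f) where
  act h := by rw [LinearMap.comp_assoc, hf.act, ← LinearMap.comp_assoc, hg.act,
    LinearMap.comp_assoc]
  coact := by rw [← LinearMap.comp_assoc, hg.coact, LinearMap.comp_assoc, hf.coact,
    ← LinearMap.comp_assoc, ← LinearMap.lTensor_comp]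

lemma isHom_inl : YV.IsHom (YV.prod YW) (LinearMap.inl k M N) where
  act g := by
    ext x
    · rfl
    · exact (map_zero (YW.act g)).symm
  coact := LinearMap.coprod_inl _ _

lemma isHom_inr : YW.IsHom (YV.prod YW) (LinearMap.inr k M N) where
  act g := by
    ext x
    · exact (map_zero (YV.act g)).symm
    · rfl
  coact := LinearMap.coprod_inr _ _

lemma isHom_fst : (YV.prod YW).IsHom YV (LinearMap.fst k M N) where
  act g := rfl
  coact := by
    refine LinearMap.prod_ext ?_ ?_
    · ext v
      have := congr($((isHom_inl (YV := YV) (YW := YW)).coact) v)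
      simp only [LinearMap.comp_apply] at this ⊢
      rw [this, ← LinearMap.lTensor_comp_apply, LinearMap.fst_comp_inl]
      simp
    · ext v
      have := congr($((isHom_inr (YV := YV) (YW := YW)).coact) v)
      simp only [LinearMap.comp_apply] at this ⊢
      rw [this, ← LinearMap.lTensor_comp_apply, LinearMap.fst_comp_inr]
      simp

lemma isHom_snd : (YV.prod YW).IsHom YW (LinearMap.snd k M N) where
  act g := rfl
  coact := by
    refine LinearMap.prod_ext ?_ ?_
    · ext v
      have := congr($((isHom_inl (YV := YV) (YW := YW)).coact) v)
      simp only [LinearMap.comp_apply] at this ⊢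
      rw [this, ← LinearMap.lTensor_comp_apply, LinearMap.snd_comp_inl]
      simp
    · ext v
      have := congr($((isHom_inr (YV := YV) (YW := YW)).coact) v)
      simp only [LinearMap.comp_apply] at this ⊢
      rw [this, ← LinearMap.lTensor_comp_apply, LinearMap.snd_comp_inr]
      simp

lemma IsHom.symm {e : M ≃ₗ[k] N} (he : YV.IsHom YW e.toLinearMap) :
    YW.IsHom YV e.symm.toLinearMap where
  act g := by
    ext x
    obtain ⟨x, rfl⟩ := e.surjective x
    have := congr($(he.act g) x)
    simp only [LinearMap.comp_apply, LinearEquiv.coe_coe] at this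
    simp [← this]
  coact := by
    ext x
    obtain ⟨x, rfl⟩ := e.surjective x
    have := congr($(he.coact) x)
    simp only [LinearMap.comp_apply, LinearEquiv.coe_coe] at this
    simp only [LinearMap.comp_apply, LinearEquiv.coe_coe, LinearEquiv.symm_apply_apply, this,
      ← LinearMap.lTensor_comp_apply]
    simp

lemma isHom_zero : YV.IsHom YW 0 where
  act g := by simp
  coact := by simp

end Prod

namespace LinkData

variable {k Γ M N X I S : Type*} [Field k] [CommGroup Γ] [AddCommGroup M] [Module k M]
  [AddCommGroup N] [Module k N] [AddCommGroup X] [Module k X]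
  {YV : YetterDrinfeld k Γ M} {YW : YetterDrinfeld k Γ N} (L : LinkData YV YW I S)
  {YU : YetterDrinfeld k Γ X} {e : (M × N) ≃ₗ[k] X} (he : (YV.prod YW).IsHom YU e.toLinearMap)

include he in
lemma isHomV : YV.IsHom YU (e.toLinearMap ∘ₗ LinearMap.inl k M N) := he.comp isHom_inl

include he in
lemma isHomW : YW.IsHom YU (e.toLinearMap ∘ₗ LinearMap.inr k M N) := he.comp isHom_inr

include he in
lemma isHomPV : YU.IsHom YV (LinearMap.fst k M N ∘ₗ e.symm.toLinearMap) := isHom_fst.comp he.symm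

include he in
lemma isHomPW : YU.IsHom YW (LinearMap.snd k M N ∘ₗ e.symm.toLinearMap) := isHom_snd.comp he.symm

/-- The diagonal basis of `U ≅ V ⊕ W`. -/
def DU : YU.DiagBasis (I ⊕ S) where
  b := (L.DV.b.prod L.DW.b).map e
  χ := Sum.elim L.DV.χ L.DW.χ
  γ := Sum.elim L.DV.γ L.DW.γ
  act_b g i := by
    rcases i with i | j
    · have := congr($((isHomV he).act g) (L.DV.b i))
      simp only [LinearMap.comp_apply, L.DV.act_b, map_smul] at this
      simpa using this.symm
    · have := congr($((isHomW he).act g) (L.DW.b j))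
      simp only [LinearMap.comp_apply, L.DW.act_b, map_smul] at this
      simpa using this.symm
  homog i := by
    rcases i with i | j
    · simpa using (isHomV he).isHomog (L.DV.homog i)
    · simpa using (isHomW he).isHomog (L.DW.homog j)

lemma DU_b_inl (i : I) : (L.DU he).b (Sum.inl i) = e (L.DV.b i, 0) := by simp [DU]

lemma DU_b_inr (j : S) : (L.DU he).b (Sum.inr j) = e (0, L.DW.b j) := by simp [DU]

/-- the inclusion of `𝔅(V) ⋊ Γ` into `𝔅(U) ⋊ Γ` -/
def jV : YV.Boson →ₐc[k] YU.Boson := Boson.map L.DV (L.DU he) (isHomV he)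

/-- the inclusion of `𝔅(W) ⋊ Γ` into `𝔅(U) ⋊ Γ` -/
def jW : YW.Boson →ₐc[k] YU.Boson := Boson.map L.DW (L.DU he) (isHomW he)

/-- the projection of `𝔅(U) ⋊ Γ` onto `𝔅(V) ⋊ Γ` -/
def rV : YU.Boson →ₐc[k] YV.Boson := Boson.map (L.DU he) L.DV (isHomPV he)

/-- the projection of `𝔅(U) ⋊ Γ` onto `𝔅(W) ⋊ Γ` -/
def rW : YU.Boson →ₐc[k] YW.Boson := Boson.map (L.DU he) L.DW (isHomPW he)

/-- the map `𝔅(U) ⋊ Γ → 𝔅(V) ⋊ Γ` that factors through the projection onto `k Γ` -/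
def r0 : YU.Boson →ₐc[k] YV.Boson := Boson.map (L.DU he) L.DV isHom_zero

lemma jV_ι (v : M) : L.jV he (Boson.ι YV v) = Boson.ι YU (e (v, 0)) := Boson.map_ι _ _ _ v

lemma jW_ι (w : N) : L.jW he (Boson.ι YW w) = Boson.ι YU (e (0, w)) := Boson.map_ι _ _ _ w

lemma jV_of (g : Γ) : L.jV he (Boson.of YV g) = Boson.of YU g := Boson.map_of _ _ _ g

lemma jW_of (g : Γ) : L.jW he (Boson.of YW g) = Boson.of YU g := Boson.map_of _ _ _ g

lemma rV_ι (u : X) : L.rV he (Boson.ι YU u) = Boson.ι YV (e.symm u).1 := Boson.map_ι _ _ _ u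

lemma rW_ι (u : X) : L.rW he (Boson.ι YU u) = Boson.ι YW (e.symm u).2 := Boson.map_ι _ _ _ u

lemma r0_ι (u : X) : L.r0 he (Boson.ι YU u) = 0 := by simp [r0]

lemma rV_of (g : Γ) : L.rV he (Boson.of YU g) = Boson.of YV g := Boson.map_of _ _ _ g

lemma rW_of (g : Γ) : L.rW he (Boson.of YU g) = Boson.of YW g := Boson.map_of _ _ _ g

lemma r0_of (g : Γ) : L.r0 he (Boson.of YU g) = Boson.of YV g := Boson.map_of _ _ _ g

/-- Trivial double braiding makes `v_i` and `w_j` commute up to a scalar in `𝔅(U)`, so there is no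
linking term: type `(0, 0)`. -/
lemma isLink_j : L.IsLink 0 0 (L.jV he : YV.Boson →ₐ[k] YU.Boson)
    (L.jW he : YW.Boson →ₐ[k] YU.Boson) where
  of_eq g := (L.jW_of he g).trans (L.jV_of he g).symm
  link i j := by
    have h := Boson.ι_mul_ι (L.DU he) (Sum.inr j) (Sum.inl i) (L.braid i j)
    rw [DU_b_inl, DU_b_inr] at h
    simp only [zero_smul, sub_zero, smul_zero, add_zero]
    change L.jW he _ * L.jV he _ = _ • (L.jV he _ * L.jW he _)
    rw [jV_ι, jW_ι]
    exact h

lemma adjoin_j : Algebra.adjoin k (Set.range (L.jV he : YV.Boson →ₐ[k] YU.Boson) ∪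
    Set.range (L.jW he : YW.Boson →ₐ[k] YU.Boson)) = ⊤ := by
  rw [eq_top_iff, ← Boson.adjoin_eq_top YU, Algebra.adjoin_le_iff]
  set St := Algebra.adjoin k (Set.range (L.jV he : YV.Boson →ₐ[k] YU.Boson) ∪
    Set.range (L.jW he : YW.Boson →ₐ[k] YU.Boson))
  have hV : ∀ b, L.jV he b ∈ St := fun b => Algebra.subset_adjoin (Or.inl ⟨b, rfl⟩)
  have hW : ∀ b, L.jW he b ∈ St := fun b => Algebra.subset_adjoin (Or.inr ⟨b, rfl⟩)
  rintro _ (⟨u, rfl⟩ | ⟨g, rfl⟩)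
  · obtain ⟨⟨v, w⟩, rfl⟩ := e.surjective u
    have : e (v, w) = e (v, 0) + e (0, w) := by rw [← map_add]; simp
    rw [this, map_add, ← L.jV_ι he, ← L.jW_ι he]
    exact St.add_mem (hV _) (hW _)
  · rw [← L.jV_of he]; exact hV _

/-- Every element of `𝔅(U) ⋊ Γ` is a sum of products of elements of the two subalgebras. -/
lemma j_induction {P : YU.Boson → Prop} (add : ∀ x y, P x → P y → P (x + y))
    (mul : ∀ b c, P (L.jV he b * L.jW he c)) (x : YU.Boson) : P x :=
  (L.isLink_j he).induction (L.adjoin_j he) add mul x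

end LinkData

end YetterDrinfeld

/-! ### Cleft extensions and their cocycles. -/

namespace Convolution

open WithConv (toConv)

section

variable {k C A R : Type*} [Field k] [AddCommGroup C] [Module k C] [Coalgebra k C]
  [AddCommGroup A] [Module k A] [Coalgebra k A] [Ring R] [Algebra k R]

/-- Both sides are convolution inverses of `p`. -/
lemma map_antipode {H H' : Type*} [Ring H] [HopfAlgebra k H] [Ring H'] [HopfAlgebra k H']
    (p : H →ₐc[k] H') (x : H) :
    p (HopfAlgebra.antipode k x) = HopfAlgebra.antipode k (p x) := by
  have h1 := (isUnit_algHom (p : H →ₐ[k] H')).1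
  have h2 := LinearMap.convMul_comp_coalgHom_distrib (toConv (HopfAlgebra.antipode k (A := H')))
    (toConv LinearMap.id) (p : H →ₗc[k] H')
  rw [LinearMap.antipode_mul_id] at h2
  have h3 := (one_comp (R := H') (p : H →ₗc[k] H')).symm.trans (congrArg toConv h2)
  exact congr($(left_inv_eq_right_inv h3.symm h1).ofConv x).symm

/-- The counit absorbs one tensor leg, which reduces each side of the cocycle identity to a single
coproduct. -/
lemma form_tmul_counit_mul (s : C →ₗ[k] k) (K : C ⊗[k] A →ₗ[k] k) (x : C) (a : A) :
    (toConv (LinearMap.mul' k k ∘ₗ TensorProduct.map s (Coalgebra.counit (R := k) (A := A))) *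
      toConv K).ofConv (x ⊗ₜ a) =
    TensorProduct.lid k k (TensorProduct.map s (K ∘ₗ (TensorProduct.mk k C A).flip a)
      (Coalgebra.comul (R := k) x)) := by
  have h1 := congr(TensorProduct.lid k _ $(Coalgebra.rTensor_counit_comul (R := k) a))
  rw [LinearMap.convMul_apply, TensorProduct.comul_tmul]
  conv_rhs => rw [← one_smul k a, ← TensorProduct.lid_tmul, ← h1]
  generalize Coalgebra.comul (R := k) x = t
  generalize Coalgebra.comul (R := k) a = t'
  induction t with
  | zero => simp
  | add a b ha hb => simp only [map_add, TensorProduct.add_tmul, ha, hb]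
  | tmul x y =>
    induction t' with
    | zero => simp
    | add a b ha hb =>
      simp only [map_add, TensorProduct.tmul_add, ha, hb, LinearMap.comp_add,
        TensorProduct.map_add_right, LinearMap.add_apply]
    | tmul a b => simp; ring

lemma form_counit_tmul_mul (s : C →ₗ[k] k) (K : A ⊗[k] C →ₗ[k] k) (a : A) (x : C) :
    (toConv (LinearMap.mul' k k ∘ₗ TensorProduct.map (Coalgebra.counit (R := k) (A := A)) s) *
      toConv K).ofConv (a ⊗ₜ x) =
    TensorProduct.lid k k (TensorProduct.map s (K ∘ₗ TensorProduct.mk k A C a)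
      (Coalgebra.comul (R := k) x)) := by
  have h1 := congr(TensorProduct.lid k _ $(Coalgebra.rTensor_counit_comul (R := k) a))
  rw [LinearMap.convMul_apply, TensorProduct.comul_tmul]
  conv_rhs => rw [← one_smul k a, ← TensorProduct.lid_tmul, ← h1]
  generalize Coalgebra.comul (R := k) x = t
  generalize Coalgebra.comul (R := k) a = t'
  induction t with
  | zero => simp
  | add a b ha hb => simp only [map_add, TensorProduct.tmul_add, ha, hb]
  | tmul x y =>
    induction t' with
    | zero => simp
    | add a b ha hb =>
      simp only [map_add, TensorProduct.add_tmul, ha, hb, LinearMap.comp_add,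
        TensorProduct.map_add_right, LinearMap.add_apply]
    | tmul a b => simp; ring

end

section

variable {k A R : Type*} [Field k] [Ring A] [Bialgebra k A] [Ring R] [Algebra k R]

lemma isUnit_comp_mul {f : WithConv (A →ₗ[k] R)} (hf : IsUnit f) :
    IsUnit (toConv (f.ofConv ∘ₗ LinearMap.mul' k A)) :=
  isUnit_comp hf (Bialgebra.mulCoalgHom k A)

/-- The map `a ⊗ b ↦ f(a) f(b)` is the convolution product of the pullbacks of `f` along the
coalgebra maps `id ⊗ ε` and `ε ⊗ id`. -/
lemma isUnit_mul_map {f : WithConv (A →ₗ[k] R)} (hf : IsUnit f) :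
    IsUnit (toConv (LinearMap.mul' k R ∘ₗ TensorProduct.map f.ofConv f.ofConv)) := by
  let p1 : A ⊗[k] A →ₗc[k] A := (Coalgebra.TensorProduct.rid k k A : A ⊗[k] k →ₗc[k] A).comp
    (Coalgebra.TensorProduct.map (CoalgHom.id k A) (Coalgebra.counitCoalgHom k A))
  let p2 : A ⊗[k] A →ₗc[k] A := (Coalgebra.TensorProduct.lid k A : k ⊗[k] A →ₗc[k] A).comp
    (Coalgebra.TensorProduct.map (Coalgebra.counitCoalgHom k A) (CoalgHom.id k A))
  have h1 : ∀ a b, p1 (a ⊗ₜ b) = Coalgebra.counit (R := k) b • a := fun a b => rfl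
  have h2 : ∀ a b, p2 (a ⊗ₜ b) = Coalgebra.counit (R := k) a • b := fun a b => rfl
  have e : toConv (LinearMap.mul' k R ∘ₗ TensorProduct.map f.ofConv f.ofConv) =
      toConv (f.ofConv ∘ₗ p1.toLinearMap) * toConv (f.ofConv ∘ₗ p2.toLinearMap) := by
    refine WithConv.ofConv_injective (TensorProduct.ext' fun a b => ?_)
    have ha := congr(TensorProduct.rid k _ $(Coalgebra.lTensor_counit_comul (R := k) a))
    have hb := congr(TensorProduct.lid k _ $(Coalgebra.rTensor_counit_comul (R := k) b))
    rw [LinearMap.convMul_apply, WithConv.ofConv_toConv, LinearMap.comp_apply,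
      TensorProduct.map_tmul, LinearMap.mul'_apply, TensorProduct.comul_tmul]
    conv_lhs => rw [← one_smul k a, ← TensorProduct.rid_tmul, ← ha, ← one_smul k b,
      ← TensorProduct.lid_tmul, ← hb]
    generalize Coalgebra.comul (R := k) a = s
    generalize Coalgebra.comul (R := k) b = t
    induction s with
    | zero => simp
    | add a b ha hb => simp only [map_add, TensorProduct.add_tmul, add_mul, ha, hb]
    | tmul x y =>
      induction t with
      | zero => simp
      | add a b ha hb => simp only [map_add, TensorProduct.tmul_add, mul_add, ha, hb]
      | tmul a b =>
        simp [h1, h2, smul_smul, mul_comm]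
  rw [e]
  exact (isUnit_comp hf p1).mul (isUnit_comp hf p2)

end

/-- A cleft extension `R` of `k` by the bialgebra `A`, with its section `φ` and an augmentation
`l`. -/
structure Cleft (k A R : Type*) [Field k] [Ring A] [Bialgebra k A] [Ring R] [Algebra k R] where
  φ : A →ₗ[k] R
  l : R →ₗ[k] k
  δ : R →ₐ[k] R ⊗[k] A
  φ_one : φ 1 = 1
  isUnit : IsUnit (toConv φ)
  l_φ : ∀ a, l (φ a) = Coalgebra.counit (R := k) a
  surjective : Function.Surjective φ
  δ_φ : ∀ a, δ (φ a) = φ.rTensor A (Coalgebra.comul (R := k) a)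

namespace Cleft

variable {k A R : Type*} [Field k] [Ring A] [Bialgebra k A] [Ring R] [Algebra k R]
  (c : Cleft k A R)

/-- Every element is a value of `φ`, on which the identity is colinearity together with the counit
law. It recovers an element from its coaction. -/
lemma l_δ (x : R) : TensorProduct.lid k _ (TensorProduct.map c.l c.φ (c.δ x)) = x := by
  obtain ⟨a, rfl⟩ := c.surjective x
  rw [δ_φ]
  have : ∀ t : A ⊗[k] A, TensorProduct.lid k _ (TensorProduct.map c.l c.φ (c.φ.rTensor _ t)) =
      c.φ (TensorProduct.lid k _ ((Coalgebra.counit (R := k)).rTensor _ t)) := by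
    intro t
    induction t with
    | zero => simp
    | add a b ha hb => simp only [map_add, ha, hb]
    | tmul a b => simp [c.l_φ]
  rw [this, Coalgebra.rTensor_counit_comul]
  simp

/-- The map `a ⊗ b ↦ φ(a) φ(b)`. -/
def φ2 : A ⊗[k] A →ₗ[k] R := LinearMap.mul' k R ∘ₗ TensorProduct.map c.φ c.φ

/-- The cocycle of the section. -/
def form : A ⊗[k] A →ₗ[k] k := c.l ∘ₗ c.φ2

lemma φ2_tmul (a b : A) : c.φ2 (a ⊗ₜ b) = c.φ a * c.φ b := rfl

lemma form_tmul (a b : A) : c.form (a ⊗ₜ b) = c.l (c.φ a * c.φ b) := rfl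

/-- `φ(a) φ(b) = σ(a₁, b₁) φ(a₂ b₂)`: apply `l_δ` to the product and use that the coaction is
multiplicative. -/
lemma φ2_eq : toConv c.φ2 = toConv (Algebra.linearMap k R ∘ₗ c.form) *
    toConv (c.φ ∘ₗ LinearMap.mul' k A) := by
  refine WithConv.ofConv_injective (TensorProduct.ext' fun a b => ?_)
  rw [LinearMap.convMul_apply, WithConv.ofConv_toConv, φ2_tmul, ← c.l_δ (_ * _), map_mul,
    δ_φ, δ_φ, TensorProduct.comul_tmul]
  generalize Coalgebra.comul (R := k) a = s
  generalize Coalgebra.comul (R := k) b = t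
  induction s with
  | zero => simp
  | add s s' hs hs' => simp only [map_add, add_mul, TensorProduct.add_tmul, hs, hs']
  | tmul a a' =>
    induction t with
    | zero => simp
    | add s s' hs hs' => simp only [map_add, mul_add, TensorProduct.tmul_add, hs, hs']
    | tmul b b' => simp [form_tmul, ← Algebra.smul_def]

lemma φ2_apply (x : A ⊗[k] A) : c.φ2 x = TensorProduct.lid k _ (TensorProduct.map c.form
    (c.φ ∘ₗ LinearMap.mul' k A) (Coalgebra.comul (R := k) x)) := by
  have h := congr($(c.φ2_eq).ofConv x)
  rw [LinearMap.convMul_apply, WithConv.ofConv_toConv] at h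
  rw [h]
  generalize Coalgebra.comul (R := k) x = s
  induction s with
  | zero => simp
  | add s s' hs hs' => simp only [map_add, hs, hs']
  | tmul a a' => simp [← Algebra.smul_def]

/-- By `φ2_eq` the form, with values in `R`, is the quotient of two units of the convolution
algebra; `l` retracts `R` onto `k` and carries the inverse back to a form. -/
lemma isUnit_form : IsUnit (toConv c.form) := by
  have hl : c.l 1 = 1 := by
    have h := c.l_φ 1
    rwa [c.φ_one, Bialgebra.counit_one (R := k) (A := A)] at h
  have h1 := isUnit_mul_map c.isUnit
  have h2 := isUnit_comp_mul c.isUnit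
  rw [WithConv.ofConv_toConv] at h1 h2
  rw [← φ2] at h1
  have h3 : IsUnit (toConv (Algebra.linearMap k R ∘ₗ c.form)) := by
    have h4 := h1.mul h2.unit⁻¹.isUnit
    rwa [c.φ2_eq, mul_assoc, IsUnit.mul_val_inv, mul_one] at h4
  exact isUnit_of_isUnit_algebraMap hl h3

/-- The cocycle of the section, as a unit. -/
def σ : (WithConv (A ⊗[k] A →ₗ[k] k))ˣ := c.isUnit_form.unit

@[simp] lemma val_σ : c.σ.val = toConv c.form := rfl

/-- The cocycle identity is `l` applied to the two bracketings of `φ(x) φ(y) φ(z)`, once `φ2_eq`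
rewrites the bracketed factor. -/
lemma isTwoCocycle : IsTwoCocycle c.σ where
  one_left x := by
    rw [val_σ, WithConv.ofConv_toConv, form_tmul, φ_one, one_mul, l_φ]
  one_right x := by
    rw [val_σ, WithConv.ofConv_toConv, form_tmul, φ_one, mul_one, l_φ]
  cocycle := by
    simp only [val_σ, WithConv.ofConv_toConv]
    -- The associator is a coalgebra map, so the right-hand convolution product can be computed on
    -- `A ⊗ (A ⊗ A)`.
    have hr := LinearMap.convMul_comp_coalgHom_distrib
      (toConv (LinearMap.mul' k k ∘ₗ TensorProduct.map (Coalgebra.counit (R := k) (A := A)) c.form))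
      (toConv (c.form ∘ₗ (LinearMap.mul' k A).lTensor A))
      (Coalgebra.TensorProduct.assoc k k A A A : (A ⊗[k] A) ⊗[k] A →ₗc[k] A ⊗[k] (A ⊗[k] A))
    have hr2 : toConv (LinearMap.mul' k k ∘ₗ
        TensorProduct.map (Coalgebra.counit (R := k) (A := A)) c.form ∘ₗ
        (TensorProduct.assoc k A A A).toLinearMap) * toConv (c.form ∘ₗ (LinearMap.mul' k A).lTensor A
          ∘ₗ (TensorProduct.assoc k A A A).toLinearMap) = toConv _ := (congrArg toConv hr).symm
    rw [hr2]
    refine WithConv.ofConv_injective (TensorProduct.ext_threefold fun x y z => ?_)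
    rw [form_tmul_counit_mul]
    change _ = (toConv (LinearMap.mul' k k ∘ₗ
        TensorProduct.map (Coalgebra.counit (R := k) (A := A)) c.form) *
        toConv (c.form ∘ₗ (LinearMap.mul' k A).lTensor A)).ofConv (x ⊗ₜ (y ⊗ₜ z))
    rw [form_counit_tmul_mul]
    have hl : ∀ t, TensorProduct.lid k k (TensorProduct.map c.form
        ((c.form ∘ₗ (LinearMap.mul' k A).rTensor A) ∘ₗ (TensorProduct.mk k (A ⊗[k] A) A).flip z) t) =
        c.l (TensorProduct.lid k _ (TensorProduct.map c.form (c.φ ∘ₗ LinearMap.mul' k A) t) *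
          c.φ z) := by
      intro t
      induction t with
      | zero => simp
      | add s s' hs hs' => simp only [map_add, add_mul, hs, hs']
      | tmul a b => simp [form_tmul]
    have hr : ∀ t, TensorProduct.lid k k (TensorProduct.map c.form
        ((c.form ∘ₗ (LinearMap.mul' k A).lTensor A) ∘ₗ (TensorProduct.mk k A (A ⊗[k] A)) x) t) =
        c.l (c.φ x * TensorProduct.lid k _ (TensorProduct.map c.form
          (c.φ ∘ₗ LinearMap.mul' k A) t)) := by
      intro t
      induction t with
      | zero => simp
      | add s s' hs hs' => simp only [map_add, mul_add, hs, hs']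
      | tmul a b => simp [form_tmul]
    rw [hl, hr, ← c.φ2_apply, ← c.φ2_apply, φ2_tmul, φ2_tmul, mul_assoc]

variable {E : Type*} [Ring E] [Algebra k E] {j : A →ₗ[k] E} {d : R →ₐ[k] E ⊗[k] R}

/-- A map that intertwines coactions is multiplicative for the deformed product. -/
lemma map_deformedMul (hd : ∀ a, d (c.φ a) = TensorProduct.map j c.φ (Coalgebra.comul (R := k) a))
    (a b : A) : j (deformedMul c.σ (a ⊗ₜ b)) = j a * j b := by
  -- Apply `d` and then `id ⊗ l` to `φ(a) φ(b) = σ(a₁, b₁) φ(a₂ b₂)`: this gives `j(a₁) j(b₁) σ(a₂,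
  -- b₂) = σ(a₁, b₁) j(a₂ b₂)`.
  have key : toConv (LinearMap.mul' k E ∘ₗ TensorProduct.map j j) *
      toConv (Algebra.linearMap k E ∘ₗ c.form) =
      toConv (Algebra.linearMap k E ∘ₗ c.form) * toConv (j ∘ₗ LinearMap.mul' k A) := by
    refine WithConv.ofConv_injective (TensorProduct.ext' fun a b => ?_)
    have h1 := congr(TensorProduct.rid k E (c.l.lTensor E (d $(c.φ2_apply (a ⊗ₜ b)))))
    rw [φ2_tmul, map_mul, hd, hd] at h1
    rw [LinearMap.convMul_apply, LinearMap.convMul_apply]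
    have h2 : ∀ t : (A ⊗[k] A) ⊗[k] (A ⊗[k] A), TensorProduct.rid k E (c.l.lTensor E (d
        (TensorProduct.lid k R (TensorProduct.map c.form (c.φ ∘ₗ LinearMap.mul' k A) t)))) =
        LinearMap.mul' k E (TensorProduct.map (Algebra.linearMap k E ∘ₗ c.form)
          (j ∘ₗ LinearMap.mul' k A) t) := by
      have h3 : ∀ a, TensorProduct.rid k E (c.l.lTensor E (d (c.φ a))) = j a := by
        intro a
        rw [hd]
        have : ∀ t : A ⊗[k] A, TensorProduct.rid k E (c.l.lTensor E (TensorProduct.map j c.φ t)) =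
            j (TensorProduct.rid k A ((Coalgebra.counit (R := k)).lTensor _ t)) := by
          intro t
          induction t with
          | zero => simp
          | add a b ha hb => simp only [map_add, ha, hb]
          | tmul a b => simp [c.l_φ]
        rw [this, Coalgebra.lTensor_counit_comul]
        simp
      intro t
      induction t with
      | zero => simp
      | add a b ha hb => simp only [map_add, ha, hb]
      | tmul x y =>
        rw [TensorProduct.map_tmul, TensorProduct.lid_tmul, map_smul, map_smul, map_smul,
          LinearMap.comp_apply, h3]
        simp [← Algebra.smul_def]
    rw [h2] at h1
    simp only [WithConv.ofConv_toConv]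
    rw [← h1, TensorProduct.comul_tmul]
    generalize Coalgebra.comul (R := k) a = s
    generalize Coalgebra.comul (R := k) b = t
    induction s with
    | zero => simp
    | add a b ha hb => simp only [map_add, TensorProduct.add_tmul, add_mul, ha, hb]
    | tmul x y =>
      induction t with
      | zero => simp
      | add a b ha hb => simp only [map_add, TensorProduct.tmul_add, mul_add, ha, hb]
      | tmul a b => simp [form_tmul, ← Algebra.commutes, ← Algebra.smul_def]
  have e : j ∘ₗ deformedMul c.σ = LinearMap.mul' k E ∘ₗ TensorProduct.map j j := by
    rw [deformedMul, comp_mul_scalar, comp_scalar_mul, WithConv.toConv_ofConv]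
    simp only [val_σ, WithConv.ofConv_toConv]
    rw [← key, mul_assoc]
    -- After `key` the form stands next to its convolution inverse, and the two cancel.
    have : toConv (Algebra.linearMap k E ∘ₗ c.form) *
        toConv (Algebra.linearMap k E ∘ₗ c.σ⁻¹.val.ofConv) = 1 := by
      have := LinearMap.algHom_comp_convMul_distrib (Algebra.ofId k E) c.σ.val c.σ⁻¹.val
      rw [Units.mul_inv] at this
      refine (congrArg toConv this).symm.trans ?_
      ext x
      simp [Algebra.ofId_apply]
    rw [this, mul_one]
  exact congr($e (a ⊗ₜ b))

end Cleft
end Convolution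

/-! ### `Q` as a cleft extension by `𝔅(U) ⋊ Γ`. -/

namespace YetterDrinfeld
namespace LinkData

open Coalgebra (comul)
open WithConv (toConv)

variable {k Γ M N X I S : Type*} [Field k] [CommGroup Γ] [AddCommGroup M] [Module k M]
  [AddCommGroup N] [Module k N] [AddCommGroup X] [Module k X]
  {YV : YetterDrinfeld k Γ M} {YW : YetterDrinfeld k Γ N} (L : LinkData YV YW I S)
  {YU : YetterDrinfeld k Γ X} {e : (M × N) ≃ₗ[k] X} (he : (YV.prod YW).IsHom YU e.toLinearMap)

/-! ### The section `𝔅(U) ⋊ Γ → Q` -/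

/-- the algebra map `𝔅(U) ⋊ Γ → 𝔅(V) ⋊ Γ → Q` -/
def qV : YU.Boson →ₐ[k] L.Q := (Q.inV L).comp (L.rV he : YU.Boson →ₐ[k] YV.Boson)

/-- the algebra map `𝔅(U) ⋊ Γ → k Γ → Q` -/
def q0 : YU.Boson →ₐ[k] L.Q := (Q.inV L).comp (L.r0 he : YU.Boson →ₐ[k] YV.Boson)

/-- the algebra map `𝔅(U) ⋊ Γ → 𝔅(W) ⋊ Γ → Q` -/
def qW : YU.Boson →ₐ[k] L.Q := (Q.inW L).comp (L.rW he : YU.Boson →ₐ[k] YW.Boson)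

lemma qV_ι (u : X) : L.qV he (Boson.ι YU u) = Q.inV L (Boson.ι YV (e.symm u).1) :=
  congrArg (Q.inV L) (L.rV_ι he u)

lemma qW_ι (u : X) : L.qW he (Boson.ι YU u) = Q.inW L (Boson.ι YW (e.symm u).2) :=
  congrArg (Q.inW L) (L.rW_ι he u)

lemma q0_ι (u : X) : L.q0 he (Boson.ι YU u) = 0 :=
  (congrArg (Q.inV L) (L.r0_ι he u)).trans (map_zero _)

lemma qV_of (g : Γ) : L.qV he (Boson.of YU g) = Q.inV L (Boson.of YV g) :=
  congrArg (Q.inV L) (L.rV_of he g)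

lemma q0_of (g : Γ) : L.q0 he (Boson.of YU g) = Q.inV L (Boson.of YV g) :=
  congrArg (Q.inV L) (L.r0_of he g)

lemma qW_of (g : Γ) : L.qW he (Boson.of YU g) = Q.inV L (Boson.of YV g) :=
  (congrArg (Q.inW L) (L.rW_of he g)).trans ((Q.isLink L).of_eq g)

/-- The section of `Q` in the convolution algebra. -/
def cleftConv : WithConv (YU.Boson →ₗ[k] L.Q) :=
  toConv (L.qV he).toLinearMap *
    toConv ((L.q0 he).toLinearMap ∘ₗ HopfAlgebra.antipode k (A := YU.Boson)) *
    toConv (L.qW he).toLinearMap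

/-- The section of `Q`: the colinear map sending `b h` to `b h`. -/
def cleft : YU.Boson →ₗ[k] L.Q := (L.cleftConv he).ofConv

/-- The section is a product of an algebra map, an algebra map composed with the antipode, and an
algebra map; each factor is invertible. The middle factor removes the group part that the two
projections would otherwise count twice. -/
lemma isUnit_cleft : IsUnit (L.cleftConv he) := by
  have h1 := Convolution.isUnit_algHom (L.qV he)
  have h2 := Convolution.isUnit_algHom (L.q0 he)
  have h3 := Convolution.isUnit_algHom (L.qW he)
  exact (IsUnit.mul ⟨⟨_, _, h1.1, h1.2⟩, rfl⟩ ⟨⟨_, _, h2.2, h2.1⟩, rfl⟩).mul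
    ⟨⟨_, _, h3.1, h3.2⟩, rfl⟩

/-- The grouplike `g` passes through the three factors as `g`, `g⁻¹`, `g`; the last two cancel. -/
lemma cleft_of_mul (g : Γ) (a : YU.Boson) :
    L.cleft he (Boson.of YU g * a) = Q.inV L (Boson.of YV g) * L.cleft he a := by
  have hg : Q.inV L (Boson.of YV g⁻¹) * Q.inV L (Boson.of YV g) = 1 := by
    rw [← map_mul, ← map_mul]; simp
  have h1 : ∀ a, (toConv (L.qV he).toLinearMap *
      toConv ((L.q0 he).toLinearMap ∘ₗ HopfAlgebra.antipode k (A := YU.Boson))).ofConv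
        (Boson.of YU g * a) = Q.inV L (Boson.of YV g) * (toConv (L.qV he).toLinearMap *
      toConv ((L.q0 he).toLinearMap ∘ₗ HopfAlgebra.antipode k (A := YU.Boson))).ofConv a *
        Q.inV L (Boson.of YV g⁻¹) := by
    refine Convolution.mul_grouplike (s := 1) (s' := 1) (Boson.comul_of _ g) (fun a => ?_)
      (fun a => ?_) (one_mul 1)
    · simp [qV_of]
    · simp [HopfAlgebra.antipode_mul_antidistrib, q0_of]
  have := Convolution.mul_grouplike (z := 1) (Boson.comul_of _ g) h1
    (G := toConv (L.qW he).toLinearMap) (s' := Q.inV L (Boson.of YV g)) (fun a => by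
      simp [qW_of]) hg a
  rw [mul_one] at this
  exact this

/-- The second and third factors kill everything of the form `v a`, so in the coproduct of `v` only
the term `v ⊗ 1` contributes. -/
lemma cleft_V_mul (i : I) (a : YU.Boson) :
    L.cleft he (L.jV he (Boson.ι YV (L.DV.b i)) * a) =
      Q.inV L (Boson.ι YV (L.DV.b i)) * L.cleft he a := by
  rw [jV_ι]
  have hΔ := Boson.comul_ι_b (L.DU he) (Sum.inl i)
  rw [DU_b_inl] at hΔ
  have hh : YU.IsHomog _ (e (L.DV.b i, 0)) := (isHomV he).isHomog (L.DV.homog i)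
  refine Convolution.mul_skewPrimitive hΔ (fun a => Convolution.mul_skewPrimitive hΔ
    (fun a => ?_) (fun a => ?_) a) (fun a => ?_) a
  · simp [qV_ι]
  · simp [HopfAlgebra.antipode_mul_antidistrib, Boson.antipode_ι YU hh, q0_ι]
  · simp [qW_ι]

/-- On `𝔅(W) ⋊ Γ` the projection to `𝔅(V) ⋊ Γ` factors through `k Γ`, so the first two convolution
factors are inverse to each other. -/
lemma cleft_W (c : YW.Boson) : L.cleft he (L.jW he c) = Q.inW L c := by
  let jW' : YW.Boson →ₗc[k] YU.Boson := L.jW he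
  have e1 : (L.qV he).comp (L.jW he : YW.Boson →ₐ[k] YU.Boson) =
      (L.q0 he).comp (L.jW he : YW.Boson →ₐ[k] YU.Boson) := by
    refine Boson.algHom_ext (fun v => ?_) (fun g => ?_)
    · change L.qV he (L.jW he _) = L.q0 he (L.jW he _)
      rw [jW_ι, qV_ι, q0_ι]; simp
    · change L.qV he (L.jW he _) = L.q0 he (L.jW he _)
      rw [jW_of, qV_of, q0_of]
  have e2 : (L.qW he).comp (L.jW he : YW.Boson →ₐ[k] YU.Boson) = Q.inW L := by
    refine Boson.algHom_ext (fun v => ?_) (fun g => ?_)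
    · change L.qW he (L.jW he _) = _
      rw [jW_ι, qW_ι]; simp
    · change L.qW he (L.jW he _) = _
      rw [jW_of, qW_of, (Q.isLink L).of_eq]
  have e3 : (toConv (L.qV he).toLinearMap *
      toConv ((L.q0 he).toLinearMap ∘ₗ HopfAlgebra.antipode k (A := YU.Boson))).ofConv ∘ₗ
        jW'.toLinearMap = (1 : WithConv (YW.Boson →ₗ[k] L.Q)).ofConv := by
    have h1 : (L.qV he).toLinearMap ∘ₗ jW'.toLinearMap =
        ((L.q0 he).comp (L.jW he : YW.Boson →ₐ[k] YU.Boson)).toLinearMap := by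
      rw [← e1]; rfl
    have h2 : ((L.q0 he).toLinearMap ∘ₗ HopfAlgebra.antipode k (A := YU.Boson)) ∘ₗ
        jW'.toLinearMap = ((L.q0 he).comp (L.jW he : YW.Boson →ₐ[k] YU.Boson)).toLinearMap ∘ₗ
          HopfAlgebra.antipode k :=
      LinearMap.ext fun x => congrArg (L.q0 he) (Convolution.map_antipode (L.jW he) x).symm
    rw [LinearMap.convMul_comp_coalgHom_distrib,
      ← (Convolution.isUnit_algHom ((L.q0 he).comp (L.jW he : YW.Boson →ₐ[k] YU.Boson))).1,
      WithConv.ofConv_toConv, WithConv.ofConv_toConv, h1, h2]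
  have e4 := LinearMap.convMul_comp_coalgHom_distrib (toConv (L.qV he).toLinearMap *
      toConv ((L.q0 he).toLinearMap ∘ₗ HopfAlgebra.antipode k (A := YU.Boson)))
      (toConv (L.qW he).toLinearMap) jW'
  rw [e3, WithConv.toConv_ofConv, one_mul] at e4
  have := congr($e4 c)
  refine this.trans ?_
  exact congr($e2 c)

lemma cleft_mul (b : YV.Boson) (c : YW.Boson) :
    L.cleft he (L.jV he b * L.jW he c) = Q.inV L b * Q.inW L c := by
  induction b using Boson.left_induction L.DV with
  | one => simp [cleft_W]
  | smul r x hx => simp only [map_smul, smul_mul_assoc, hx]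
  | add x y hx hy => simp only [map_add, add_mul, hx, hy]
  | mul i x hx =>
    rw [map_mul (L.jV he), mul_assoc, cleft_V_mul, hx, map_mul, mul_assoc]
  | of_mul g x hx =>
    rw [map_mul (L.jV he), jV_of, mul_assoc, cleft_of_mul, hx, map_mul, mul_assoc]

lemma cleft_one : L.cleft he 1 = 1 := by
  have := L.cleft_mul he 1 1
  simpa using this

lemma cleft_surjective : Function.Surjective (L.cleft he) := by
  intro x
  induction x using (Q.isLink L).induction Q.adjoin_eq_top with
  | add x y hx hy =>
    obtain ⟨a, rfl⟩ := hx
    obtain ⟨b, rfl⟩ := hy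
    exact ⟨a + b, map_add _ _ _⟩
  | mul b c => exact ⟨_, L.cleft_mul he b c⟩

/-- Normalizes the cocycle: the augmentation of `Q` restricts to the counit along the section. -/
lemma vacForm_cleft (a : YU.Boson) : Q.vacForm L (L.cleft he a) = Coalgebra.counit (R := k) a := by
  induction a using L.j_induction he with
  | add x y hx hy => simp only [map_add, hx, hy]
  | mul b c => rw [cleft_mul, Q.vacForm_mul, Bialgebra.counit_mul]; simp

/-- An algebra map out of `Q` given by the coproduct is compatible with maps out of
`𝔅(U) ⋊ Γ`. -/
lemma map_cleft {R R' : Type*} [Ring R] [Algebra k R] [Ring R'] [Algebra k R']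
    {p : YV.Boson →ₐ[k] R} {q : YW.Boson →ₐ[k] R} {p' : YV.Boson →ₐ[k] R'}
    {q' : YW.Boson →ₐ[k] R'} {j : YU.Boson →ₗ[k] R} {j' : YU.Boson →ₗ[k] R'}
    (hj : ∀ b c, j (L.jV he b * L.jW he c) = p b * q c)
    (hj' : ∀ b c, j' (L.jV he b * L.jW he c) = p' b * q' c)
    (h : L.IsLink 1 0 (IsLink.tensorHom p p') (IsLink.tensorHom q q')) (a : YU.Boson) :
    Q.lift h (L.cleft he a) = TensorProduct.map j j' (comul (R := k) a) := by
  induction a using L.j_induction he with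
  | add x y hx hy => simp only [map_add, hx, hy]
  | mul b c =>
    rw [cleft_mul, map_mul, Q.lift_inV, Q.lift_inW, Bialgebra.comul_mul,
      ← CoalgHomClass.map_comp_comul_apply, ← CoalgHomClass.map_comp_comul_apply]
    change Algebra.TensorProduct.map p p' (comul (R := k) b) *
      Algebra.TensorProduct.map q q' (comul (R := k) c) = _
    generalize comul (R := k) b = s
    generalize comul (R := k) c = t
    induction s with
    | zero => simp
    | add s s' hs hs' => simp only [map_add, add_mul, hs, hs']
    | tmul b b' =>
      induction t with
      | zero => simp
      | add s s' hs hs' => simp only [map_add, mul_add, hs, hs']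
      | tmul c c' => simp [hj, hj']

/-! ### The cocycle -/

/-- the coaction of `𝔅(U) ⋊ Γ` on `Q` -/
def coaction : L.Q →ₐ[k] L.Q ⊗[k] YU.Boson :=
  Q.lift ((Q.isLink L).tensor (L.isLink_j he))

/-- The coaction is built from coproducts on both factors, so it agrees with the coproduct of `b c`
on straightened products. -/
lemma coaction_cleft (a : YU.Boson) :
    L.coaction he (L.cleft he a) = (L.cleft he).rTensor _ (comul (R := k) a) := by
  have h := L.map_cleft he (p' := (L.jV he : YV.Boson →ₐ[k] YU.Boson))
    (q' := (L.jW he : YW.Boson →ₐ[k] YU.Boson)) (j' := LinearMap.id) (L.cleft_mul he)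
    (fun b c => by simp) ((Q.isLink L).tensor (L.isLink_j he)) a
  exact h

/-- `Q` as a cleft extension of `k` by `𝔅(U) ⋊ Γ`. -/
def cleftData : Convolution.Cleft k YU.Boson L.Q where
  φ := L.cleft he
  l := Q.vacForm L
  δ := L.coaction he
  φ_one := L.cleft_one he
  isUnit := L.isUnit_cleft he
  l_φ := L.vacForm_cleft he
  surjective := L.cleft_surjective he
  δ_φ := L.coaction_cleft he

section

variable {E : Type*} [Ring E] [Algebra k E] {p : YV.Boson →ₐ[k] E} {q : YW.Boson →ₐ[k] E}
  (h : L.IsLink 1 1 p q)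

/-- The linear map `𝔅(U) ⋊ Γ → E`, `b c ↦ p(b) q(c)`, for a pair of maps `p`, `q` that satisfies
the linking relations. -/
def descend : YU.Boson →ₗ[k] E :=
  (TensorProduct.rid k E).toLinearMap ∘ₗ (Q.vacForm L).lTensor E ∘ₗ
    (Q.lift (h.tensor (Q.isLink L))).toLinearMap ∘ₗ L.cleft he

/-- Straightened products go to `p(b₁) q(c₁) ⊗ b₂ c₂` in `E ⊗ Q`, and the vacuum form removes the
second tensorand by the counit law. The detour through `Q` is what makes this map on products well
defined. -/
lemma descend_mul (b : YV.Boson) (c : YW.Boson) :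
    L.descend he h (L.jV he b * L.jW he c) = p b * q c := by
  rw [descend, LinearMap.comp_apply, LinearMap.comp_apply, LinearMap.comp_apply, cleft_mul,
    AlgHom.toLinearMap_apply, map_mul, Q.lift_inV, Q.lift_inW]
  change TensorProduct.rid k E ((Q.vacForm L).lTensor E
    (Algebra.TensorProduct.map p (Q.inV L) (comul (R := k) b) *
      Algebra.TensorProduct.map q (Q.inW L) (comul (R := k) c))) = _
  have hb := congr(TensorProduct.rid k _ $(Coalgebra.lTensor_counit_comul (R := k) b))
  have hc := congr(TensorProduct.rid k _ $(Coalgebra.lTensor_counit_comul (R := k) c))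
  rw [TensorProduct.rid_tmul, one_smul] at hb hc
  conv_rhs => rw [← hb, ← hc]
  generalize comul (R := k) b = s
  generalize comul (R := k) c = t
  induction s with
  | zero => simp
  | add s s' hs hs' => simp only [map_add, add_mul, hs, hs']
  | tmul b b' =>
    induction t with
    | zero => simp
    | add s s' hs hs' => simp only [map_add, mul_add, hs, hs']
    | tmul c c' => simp [Q.vacForm_mul, smul_smul, mul_comm]

/-- An instance of `map_deformedMul`: the algebra map `Q → E ⊗ Q`, of composite type `(1, 1)(1, 0)`,
intertwines the section with the descended map. -/
lemma descend_deformedMul (a b : YU.Boson) :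
    L.descend he h (deformedMul (L.cleftData he).σ (a ⊗ₜ b)) =
      L.descend he h a * L.descend he h b :=
  (L.cleftData he).map_deformedMul (d := Q.lift (h.tensor (Q.isLink L)))
    (fun a => L.map_cleft he (L.descend_mul he h) (L.cleft_mul he) _ a) a b

end

end LinkData
end YetterDrinfeld

namespace YetterDrinfeld

variable {k Γ κ : Type*} [Field k] [CommGroup Γ]

/-- The standard basis of an object of diagonal type. -/
def diagBasis (χ : κ → (Γ →* kˣ)) (γ : κ → Γ) : (diag χ γ).DiagBasis κ where
  b := Finsupp.basisSingleOne
  χ := χ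
  γ := γ
  act_b g i := by simp
  homog i := by simpa using diag_isHomog χ γ i

@[simp] lemma diagBasis_b (χ : κ → (Γ →* kˣ)) (γ : κ → Γ) (i : κ) :
    (diagBasis χ γ).b i = Finsupp.single i 1 := by simp [diagBasis]

end YetterDrinfeld

namespace DoubleData

open YetterDrinfeld

variable {k F G I : Type*} [Field k] [CommGroup F] [CommGroup G] (D : DoubleData k F G I)

/-! ### Generators of the double -/

/-- the grouplikes `f g` of `𝒟` as a group homomorphism -/
def grpHom : F × G →* D.Double where
  toFun := D.grp
  map_one' := by simp [grp]
  map_mul' s t := by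
    have h := (Double.crossRel D).gf t.1 s.2
    simp only [grp, Prod.fst_mul, Prod.snd_mul, map_mul]
    rw [mul_assoc, mul_assoc, ← mul_assoc (Double.inH D _) (Double.inB D _), h]
    simp only [mul_assoc]

@[simp] lemma grpHom_apply (t : F × G) : D.grpHom t = D.grp t := rfl

lemma grp_mul (s t : F × G) : D.grp (s * t) = D.grp s * D.grp t := map_mul D.grpHom s t

@[simp] lemma grp_one : D.grp 1 = 1 := map_one D.grpHom

lemma grp_fst (f : F) : D.grp (f, 1) = Double.inB D (D.ofB f) := by simp [grp]

lemma grp_snd (g : G) : D.grp (1, g) = Double.inH D (D.ofH g) := by simp [grp]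

lemma grp_mk (f : F) (g : G) : D.grp (f, g) = Double.inB D (D.ofB f) * Double.inH D (D.ofH g) := rfl

lemma v_single (i : I) : D.v (Finsupp.single i 1) = Double.inB D (D.vB i) := rfl

lemma w_single (i : I) : D.w (Finsupp.single i 1) = Double.inH D (D.wH i) := rfl

lemma chi_apply (i : I) (t : F × G) : D.chi i t = D.τ₀ t.1 (D.g i) * D.τ₀ (D.f i) t.2 := rfl

/-- `F` acts on `v_i` through `ĝ_i` inside `B` and `G` through `f̂_i` by a cross relation; together
they give the character of `F × G`. -/
lemma grp_mul_v_single (t : F × G) (i : I) : D.grp t * D.v (Finsupp.single i 1) =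
    (D.chi i t : k) • (D.v (Finsupp.single i 1) * D.grp t) := by
  have h1 : D.ofB t.1 * D.vB i = (D.τ₀ t.1 (D.g i) : k) • (D.vB i * D.ofB t.1) := by
    have := Boson.of_mul_ι_b (diagBasis (fun i => D.τ₀.flip (D.g i)) D.f) t.1 i
    rwa [diagBasis_b] at this
  rw [v_single, grp, mul_assoc, (Double.crossRel D).gv, mul_smul_comm, ← mul_assoc, ← map_mul, h1,
    map_smul, smul_mul_assoc, smul_smul, map_mul, mul_assoc, chi_apply, Units.val_mul, mul_comm]

lemma grp_mul_w_single (t : F × G) (i : I) : D.grp t * D.w (Finsupp.single i 1) =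
    (((D.chi i)⁻¹ t : kˣ) : k) • (D.w (Finsupp.single i 1) * D.grp t) := by
  have h1 : D.ofH t.2 * D.wH i = ((D.τ₀ (D.f i) t.2)⁻¹ : kˣ).val • (D.wH i * D.ofH t.2) := by
    have := Boson.of_mul_ι_b (diagBasis (fun i => (D.τ₀ (D.f i))⁻¹) D.g) t.2 i
    rwa [diagBasis_b] at this
  have h2 : Double.inB D (D.ofB t.1) * Double.inH D (D.wH i) = ((D.τ₀ t.1 (D.g i))⁻¹ : kˣ).val •
      (Double.inH D (D.wH i) * Double.inB D (D.ofB t.1)) := by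
    rw [(Double.crossRel D).wf, smul_smul]
    simp
  rw [w_single, grp, mul_assoc, ← map_mul, h1, map_smul, mul_smul_comm, map_mul, ← mul_assoc, h2,
    smul_mul_assoc, smul_smul, mul_assoc, MonoidHom.inv_apply, chi_apply, mul_inv, Units.val_mul,
    mul_comm]

lemma comul_grp (t : F × G) : Coalgebra.comul (R := k) (D.grp t) = D.grp t ⊗ₜ D.grp t := by
  rw [grp, Bialgebra.comul_mul, Double.comul_inB, Double.comul_inH]
  simp

lemma counit_grp (t : F × G) : Coalgebra.counit (R := k) (D.grp t) = 1 := by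
  rw [grp, Bialgebra.counit_mul]
  simp

lemma comul_v_single (i : I) : Coalgebra.comul (R := k) (D.v (Finsupp.single i 1)) =
    D.v (Finsupp.single i 1) ⊗ₜ 1 + D.grp (D.f i, 1) ⊗ₜ D.v (Finsupp.single i 1) := by
  rw [v_single, Double.comul_inB, grp_fst]
  simp

lemma comul_w_single (i : I) : Coalgebra.comul (R := k) (D.w (Finsupp.single i 1)) =
    D.w (Finsupp.single i 1) ⊗ₜ 1 + D.grp (1, D.g i) ⊗ₜ D.w (Finsupp.single i 1) := by
  rw [w_single, Double.comul_inH, grp_snd]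
  simp

/-- `𝒟` is generated by `V`, `W` and `F × G`. -/
lemma adjoin_gen_eq_top : Algebra.adjoin k (Set.range (fun i => D.v (Finsupp.single i 1)) ∪
    Set.range (fun i => D.w (Finsupp.single i 1)) ∪ Set.range D.grp) = ⊤ := by
  set St := Algebra.adjoin k (Set.range (fun i => D.v (Finsupp.single i 1)) ∪
    Set.range (fun i => D.w (Finsupp.single i 1)) ∪ Set.range D.grp)
  have hv : ∀ x, D.v x ∈ St := by
    intro x
    induction x using Finsupp.induction_linear with
    | zero => simp
    | add x y hx hy => rw [map_add]; exact St.add_mem hx hy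
    | single i c =>
      rw [← Finsupp.smul_single_one, map_smul]
      exact St.smul_mem (Algebra.subset_adjoin (Or.inl (Or.inl ⟨i, rfl⟩))) _
  have hw : ∀ x, D.w x ∈ St := by
    intro x
    induction x using Finsupp.induction_linear with
    | zero => simp
    | add x y hx hy => rw [map_add]; exact St.add_mem hx hy
    | single i c =>
      rw [← Finsupp.smul_single_one, map_smul]
      exact St.smul_mem (Algebra.subset_adjoin (Or.inl (Or.inr ⟨i, rfl⟩))) _
  have hg : ∀ t, D.grp t ∈ St := fun t => Algebra.subset_adjoin (Or.inr ⟨t, rfl⟩)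
  have hB : St.comap (Double.inB D) = ⊤ := by
    rw [eq_top_iff, ← Boson.adjoin_eq_top D.V, Algebra.adjoin_le_iff]
    rintro _ (⟨x, rfl⟩ | ⟨f, rfl⟩)
    · exact hv x
    · have := hg (f, 1)
      rwa [grp_fst] at this
  have hH : St.comap (Double.inH D) = ⊤ := by
    rw [eq_top_iff, ← Boson.adjoin_eq_top D.W, Algebra.adjoin_le_iff]
    rintro _ (⟨x, rfl⟩ | ⟨f, rfl⟩)
    · exact hw x
    · have := hg (1, f)
      rwa [grp_snd] at this
  rw [eq_top_iff, ← Double.adjoin_eq_top D, Algebra.adjoin_le_iff]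
  rintro _ (⟨x, rfl⟩ | ⟨x, rfl⟩)
  · have : x ∈ St.comap (Double.inB D) := hB ▸ Algebra.mem_top
    exact this
  · have : x ∈ St.comap (Double.inH D) := hH ▸ Algebra.mem_top
    exact this

/-! ### The linking data of the double over a quotient of `F × G` -/

section Quotient

variable (T : Subgroup (F × G)) (hT : T ≤ D.C)

@[simp] lemma chiBar_mk (i : I) (t : F × G) :
    D.chiBar T hT i (QuotientGroup.mk t) = D.chi i t := rfl

variable {S : Type*} (s : S → I)

/-- the object `⨁ⱼ (k v_{s j}; χ_{s j}, f_{s j})` over `Γ` -/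
def subV : YetterDrinfeld k ((F × G) ⧸ T) (S →₀ k) :=
  .diag (fun j => D.chiBar T hT (s j)) (fun j => QuotientGroup.mk (D.f (s j), 1))

/-- the object `⨁ⱼ (k w_{s j}; χ_{s j}⁻¹, g_{s j})` over `Γ` -/
def subW : YetterDrinfeld k ((F × G) ⧸ T) (S →₀ k) :=
  .diag (fun j => (D.chiBar T hT (s j))⁻¹) (fun j => QuotientGroup.mk (1, D.g (s j)))

end Quotient

end DoubleData

/-! ### Linked pairs obtained from algebra maps out of `𝒟`. -/

namespace DoubleData

open YetterDrinfeld

variable {k F G I : Type*} [Field k] [CommGroup F] [CommGroup G] (D : DoubleData k F G I)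
  (T : Subgroup (F × G)) (hT : T ≤ D.C) {S J : Type*} (r : J → I) (s : S → I)

/-- the diagonal basis of `subV` -/
def basisV : (D.subV T hT r).DiagBasis J := diagBasis _ _

/-- the diagonal basis of `subW` -/
def basisW : (D.subW T hT s).DiagBasis S := diagBasis _ _

@[simp] lemma basisV_b (i : J) : (D.basisV T hT r).b i = Finsupp.single i 1 := diagBasis_b _ _ i

@[simp] lemma basisW_b (i : S) : (D.basisW T hT s).b i = Finsupp.single i 1 := diagBasis_b _ _ i

@[simp] lemma basisV_χ (i : J) (t : F × G) :
    (D.basisV T hT r).χ i (QuotientGroup.mk t) = D.chi (r i) t := rfl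

@[simp] lemma basisW_χ (i : S) (t : F × G) :
    (D.basisW T hT s).χ i (QuotientGroup.mk t) = (D.chi (s i) t)⁻¹ := rfl

@[simp] lemma basisV_γ (i : J) : (D.basisV T hT r).γ i = QuotientGroup.mk (D.f (r i), 1) := rfl

@[simp] lemma basisW_γ (i : S) : (D.basisW T hT s).γ i = QuotientGroup.mk (1, D.g (s i)) := rfl

/-- the diagonal basis of `V` -/
def basisDV : D.V.DiagBasis I := diagBasis _ _

/-- the diagonal basis of `W` -/
def basisDW : D.W.DiagBasis I := diagBasis _ _

/-- The linking data given by the relations of `𝒟`. -/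
def linkData (u : S → J) (hu : ∀ j, r (u j) = s j) :
    LinkData (D.subV T hT r) (D.subW T hT s) J S where
  DV := D.basisV T hT r
  DW := D.basisW T hT s
  s := u
  -- The linking term of `𝒟` is `f g - 1`, while a linked pair of type `(1, 1)` has `β (1 - g f)`.
  β _ := -1
  braid i j := by
    rw [basisV_γ, basisW_γ, basisV_χ, basisW_χ, ← Units.val_mul, chi_apply, chi_apply]
    simp
  inv j _ := by
    refine MonoidHom.ext fun t => ?_
    induction t using QuotientGroup.induction_on with
    | H t => rw [MonoidHom.inv_apply, basisV_χ, basisW_χ, hu]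

section Out

variable {E : Type*} [Ring E] [Algebra k E] (p : D.Double →ₐ[k] E) (hp : ∀ t ∈ T, p (D.grp t) = 1)

/-- the map `Γ → E` induced by an algebra map `𝒟 → E` -/
def mapΓ : (F × G) ⧸ T →* E :=
  QuotientGroup.lift T ((p : D.Double →* E).comp D.grpHom) fun t ht => hp t ht

@[simp] lemma mapΓ_mk (t : F × G) : D.mapΓ T p hp (QuotientGroup.mk t) = p (D.grp t) := rfl

/-- Over `F` and over `Γ` the object has the same braiding, because the second factor of the
character of `F × G` is trivial at `(f, 1)`. -/
lemma isBraidedMapV : IsBraidedMap (D.basisV T hT r) D.V (Finsupp.lmapDomain k k r) := by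
  refine fun j => Or.inr ⟨D.f (r j), ?_, ?_⟩
  · rw [basisV_b, Finsupp.lmapDomain_apply, Finsupp.mapDomain_single]
    exact diag_isHomog _ _ _
  · ext i : 2
    simp [V, subV, chi_apply]

lemma isBraidedMapW : IsBraidedMap (D.basisW T hT s) D.W (Finsupp.lmapDomain k k s) := by
  refine fun j => Or.inr ⟨D.g (s j), ?_, ?_⟩
  · rw [basisW_b, Finsupp.lmapDomain_apply, Finsupp.mapDomain_single]
    exact diag_isHomog _ _ _
  · ext i : 2
    simp [W, subW, chi_apply]

/-- The map `𝔅(V) ⋊ Γ → E` induced by an algebra map `𝒟 → E`. -/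
def fromV : (D.subV T hT r).Boson →ₐ[k] E :=
  Boson.lift ((p.comp ((Double.inB D).comp (Boson.inc D.V))).comp
    (Nichols.map (D.isBraidedMapV T hT r) D.basisDV)) (D.mapΓ T p hp) (fun t x => by
    induction t using QuotientGroup.induction_on with
    | H t =>
      have h1 : ∀ x, ((p.comp ((Double.inB D).comp (Boson.inc D.V))).comp
          (Nichols.map (D.isBraidedMapV T hT r) D.basisDV)) (Nichols.mk _ (TensorAlgebra.ι k x)) =
            p (D.v (Finsupp.lmapDomain k k r x)) := fun x => by
        rw [AlgHom.comp_apply, Nichols.map_mk, mapT_ι]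
        rfl
      simp only [h1, mapΓ_mk]
      induction x using Finsupp.induction_linear with
      | zero => simp
      | add x y hx hy => simp only [map_add, add_mul, mul_add, hx, hy]
      | single i c =>
        rw [← Finsupp.smul_single_one]
        simp only [map_smul, smul_mul_assoc, mul_smul_comm]
        congr 1
        rw [subV, diag_act_single, map_smul, Finsupp.lmapDomain_apply, Finsupp.mapDomain_single,
          ← map_mul p, ← map_mul p, grp_mul_v_single, map_smul, smul_mul_assoc]
        rfl)

/-- The map `𝔅(W) ⋊ Γ → E` induced by an algebra map `𝒟 → E`. -/
def fromW : (D.subW T hT s).Boson →ₐ[k] E :=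
  Boson.lift ((p.comp ((Double.inH D).comp (Boson.inc D.W))).comp
    (Nichols.map (D.isBraidedMapW T hT s) D.basisDW)) (D.mapΓ T p hp) (fun t x => by
    induction t using QuotientGroup.induction_on with
    | H t =>
      have h1 : ∀ x, ((p.comp ((Double.inH D).comp (Boson.inc D.W))).comp
          (Nichols.map (D.isBraidedMapW T hT s) D.basisDW)) (Nichols.mk _ (TensorAlgebra.ι k x)) =
            p (D.w (Finsupp.lmapDomain k k s x)) := fun x => by
        rw [AlgHom.comp_apply, Nichols.map_mk, mapT_ι]
        rfl
      simp only [h1, mapΓ_mk]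
      induction x using Finsupp.induction_linear with
      | zero => simp
      | add x y hx hy => simp only [map_add, add_mul, mul_add, hx, hy]
      | single i c =>
        rw [← Finsupp.smul_single_one]
        simp only [map_smul, smul_mul_assoc, mul_smul_comm]
        congr 1
        rw [subW, diag_act_single, map_smul, Finsupp.lmapDomain_apply, Finsupp.mapDomain_single,
          ← map_mul p, ← map_mul p, grp_mul_w_single, map_smul, smul_mul_assoc]
        rfl)

@[simp] lemma fromV_of (t : F × G) :
    D.fromV T hT r p hp (Boson.of _ (QuotientGroup.mk t)) = p (D.grp t) := by
  simp [fromV]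

@[simp] lemma fromW_of (t : F × G) :
    D.fromW T hT s p hp (Boson.of _ (QuotientGroup.mk t)) = p (D.grp t) := by
  simp [fromW]

@[simp] lemma fromV_ι (x : J →₀ k) :
    D.fromV T hT r p hp (Boson.ι _ x) = p (D.v (Finsupp.lmapDomain k k r x)) := by
  rw [fromV, Boson.lift_ι, AlgHom.comp_apply, Nichols.map_mk, mapT_ι]
  rfl

@[simp] lemma fromW_ι (x : S →₀ k) :
    D.fromW T hT s p hp (Boson.ι _ x) = p (D.w (Finsupp.lmapDomain k k s x)) := by
  rw [fromW, Boson.lift_ι, AlgHom.comp_apply, Nichols.map_mk, mapT_ι]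
  rfl

/-- Injectivity of `r` ensures that distinct indices of the subfamily stay distinct in `I`, so that
unlinked pairs remain unlinked. -/
lemma isLink_from (hr : Function.Injective r) (u : S → J) (hu : ∀ j, r (u j) = s j) :
    (D.linkData T hT r s u hu).IsLink 1 1 (D.fromV T hT r p hp) (D.fromW T hT s p hp) where
  of_eq t := by
    induction t using QuotientGroup.induction_on with
    | H t => rw [fromV_of, fromW_of]
  link i j := by
    classical
    change D.fromW T hT s p hp (Boson.ι _ ((D.basisW T hT s).b j)) *
      D.fromV T hT r p hp (Boson.ι _ ((D.basisV T hT r).b i)) = (D.chi (r i) (1, D.g (s j)) : k) •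
      (D.fromV T hT r p hp (Boson.ι _ ((D.basisV T hT r).b i)) *
        D.fromW T hT s p hp (Boson.ι _ ((D.basisW T hT s).b j))) +
      Finsupp.single (u j) (-1 : k) i • ((1 : k) • 1 - (1 : k) • D.fromV T hT r p hp (Boson.of _
        (QuotientGroup.mk ((1, D.g (s j)) * (D.f (r i), 1)))))
    rw [basisV_b, basisW_b, fromV_ι, fromW_ι, fromV_of, Finsupp.lmapDomain_apply,
      Finsupp.lmapDomain_apply, Finsupp.mapDomain_single, Finsupp.mapDomain_single, ← map_mul,
      ← map_mul, v_single, w_single]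
    have hχ : D.chi (r i) (1, D.g (s j)) = D.τ₀ (D.f (r i)) (D.g (s j)) := by simp [chi_apply]
    rw [hχ]
    by_cases h : u j = i
    · have h' : s j = r i := by rw [← hu, h]
      rw [h', (Double.crossRel D).wv_eq]
      simp [h, grp_mk]
    · have h' : r i ≠ s j := by
        rw [← hu]
        exact fun h' => h (hr h').symm
      rw [(Double.crossRel D).wv_ne _ _ h']
      simp [h]

/-- The family `s` may miss some `w_i`; for these the hypothesis `hW` says that their images are
generated by the others and by `V`. -/
lemma adjoin_from (hV : Function.Surjective r)
    (hpsurj : Function.Surjective p)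
    (hW : ∀ x, p (D.w x) ∈ Algebra.adjoin k (Set.range (D.fromV T hT r p hp) ∪
      Set.range (D.fromW T hT s p hp))) :
    Algebra.adjoin k (Set.range (D.fromV T hT r p hp) ∪ Set.range (D.fromW T hT s p hp)) = ⊤ := by
  set St := Algebra.adjoin k (Set.range (D.fromV T hT r p hp) ∪ Set.range (D.fromW T hT s p hp))
  have h1 : St.comap p = ⊤ := by
    rw [eq_top_iff, ← D.adjoin_gen_eq_top, Algebra.adjoin_le_iff]
    rintro _ ((⟨i, rfl⟩ | ⟨i, rfl⟩) | ⟨t, rfl⟩)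
    · obtain ⟨j, rfl⟩ := hV i
      refine Algebra.subset_adjoin (Or.inl ⟨Boson.ι _ (Finsupp.single j 1), ?_⟩)
      simp
    · exact hW _
    · exact Algebra.subset_adjoin (Or.inl ⟨_, D.fromV_of T hT r p hp t⟩)
  rw [eq_top_iff]
  rintro x -
  obtain ⟨x, rfl⟩ := hpsurj x
  have : x ∈ St.comap p := h1 ▸ Algebra.mem_top
  exact this

end Out

section Bialgebra

variable {E : Type*} [Ring E] [Bialgebra k E] (p : D.Double →ₐ[k] E) (hp : ∀ t ∈ T, p (D.grp t) = 1)
  (hΔ : ∀ x, Coalgebra.comul (R := k) (p x) =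
    Algebra.TensorProduct.map p p (Coalgebra.comul (R := k) x))

include hΔ

lemma comul_fromV (x : (D.subV T hT r).Boson) :
    Coalgebra.comul (R := k) (D.fromV T hT r p hp x) =
      Algebra.TensorProduct.map (D.fromV T hT r p hp) (D.fromV T hT r p hp)
        (Coalgebra.comul (R := k) x) := by
  have h : (Bialgebra.comulAlgHom k E).comp (D.fromV T hT r p hp) =
      (Algebra.TensorProduct.map (D.fromV T hT r p hp) (D.fromV T hT r p hp)).comp
        (Bialgebra.comulAlgHom k _) := by
    refine Boson.algHom_ext (fun x => ?_) (fun t => ?_)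
    · induction x using Finsupp.induction_linear with
      | zero => simp
      | add x y hx hy => simp only [map_add, hx, hy]
      | single i c =>
        rw [← Finsupp.smul_single_one]
        simp only [map_smul]
        congr 1
        have h1 := Boson.comul_ι_b (D.basisV T hT r) i
        rw [basisV_b] at h1
        simp only [AlgHom.comp_apply, Bialgebra.comulAlgHom_apply, h1, map_add,
          Algebra.TensorProduct.map_tmul, basisV_γ, fromV_of, fromV_ι, map_one]
        rw [Finsupp.lmapDomain_apply, Finsupp.mapDomain_single]
        rw [hΔ, comul_v_single]
        simp
    · induction t using QuotientGroup.induction_on with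
      | H t =>
        simp only [AlgHom.comp_apply, Bialgebra.comulAlgHom_apply, Boson.comul_of,
          Algebra.TensorProduct.map_tmul, fromV_of]
        rw [hΔ, comul_grp]
        simp
  exact congr($h x)

lemma comul_fromW (x : (D.subW T hT s).Boson) :
    Coalgebra.comul (R := k) (D.fromW T hT s p hp x) =
      Algebra.TensorProduct.map (D.fromW T hT s p hp) (D.fromW T hT s p hp)
        (Coalgebra.comul (R := k) x) := by
  have h : (Bialgebra.comulAlgHom k E).comp (D.fromW T hT s p hp) =
      (Algebra.TensorProduct.map (D.fromW T hT s p hp) (D.fromW T hT s p hp)).comp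
        (Bialgebra.comulAlgHom k _) := by
    refine Boson.algHom_ext (fun x => ?_) (fun t => ?_)
    · induction x using Finsupp.induction_linear with
      | zero => simp
      | add x y hx hy => simp only [map_add, hx, hy]
      | single i c =>
        rw [← Finsupp.smul_single_one]
        simp only [map_smul]
        congr 1
        have h1 := Boson.comul_ι_b (D.basisW T hT s) i
        rw [basisW_b] at h1
        simp only [AlgHom.comp_apply, Bialgebra.comulAlgHom_apply, h1, map_add,
          Algebra.TensorProduct.map_tmul, basisW_γ, fromW_of, fromW_ι, map_one]
        rw [Finsupp.lmapDomain_apply, Finsupp.mapDomain_single]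
        rw [hΔ, comul_w_single]
        simp
    · induction t using QuotientGroup.induction_on with
      | H t =>
        simp only [AlgHom.comp_apply, Bialgebra.comulAlgHom_apply, Boson.comul_of,
          Algebra.TensorProduct.map_tmul, fromW_of]
        rw [hΔ, comul_grp]
        simp
  exact congr($h x)

end Bialgebra

end DoubleData

namespace YetterDrinfeld

lemma IsHom.prodMap {k Γ M N M' N' : Type*} [Field k] [CommGroup Γ] [AddCommGroup M] [Module k M]
    [AddCommGroup N] [Module k N] [AddCommGroup M'] [Module k M'] [AddCommGroup N'] [Module k N']
    {Y : YetterDrinfeld k Γ M} {Z : YetterDrinfeld k Γ N} {Y' : YetterDrinfeld k Γ M'}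
    {Z' : YetterDrinfeld k Γ N'} {f : M →ₗ[k] M'} {g : N →ₗ[k] N'} (hf : Y.IsHom Y' f)
    (hg : Z.IsHom Z' g) : (Y.prod Z).IsHom (Y'.prod Z') (LinearMap.prodMap f g) where
  act a := by
    refine LinearMap.ext fun x => Prod.ext ?_ ?_
    · exact congr($(hf.act a) x.1)
    · exact congr($(hg.act a) x.2)
  coact := by
    refine LinearMap.prod_ext ?_ ?_
    · have e : LinearMap.prodMap f g ∘ₗ LinearMap.inl k M N = LinearMap.inl k M' N' ∘ₗ f := by
        ext <;> simp
      rw [LinearMap.comp_assoc, LinearMap.comp_assoc, isHom_inl.coact,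
        ← LinearMap.comp_assoc Y.coact, ← LinearMap.lTensor_comp, e, LinearMap.lTensor_comp,
        LinearMap.comp_assoc,
        ← hf.coact, ← LinearMap.comp_assoc, isHom_inl.coact, LinearMap.comp_assoc]
    · have e : LinearMap.prodMap f g ∘ₗ LinearMap.inr k M N = LinearMap.inr k M' N' ∘ₗ g := by
        ext <;> simp
      rw [LinearMap.comp_assoc, LinearMap.comp_assoc, isHom_inr.coact,
        ← LinearMap.comp_assoc Z.coact, ← LinearMap.lTensor_comp, e, LinearMap.lTensor_comp,
        LinearMap.comp_assoc,
        ← hg.coact, ← LinearMap.comp_assoc, isHom_inr.coact, LinearMap.comp_assoc]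

end YetterDrinfeld

/-! ### The comparison map from `𝔅(U) ⋊ Γ` to quotients of `𝒟`. -/

namespace DoubleData
namespace ThinData

open YetterDrinfeld

variable {k F G I : Type*} [Field k] [CommGroup F] [CommGroup G] {D : DoubleData k F G I}
  (P : D.ThinData)

/-! ### A decomposition `U ≅ V ⊕ W'` -/

/-- The classes of the `w_i` span `W / ζ(Z)`, so some of them form a basis. Choosing the complement
among standard basis vectors keeps it of diagonal type. -/
lemma exists_basis : ∃ S : Set I,
    (∀ x : S →₀ k, Finsupp.lmapDomain k k Subtype.val x ∈ LinearMap.range P.ζ → x = 0) ∧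
    ∀ w, ∃ (x : S →₀ k) (z : P.Z), w = Finsupp.lmapDomain k k Subtype.val x + P.ζ z := by
  let N := LinearMap.range P.ζ
  let b : I → (I →₀ k) ⧸ N := fun i => N.mkQ (Finsupp.single i 1)
  obtain ⟨S, -, -, h1, h2⟩ := exists_linearIndepOn_extension (K := k) (v := b)
    (linearIndepOn_empty k b) (Set.subset_univ ∅)
  have key : ∀ x : S →₀ k, N.mkQ (Finsupp.lmapDomain k k Subtype.val x) =
      Finsupp.linearCombination k (fun j : S => b j) x := by
    intro x
    induction x using Finsupp.induction_linear with
    | zero => simp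
    | add x y hx hy => simp only [map_add, hx, hy]
    | single i c =>
      rw [← Finsupp.smul_single_one]
      simp only [map_smul]
      congr 1
      simp [b]
  refine ⟨S, fun x hx => ?_, fun w => ?_⟩
  · have h3 : N.mkQ (Finsupp.lmapDomain k k Subtype.val x) = 0 := by
      rwa [Submodule.mkQ_apply, Submodule.Quotient.mk_eq_zero]
    rw [key] at h3
    exact (linearIndependent_iff.1 h2) x h3
  · have h3 : ∀ w, N.mkQ w ∈ Submodule.span k (b '' S) := by
      intro w
      induction w using Finsupp.induction_linear with
      | zero => simp
      | add x y hx hy => rw [map_add]; exact add_mem hx hy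
      | single i c =>
        rw [← Finsupp.smul_single_one, map_smul]
        exact Submodule.smul_mem _ _ (h1 ⟨i, trivial, rfl⟩)
    have h4 := h3 w
    rw [Set.image_eq_range, ← Finsupp.range_linearCombination] at h4
    obtain ⟨x, hx⟩ := h4
    have h5 : N.mkQ (w - Finsupp.lmapDomain k k Subtype.val x) = 0 := by
      rw [map_sub, key, hx, sub_self]
    rw [Submodule.mkQ_apply, Submodule.Quotient.mk_eq_zero] at h5
    obtain ⟨z, hz⟩ := h5
    exact ⟨x, z, by rw [hz]; abel⟩

/-- A set of indices such that the vectors `w_j` for `j` in it form a basis of `W / ζ(Z)`. -/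
def S : Set I := P.exists_basis.choose

/-- the index of a basis vector of `W / ζ(Z)` -/
def incS : P.S → I := Subtype.val

/-- the complement of `ζ(Z)` in `W` -/
def inclW : (P.S →₀ k) →ₗ[k] (I →₀ k) := Finsupp.lmapDomain k k P.incS

lemma inclW_mem {x : P.S →₀ k} (hx : P.inclW x ∈ LinearMap.range P.ζ) : x = 0 :=
  P.exists_basis.choose_spec.1 x hx

lemma exists_inclW (w : I →₀ k) : ∃ x z, w = P.inclW x + P.ζ z :=
  P.exists_basis.choose_spec.2 w

/-- the map `V ⊕ W' → U` -/
def preEquiv : (I →₀ k) × (P.S →₀ k) →ₗ[k] ((I →₀ k) × (I →₀ k)) ⧸ P.K :=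
  P.K.mkQ ∘ₗ LinearMap.prodMap LinearMap.id P.inclW

lemma preEquiv_apply (v : I →₀ k) (x : P.S →₀ k) :
    P.preEquiv (v, x) = P.K.mkQ (v, P.inclW x) := rfl

/-- Modulo `z - ζ(z)`, the part of a vector of `W` in `ζ(Z)` moves over to `V`. Nothing else is
identified: a relation whose `W`-part lies in the complement has `ζ(z) = 0`, hence `z = 0`. -/
lemma preEquiv_bijective : Function.Bijective P.preEquiv := by
  constructor
  · rw [injective_iff_map_eq_zero]
    rintro ⟨v, x⟩ h
    rw [preEquiv_apply, Submodule.mkQ_apply, Submodule.Quotient.mk_eq_zero] at h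
    obtain ⟨z, hz⟩ := h
    replace hz : (z : I →₀ k) = v ∧ (-P.ζ) z = P.inclW x := Prod.mk.inj hz
    have hx : x = 0 := P.inclW_mem ⟨-z, (P.ζ.map_neg z).trans hz.2⟩
    subst hx
    have h2 : P.ζ z = 0 := by
      have := hz.2
      rwa [map_zero, LinearMap.neg_apply, neg_eq_zero] at this
    have h3 : z = 0 := P.ζ_injective (h2.trans (map_zero _).symm)
    rw [← hz.1, h3]
    simp
  · intro u
    obtain ⟨⟨v, w⟩, rfl⟩ := P.K.mkQ_surjective u
    obtain ⟨x, z, rfl⟩ := P.exists_inclW w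
    refine ⟨(v + z, x), ?_⟩
    rw [preEquiv_apply, ← sub_eq_zero, ← map_sub, Submodule.mkQ_apply,
      Submodule.Quotient.mk_eq_zero]
    exact ⟨z, by simp⟩

/-- The isomorphism `V ⊕ W' ≅ U`. -/
def equiv : ((I →₀ k) × (P.S →₀ k)) ≃ₗ[k] ((I →₀ k) × (I →₀ k)) ⧸ P.K :=
  LinearEquiv.ofBijective P.preEquiv P.preEquiv_bijective

lemma equiv_apply (v : I →₀ k) (x : P.S →₀ k) : P.equiv (v, x) = P.K.mkQ (v, P.inclW x) := rfl

lemma isHom_mkQ : P.VW.IsHom P.U P.K.mkQ where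
  act g := by ext <;> rfl
  coact := LinearMap.ext fun _ => rfl

lemma isHom_inclW : (D.subW P.T P.T_le P.incS).IsHom (D.WΓ P.T P.T_le) P.inclW where
  act g := by
    ext i : 2
    simp [inclW, subW, WΓ]
  coact := by
    ext i : 2
    simp [inclW, subW, WΓ, diag]

lemma isHom_equiv : ((D.subV P.T P.T_le id).prod (D.subW P.T P.T_le P.incS)).IsHom P.U
    P.equiv.toLinearMap := by
  have h : (D.subV P.T P.T_le id).IsHom (D.VΓ P.T P.T_le) LinearMap.id :=
    ⟨fun g => rfl, by rw [LinearMap.lTensor_id]; rfl⟩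
  exact P.isHom_mkQ.comp (h.prodMap P.isHom_inclW)

/-! ### The map from `𝔅(U) ⋊ Γ` to a quotient of `𝒟` -/

/-- The linking data of `V` and the complement of `ζ(Z)` in `W`. -/
def link : LinkData (D.subV P.T P.T_le id) (D.subW P.T P.T_le P.incS) I P.S :=
  D.linkData P.T P.T_le id P.incS P.incS fun _ => rfl

/-- The cocycle of `𝒜(T, Z, ζ)`. -/
def σ : (WithConv (P.U.Boson ⊗[k] P.U.Boson →ₗ[k] k))ˣ := (P.link.cleftData P.isHom_equiv).σ

lemma isTwoCocycle_σ : IsTwoCocycle P.σ := (P.link.cleftData P.isHom_equiv).isTwoCocycle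

section

variable {E : Type*} [Ring E] [Algebra k E] (p : D.Double →ₐ[k] E)
  (hp : ∀ t ∈ P.T, p (D.grp t) = 1)

/-- The linear map `𝔅(U) ⋊ Γ → E` induced by an algebra map `𝒟 → E`. -/
def toQuot : P.U.Boson →ₗ[k] E :=
  P.link.descend P.isHom_equiv
    (D.isLink_from P.T P.T_le id P.incS p hp Function.injective_id P.incS fun _ => rfl)

lemma toQuot_mul (b c) :
    P.toQuot p hp (P.link.jV P.isHom_equiv b * P.link.jW P.isHom_equiv c) =
      D.fromV P.T P.T_le id p hp b * D.fromW P.T P.T_le P.incS p hp c :=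
  P.link.descend_mul P.isHom_equiv _ b c

lemma toQuot_deformedMul (a b) :
    P.toQuot p hp (deformedMul P.σ (a ⊗ₜ b)) = P.toQuot p hp a * P.toQuot p hp b :=
  P.link.descend_deformedMul P.isHom_equiv _ a b

lemma toQuot_ofU (t : F × G) : P.toQuot p hp (P.ofU t) = p (D.grp t) := by
  have h := P.toQuot_mul p hp (Boson.of _ (QuotientGroup.mk t)) 1
  rw [map_one, map_one, mul_one, mul_one, LinkData.jV_of, fromV_of] at h
  exact h

lemma toQuot_one : P.toQuot p hp 1 = 1 := by
  have h := P.toQuot_mul p hp 1 1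
  simpa only [map_one, mul_one] using h

variable (hz : ∀ z, p (D.v (z : P.Z)) = p (D.w (P.ζ z)))

include hz in
-- By construction the map is known on `V` and on the complement only; the relations `z = ζ(z)` in
-- `E` extend the formula to all of `U`.
lemma toQuot_ι_mul_of (v w : I →₀ k) (t : F × G) :
    P.toQuot p hp (Boson.ι P.U (P.K.mkQ (v, w)) * P.ofU t) =
      (p (D.v v) + p (D.w w)) * p (D.grp t) := by
  have h1 : ∀ v, P.toQuot p hp (Boson.ι P.U (P.equiv (v, 0)) * P.ofU t) =
      p (D.v v) * p (D.grp t) := by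
    intro v
    have h := P.toQuot_mul p hp (Boson.ι _ v * Boson.of _ (QuotientGroup.mk t)) 1
    rw [map_one, map_one, mul_one, mul_one, map_mul (P.link.jV _), LinkData.jV_ι, LinkData.jV_of,
      map_mul (D.fromV _ _ _ _ _), fromV_of, fromV_ι, Finsupp.lmapDomain_id] at h
    exact h
  have h2 : ∀ x, P.toQuot p hp (Boson.ι P.U (P.equiv (0, x)) * P.ofU t) =
      p (D.w (P.inclW x)) * p (D.grp t) := by
    intro x
    have h := P.toQuot_mul p hp 1 (Boson.ι _ x * Boson.of _ (QuotientGroup.mk t))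
    rw [map_one, map_one, one_mul, one_mul, map_mul (P.link.jW _), LinkData.jW_ι, LinkData.jW_of,
      map_mul (D.fromW _ _ _ _ _), fromW_of, fromW_ι] at h
    exact h
  obtain ⟨x, z, rfl⟩ := P.exists_inclW w
  have e : P.K.mkQ (v, P.inclW x + P.ζ z) = P.equiv (v + z, 0) + P.equiv (0, x) := by
    rw [← map_add, Prod.mk_add_mk, add_zero, zero_add, equiv_apply, ← sub_eq_zero, ← map_sub,
      Submodule.mkQ_apply, Submodule.Quotient.mk_eq_zero]
    exact ⟨-z, Prod.ext (by simp) (by simp [P.ζ.map_neg z])⟩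
  rw [e, map_add, add_mul, map_add, h1, h2, map_add, map_add, map_add, map_add, hz, ← add_mul]
  congr 1
  abel

include hz in
lemma toQuot_vU (v : I →₀ k) : P.toQuot p hp (P.vU v) = p (D.v v) := by
  have h := P.toQuot_ι_mul_of p hp hz v 0 1
  simpa [ofU, vU] using h

include hz in
lemma toQuot_wU (w : I →₀ k) : P.toQuot p hp (P.wU w) = p (D.w w) := by
  have h := P.toQuot_ι_mul_of p hp hz 0 w 1
  simpa [ofU, wU] using h

include hz in
-- The target is spanned by straightened products. It suffices that the images of `V`, `W'` and `Γ`
-- generate it, and `ζ(Z)` has the same image as `Z`.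
lemma toQuot_surjective (hs : Function.Surjective p) : Function.Surjective (P.toQuot p hp) := by
  intro y
  have hgen := D.adjoin_from P.T P.T_le id P.incS p hp Function.surjective_id hs (fun w => by
    set St := Algebra.adjoin k (Set.range (D.fromV P.T P.T_le id p hp) ∪
      Set.range (D.fromW P.T P.T_le P.incS p hp))
    obtain ⟨x, z, rfl⟩ := P.exists_inclW w
    rw [map_add, map_add, ← hz]
    refine St.add_mem (Algebra.subset_adjoin (Or.inr ⟨_, D.fromW_ι P.T P.T_le P.incS p hp x⟩))
      (Algebra.subset_adjoin (Or.inl ⟨Boson.ι _ z, ?_⟩))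
    rw [fromV_ι, Finsupp.lmapDomain_id]
    rfl)
  induction y using (D.isLink_from P.T P.T_le id P.incS p hp Function.injective_id P.incS
    fun _ => rfl).induction hgen with
  | add x y hx hy =>
    obtain ⟨a, rfl⟩ := hx
    obtain ⟨b, rfl⟩ := hy
    exact ⟨a + b, map_add _ _ _⟩
  | mul b c => exact ⟨_, P.toQuot_mul p hp b c⟩

end

section Bialgebra

variable {E : Type*} [Ring E] [Bialgebra k E] (p : D.Double →ₐ[k] E)
  (hp : ∀ t ∈ P.T, p (D.grp t) = 1) (hΔ : ∀ x, Coalgebra.comul (R := k) (p x) =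
    Algebra.TensorProduct.map p p (Coalgebra.comul (R := k) x))

include hΔ in
-- Both sides are compared on the products `b c`; the two maps out of the bosonizations are
-- compatible with coproducts.
lemma comul_toQuot (x : P.U.Boson) :
    TensorProduct.map (P.toQuot p hp) (P.toQuot p hp) (Coalgebra.comul (R := k) x) =
      Coalgebra.comul (R := k) (P.toQuot p hp x) := by
  induction x using P.link.j_induction P.isHom_equiv with
  | add x y hx hy => simp only [map_add, hx, hy]
  | mul b c =>
    rw [toQuot_mul, Bialgebra.comul_mul, Bialgebra.comul_mul, D.comul_fromV P.T P.T_le id p hp hΔ,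
      D.comul_fromW P.T P.T_le P.incS p hp hΔ, ← CoalgHomClass.map_comp_comul_apply,
      ← CoalgHomClass.map_comp_comul_apply]
    generalize Coalgebra.comul (R := k) b = s
    generalize Coalgebra.comul (R := k) c = t
    induction s with
    | zero => simp
    | add s s' hs hs' => simp only [map_add, add_mul, hs, hs']
    | tmul b b' =>
      induction t with
      | zero => simp
      | add s s' hs hs' => simp only [map_add, mul_add, hs, hs']
      | tmul c c' => simp [toQuot_mul]

end Bialgebra

end ThinData
end DoubleData

/-! ### Separation of characters and grouplikes -/

section Separation

variable {k Γ κ Y E : Type*} [Field k] [AddCommGroup Y] [Module k Y]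
  [AddCommGroup E] [Module k E]

/-- Terms that carry different characters vanish separately. -/
lemma sum_filter_char_eq_zero [Monoid Γ] {χ : κ → Γ →* kˣ} {y : κ → Y} {s : Finset κ}
    (h : ∀ g, ∑ l ∈ s, (χ l g : k) • y l = 0) (ψ : Γ →* kˣ) [DecidablePred fun l => χ l = ψ] :
    ∑ l ∈ s with χ l = ψ, y l = 0 := by
  classical
  rw [← Module.forall_dual_apply_eq_zero_iff k]
  intro φ
  let u : (Γ →* kˣ) → (Γ →* k) := fun ψ => (Units.coeHom k).comp ψ
  have hu : Function.Injective u := fun a b hab => by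
    ext g
    exact DFunLike.congr_fun hab g
  -- Terms are collected by character, after a linear form on `Y`, so that independence of
  -- characters applies.
  let c : (Γ →* k) →₀ k := ∑ l ∈ s, Finsupp.single (u (χ l)) (φ (y l))
  have hc : c = 0 := by
    refine linearIndependent_iff.1 (linearIndependent_monoidHom Γ k) c (funext fun g => ?_)
    have h1 := congrArg φ (h g)
    simp only [map_sum, map_smul, map_zero, smul_eq_mul] at h1
    simp only [c, map_sum, Finsupp.linearCombination_single, Finset.sum_apply, Pi.smul_apply,
      smul_eq_mul, Pi.zero_apply]
    rw [← h1]
    exact Finset.sum_congr rfl fun l _ => mul_comm _ _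
  have h2 : c (u ψ) = 0 := by rw [hc]; rfl
  rw [map_sum, Finset.sum_filter]
  refine Eq.trans ?_ h2
  simp only [c, Finsupp.finset_sum_apply, Finsupp.single_apply, hu.eq_iff]

/-- The term `z` is given the extra index `none`, with the trivial character, and then separated
from all other terms. -/
lemma eq_zero_of_char_ne_one [Monoid Γ] {χ : κ → Γ →* kˣ} {y : κ → Y} {s : Finset κ} {z : Y}
    (h : ∀ g, z + ∑ l ∈ s, (χ l g : k) • y l = 0) (hχ : ∀ l ∈ s, χ l ≠ 1) : z = 0 := by
  classical
  have := sum_filter_char_eq_zero (χ := fun o : Option κ => o.elim 1 χ)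
    (y := fun o => o.elim z y) (s := Finset.insertNone s) (fun g => by
      rw [Finset.sum_insertNone]
      simpa using h g) 1
  rw [Finset.sum_filter, Finset.sum_insertNone] at this
  simp only [Option.elim_none, if_true, Option.elim_some] at this
  exact (add_zero z).symm.trans
    ((congrArg _ (Finset.sum_eq_zero fun l hl => if_neg (hχ l hl)).symm).trans this)

/-- A coordinate on the span, extended to the whole space. -/
lemma LinearIndependent.exists_dual {b : Γ → E} (hb : LinearIndependent k b) (g : Γ) :
    ∃ φ : E →ₗ[k] k, ∀ h, φ (b h) = Finsupp.single h (1 : k) g := by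
  obtain ⟨φ, hφ⟩ := LinearMap.exists_extend (Finsupp.lapply g ∘ₗ hb.repr)
  refine ⟨φ, fun h => ?_⟩
  have h1 := congr($hφ ⟨b h, Submodule.subset_span ⟨h, rfl⟩⟩)
  refine h1.trans ?_
  rw [LinearMap.comp_apply, hb.repr_eq_single h ⟨b h, Submodule.subset_span ⟨h, rfl⟩⟩ rfl]
  rfl

/-- Tensors whose first factors are different linearly independent vectors vanish separately. -/
lemma sum_filter_tmul_eq_zero {b : Γ → E} (hb : LinearIndependent k b) {γ : κ → Γ} {y : κ → Y}
    {s : Finset κ} (h : ∑ l ∈ s, b (γ l) ⊗ₜ[k] y l = 0) (g : Γ)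
    [DecidablePred fun l => γ l = g] : ∑ l ∈ s with γ l = g, y l = 0 := by
  classical
  obtain ⟨φ, hφ⟩ := hb.exists_dual g
  have h1 := congr(TensorProduct.lid k Y (φ.rTensor Y $h))
  simp only [map_sum, LinearMap.rTensor_tmul, TensorProduct.lid_tmul, hφ, map_zero,
    Finsupp.single_apply, ite_smul, one_smul, zero_smul] at h1
  rwa [Finset.sum_filter]

lemma eq_zero_of_sum_tmul_eq_zero {b : Γ → E} (hb : LinearIndependent k b) {y : Γ → Y}
    {s : Finset Γ} (h : ∑ g ∈ s, y g ⊗ₜ[k] b g = 0) {g : Γ} (hg : g ∈ s) : y g = 0 := by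
  classical
  have h1 := congr(TensorProduct.comm k Y E $h)
  simp only [map_sum, TensorProduct.comm_tmul, map_zero] at h1
  have := sum_filter_tmul_eq_zero hb (γ := id) h1 g
  rw [Finset.sum_filter] at this
  simpa [hg] using this

end Separation

/-! ### Injectivity of the comparison map. -/

namespace DoubleData

open YetterDrinfeld

section GroupLike

variable {k F G I : Type*} [Field k] [CommGroup F] [CommGroup G] (D : DoubleData k F G I)
  (T : Subgroup (F × G)) {E : Type*} [Ring E] [Bialgebra k E] (p : D.Double →ₐ[k] E)
  (hp : ∀ t ∈ T, p (D.grp t) = 1)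
  (hΔ : ∀ x, Coalgebra.comul (R := k) (p x) =
    Algebra.TensorProduct.map p p (Coalgebra.comul (R := k) x))
  (hε : ∀ x, Coalgebra.counit (R := k) (p x) = Coalgebra.counit (R := k) x)
  (hT : ∀ t, p (D.grp t) = 1 → t ∈ T)

include hΔ in
lemma comul_mapΓ (g : (F × G) ⧸ T) : Coalgebra.comul (R := k) (D.mapΓ T p hp g) =
    D.mapΓ T p hp g ⊗ₜ D.mapΓ T p hp g := by
  induction g using QuotientGroup.induction_on with
  | H t => rw [mapΓ_mk, hΔ, comul_grp, Algebra.TensorProduct.map_tmul]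

include hT in
lemma mapΓ_injective : Function.Injective (D.mapΓ T p hp) := by
  rw [injective_iff_map_eq_one]
  intro g hg
  induction g using QuotientGroup.induction_on with
  | H t => exact (QuotientGroup.eq_one_iff t).2 (hT t hg)

include hΔ hε hT in
-- Grouplike elements that are distinct are linearly independent, and `Γ` embeds because `T`
-- contains all `t` with `p(t) = 1`.
lemma linearIndependent_mapΓ : LinearIndependent k (D.mapΓ T p hp) := by
  have h : ∀ g, IsGroupLikeElem k (D.mapΓ T p hp g) := fun g => by
    refine ⟨?_, D.comul_mapΓ T p hp hΔ g⟩
    induction g using QuotientGroup.induction_on with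
    | H t => rw [mapΓ_mk, hε, counit_grp]
  have h1 := linearIndepOn_isGroupLikeElem (R := k) (A := E)
  exact LinearIndependent.comp h1 (fun g => ⟨D.mapΓ T p hp g, h g⟩)
    fun a b hab => D.mapΓ_injective T p hp hT (Subtype.ext_iff.1 hab)

end GroupLike

namespace ThinData

variable {k F G I : Type*} [Field k] [CommGroup F] [CommGroup G] {D : DoubleData k F G I}
  (P : D.ThinData) {E : Type*} [Ring E]

section

variable [Algebra k E] (p : D.Double →ₐ[k] E) (hp : ∀ t ∈ P.T, p (D.grp t) = 1)
  (hz : ∀ z, p (D.v (z : P.Z)) = p (D.w (P.ζ z)))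

/-- the image of `U` in `E` -/
def genU : (((I →₀ k) × (I →₀ k)) ⧸ P.K) →ₗ[k] E := P.toQuot p hp ∘ₗ Boson.ι P.U

/-- the basis of `U` -/
def basisU : P.U.DiagBasis (I ⊕ P.S) := P.link.DU P.isHom_equiv

lemma basisU_b_inl (i : I) : P.basisU.b (Sum.inl i) = P.K.mkQ (Finsupp.single i 1, 0) := by
  refine (P.link.DU_b_inl P.isHom_equiv i).trans ?_
  change P.K.mkQ ((D.basisV P.T P.T_le id).b i, P.inclW 0) = _
  rw [map_zero, basisV_b]

lemma basisU_b_inr (j : P.S) :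
    P.basisU.b (Sum.inr j) = P.K.mkQ (0, Finsupp.single (P.incS j) 1) := by
  refine (P.link.DU_b_inr P.isHom_equiv j).trans ?_
  change P.K.mkQ (0, P.inclW ((D.basisW P.T P.T_le P.incS).b j)) = _
  rw [basisW_b, inclW, Finsupp.lmapDomain_apply, Finsupp.mapDomain_single]

lemma basisU_χ_inl (i : I) (t : F × G) :
    P.basisU.χ (Sum.inl i) (QuotientGroup.mk t) = D.chi i t := rfl

lemma basisU_χ_inr (j : P.S) (t : F × G) :
    P.basisU.χ (Sum.inr j) (QuotientGroup.mk t) = (D.chi (P.incS j))⁻¹ t := rfl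

lemma basisU_γ_inl (i : I) : P.basisU.γ (Sum.inl i) = QuotientGroup.mk (D.f i, 1) := rfl

lemma basisU_γ_inr (j : P.S) :
    P.basisU.γ (Sum.inr j) = QuotientGroup.mk (1, D.g (P.incS j)) := rfl

include hz in
lemma genU_mkQ (v w : I →₀ k) : P.genU p hp (P.K.mkQ (v, w)) = p (D.v v) + p (D.w w) := by
  have h := P.toQuot_ι_mul_of p hp hz v w 1
  rw [grp_one, map_one, mul_one, ofU, QuotientGroup.mk_one, map_one, mul_one] at h
  exact h

include hz in
lemma toQuot_ι_mul (u) (g : P.Γ) : P.toQuot p hp (Boson.ι P.U u * Boson.of P.U g) =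
    P.genU p hp u * D.mapΓ P.T p hp g := by
  obtain ⟨⟨v, w⟩, rfl⟩ := P.K.mkQ_surjective u
  induction g using QuotientGroup.induction_on with
  | H t =>
    rw [P.genU_mkQ p hp hz, mapΓ_mk]
    exact P.toQuot_ι_mul_of p hp hz v w t

include hz in
lemma mapΓ_mul_genU (g : P.Γ) (l : I ⊕ P.S) :
    D.mapΓ P.T p hp g * P.genU p hp (P.basisU.b l) =
      (P.basisU.χ l g : k) • (P.genU p hp (P.basisU.b l) * D.mapΓ P.T p hp g) := by
  induction g using QuotientGroup.induction_on with
  | H t =>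
    rcases l with i | j
    · rw [basisU_b_inl, P.genU_mkQ p hp hz, map_zero, map_zero, add_zero, mapΓ_mk, ← map_mul,
        grp_mul_v_single, map_smul, map_mul]
      rfl
    · rw [basisU_b_inr, P.genU_mkQ p hp hz, map_zero, map_zero, zero_add, mapΓ_mk, ← map_mul,
        grp_mul_w_single, map_smul, map_mul]
      rfl

/-- conjugation by an element of `Γ` -/
def conj (g : P.Γ) : E →ₗ[k] E :=
  LinearMap.mulLeft k (D.mapΓ P.T p hp g) ∘ₗ LinearMap.mulRight k (D.mapΓ P.T p hp g⁻¹)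

lemma conj_mapΓ (g h : P.Γ) : P.conj p hp g (D.mapΓ P.T p hp h) = D.mapΓ P.T p hp h := by
  simp only [conj, LinearMap.comp_apply, LinearMap.mulLeft_apply, LinearMap.mulRight_apply]
  rw [← map_mul, ← map_mul, mul_comm h, mul_inv_cancel_left]

include hz in
lemma conj_genU_mul (g h : P.Γ) (l : I ⊕ P.S) :
    P.conj p hp g (P.genU p hp (P.basisU.b l) * D.mapΓ P.T p hp h) =
      (P.basisU.χ l g : k) • (P.genU p hp (P.basisU.b l) * D.mapΓ P.T p hp h) := by
  simp only [conj, LinearMap.comp_apply, LinearMap.mulLeft_apply, LinearMap.mulRight_apply]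
  rw [mul_assoc, ← map_mul, ← mul_assoc, P.mapΓ_mul_genU p hp hz, smul_mul_assoc, mul_assoc,
    ← map_mul, mul_comm h, mul_inv_cancel_left]

end

section

variable [Bialgebra k E] (p : D.Double →ₐ[k] E) (hp : ∀ t ∈ P.T, p (D.grp t) = 1)
  (hz : ∀ z, p (D.v (z : P.Z)) = p (D.w (P.ζ z)))
  (hΔ : ∀ x, Coalgebra.comul (R := k) (p x) =
    Algebra.TensorProduct.map p p (Coalgebra.comul (R := k) x))
  (hε : ∀ x, Coalgebra.counit (R := k) (p x) = Coalgebra.counit (R := k) x)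
  (hT : ∀ t, p (D.grp t) = 1 → t ∈ P.T)

include hz hΔ in
lemma comul_genU (l : I ⊕ P.S) : Coalgebra.comul (R := k) (P.genU p hp (P.basisU.b l)) =
    P.genU p hp (P.basisU.b l) ⊗ₜ 1 +
      D.mapΓ P.T p hp (P.basisU.γ l) ⊗ₜ P.genU p hp (P.basisU.b l) := by
  rcases l with i | j
  · rw [basisU_b_inl, P.genU_mkQ p hp hz, map_zero, map_zero, add_zero, hΔ, comul_v_single]
    simp [basisU_γ_inl]
  · rw [basisU_b_inr, P.genU_mkQ p hp hz, map_zero, map_zero, zero_add, hΔ, comul_w_single]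
    simp [basisU_γ_inr]

variable (hK : ∀ v w, p (D.v v) + p (D.w w) = 0 → (v, w) ∈ P.K) (hχ : ∀ i, D.chi i ≠ 1)

include hχ in
-- This is where the hypothesis of the theorem enters: all basis vectors of `U` carry nontrivial
-- characters.
lemma basisU_χ_ne_one (l : I ⊕ P.S) : P.basisU.χ l ≠ 1 := by
  intro h
  rcases l with i | j
  · refine hχ i (MonoidHom.ext fun t => ?_)
    rw [← P.basisU_χ_inl, h]
    rfl
  · refine hχ (P.incS j) (MonoidHom.ext fun t => ?_)
    have h1 := P.basisU_χ_inr j t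
    rw [h] at h1
    exact (inv_eq_one.1 h1.symm)

include hz hK in
lemma genU_injective : Function.Injective (P.genU p hp) := by
  rw [injective_iff_map_eq_zero]
  intro u hu
  obtain ⟨⟨v, w⟩, rfl⟩ := P.K.mkQ_surjective u
  rw [P.genU_mkQ p hp hz] at hu
  rw [Submodule.mkQ_apply, Submodule.Quotient.mk_eq_zero]
  exact hK v w hu

include hz hΔ hε hT hK hχ in
-- By the criterion only sums of `(c + u) g` matter. Conjugation by `Γ` fixes `g` and acts on `u g`
-- by nontrivial characters, so it separates first the group part and then, in the coproduct, the
-- two kinds of terms `u g ⊗ g` and `γ g ⊗ u g`.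
theorem toQuot_injective : Function.Injective (P.toQuot p hp) := by
  classical
  refine Boson.injective_of_filt_two P.basisU (P.comul_toQuot p hp hΔ) fun x hx h0 => ?_
  obtain ⟨s, c, u, rfl⟩ := Boson.eq_sum_of_mem_filt_two P.basisU hx
  have hb := D.linearIndependent_mapΓ P.T p hp hΔ hε hT
  set γ := D.mapΓ P.T p hp
  set ε := fun l => P.genU p hp (P.basisU.b l)
  let L : Finset (I ⊕ P.S) := s.biUnion fun g => (P.basisU.b.repr (u g)).support
  have hu : ∀ g ∈ s, P.genU p hp (u g) = ∑ l ∈ L, P.basisU.b.repr (u g) l • ε l := by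
    intro g hg
    conv_lhs => rw [← P.basisU.b.linearCombination_repr (u g)]
    rw [Finsupp.linearCombination_apply, Finsupp.sum_of_support_subset _
      (Finset.subset_biUnion_of_mem (fun g => (P.basisU.b.repr (u g)).support) hg) _ (by simp),
      map_sum]
    simp only [map_smul, ε]
    rfl
  have hJ : ∀ g, P.toQuot p hp ((c g • 1 + Boson.ι P.U (u g)) * Boson.of P.U g) =
      c g • γ g + P.genU p hp (u g) * γ g := by
    intro g
    rw [add_mul, smul_mul_assoc, one_mul, map_add, map_smul, P.toQuot_ι_mul p hp hz]
    congr 2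
    induction g using QuotientGroup.induction_on with
    | H t => exact P.toQuot_ofU p hp t
  have h1 : ∑ g ∈ s, c g • γ g + ∑ g ∈ s, P.genU p hp (u g) * γ g = 0 := by
    rw [← Finset.sum_add_distrib, ← h0, map_sum]
    exact Finset.sum_congr rfl fun g _ => (hJ g).symm
  have h2 : ∑ g ∈ s, P.genU p hp (u g) * γ g =
      ∑ l ∈ L, ∑ g ∈ s, P.basisU.b.repr (u g) l • (ε l * γ g) := by
    rw [Finset.sum_comm]
    refine Finset.sum_congr rfl fun g hg => ?_
    rw [hu g hg, Finset.sum_mul]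
    exact Finset.sum_congr rfl fun l _ => smul_mul_assoc _ _ _
  -- Conjugation fixes this sum and scales the remaining terms by nontrivial characters.
  have h3 : ∑ g ∈ s, c g • γ g = 0 := by
    refine eq_zero_of_char_ne_one (χ := P.basisU.χ) (s := L)
      (y := fun l => ∑ g ∈ s, P.basisU.b.repr (u g) l • (ε l * γ g)) (fun h => ?_)
      fun l _ => P.basisU_χ_ne_one hχ l
    have := congrArg (P.conj p hp h) h1
    rw [h2, map_zero] at this
    rw [← this, map_add, map_sum, map_sum]
    congr 1
    · exact Finset.sum_congr rfl fun g _ => by rw [map_smul, conj_mapΓ]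
    · refine Finset.sum_congr rfl fun l _ => ?_
      rw [map_sum, Finset.smul_sum]
      refine Finset.sum_congr rfl fun g _ => ?_
      rw [map_smul, P.conj_genU_mul p hp hz, smul_comm]
  have hc : ∀ g ∈ s, c g = 0 := linearIndependent_iff'.1 hb s c h3
  rw [h3, zero_add] at h1
  -- Take the coproduct of the relation and conjugate the second tensorand only: the terms with `γ
  -- g` there are fixed, those with `ε l * γ g` are scaled by nontrivial characters.
  have h4 : ∑ g ∈ s, (P.genU p hp (u g) * γ g) ⊗ₜ[k] γ g = 0 := by
    refine eq_zero_of_char_ne_one (χ := P.basisU.χ) (s := L)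
      (y := fun l => ∑ g ∈ s, P.basisU.b.repr (u g) l •
        ((γ (P.basisU.γ l) * γ g) ⊗ₜ[k] (ε l * γ g))) (fun h => ?_)
      fun l _ => P.basisU_χ_ne_one hχ l
    have h5 := congr((P.conj p hp h).lTensor E (Coalgebra.comul (R := k) $h1))
    have h6 : ∀ l g, Coalgebra.comul (R := k) (ε l * γ g) =
        (ε l * γ g) ⊗ₜ γ g + (γ (P.basisU.γ l) * γ g) ⊗ₜ (ε l * γ g) := by
      intro l g
      rw [Bialgebra.comul_mul, P.comul_genU p hp hz hΔ, D.comul_mapΓ P.T p hp hΔ, add_mul]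
      simp only [Algebra.TensorProduct.tmul_mul_tmul, one_mul]
      rfl
    have h7 : ∀ l g, (P.conj p hp h).lTensor E (Coalgebra.comul (R := k) (ε l * γ g)) =
        (ε l * γ g) ⊗ₜ γ g + (P.basisU.χ l h : k) •
          ((γ (P.basisU.γ l) * γ g) ⊗ₜ (ε l * γ g)) := by
      intro l g
      rw [h6, map_add, LinearMap.lTensor_tmul, LinearMap.lTensor_tmul, conj_mapΓ,
        P.conj_genU_mul p hp hz, TensorProduct.tmul_smul]
    rw [h2, map_zero, map_zero] at h5
    simp only [map_sum, map_smul, h7, smul_add, Finset.sum_add_distrib] at h5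
    rw [← h5]
    congr 1
    · rw [Finset.sum_comm]
      refine Finset.sum_congr rfl fun g hg => ?_
      rw [hu g hg, Finset.sum_mul, TensorProduct.sum_tmul]
      exact Finset.sum_congr rfl fun l _ => by rw [smul_mul_assoc, TensorProduct.smul_tmul']
    · refine Finset.sum_congr rfl fun l _ => ?_
      rw [Finset.smul_sum]
      exact Finset.sum_congr rfl fun g _ => smul_comm _ _ _
  -- Independence of the second tensorands isolates `u g` times `g`, whose image is zero; cancelling
  -- `g` leaves a relation in `U`, on which the map is injective.
  have hu0 : ∀ g ∈ s, u g = 0 := by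
    intro g hg
    have h5 := eq_zero_of_sum_tmul_eq_zero hb h4 hg
    have h6 : P.genU p hp (u g) = 0 := by
      have := congrArg (· * γ g⁻¹) h5
      simpa only [mul_assoc, ← map_mul, mul_inv_cancel, map_one, mul_one, zero_mul] using this
    exact P.genU_injective p hp hz hK (h6.trans (map_zero _).symm)
  refine Finset.sum_eq_zero fun g hg => ?_
  rw [hc g hg, hu0 g hg]
  simp

end

end ThinData
end DoubleData

/-! ### The ideal `𝔞(T, Z, ζ)` and a square zero representation. -/

namespace DoubleData

open YetterDrinfeld

variable {k F G I : Type*} [Field k] [CommGroup F] [CommGroup G] (D : DoubleData k F G I)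

/-- Both sides are `τ₀(f_j, g_i) τ₀(f_i, g_j)`. Hence for `j ∈ I_T` every `f_i g_i` acts trivially
on `v_j` and `w_j`. -/
lemma chi_comm (i j : I) : D.chi i (D.f j, D.g j) = D.chi j (D.f i, D.g i) := by
  rw [chi_apply, chi_apply, mul_comm]

namespace ThinData

variable {D} (P : D.ThinData)

instance : P.ideal.IsTwoSided := inferInstanceAs (TwoSidedIdeal.asIdeal _).IsTwoSided

lemma grp_sub_one_mem {t : F × G} (ht : t ∈ P.T) : D.grp t - 1 ∈ P.ideal :=
  TwoSidedIdeal.mem_asIdeal.2 (TwoSidedIdeal.subset_span (Or.inl ⟨t, ht, rfl⟩))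

lemma v_sub_w_mem (z : P.Z) : D.v z - D.w (P.ζ z) ∈ P.ideal :=
  TwoSidedIdeal.mem_asIdeal.2 (TwoSidedIdeal.subset_span (Or.inr ⟨z, rfl⟩))

lemma ideal_le {𝔞 : Ideal D.Double} [𝔞.IsTwoSided] (h1 : ∀ t ∈ P.T, D.grp t - 1 ∈ 𝔞)
    (h2 : ∀ z : P.Z, D.v z - D.w (P.ζ z) ∈ 𝔞) : P.ideal ≤ 𝔞 := by
  intro x hx
  have h : TwoSidedIdeal.span ({x | ∃ t ∈ P.T, x = D.grp t - 1} ∪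
    {x | ∃ z : P.Z, x = D.v z - D.w (P.ζ z)}) ≤ 𝔞.toTwoSided := by
    rw [TwoSidedIdeal.span_le]
    rintro _ (⟨t, ht, rfl⟩ | ⟨z, rfl⟩)
    · exact Ideal.mem_toTwoSided.2 (h1 t ht)
    · exact Ideal.mem_toTwoSided.2 (h2 z)
  exact Ideal.mem_toTwoSided.1 (h (TwoSidedIdeal.mem_asIdeal.1 hx))

/-- The two conditions say that `p` kills the generators of the ideal. -/
lemma map_eq_zero {R : Type*} [Ring R] [Algebra k R] (p : D.Double →ₐ[k] R)
    (hp : ∀ t ∈ P.T, p (D.grp t) = 1) (hz : ∀ z, p (D.v (z : P.Z)) = p (D.w (P.ζ z)))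
    {x : D.Double} (hx : x ∈ P.ideal) : p x = 0 := by
  have h : P.ideal ≤ RingHom.ker p := P.ideal_le
    (fun t ht => by rw [RingHom.mem_ker, map_sub, hp t ht, map_one, sub_self])
    (fun z => by rw [RingHom.mem_ker, map_sub, hz, sub_self])
  exact h hx

end ThinData

/-! ### Square zero representations of the double -/

section SquareZero

variable {R : Type*} [Ring R] [Algebra k R] {a b : (I →₀ k) →ₗ[k] R} {γ : F × G →* R}
  (haa : ∀ x y, a x * a y = 0) (hbb : ∀ x y, b x * b y = 0) (hab : ∀ x y, a x * b y = 0)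
  (hba : ∀ x y, b x * a y = 0)
  (ha : ∀ t i, γ t * a (Finsupp.single i 1) =
    (D.chi i t : k) • (a (Finsupp.single i 1) * γ t))
  (hb : ∀ t i, γ t * b (Finsupp.single i 1) =
    ((D.chi i t)⁻¹ : kˣ).val • (b (Finsupp.single i 1) * γ t))
  (hγ : ∀ i, γ (D.f i, D.g i) = 1)

/-- The map from a Nichols algebra given by a linear map with products zero. -/
def nicholsSquareZero {Γ M : Type*} [CommGroup Γ] [AddCommGroup M] [Module k M]
    (Y : YetterDrinfeld k Γ M) (a : M →ₗ[k] R) (h : ∀ x y, a x * a y = 0) : Y.Nichols →ₐ[k] R :=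
  Nichols.lift Y (TensorAlgebra.lift k a) fun x hx => by
    rw [TensorAlgebra.lift_eq_of_mul_eq_zero a h,
      Y.isBraidedHopfIdeal_nicholsIdeal.counit_eq_zero x hx, degOne_nicholsIdeal hx]
    simp

/-- An algebra map out of `𝒟` for which all products of elements of `V` and `W` are zero. -/
def liftSquareZero : D.Double →ₐ[k] R :=
  Double.lift
    (Boson.lift (nicholsSquareZero D.V a haa) (γ.comp (MonoidHom.inl F G)) (fun f x => by
      simp only [nicholsSquareZero, Nichols.lift_mk, TensorAlgebra.lift_ι_apply]
      induction x using Finsupp.induction_linear with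
      | zero => simp
      | add x y hx hy => simp only [map_add, add_mul, mul_add, hx, hy]
      | single i c =>
        rw [← Finsupp.smul_single_one]
        simp only [map_smul, smul_mul_assoc, mul_smul_comm]
        congr 1
        rw [V, diag_act_single, map_smul, smul_mul_assoc, MonoidHom.comp_apply,
          MonoidHom.inl_apply, ha]
        simp [chi_apply]))
    (Boson.lift (nicholsSquareZero D.W b hbb) (γ.comp (MonoidHom.inr F G)) (fun f x => by
      simp only [nicholsSquareZero, Nichols.lift_mk, TensorAlgebra.lift_ι_apply]
      induction x using Finsupp.induction_linear with
      | zero => simp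
      | add x y hx hy => simp only [map_add, add_mul, mul_add, hx, hy]
      | single i c =>
        rw [← Finsupp.smul_single_one]
        simp only [map_smul, smul_mul_assoc, mul_smul_comm]
        congr 1
        rw [W, diag_act_single, map_smul, smul_mul_assoc, MonoidHom.comp_apply,
          MonoidHom.inr_apply, hb]
        simp [chi_apply]))
    (by
      have h1 : ∀ i g, γ (1, g) * a (Finsupp.single i 1) =
          (D.τ₀ (D.f i) g : k) • (a (Finsupp.single i 1) * γ (1, g)) := fun i g => by
        rw [ha]; simp [chi_apply]
      have h2 : ∀ i f, b (Finsupp.single i 1) * γ (f, 1) =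
          (D.τ₀ f (D.g i) : k) • (γ (f, 1) * b (Finsupp.single i 1)) := fun i f => by
        rw [hb]; simp [chi_apply, smul_smul]
      -- With all products of `V` and `W` zero, the linking relation becomes `0 = γ(f_i g_i) - 1`.
      have h3 : ∀ i, γ (D.f i, 1) * γ (1, D.g i) = 1 := fun i => by
        rw [← map_mul, Prod.mk_mul_mk, one_mul, mul_one, hγ]
      constructor
      · intro f g
        simp only [ofB, ofH, Boson.lift_of, MonoidHom.comp_apply, MonoidHom.inl_apply,
          MonoidHom.inr_apply, ← map_mul, mul_comm]
      · intro i g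
        simpa [ofH, vB, nicholsSquareZero] using h1 i g
      · intro i g
        simpa [ofB, wH, nicholsSquareZero] using h2 i g
      · intro i j _
        simp [vB, wH, nicholsSquareZero, hab, hba]
      · intro i
        simp [vB, wH, ofB, ofH, nicholsSquareZero, hab, hba, h3])

lemma liftSquareZero_v (x : I →₀ k) :
    liftSquareZero D haa hbb hab hba ha hb hγ (D.v x) = a x := by
  simp [liftSquareZero, v, nicholsSquareZero]

lemma liftSquareZero_w (x : I →₀ k) :
    liftSquareZero D haa hbb hab hba ha hb hγ (D.w x) = b x := by
  simp [liftSquareZero, w, nicholsSquareZero]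

lemma liftSquareZero_grp (t : F × G) :
    liftSquareZero D haa hbb hab hba ha hb hγ (D.grp t) = γ t := by
  rw [grp, map_mul, liftSquareZero, Double.lift_inB, Double.lift_inH, ofB, ofH, Boson.lift_of,
    Boson.lift_of, MonoidHom.comp_apply, MonoidHom.comp_apply, ← map_mul]
  simp

end SquareZero

namespace ThinData

variable {D} (P : D.ThinData)

open Classical in
/-- the projection of `V` onto `V_T` -/
def projT : (I →₀ k) →ₗ[k] (I →₀ k) :=
  (Finsupp.supported k k (D.IT P.T)).subtype ∘ₗ Finsupp.restrictDom k k (D.IT P.T)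

lemma projT_eq {x : I →₀ k} (hx : x ∈ Finsupp.supported k k (D.IT P.T)) : P.projT x = x := by
  classical
  rw [Finsupp.mem_supported'] at hx
  ext i
  by_cases hi : i ∈ D.IT P.T
  · simp [projT, Finsupp.restrictDom, hi]
  · simp [projT, Finsupp.restrictDom, hi, hx i hi]

lemma projT_single_of_mem {i : I} (hi : i ∈ D.IT P.T) (c : k) :
    P.projT (Finsupp.single i c) = Finsupp.single i c :=
  P.projT_eq (Finsupp.single_mem_supported k c hi)

lemma projT_single_of_notMem {i : I} (hi : i ∉ D.IT P.T) (c : k) :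
    P.projT (Finsupp.single i c) = 0 := by
  classical
  ext j
  simp only [projT, Finsupp.restrictDom, LinearMap.comp_apply]
  by_cases hj : j ∈ D.IT P.T
  · have : i ≠ j := fun h => hi (h ▸ hj)
    simp [hj, this]
  · simp [hj]

/-- the projection of `V ⊕ W` onto `V_T ⊕ W_T` -/
def projT₂ : ((I →₀ k) × (I →₀ k)) →ₗ[k] ((I →₀ k) × (I →₀ k)) :=
  LinearMap.prodMap P.projT P.projT

lemma VW_act_apply (t : F × G) (x : (I →₀ k) × (I →₀ k)) :
    P.VW.act (QuotientGroup.mk t) x =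
      ((D.VΓ P.T P.T_le).act (QuotientGroup.mk t) x.1,
        (D.WΓ P.T P.T_le).act (QuotientGroup.mk t) x.2) := rfl

lemma VW_act_inl (t : F × G) (i : I) (c : k) :
    P.VW.act (QuotientGroup.mk t) (Finsupp.single i c, 0) =
      (D.chi i t : k) • (Finsupp.single i c, 0) := by
  rw [VW_act_apply, VΓ, diag_act_single]
  simp

lemma VW_act_inr (t : F × G) (i : I) (c : k) :
    P.VW.act (QuotientGroup.mk t) (0, Finsupp.single i c) =
      ((D.chi i t)⁻¹ : kˣ).val • (0, Finsupp.single i c) := by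
  rw [VW_act_apply, WΓ, diag_act_single]
  simp

lemma projT₂_inl_of_mem {i : I} (hi : i ∈ D.IT P.T) (c : k) :
    P.projT₂ (Finsupp.single i c, 0) = (Finsupp.single i c, 0) := by
  simp [projT₂, P.projT_single_of_mem hi]

lemma projT₂_inl_of_notMem {i : I} (hi : i ∉ D.IT P.T) (c : k) :
    P.projT₂ (Finsupp.single i c, 0) = 0 := by
  simp [projT₂, P.projT_single_of_notMem hi]

lemma projT₂_inr_of_mem {i : I} (hi : i ∈ D.IT P.T) (c : k) :
    P.projT₂ (0, Finsupp.single i c) = (0, Finsupp.single i c) := by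
  simp [projT₂, P.projT_single_of_mem hi]

lemma projT₂_inr_of_notMem {i : I} (hi : i ∉ D.IT P.T) (c : k) :
    P.projT₂ (0, Finsupp.single i c) = 0 := by
  simp [projT₂, P.projT_single_of_notMem hi]

lemma pair_induction {p : (I →₀ k) × (I →₀ k) → Prop} (h0 : p 0)
    (hadd : ∀ x y, p x → p y → p (x + y)) (hsmul : ∀ (c : k) x, p x → p (c • x))
    (hl : ∀ i, p (Finsupp.single i 1, 0)) (hr : ∀ i, p (0, Finsupp.single i 1)) (x) : p x := by
  have h1 : ∀ v, p (v, 0) := by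
    intro v
    induction v using Finsupp.induction_linear with
    | zero => exact h0
    | add x y hx hy => simpa using hadd _ _ hx hy
    | single i c => simpa using hsmul c _ (hl i)
  have h2 : ∀ v, p (0, v) := by
    intro v
    induction v using Finsupp.induction_linear with
    | zero => exact h0
    | add x y hx hy => simpa using hadd _ _ hx hy
    | single i c => simpa using hsmul c _ (hr i)
  simpa using hadd _ _ (h1 x.1) (h2 x.2)

lemma projT₂_act (t : F × G) (x : (I →₀ k) × (I →₀ k)) :
    P.projT₂ (P.VW.act (QuotientGroup.mk t) x) = P.VW.act (QuotientGroup.mk t) (P.projT₂ x) := by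
  induction x using pair_induction with
  | h0 => simp
  | hadd x y hx hy => simp only [map_add, hx, hy]
  | hsmul c x hx => simp only [map_smul, hx]
  | hl i =>
    rw [VW_act_inl, map_smul]
    by_cases hi : i ∈ D.IT P.T
    · rw [P.projT₂_inl_of_mem hi, VW_act_inl]
    · rw [P.projT₂_inl_of_notMem hi, map_zero, smul_zero]
  | hr i =>
    rw [VW_act_inr, map_smul]
    by_cases hi : i ∈ D.IT P.T
    · rw [P.projT₂_inr_of_mem hi, VW_act_inr]
    · rw [P.projT₂_inr_of_notMem hi, map_zero, smul_zero]

/-- the elements of `V ⊕ W` whose projection to `V_T ⊕ W_T` has the form `z - ζ(z)` -/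
def KT : Submodule k ((I →₀ k) × (I →₀ k)) := P.K.comap P.projT₂

lemma act_mem_KT (t : F × G) {x} (hx : x ∈ P.KT) : P.VW.act (QuotientGroup.mk t) x ∈ P.KT := by
  rw [KT, Submodule.mem_comap, projT₂_act]
  exact P.K_sub.act_mem _ _ hx

/-- the space `(V ⊕ W) / KT ≅ (V_T ⊕ W_T) / {z - ζ(z)}` -/
abbrev UT : Type _ := ((I →₀ k) × (I →₀ k)) ⧸ P.KT

/-- the action of `F × G` on `UT` -/
def actUT : F × G →* Module.End k P.UT where
  toFun t := P.KT.mapQ P.KT (P.VW.act (QuotientGroup.mk t)) (fun _ hx => P.act_mem_KT t hx)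
  map_one' := by
    refine Submodule.linearMap_qext _ (LinearMap.ext fun x => ?_)
    simp
  map_mul' s t := by
    refine Submodule.linearMap_qext _ (LinearMap.ext fun x => ?_)
    simp

lemma actUT_mkQ (t : F × G) (x) :
    P.actUT t (P.KT.mkQ x) = P.KT.mkQ (P.VW.act (QuotientGroup.mk t) x) := rfl

lemma mkQ_eq_zero_of_projT₂ {x} (hx : P.projT₂ x = 0) : P.KT.mkQ x = 0 := by
  rw [Submodule.mkQ_apply, Submodule.Quotient.mk_eq_zero, KT, Submodule.mem_comap, hx]
  exact zero_mem _

/-- On `V_T` and `W_T` the characters are trivial at `f_i g_i` by `chi_comm`; the other basis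
vectors vanish in the quotient. -/
lemma actUT_linking (i : I) : P.actUT (D.f i, D.g i) = 1 := by
  refine Submodule.linearMap_qext _ (LinearMap.ext fun x => ?_)
  rw [LinearMap.comp_apply, LinearMap.comp_apply, actUT_mkQ, Module.End.one_apply]
  induction x using pair_induction with
  | h0 => simp
  | hadd x y hx hy => simp only [map_add, hx, hy]
  | hsmul c x hx => simp only [map_smul, hx]
  | hl j =>
    by_cases hj : j ∈ D.IT P.T
    · rw [VW_act_inl, chi_comm, D.chi_eq_one (P.T_le hj), Units.val_one, one_smul]
    · rw [VW_act_inl, map_smul, P.mkQ_eq_zero_of_projT₂ (P.projT₂_inl_of_notMem hj 1), smul_zero]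
  | hr j =>
    by_cases hj : j ∈ D.IT P.T
    · rw [VW_act_inr, chi_comm, D.chi_eq_one (P.T_le hj), inv_one, Units.val_one, one_smul]
    · rw [VW_act_inr, map_smul, P.mkQ_eq_zero_of_projT₂ (P.projT₂_inr_of_notMem hj 1), smul_zero]

/-- the action of `F × G` on `k ⊕ UT` -/
def actUT₁ : F × G →* Module.End k (k × P.UT) where
  toFun t := LinearMap.prodMap LinearMap.id (P.actUT t)
  map_one' := by rw [map_one]; rfl
  map_mul' s t := by rw [map_mul]; rfl

/-- the operator `(c, y) ↦ (0, c x)` -/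
def raise : P.UT →ₗ[k] Module.End k (k × P.UT) where
  toFun x := LinearMap.inr k k P.UT ∘ₗ LinearMap.toSpanSingleton k P.UT x ∘ₗ LinearMap.fst k k P.UT
  map_add' x y := by ext <;> simp
  map_smul' c x := by ext <;> simp

lemma raise_apply (x : P.UT) (n : k × P.UT) : P.raise x n = (0, n.1 • x) := by simp [raise]

lemma raise_mul (x y : P.UT) : P.raise x * P.raise y = 0 :=
  LinearMap.ext fun n => by simp [raise_apply]

lemma actUT₁_mul_raise (t : F × G) (x : P.UT) {c : k} (hx : P.actUT t x = c • x) :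
    P.actUT₁ t * P.raise x = c • (P.raise x * P.actUT₁ t) := by
  refine LinearMap.ext fun n => ?_
  simp [raise_apply, actUT₁, hx, smul_comm c]

/-- a representation of `𝒟` on `k ⊕ UT` -/
def repUT : D.Double →ₐ[k] Module.End k (k × P.UT) :=
  liftSquareZero (a := P.raise ∘ₗ P.KT.mkQ ∘ₗ LinearMap.inl k _ _)
    (b := P.raise ∘ₗ P.KT.mkQ ∘ₗ LinearMap.inr k _ _) (γ := P.actUT₁) D
    (fun _ _ => P.raise_mul _ _) (fun _ _ => P.raise_mul _ _) (fun _ _ => P.raise_mul _ _)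
    (fun _ _ => P.raise_mul _ _)
    (fun t i => P.actUT₁_mul_raise t _ (by
      rw [LinearMap.comp_apply, actUT_mkQ, LinearMap.inl_apply, VW_act_inl, map_smul]))
    (fun t i => P.actUT₁_mul_raise t _ (by
      rw [LinearMap.comp_apply, actUT_mkQ, LinearMap.inr_apply, VW_act_inr, map_smul]))
    (fun i => by
      change LinearMap.prodMap LinearMap.id (P.actUT _) = _
      rw [actUT_linking]; rfl)

lemma repUT_v (x : I →₀ k) : P.repUT (D.v x) = P.raise (P.KT.mkQ (x, 0)) := liftSquareZero_v ..

lemma repUT_w (x : I →₀ k) : P.repUT (D.w x) = P.raise (P.KT.mkQ (0, x)) := liftSquareZero_w ..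

lemma actUT_eq_one {t : F × G} (ht : t ∈ P.T) : P.actUT t = 1 := by
  have : (QuotientGroup.mk t : P.Γ) = 1 := (QuotientGroup.eq_one_iff t).2 ht
  refine Submodule.linearMap_qext _ (LinearMap.ext fun x => ?_)
  rw [LinearMap.comp_apply, LinearMap.comp_apply, actUT_mkQ, this, map_one]
  rfl

/-- `T` acts trivially because the action factors through `Γ`, and `z - ζ(z)` vanishes because `Z`
and `ζ(Z)` are supported on `I_T`, where the projection is the identity. -/
lemma repUT_eq_zero {x : D.Double} (hx : x ∈ P.ideal) : P.repUT x = 0 := by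
  refine P.map_eq_zero P.repUT (fun t ht => ?_) (fun z => ?_) hx
  · rw [repUT, liftSquareZero_grp]
    change LinearMap.prodMap LinearMap.id (P.actUT _) = _
    rw [P.actUT_eq_one ht]; rfl
  · rw [repUT_v, repUT_w, ← sub_eq_zero, ← map_sub, ← map_sub]
    have : P.KT.mkQ ((z : I →₀ k), 0) - P.KT.mkQ (0, P.ζ z) = 0 := by
      rw [← map_sub, Submodule.mkQ_apply, Submodule.Quotient.mk_eq_zero, KT, Submodule.mem_comap]
      refine ⟨z, Prod.ext ?_ ?_⟩
      · simpa [projT₂] using (P.projT_eq (P.Z_le z.2)).symm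
      · simpa [projT₂] using (P.projT_eq (P.ζ_mem z)).symm
    rw [map_sub P.KT.mkQ, this, map_zero]

/-- Applied to `(1, 0)`, the operator of `x + y` returns the class of `(x, y)`. -/
lemma projT₂_mem_K {x y : I →₀ k} (h : D.v x + D.w y ∈ P.ideal) : P.projT₂ (x, y) ∈ P.K := by
  have h1 := congr($(P.repUT_eq_zero h) (1, 0))
  rw [map_add, repUT_v, repUT_w, ← map_add, ← map_add, raise_apply] at h1
  have h2 : P.KT.mkQ (x, y) = 0 := by simpa using h1
  rwa [Submodule.mkQ_apply, Submodule.Quotient.mk_eq_zero] at h2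

end ThinData
end DoubleData

/-! ### A linked pair of type `(1, 1)` with faithful `Γ`. -/

namespace YetterDrinfeld

namespace LinkData

variable {k Γ M N I S : Type*} [Field k] [CommGroup Γ] [AddCommGroup M] [Module k M]
  [AddCommGroup N] [Module k N] {YV : YetterDrinfeld k Γ M} {YW : YetterDrinfeld k Γ N}
  (L : LinkData YV YW I S)

variable (YV) in
/-- the projection of `𝔅(M) ⋊ Γ` onto `k Γ` -/
def toGroupAlg : YV.Boson →ₐ[k] MonoidAlgebra k Γ :=
  Boson.lift ((Algebra.ofId k _).comp (Nichols.counit YV)) (MonoidAlgebra.of k Γ)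
    (fun g v => by simp)

@[simp] lemma toGroupAlg_ι (x : M) : toGroupAlg YV (Boson.ι YV x) = 0 := by simp [toGroupAlg]

@[simp] lemma toGroupAlg_of (g : Γ) :
    toGroupAlg YV (Boson.of YV g) = MonoidAlgebra.of k Γ g := by simp [toGroupAlg]

lemma isLink_toGroupAlg : L.IsLink 0 0 (toGroupAlg YV) (toGroupAlg YW) where
  of_eq g := by simp
  link i j := by simp

variable (YV) in
/-- The algebra `End(𝔅(V)) ⊗ k Γ ⊗ End(𝔅(V))ᵒᵖ`. -/
abbrev TripleAlg : Type _ :=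
  Module.End k YV.Nichols ⊗[k] (MonoidAlgebra k Γ ⊗[k] (Module.End k YV.Nichols)ᵐᵒᵖ)

instance : Ring (MonoidAlgebra k Γ ⊗[k] (Module.End k YV.Nichols)ᵐᵒᵖ) :=
  Algebra.TensorProduct.instRing

instance : Algebra k (MonoidAlgebra k Γ ⊗[k] (Module.End k YV.Nichols)ᵐᵒᵖ) :=
  Algebra.TensorProduct.leftAlgebra

instance : Ring (TripleAlg YV) := Algebra.TensorProduct.instRing

instance : Algebra k (TripleAlg YV) := Algebra.TensorProduct.leftAlgebra

variable (YV) in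
/-- the map of `𝔅(V) ⋊ Γ` to the triple tensor product -/
def tripleV : YV.Boson →ₐ[k] TripleAlg YV :=
  IsLink.tensorHom repV (IsLink.tensorHom (toGroupAlg YV) (IsLink.opHom repV))

/-- the map of `𝔅(W) ⋊ Γ` to the triple tensor product -/
def tripleW : YW.Boson →ₐ[k] TripleAlg YV :=
  IsLink.tensorHom L.repW (IsLink.tensorHom (toGroupAlg YW) (IsLink.opHom L.repW))

/-- The types `(1, 0)`, `(0, 0)`, `(0, 1)` compose to `(1, 1)`, the type of `𝒟`. The middle factor
is the group algebra, so `Γ` is represented faithfully even when it is not on `𝔅(V)`. -/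
lemma isLink_triple : L.IsLink 1 1 (tripleV YV) L.tripleW :=
  L.isLink_rep.tensor (L.isLink_toGroupAlg.tensor L.isLink_rep.op)

variable (YV) in
/-- the map `X ⊗ c ⊗ Y ↦ θ(X) ε(Y 1) c` -/
def probe (θ : Module.End k YV.Nichols →ₗ[k] k) : TripleAlg YV →ₗ[k] MonoidAlgebra k Γ :=
  (TensorProduct.lid k _).toLinearMap ∘ₗ TensorProduct.map θ
    ((TensorProduct.rid k _).toLinearMap ∘ₗ TensorProduct.map LinearMap.id
      (vac YV ∘ₗ (MulOpposite.opLinearEquiv k).symm.toLinearMap))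

lemma probe_tmul (θ : Module.End k YV.Nichols →ₗ[k] k) (X : Module.End k YV.Nichols)
    (c : MonoidAlgebra k Γ) (Y : (Module.End k YV.Nichols)ᵐᵒᵖ) :
    probe YV θ (X ⊗ₜ (c ⊗ₜ Y)) = θ X • (vac YV Y.unop • c) := by
  simp [probe, smul_smul, mul_comm]

lemma vac_repV_of (g : Γ) : vac YV (repV (Boson.of YV g)) = 1 := by
  rw [vac_apply, repV_of]; simp

lemma probe_vac_of (g : Γ) :
    probe YV (vac YV) (tripleV YV (Boson.of YV g)) = MonoidAlgebra.of k Γ g := by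
  rw [tripleV, IsLink.tensorHom_of, IsLink.tensorHom_of, probe_tmul, IsLink.opHom_apply,
    Boson.antipode_of, MulOpposite.unop_op, vac_repV_of, vac_repV_of]
  simp

variable {θ : Module.End k YV.Nichols →ₗ[k] k} (hθ : ∀ g, θ (repV (Boson.of YV g)) = 0)
include hθ

lemma probe_of_tmul (g : Γ) (y) : probe YV θ (repV (Boson.of YV g) ⊗ₜ y) = 0 := by
  simp [probe, hθ]

omit hθ in
lemma probe_tmul_one (X) : probe YV θ (X ⊗ₜ 1) = θ X • 1 := by
  rw [Algebra.TensorProduct.one_def, probe_tmul, MulOpposite.unop_one]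
  simp [vac_apply]

/-- A form that vanishes on group elements sees only the first term of the coproduct `v ⊗ 1 + f ⊗
v`. -/
lemma probe_tripleV_b (i : I) : probe YV θ (tripleV YV (Boson.ι YV (L.DV.b i))) =
    θ (repV (Boson.ι YV (L.DV.b i))) • 1 := by
  rw [tripleV, IsLink.tensorHom_b, map_add, probe_of_tmul hθ, add_zero, probe_tmul_one]

lemma probe_tripleW_b (j : S) : probe YV θ (L.tripleW (Boson.ι YW (L.DW.b j))) =
    θ (L.repW (Boson.ι YW (L.DW.b j))) • 1 := by
  rw [tripleW, IsLink.tensorHom_b, map_add, L.isLink_rep.of_eq, probe_of_tmul hθ, add_zero,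
    probe_tmul_one]

omit hθ

/-- the form `X ↦ ε(∂ᵢ(X 1))` on `End(𝔅(V))` -/
def derForm (i : I) : Module.End k YV.Nichols →ₗ[k] k :=
  (Nichols.counit YV).toLinearMap ∘ₗ Nichols.der L.DV i ∘ₗ LinearMap.applyₗ 1

lemma derForm_apply (i : I) (X) :
    L.derForm i X = Nichols.counit YV (Nichols.der L.DV i (X 1)) := rfl

/-- the form `X ↦ ε(X vᵢ)` on `End(𝔅(V))` -/
def vecForm (i : I) : Module.End k YV.Nichols →ₗ[k] k :=
  (Nichols.counit YV).toLinearMap ∘ₗ LinearMap.applyₗ (Nichols.mk YV (TensorAlgebra.ι k (L.DV.b i)))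

lemma vecForm_apply (i : I) (X) : L.vecForm i X =
    Nichols.counit YV (X (Nichols.mk YV (TensorAlgebra.ι k (L.DV.b i)))) := rfl

lemma derForm_of (i : I) (g : Γ) : L.derForm i (repV (Boson.of YV g)) = 0 := by
  rw [derForm_apply, repV_of]; simp

lemma vecForm_of (i : I) (g : Γ) : L.vecForm i (repV (Boson.of YV g)) = 0 := by
  rw [vecForm_apply, repV_of]; simp

/-- Together with the next three lemmas: `derForm` detects the coordinates of `V` and ignores `W`,
while `vecForm` ignores `V` and detects the coordinates of `W` that are linked. -/
lemma derForm_v (i j : I) : L.derForm i (repV (Boson.ι YV (L.DV.b j))) = Finsupp.single j 1 i := by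
  rw [derForm_apply, repV_ι, Nichols.der_b_mul]; simp

lemma vecForm_v (i j : I) : L.vecForm i (repV (Boson.ι YV (L.DV.b j))) = 0 := by
  rw [vecForm_apply, repV_ι]; simp

lemma derForm_w (i : I) (j : S) : L.derForm i (L.repW (Boson.ι YW (L.DW.b j))) = 0 := by
  rw [derForm_apply, repW_b]; simp

/-- The operator `w_j` sends the vector `v_i` to the linking scalar, so this form reads off how
`w_j` is linked. -/
lemma vecForm_w (i : I) (j : S) : L.vecForm i (L.repW (Boson.ι YW (L.DW.b j))) =
    L.β j * Finsupp.single i 1 (L.s j) := by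
  have h := Nichols.der_b_mul L.DV (L.s j) i 1
  rw [mul_one] at h
  rw [vecForm_apply, repW_b, h]; simp

end LinkData

end YetterDrinfeld

/-! ### The indices outside `I_T` and uniqueness of `T` and `K`. -/

namespace DoubleData

open YetterDrinfeld

variable {k F G I : Type*} [Field k] [CommGroup F] [CommGroup G] (D : DoubleData k F G I)
  (T : Subgroup (F × G)) (hT : T ≤ D.C)

/-- the inclusion of the complement of `I_T` -/
def incCompl : ↥(D.IT T)ᶜ → I := Subtype.val

/-- the projection of `k^I` onto the complement of `k^(I_T)` -/
def resCompl : (I →₀ k) →ₗ[k] (↥(D.IT T)ᶜ →₀ k) := Finsupp.lsubtypeDomain (D.IT T)ᶜ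

lemma resCompl_apply (x : I →₀ k) (i : ↥(D.IT T)ᶜ) : D.resCompl T x i = x i := rfl

lemma resCompl_single (i : ↥(D.IT T)ᶜ) :
    D.resCompl T (Finsupp.single (D.incCompl T i) (1 : k)) = Finsupp.single i 1 := by
  classical
  ext j
  rw [resCompl_apply, Finsupp.single_apply, Finsupp.single_apply]
  exact if_congr Subtype.ext_iff.symm rfl rfl

lemma resCompl_single_of_mem {i : I} (hi : i ∈ D.IT T) :
    D.resCompl T (Finsupp.single i (1 : k)) = 0 := by
  ext j
  rw [resCompl_apply, Finsupp.single_eq_of_ne]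
  · rfl
  · rintro rfl
    exact j.2 hi

/-- Killing the vectors with index in `I_T` is compatible with the braiding, since each remaining
vector keeps its degree and character. -/
lemma isBraidedMap_resV :
    IsBraidedMap D.basisDV (D.subV T hT (D.incCompl T)) (D.resCompl T) := by
  intro j
  rw [basisDV, diagBasis_b]
  by_cases hj : j ∈ D.IT T
  · exact Or.inl (D.resCompl_single_of_mem T hj)
  refine Or.inr ⟨QuotientGroup.mk (D.f j, 1), ?_, ?_⟩
  · rw [show j = D.incCompl T ⟨j, hj⟩ from rfl, resCompl_single]
    exact diag_isHomog _ _ _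
  · refine Finsupp.lhom_ext' fun i => LinearMap.ext_ring ?_
    rw [LinearMap.comp_apply, LinearMap.comp_apply, LinearMap.comp_apply, LinearMap.comp_apply,
      Finsupp.lsingle_apply, show D.V.act _ _ = _ from diag_act_single _ _ _ _ _, map_smul]
    by_cases hi : i ∈ D.IT T
    · rw [D.resCompl_single_of_mem T hi, map_zero, smul_zero]
    · rw [show i = D.incCompl T ⟨i, hi⟩ from rfl, resCompl_single, subV, diag_act_single]
      simp [chi_apply, diagBasis]

lemma isBraidedMap_resW :
    IsBraidedMap D.basisDW (D.subW T hT (D.incCompl T)) (D.resCompl T) := by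
  intro j
  rw [basisDW, diagBasis_b]
  by_cases hj : j ∈ D.IT T
  · exact Or.inl (D.resCompl_single_of_mem T hj)
  refine Or.inr ⟨QuotientGroup.mk (1, D.g j), ?_, ?_⟩
  · rw [show j = D.incCompl T ⟨j, hj⟩ from rfl, resCompl_single]
    exact diag_isHomog _ _ _
  · refine Finsupp.lhom_ext' fun i => LinearMap.ext_ring ?_
    rw [LinearMap.comp_apply, LinearMap.comp_apply, LinearMap.comp_apply, LinearMap.comp_apply,
      Finsupp.lsingle_apply, show D.W.act _ _ = _ from diag_act_single _ _ _ _ _, map_smul]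
    by_cases hi : i ∈ D.IT T
    · rw [D.resCompl_single_of_mem T hi, map_zero, smul_zero]
    · rw [show i = D.incCompl T ⟨i, hi⟩ from rfl, resCompl_single, subW, diag_act_single]
      simp [chi_apply, diagBasis]

/-- the linking data for the indices outside `I_T` -/
def linkCompl : LinkData (D.subV T hT (D.incCompl T)) (D.subW T hT (D.incCompl T))
    ↥(D.IT T)ᶜ ↥(D.IT T)ᶜ :=
  D.linkData T hT (D.incCompl T) (D.incCompl T) id fun _ => rfl

section Lift

variable {R : Type*} [Ring R] [Algebra k R] {p : (D.subV T hT (D.incCompl T)).Boson →ₐ[k] R}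
  {q : (D.subW T hT (D.incCompl T)).Boson →ₐ[k] R} (h : (D.linkCompl T hT).IsLink 1 1 p q)

lemma linkCompl_link (i j : ↥(D.IT T)ᶜ) :
    (D.linkCompl T hT).link j i = Finsupp.single j (-1) i := rfl

/-- the restriction of a linked pair to `B` -/
def complB (p : (D.subV T hT (D.incCompl T)).Boson →ₐ[k] R) : D.B →ₐ[k] R :=
  Boson.lift ((p.comp (Boson.inc _)).comp
    (Nichols.map (D.isBraidedMap_resV T hT) (D.basisV T hT (D.incCompl T))))
    ((p : _ →* R).comp ((Boson.of _).comp ((QuotientGroup.mk' T).comp (MonoidHom.inl F G))))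
    (fun f x => by
      have h1 : ∀ x, ((p.comp (Boson.inc _)).comp
          (Nichols.map (D.isBraidedMap_resV T hT) (D.basisV T hT (D.incCompl T))))
            (Nichols.mk _ (TensorAlgebra.ι k x)) = p (Boson.ι _ (D.resCompl T x)) := fun x => by
        rw [AlgHom.comp_apply, Nichols.map_mk, mapT_ι]
        rfl
      simp only [h1]
      induction x using Finsupp.induction_linear with
      | zero => simp
      | add x y hx hy => simp only [map_add, add_mul, mul_add, hx, hy]
      | single i c =>
        rw [← Finsupp.smul_single_one]
        simp only [map_smul, smul_mul_assoc, mul_smul_comm]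
        congr 1
        rw [V, diag_act_single, map_smul, map_smul, map_smul, smul_mul_assoc]
        by_cases hi : i ∈ D.IT T
        · rw [D.resCompl_single_of_mem T hi]; simp
        · rw [show i = D.incCompl T ⟨i, hi⟩ from rfl, resCompl_single,
            ← D.basisV_b T hT (D.incCompl T)]
          change _ = p (Boson.of _ (QuotientGroup.mk (f, 1))) * _
          rw [← map_mul p, Boson.of_mul_ι_b, map_smul, map_mul, basisV_χ, chi_apply]
          simp)

/-- the restriction of a linked pair to `H` -/
def complH (q : (D.subW T hT (D.incCompl T)).Boson →ₐ[k] R) : D.H →ₐ[k] R :=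
  Boson.lift ((q.comp (Boson.inc _)).comp
    (Nichols.map (D.isBraidedMap_resW T hT) (D.basisW T hT (D.incCompl T))))
    ((q : _ →* R).comp ((Boson.of _).comp ((QuotientGroup.mk' T).comp (MonoidHom.inr F G))))
    (fun f x => by
      have h1 : ∀ x, ((q.comp (Boson.inc _)).comp
          (Nichols.map (D.isBraidedMap_resW T hT) (D.basisW T hT (D.incCompl T))))
            (Nichols.mk _ (TensorAlgebra.ι k x)) = q (Boson.ι _ (D.resCompl T x)) := fun x => by
        rw [AlgHom.comp_apply, Nichols.map_mk, mapT_ι]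
        rfl
      simp only [h1]
      induction x using Finsupp.induction_linear with
      | zero => simp
      | add x y hx hy => simp only [map_add, add_mul, mul_add, hx, hy]
      | single i c =>
        rw [← Finsupp.smul_single_one]
        simp only [map_smul, smul_mul_assoc, mul_smul_comm]
        congr 1
        rw [W, diag_act_single, map_smul, map_smul, map_smul, smul_mul_assoc]
        by_cases hi : i ∈ D.IT T
        · rw [D.resCompl_single_of_mem T hi]; simp
        · rw [show i = D.incCompl T ⟨i, hi⟩ from rfl, resCompl_single,
            ← D.basisW_b T hT (D.incCompl T)]
          change _ = q (Boson.of _ (QuotientGroup.mk (1, f))) * _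
          rw [← map_mul q, Boson.of_mul_ι_b, map_smul, map_mul, basisW_χ, chi_apply]
          simp)

lemma complB_ι (x : I →₀ k) : D.complB T hT p (Boson.ι D.V x) = p (Boson.ι _ (D.resCompl T x)) := by
  rw [complB, Boson.lift_ι, AlgHom.comp_apply, Nichols.map_mk, mapT_ι]
  rfl

lemma complH_ι (x : I →₀ k) : D.complH T hT q (Boson.ι D.W x) = q (Boson.ι _ (D.resCompl T x)) := by
  rw [complH, Boson.lift_ι, AlgHom.comp_apply, Nichols.map_mk, mapT_ι]
  rfl

lemma complB_of (f : F) :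
    D.complB T hT p (Boson.of D.V f) = p (Boson.of _ (QuotientGroup.mk (f, 1))) := by
  rw [complB, Boson.lift_of]
  rfl

lemma complH_of (g : G) :
    D.complH T hT q (Boson.of D.W g) = q (Boson.of _ (QuotientGroup.mk (1, g))) := by
  rw [complH, Boson.lift_of]
  rfl

include h in
-- For `i ∈ I_T` the linking term `f_i g_i - 1` is zero in `Γ`, so sending `v_i` and `w_i` to zero
-- is consistent with the relations of `𝒟`; for the other indices the relations are those of the
-- linked pair.
lemma crossRel_compl : D.CrossRel (D.complB T hT p) (D.complH T hT q) where
  gf f g := by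
    rw [ofB, ofH, complB_of, complH_of, h.of_eq, ← map_mul p, ← map_mul p, ← map_mul, ← map_mul,
      mul_comm]
  gv i g := by
    rw [ofH, vB, complB_ι, complH_of, h.of_eq]
    by_cases hi : i ∈ D.IT T
    · rw [D.resCompl_single_of_mem T hi]; simp
    · rw [show i = D.incCompl T ⟨i, hi⟩ from rfl, resCompl_single]
      have := LinkData.IsLink.of_mul_v (L := D.linkCompl T hT) (p := p)
        (QuotientGroup.mk (1, g)) ⟨i, hi⟩
      simpa [linkCompl, linkData, chi_apply] using this
  wf i f := by
    rw [ofB, wH, complH_ι, complB_of]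
    by_cases hi : i ∈ D.IT T
    · rw [D.resCompl_single_of_mem T hi]; simp
    · rw [show i = D.incCompl T ⟨i, hi⟩ from rfl, resCompl_single]
      have := h.w_mul_of (QuotientGroup.mk (f, 1)) ⟨i, hi⟩
      simpa [linkCompl, linkData, chi_apply] using this
  wv_ne i j hij := by
    rw [wH, vB, complH_ι, complB_ι]
    by_cases hi : i ∈ D.IT T
    · rw [D.resCompl_single_of_mem T hi]; simp
    by_cases hj : j ∈ D.IT T
    · rw [D.resCompl_single_of_mem T hj]; simp
    have hij' : (⟨j, hj⟩ : ↥(D.IT T)ᶜ) ≠ ⟨i, hi⟩ := fun e => hij (Subtype.ext_iff.1 e).symm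
    rw [show i = D.incCompl T ⟨i, hi⟩ from rfl, resCompl_single,
      show j = D.incCompl T ⟨j, hj⟩ from rfl, resCompl_single]
    have := h.link ⟨i, hi⟩ ⟨j, hj⟩
    rw [linkCompl_link, Finsupp.single_eq_of_ne' hij', zero_smul, add_zero] at this
    simpa [linkCompl, linkData, chi_apply] using this
  wv_eq i := by
    rw [wH, vB, ofB, ofH, complH_ι, complB_ι, complB_of, complH_of, h.of_eq, ← map_mul p, ← map_mul,
      ← QuotientGroup.mk_mul, Prod.mk_mul_mk, one_mul, mul_one]
    by_cases hi : i ∈ D.IT T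
    · rw [D.resCompl_single_of_mem T hi, (QuotientGroup.eq_one_iff _).2 hi]; simp
    · rw [show i = D.incCompl T ⟨i, hi⟩ from rfl, resCompl_single]
      have := h.link ⟨i, hi⟩ ⟨i, hi⟩
      rw [linkCompl_link, Finsupp.single_eq_same] at this
      simpa [linkCompl, linkData, chi_apply, ← QuotientGroup.mk_mul] using this

/-- the algebra map out of `𝒟` given by a linked pair for the indices outside `I_T` -/
def complLift : D.Double →ₐ[k] R := Double.lift _ _ (D.crossRel_compl T hT h)

lemma complLift_v (x : I →₀ k) :
    D.complLift T hT h (D.v x) = p (Boson.ι _ (D.resCompl T x)) := by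
  rw [complLift, v, LinearMap.comp_apply, AlgHom.toLinearMap_apply, Double.lift_inB, complB_ι]

lemma complLift_w (x : I →₀ k) :
    D.complLift T hT h (D.w x) = q (Boson.ι _ (D.resCompl T x)) := by
  rw [complLift, w, LinearMap.comp_apply, AlgHom.toLinearMap_apply, Double.lift_inH, complH_ι]

lemma complLift_grp (t : F × G) :
    D.complLift T hT h (D.grp t) = p (Boson.of _ (QuotientGroup.mk t)) := by
  rw [complLift, grp, map_mul, Double.lift_inB, Double.lift_inH, ofB, ofH, complB_of, complH_of,
    h.of_eq, ← map_mul p, ← map_mul, ← QuotientGroup.mk_mul, Prod.mk_mul_mk, one_mul, mul_one]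

end Lift

/-- the representation of `𝒟` on a triple tensor product -/
def complRep : D.Double →ₐ[k] LinkData.TripleAlg (D.subV T hT (D.incCompl T)) :=
  D.complLift T hT (D.linkCompl T hT).isLink_triple

/-- With the three lemmas that follow, this recovers the coordinates outside `I_T` of an element of
`V + W` from its image. -/
lemma complRep_v (x : I →₀ k) (i : ↥(D.IT T)ᶜ) :
    LinkData.probe _ ((D.linkCompl T hT).derForm i) (D.complRep T hT (D.v x)) =
      D.resCompl T x i • 1 := by
  rw [complRep, complLift_v]
  generalize D.resCompl T x = y
  induction y using Finsupp.induction_linear with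
  | zero => simp
  | add x y hx hy => simp only [map_add, hx, hy, Finsupp.add_apply, add_smul]
  | single j c =>
    rw [← Finsupp.smul_single_one]
    simp only [map_smul, Finsupp.smul_apply, smul_eq_mul, mul_smul]
    congr 1
    have h := (D.linkCompl T hT).probe_tripleV_b ((D.linkCompl T hT).derForm_of i) j
    rw [LinkData.derForm_v] at h
    rw [← h]
    congr 3

lemma complRep_v' (x : I →₀ k) (i : ↥(D.IT T)ᶜ) :
    LinkData.probe _ ((D.linkCompl T hT).vecForm i) (D.complRep T hT (D.v x)) = 0 := by
  rw [complRep, complLift_v]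
  generalize D.resCompl T x = y
  induction y using Finsupp.induction_linear with
  | zero => simp
  | add x y hx hy => simp only [map_add, hx, hy, add_zero]
  | single j c =>
    rw [← Finsupp.smul_single_one]
    simp only [map_smul]
    have h := (D.linkCompl T hT).probe_tripleV_b ((D.linkCompl T hT).vecForm_of i) j
    rw [LinkData.vecForm_v, zero_smul] at h
    rw [← smul_zero c, ← h]
    congr 4

lemma complRep_w' (x : I →₀ k) (i : ↥(D.IT T)ᶜ) :
    LinkData.probe _ ((D.linkCompl T hT).derForm i) (D.complRep T hT (D.w x)) = 0 := by
  rw [complRep, complLift_w]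
  generalize D.resCompl T x = y
  induction y using Finsupp.induction_linear with
  | zero => simp
  | add x y hx hy => simp only [map_add, hx, hy, add_zero]
  | single j c =>
    rw [← Finsupp.smul_single_one]
    simp only [map_smul]
    have h := (D.linkCompl T hT).probe_tripleW_b ((D.linkCompl T hT).derForm_of i) j
    rw [LinkData.derForm_w, zero_smul] at h
    rw [← smul_zero c, ← h]
    congr 4

lemma complRep_w (x : I →₀ k) (i : ↥(D.IT T)ᶜ) :
    LinkData.probe _ ((D.linkCompl T hT).vecForm i) (D.complRep T hT (D.w x)) =
      -(D.resCompl T x i • 1) := by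
  rw [complRep, complLift_w]
  generalize D.resCompl T x = y
  induction y using Finsupp.induction_linear with
  | zero => simp
  | add x y hx hy => simp only [map_add, hx, hy, Finsupp.add_apply, add_smul, neg_add]
  | single j c =>
    rw [← Finsupp.smul_single_one]
    simp only [map_smul, Finsupp.smul_apply, smul_eq_mul, mul_smul, ← smul_neg]
    congr 1
    have h := (D.linkCompl T hT).probe_tripleW_b ((D.linkCompl T hT).vecForm_of i) j
    rw [LinkData.vecForm_w] at h
    have h2 : (D.linkCompl T hT).β j * Finsupp.single i 1 ((D.linkCompl T hT).s j) =
        -(Finsupp.single j 1 i : k) := by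
      classical
      change (-1 : k) * Finsupp.single i 1 j = _
      rw [neg_one_mul, Finsupp.single_apply, Finsupp.single_apply]
      simp only [eq_comm]
    rw [h2, neg_smul] at h
    rw [smul_neg, ← h]
    congr 3

namespace ThinData

variable {D} (P : D.ThinData)

lemma resCompl_eq_zero {x : I →₀ k} (hx : x ∈ Finsupp.supported k k (D.IT P.T)) :
    D.resCompl P.T x = 0 := by
  rw [Finsupp.mem_supported'] at hx
  ext i
  exact hx i i.2

lemma complRep_eq_zero {x : D.Double} (hx : x ∈ P.ideal) : D.complRep P.T P.T_le x = 0 := by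
  refine P.map_eq_zero _ (fun t ht => ?_) (fun z => ?_) hx
  · rw [complRep, complLift_grp, (QuotientGroup.eq_one_iff t).2 ht, map_one, map_one]
  · rw [complRep, complLift_v, complLift_w, P.resCompl_eq_zero (P.Z_le z.2),
      P.resCompl_eq_zero (P.ζ_mem z), map_zero, map_zero, map_zero, map_zero]

/-- The representation kills the ideal, and the vacuum probe reads off the class of `t` in the group
algebra of `Γ`. -/
lemma mem_T_of_grp_sub_one_mem {t : F × G} (h : D.grp t - 1 ∈ P.ideal) : t ∈ P.T := by
  have h1 := P.complRep_eq_zero h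
  rw [map_sub, map_one, sub_eq_zero, complRep, complLift_grp] at h1
  have h2 := congrArg (LinkData.probe _ (LinkData.vac _)) h1
  rw [← map_one (LinkData.tripleV (D.subV P.T P.T_le (D.incCompl P.T))),
    ← map_one (Boson.of (D.subV P.T P.T_le (D.incCompl P.T))), LinkData.probe_vac_of,
    LinkData.probe_vac_of] at h2
  exact (QuotientGroup.eq_one_iff t).1 (MonoidAlgebra.of_injective h2)

/-- The two kinds of probes return the coordinates of `x` and of `y` at each index outside `I_T`. -/
lemma mem_supported_of_add_mem {x y : I →₀ k} (h : D.v x + D.w y ∈ P.ideal) :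
    x ∈ Finsupp.supported k k (D.IT P.T) ∧ y ∈ Finsupp.supported k k (D.IT P.T) := by
  have h1 := P.complRep_eq_zero h
  rw [map_add] at h1
  constructor
  · rw [Finsupp.mem_supported']
    intro i hi
    have h2 := congrArg (LinkData.probe _ ((D.linkCompl P.T P.T_le).derForm ⟨i, hi⟩)) h1
    rw [map_add, complRep_v, complRep_w', add_zero, map_zero] at h2
    exact (smul_eq_zero.1 h2).resolve_right one_ne_zero
  · rw [Finsupp.mem_supported']
    intro i hi
    have h2 := congrArg (LinkData.probe _ ((D.linkCompl P.T P.T_le).vecForm ⟨i, hi⟩)) h1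
    rw [map_add, complRep_w, complRep_v', zero_add, map_zero, neg_eq_zero] at h2
    exact (smul_eq_zero.1 h2).resolve_right one_ne_zero

/-- The coordinates outside `I_T` vanish by the triple tensor product, and those in `I_T` are
controlled by the square zero representation. -/
lemma mem_K_of_add_mem {x y : I →₀ k} (h : D.v x + D.w y ∈ P.ideal) : (x, y) ∈ P.K := by
  have h1 := P.mem_supported_of_add_mem h
  have h2 := P.projT₂_mem_K h
  rwa [projT₂, LinearMap.prodMap_apply, P.projT_eq h1.1, P.projT_eq h1.2] at h2

variable (D) in
/-- the trivial data `T = 1`, `Z = 0` -/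
def trivial : D.ThinData where
  T := ⊥
  T_le := bot_le
  Z := ⊥
  Z_le := bot_le
  Z_sub := ⟨by simp, fun x hx => by
    rw [(Submodule.mem_bot k).1 hx, map_zero]
    exact zero_mem _⟩
  ζ := 0
  ζ_mem := by simp
  ζ_injective := fun a b _ => Subsingleton.elim a b
  ζ_hom := isHom_zero

end ThinData

/-- Take the trivial data: its relation space `K` is zero, so no nonzero vector of `V` dies in `𝒟`.
-/
lemma v_injective : Function.Injective D.v := by
  rw [injective_iff_map_eq_zero]
  intro x hx
  obtain ⟨z, hz⟩ := (ThinData.trivial D).mem_K_of_add_mem (x := x) (y := 0) (by simp [hx])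
  have h1 : z = 0 := Subtype.ext ((Submodule.mem_bot k).1 z.2)
  rw [h1, map_zero] at hz
  exact (Prod.mk.inj hz).1.symm

lemma w_injective : Function.Injective D.w := by
  rw [injective_iff_map_eq_zero]
  intro x hx
  obtain ⟨z, hz⟩ := (ThinData.trivial D).mem_K_of_add_mem (x := 0) (y := x) (by simp [hx])
  have h1 : z = 0 := Subtype.ext ((Submodule.mem_bot k).1 z.2)
  rw [h1, map_zero] at hz
  exact (Prod.mk.inj hz).2.symm

end DoubleData

namespace DoubleData

open YetterDrinfeld

variable {k F G I : Type*} [Field k] [CommGroup F] [CommGroup G] (D : DoubleData k F G I)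

/-! ### The kernel of a thin Hopf algebra quotient -/

section Hom

variable {E : Type*} [Ring E] [Algebra k E] (p : D.Double →ₐ[k] E)

/-- the group of all `t` with `p(t) = 1` -/
def kerT : Subgroup (F × G) := ((p : D.Double →* E).comp D.grpHom).ker

lemma mem_kerT {t : F × G} : t ∈ D.kerT p ↔ p (D.grp t) = 1 := Iff.rfl

lemma mem_kerT' : ∀ t ∈ D.kerT p, p (D.grp t) = 1 := fun _ h => h

/-- the basis vectors of `V` and `W` in a quotient of `𝒟` -/
def gen : I ⊕ I → E :=
  Sum.elim (fun i => p (D.v (Finsupp.single i 1))) (fun i => p (D.w (Finsupp.single i 1)))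

/-- the index of a basis vector of `V` or `W` -/
def idx : I ⊕ I → I := Sum.elim id id

/-- the degree of a basis vector of `V ⊕ W` -/
def deg (T : Subgroup (F × G)) : I ⊕ I → (F × G) ⧸ T :=
  Sum.elim (fun i => QuotientGroup.mk (D.f i, 1)) (fun i => QuotientGroup.mk (1, D.g i))

/-- the character of a basis vector of `V ⊕ W` -/
def chr : I ⊕ I → (F × G →* kˣ) := Sum.elim D.chi (fun i => (D.chi i)⁻¹)

/-- the map from `V ⊕ W` to a quotient of `𝒟` -/
def comb : (I ⊕ I →₀ k) →ₗ[k] E := Finsupp.linearCombination k (D.gen p)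

/-- the isomorphism of `k^(I ⊕ I)` with `V ⊕ W` -/
def toPair : (I ⊕ I →₀ k) ≃ₗ[k] (I →₀ k) × (I →₀ k) := Finsupp.sumFinsuppLEquivProdFinsupp k

omit [CommGroup F] [CommGroup G] in
lemma toPair_inl (i : I) (c : k) :
    toPair (Finsupp.single (Sum.inl i) c) = (Finsupp.single i c, 0) := by
  classical
  refine Prod.ext (Finsupp.ext fun j => ?_) (Finsupp.ext fun j => ?_)
  · simp [toPair, Finsupp.fst_sumFinsuppLEquivProdFinsupp, Finsupp.single_apply]
  · simp [toPair, Finsupp.snd_sumFinsuppLEquivProdFinsupp, Finsupp.single_apply]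

omit [CommGroup F] [CommGroup G] in
lemma toPair_inr (i : I) (c : k) :
    toPair (Finsupp.single (Sum.inr i) c) = (0, Finsupp.single i c) := by
  classical
  refine Prod.ext (Finsupp.ext fun j => ?_) (Finsupp.ext fun j => ?_)
  · simp [toPair, Finsupp.fst_sumFinsuppLEquivProdFinsupp, Finsupp.single_apply]
  · simp [toPair, Finsupp.snd_sumFinsuppLEquivProdFinsupp, Finsupp.single_apply]

lemma comb_eq (z : I ⊕ I →₀ k) :
    D.comb p z = p (D.v (toPair z).1) + p (D.w (toPair z).2) := by
  induction z using Finsupp.induction_linear with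
  | zero => simp
  | add x y hx hy =>
    rw [map_add, hx, hy, map_add, Prod.fst_add, Prod.snd_add]
    simp only [map_add]
    abel
  | single l c =>
    rw [comb, Finsupp.linearCombination_single, ← Finsupp.smul_single_one, map_smul, Prod.smul_fst,
      Prod.smul_snd]
    simp only [map_smul, ← smul_add]
    congr 1
    rcases l with i | i
    · rw [toPair_inl]; simp [gen]
    · rw [toPair_inr]; simp [gen]

lemma grp_mul_gen (t : F × G) (l : I ⊕ I) :
    p (D.grp t) * D.gen p l = (D.chr l t : k) • (D.gen p l * p (D.grp t)) := by
  rcases l with i | i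
  · change p _ * p _ = _ • (p _ * p _)
    rw [← map_mul, grp_mul_v_single, map_smul, map_mul]
    rfl
  · change p _ * p _ = _ • (p _ * p _)
    rw [← map_mul, grp_mul_w_single, map_smul, map_mul]
    rfl

variable {D p} in
-- If `t` becomes `1`, then `v_i = χ_i(t) v_i` in the quotient; as `v_i` survives there, `χ_i(t) =
-- 1`.
lemma kerT_le (hV : ∀ x, p (D.v x) = 0 → x = 0) : D.kerT p ≤ D.C := by
  intro t ht
  rw [C, Subgroup.mem_iInf]
  intro i
  have h := D.grp_mul_gen p t (Sum.inl i)
  rw [(D.mem_kerT p).1 ht, one_mul, mul_one] at h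
  have h1 : p (D.v (Finsupp.single i ((1 : k) - (D.chi i t : k)))) = 0 := by
    rw [← Finsupp.smul_single_one, map_smul, map_smul, sub_smul, one_smul, sub_eq_zero]
    exact h
  have h2 := hV _ h1
  rw [Finsupp.single_eq_zero, sub_eq_zero] at h2
  exact Units.ext h2.symm

variable {D p} in
-- Conjugating a relation by `F × G` scales its terms by their characters, and distinct characters
-- are independent.
lemma comb_filter_chr {z : I ⊕ I →₀ k} (hz : D.comb p z = 0) (ψ : F × G →* kˣ)
    [DecidablePred fun l => D.chr l = ψ] :
    D.comb p (z.filter fun l => D.chr l = ψ) = 0 := by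
  have h : ∀ t, ∑ l ∈ z.support, (D.chr l t : k) • z l • D.gen p l = 0 := by
    intro t
    have h1 : p (D.grp t) * D.comb p z =
        (∑ l ∈ z.support, (D.chr l t : k) • z l • D.gen p l) * p (D.grp t) := by
      rw [comb, Finsupp.linearCombination_apply, Finsupp.sum, Finset.mul_sum, Finset.sum_mul]
      refine Finset.sum_congr rfl fun l _ => ?_
      rw [mul_smul_comm, grp_mul_gen, smul_mul_assoc, smul_mul_assoc, smul_comm]
    rw [hz, mul_zero] at h1
    have h2 := congr($h1 * p (D.grp t⁻¹))
    rw [zero_mul, mul_assoc, ← map_mul, ← grp_mul, mul_inv_cancel, grp_one, map_one, mul_one] at h2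
    exact h2.symm
  have h3 := sum_filter_char_eq_zero h ψ
  rw [comb, Finsupp.linearCombination_apply, Finsupp.sum, Finsupp.support_filter]
  refine Eq.trans (Finset.sum_congr rfl fun l hl => ?_) h3
  rw [Finsupp.filter_apply, if_pos (Finset.mem_filter.1 hl).2]

variable {D p}

lemma wv_ne (i j : I) (hij : i ≠ j) : D.gen p (Sum.inr j) * D.gen p (Sum.inl i) =
    (D.τ₀ (D.f i) (D.g j) : k) • (D.gen p (Sum.inl i) * D.gen p (Sum.inr j)) := by
  change p _ * p _ = _ • (p _ * p _)
  rw [← map_mul, w_single, v_single, (Double.crossRel D).wv_ne i j hij, map_smul, map_mul]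

lemma wv_eq (i : I) : D.gen p (Sum.inr i) * D.gen p (Sum.inl i) =
    (D.τ₀ (D.f i) (D.g i) : k) • (D.gen p (Sum.inl i) * D.gen p (Sum.inr i)) +
      (p (D.grp (D.f i, D.g i)) - 1) := by
  change p _ * p _ = _ • (p _ * p _) + _
  rw [← map_mul, w_single, v_single, (Double.crossRel D).wv_eq i, map_add, map_smul, map_mul,
    map_sub, map_one, grp_mk]

/-- Holds already in `𝔅(V)`, by the commutation of vectors with trivial double braiding. -/
lemma vv_comm (i j : I) (h : (D.τ₀ (D.f i) (D.g j) : k) * D.τ₀ (D.f j) (D.g i) = 1) :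
    D.gen p (Sum.inl i) * D.gen p (Sum.inl j) =
      (D.τ₀ (D.f i) (D.g j) : k) • (D.gen p (Sum.inl j) * D.gen p (Sum.inl i)) := by
  have h1 := Boson.ι_mul_ι D.basisDV i j h
  have h2 := congr(p (Double.inB D $h1))
  simp only [map_mul, map_smul, basisDV, diagBasis_b] at h2
  exact h2

lemma ww_comm (i j : I) (h : (D.τ₀ (D.f i) (D.g j) : k) * D.τ₀ (D.f j) (D.g i) = 1) :
    D.gen p (Sum.inr i) * D.gen p (Sum.inr j) =
      ((D.τ₀ (D.f j) (D.g i))⁻¹ : kˣ).val • (D.gen p (Sum.inr j) * D.gen p (Sum.inr i)) := by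
  have h3 : (((D.τ₀ (D.f j) (D.g i))⁻¹ : kˣ) : k) * ((D.τ₀ (D.f i) (D.g j))⁻¹ : kˣ) = 1 := by
    rw [← Units.val_mul, ← mul_inv, Units.val_inv_eq_inv_val, Units.val_mul, mul_comm, h, inv_one]
  have h1 := Boson.ι_mul_ι D.basisDW i j h3
  have h2 := congr(p (Double.inH D $h1))
  simp only [map_mul, map_smul, basisDW, diagBasis_b] at h2
  exact h2

/-- Elements with the same class differ by an element of `T ⊆ C`, on which all characters are
trivial. Equal degrees in `Γ` therefore give equalities between values of `τ₀`. -/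
lemma chi_eq_of_mk_eq (hT : D.kerT p ≤ D.C) {s t : F × G}
    (h : (QuotientGroup.mk s : (F × G) ⧸ D.kerT p) = QuotientGroup.mk t) (i : I) :
    D.chi i s = D.chi i t := by
  have := D.chi_eq_one (hT (QuotientGroup.eq.1 h)) i
  rwa [map_mul, map_inv, inv_mul_eq_one] at this

/-- The relations `z ∈ V ⊕ W` of one degree and one character involve only basis vectors with
indices in `I_T`. -/
lemma mem_kerT_of_homog (hT : D.kerT p ≤ D.C) {z : I ⊕ I →₀ k} (hz : D.comb p z = 0)
    {g : (F × G) ⧸ D.kerT p} {ψ : F × G →* kˣ}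
    (h : ∀ l ∈ z.support, D.deg (D.kerT p) l = g ∧ D.chr l = ψ) {l : I ⊕ I} (hl : l ∈ z.support) :
    (D.f (idx l), D.g (idx l)) ∈ D.kerT p := by
  have hsum : D.comb p z = ∑ m ∈ z.support, z m • D.gen p m := by
    rw [comb, Finsupp.linearCombination_apply, Finsupp.sum]
  have key : ∀ {x : E}, z l • (x - 1) = 0 → x = 1 := fun {x} hx => by
    rw [← sub_eq_zero]
    exact (smul_eq_zero.1 hx).resolve_left (Finsupp.mem_support_iff.1 hl)
  rw [mem_kerT]
  have hc : ∀ m ∈ z.support, ∀ t, D.chr m t = D.chr l t := fun m hm t => by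
    rw [(h m hm).2, (h l hl).2]
  have hd : ∀ m ∈ z.support, D.deg (D.kerT p) m = D.deg (D.kerT p) l := fun m hm => by
    rw [(h m hm).1, (h l hl).1]
  rcases l with l | l
  · apply key
    -- The braided commutator of the relation with the partner `w_l`: it vanishes because the
    -- relation does, and only the term with index `l` contributes, through its linking term `f_l
    -- g_l - 1`.
    have e : ∑ m ∈ z.support, z m • (D.gen p (Sum.inr l) * D.gen p m -
        (D.τ₀ (D.f l) (D.g l) : k) • (D.gen p m * D.gen p (Sum.inr l))) = 0 := by
      have : ∑ m ∈ z.support, z m • (D.gen p (Sum.inr l) * D.gen p m -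
          (D.τ₀ (D.f l) (D.g l) : k) • (D.gen p m * D.gen p (Sum.inr l))) =
          D.gen p (Sum.inr l) * D.comb p z -
            (D.τ₀ (D.f l) (D.g l) : k) • (D.comb p z * D.gen p (Sum.inr l)) := by
        rw [hsum, Finset.mul_sum, Finset.sum_mul, Finset.smul_sum, ← Finset.sum_sub_distrib]
        refine Finset.sum_congr rfl fun m _ => ?_
        rw [smul_sub, mul_smul_comm, smul_mul_assoc, smul_comm]
      rw [this, hz, mul_zero, zero_mul, smul_zero, sub_zero]
    rw [Finset.sum_eq_single_of_mem _ hl] at e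
    · rw [wv_eq, add_sub_cancel_left] at e
      exact e
    · intro m hm hml
      rw [sub_eq_zero.2, smul_zero]
      rcases m with i | j
      -- For another `v_i` the equality of characters at `g_l` gives the same commutation scalar as
      -- for `v_l`.
      · have h1 := hc _ hm (1, D.g l)
        simp only [chr, Sum.elim_inl, chi_apply, map_one, MonoidHom.one_apply, one_mul] at h1
        rw [wv_ne i l (fun e => hml (by rw [e])), h1]
      -- For a `w_j`, equal degrees and equal characters show that `w_l` and `w_j` have trivial
      -- double braiding, so they commute up to the required scalar.
      · have h1 := hc _ hm (1, D.g l)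
        simp only [chr, Sum.elim_inl, Sum.elim_inr, MonoidHom.inv_apply, chi_apply, map_one,
          MonoidHom.one_apply, one_mul] at h1
        have h2 := chi_eq_of_mk_eq hT (hd _ hm) l
        simp only [chi_apply, map_one, MonoidHom.one_apply, one_mul, mul_one] at h2
        rw [ww_comm, h1]
        rw [h2, ← h1, ← Units.val_mul, inv_mul_cancel, Units.val_one]
  · apply key
    -- The same argument with the partner `v_l` on the other side.
    have e : ∑ m ∈ z.support, z m • (D.gen p m * D.gen p (Sum.inl l) -
        (D.τ₀ (D.f l) (D.g l) : k) • (D.gen p (Sum.inl l) * D.gen p m)) = 0 := by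
      have : ∑ m ∈ z.support, z m • (D.gen p m * D.gen p (Sum.inl l) -
          (D.τ₀ (D.f l) (D.g l) : k) • (D.gen p (Sum.inl l) * D.gen p m)) =
          D.comb p z * D.gen p (Sum.inl l) -
            (D.τ₀ (D.f l) (D.g l) : k) • (D.gen p (Sum.inl l) * D.comb p z) := by
        rw [hsum, Finset.mul_sum, Finset.sum_mul, Finset.smul_sum, ← Finset.sum_sub_distrib]
        refine Finset.sum_congr rfl fun m _ => ?_
        rw [smul_sub, mul_smul_comm, smul_mul_assoc, smul_comm]
      rw [this, hz, mul_zero, zero_mul, smul_zero, sub_zero]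
    rw [Finset.sum_eq_single_of_mem _ hl] at e
    · rw [wv_eq, add_sub_cancel_left] at e
      exact e
    · intro m hm hml
      rw [sub_eq_zero.2, smul_zero]
      rcases m with i | j
      · have h1 := hc _ hm (D.f l, 1)
        simp only [chr, Sum.elim_inl, Sum.elim_inr, MonoidHom.inv_apply, chi_apply, map_one,
          mul_one] at h1
        have h2 := chi_eq_of_mk_eq hT (hd _ hm) l
        simp only [chi_apply, map_one, MonoidHom.one_apply, one_mul, mul_one] at h2
        rw [vv_comm, h2]
        rw [h1, h2, ← Units.val_mul, mul_inv_cancel, Units.val_one]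
      · have h1 := hc _ hm (D.f l, 1)
        simp only [chr, Sum.elim_inr, MonoidHom.inv_apply, chi_apply, map_one,
          mul_one, inv_inj] at h1
        rw [wv_ne l j (fun e => hml (by rw [e])), h1]

end Hom

section Bialg

lemma smul_tmul_add_tmul {k M N : Type*} [CommRing k] [AddCommGroup M] [Module k M] [AddCommGroup N]
    [Module k N] (c : k) (x : M) (y : N) (x' : M) (y' : N) :
    c • (x ⊗ₜ[k] y + x' ⊗ₜ[k] y') = (c • x) ⊗ₜ[k] y + x' ⊗ₜ[k] (c • y') := by
  rw [smul_add, TensorProduct.smul_tmul', TensorProduct.tmul_smul]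


variable {D} {E : Type*} [Ring E] [Bialgebra k E] {p : D.Double →ₐ[k] E}
  (hΔ : ∀ x, Coalgebra.comul (R := k) (p x) =
    Algebra.TensorProduct.map p p (Coalgebra.comul (R := k) x))
  (hε : ∀ x, Coalgebra.counit (R := k) (p x) = Coalgebra.counit (R := k) x)

include hΔ in
lemma comul_gen (l : I ⊕ I) : Coalgebra.comul (R := k) (D.gen p l) =
    D.gen p l ⊗ₜ 1 + D.mapΓ (D.kerT p) p (D.mem_kerT' p) (D.deg (D.kerT p) l) ⊗ₜ D.gen p l := by
  rcases l with i | j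
  · simp [gen, hΔ, comul_v_single, deg]
  · simp [gen, hΔ, comul_w_single, deg]

include hΔ hε in
-- The coproduct of a relation `z` is `z ⊗ 1` plus terms with the degree in the first tensorand. The
-- former vanishes, and independence of grouplikes separates the latter by degree.
lemma comb_filter_deg {z : I ⊕ I →₀ k} (hz : D.comb p z = 0) (g : (F × G) ⧸ D.kerT p)
    [DecidablePred fun l => D.deg (D.kerT p) l = g] :
    D.comb p (z.filter fun l => D.deg (D.kerT p) l = g) = 0 := by
  have hsum : D.comb p z = ∑ m ∈ z.support, z m • D.gen p m := by
    rw [comb, Finsupp.linearCombination_apply, Finsupp.sum]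
  have h : ∑ l ∈ z.support, D.mapΓ (D.kerT p) p (D.mem_kerT' p) (D.deg (D.kerT p) l) ⊗ₜ[k]
      (z l • D.gen p l) = 0 := by
    have h1 := congrArg (Coalgebra.comul (R := k)) hz
    have h2 : ∀ l, Coalgebra.comul (R := k) (z l • D.gen p l) = (z l • D.gen p l) ⊗ₜ[k] 1 +
        D.mapΓ (D.kerT p) p (D.mem_kerT' p) (D.deg (D.kerT p) l) ⊗ₜ[k] (z l • D.gen p l) := by
      intro l
      rw [map_smul, comul_gen hΔ, smul_tmul_add_tmul]
    rw [hsum, map_sum, map_zero, Finset.sum_congr rfl fun l _ => h2 l, Finset.sum_add_distrib,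
      ← TensorProduct.sum_tmul, ← hsum, hz, TensorProduct.zero_tmul, zero_add] at h1
    exact h1
  have hb := D.linearIndependent_mapΓ (D.kerT p) p (D.mem_kerT' p) hΔ hε fun _ h => h
  have h3 := sum_filter_tmul_eq_zero (γ := D.deg (D.kerT p)) (y := fun l => z l • D.gen p l) hb h g
  rw [comb, Finsupp.linearCombination_apply, Finsupp.sum, Finsupp.support_filter]
  refine Eq.trans (Finset.sum_congr rfl fun l hl => ?_) h3
  rw [Finsupp.filter_apply, if_pos (Finset.mem_filter.1 hl).2]

include hΔ hε in
/-- The relations in `V ⊕ W` are sums of relations of one degree and one character. -/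
lemma comb_induction {Q : (I ⊕ I →₀ k) → Prop} (zero : Q 0) (add : ∀ x y, Q x → Q y → Q (x + y))
    (hom : ∀ z g ψ, D.comb p z = 0 →
      (∀ l ∈ z.support, D.deg (D.kerT p) l = g ∧ D.chr l = ψ) → Q z)
    {z : I ⊕ I →₀ k} (hz : D.comb p z = 0) : Q z := by
  classical
  -- Peel off the part with the degree and character of one basis vector in the support. This part
  -- is again a relation, and removing it shrinks the support.
  induction hn : z.support.card using Nat.strong_induction_on generalizing z with
  | _ n ih =>
    by_cases h0 : z = 0
    · rw [h0]; exact zero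
    obtain ⟨l, hl⟩ := Finsupp.support_nonempty_iff.2 h0
    set z₁ := (z.filter fun m => D.deg (D.kerT p) m = D.deg (D.kerT p) l).filter
      fun m => D.chr m = D.chr l with hz₁
    have h1 : D.comb p z₁ = 0 := comb_filter_chr (comb_filter_deg hΔ hε hz _) _
    have h2 : z₁ l = z l := by
      rw [hz₁, Finsupp.filter_apply, if_pos rfl, Finsupp.filter_apply, if_pos rfl]
    have h3 : (z - z₁).support ⊆ z.support.erase l := by
      intro m hm
      rw [Finset.mem_erase, Finsupp.mem_support_iff]
      rw [Finsupp.mem_support_iff, Finsupp.sub_apply] at hm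
      constructor
      · rintro rfl
        exact hm (by rw [h2, sub_self])
      · intro h
        apply hm
        have : z₁ m = 0 := by
          rw [hz₁, Finsupp.filter_apply, Finsupp.filter_apply, h]
          simp
        rw [h, this, sub_zero]
    have h4 : (z - z₁).support.card < n := by
      rw [← hn]
      exact (Finset.card_le_card h3).trans_lt (Finset.card_erase_lt_of_mem hl)
    have h5 : Q (z - z₁) := ih _ h4 (by rw [map_sub, hz, h1, sub_zero]) rfl
    have h6 : Q z₁ := hom z₁ (D.deg (D.kerT p) l) (D.chr l) h1 fun m hm => by
      rw [hz₁, Finsupp.support_filter, Finsupp.support_filter, Finset.mem_filter,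
        Finset.mem_filter] at hm
      exact ⟨hm.1.2, hm.2⟩
    have := add _ _ h6 h5
    rwa [add_sub_cancel] at this

end Bialg

end DoubleData

/-! ### The data `T`, `Z`, `ζ` of a thin quotient. -/

namespace YetterDrinfeld

variable {k Γ κ : Type*} [Field k] [CommGroup Γ]

lemma isHomog_diag_of_support {χ : κ → (Γ →* kˣ)} {γ : κ → Γ} {x : κ →₀ k} {g : Γ}
    (h : ∀ i ∈ x.support, γ i = g) : (diag χ γ).IsHomog g x := by
  have h1 : (diag χ γ).coact x =
      x.sum fun i c => MonoidAlgebra.single (γ i) 1 ⊗ₜ[k] Finsupp.single i c := rfl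
  have h2 : ∑ i ∈ x.support, Finsupp.single i (x i) = x := x.sum_single
  rw [IsHomog, h1, Finsupp.sum]
  conv_rhs => rw [← h2]
  rw [TensorProduct.tmul_sum]
  exact Finset.sum_congr rfl fun i hi => by rw [h i hi]

lemma restrict_isHomog {M : Type*} [AddCommGroup M] [Module k M] {Y : YetterDrinfeld k Γ M}
    {N : Submodule k M} {hN : Y.IsSubobject N} {g : Γ} {x : N} (hx : Y.IsHomog g (x : M)) :
    (Y.restrict N hN).IsHomog g x := by
  apply lTensor_subtype_injective
  refine (Y.lTensor_restrictCoact N hN x).trans ?_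
  rw [LinearMap.lTensor_tmul]
  exact hx

end YetterDrinfeld

namespace DoubleData

open YetterDrinfeld

variable {k F G I : Type*} [Field k] [CommGroup F] [CommGroup G] {D : DoubleData k F G I}

section Hom

variable {E : Type*} [Ring E] [Algebra k E] (p : D.Double →ₐ[k] E)

/-- the relations in `V ⊕ W` that hold in a quotient of `𝒟` -/
def kerK : Submodule k ((I →₀ k) × (I →₀ k)) :=
  LinearMap.ker ((p.toLinearMap ∘ₗ D.v).coprod (p.toLinearMap ∘ₗ D.w))

lemma mem_kerK {x : (I →₀ k) × (I →₀ k)} : x ∈ kerK p ↔ p (D.v x.1) + p (D.w x.2) = 0 := Iff.rfl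

variable {p}

lemma grp_mul_v (T : Subgroup (F × G)) (hT : T ≤ D.C) (t : F × G) (x : I →₀ k) :
    D.grp t * D.v x = D.v ((D.VΓ T hT).act (QuotientGroup.mk t) x) * D.grp t := by
  induction x using Finsupp.induction_linear with
  | zero => simp
  | add x y hx hy => simp only [map_add, mul_add, add_mul, hx, hy]
  | single i c =>
    rw [← Finsupp.smul_single_one]
    simp only [map_smul, mul_smul_comm, smul_mul_assoc]
    rw [VΓ, diag_act_single, map_smul, grp_mul_v_single, smul_mul_assoc]
    rfl

lemma grp_mul_w (T : Subgroup (F × G)) (hT : T ≤ D.C) (t : F × G) (x : I →₀ k) :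
    D.grp t * D.w x = D.w ((D.WΓ T hT).act (QuotientGroup.mk t) x) * D.grp t := by
  induction x using Finsupp.induction_linear with
  | zero => simp
  | add x y hx hy => simp only [map_add, mul_add, add_mul, hx, hy]
  | single i c =>
    rw [← Finsupp.smul_single_one]
    simp only [map_smul, mul_smul_comm, smul_mul_assoc]
    rw [WΓ, diag_act_single, map_smul, grp_mul_w_single, smul_mul_assoc]
    rfl

/-- Conjugation by a grouplike preserves relations. -/
lemma act_mem_kerK (T : Subgroup (F × G)) (hT : T ≤ D.C) (g : (F × G) ⧸ T) {x y : I →₀ k}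
    (h : (x, y) ∈ kerK p) : ((D.VΓ T hT).act g x, (D.WΓ T hT).act g y) ∈ kerK p := by
  induction g using QuotientGroup.induction_on with
  | H t =>
    rw [mem_kerK] at h ⊢
    have h1 : (p (D.v ((D.VΓ T hT).act (QuotientGroup.mk t) x)) +
        p (D.w ((D.WΓ T hT).act (QuotientGroup.mk t) y))) * p (D.grp t) = 0 := by
      rw [add_mul, ← map_mul, ← map_mul, ← grp_mul_v, ← grp_mul_w, map_mul, map_mul, ← mul_add, h,
        mul_zero]
    have h2 := congr($h1 * p (D.grp t⁻¹))
    rwa [zero_mul, mul_assoc, ← map_mul, ← grp_mul, mul_inv_cancel, grp_one, map_one, mul_one] at h2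

end Hom

section Bialg

variable {E : Type*} [Ring E] [Bialgebra k E] {p : D.Double →ₐ[k] E}
  (hΔ : ∀ x, Coalgebra.comul (R := k) (p x) =
    Algebra.TensorProduct.map p p (Coalgebra.comul (R := k) x))
  (hε : ∀ x, Coalgebra.counit (R := k) (p x) = Coalgebra.counit (R := k) x)
  (hV : ∀ x, p (D.v x) = 0 → x = 0) (hW : ∀ x, p (D.w x) = 0 → x = 0)

omit [CommGroup F] [CommGroup G] in
lemma mem_support_toPair_fst {z : I ⊕ I →₀ k} {i : I} (h : i ∈ (toPair z).1.support) :
    Sum.inl i ∈ z.support := by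
  rw [Finsupp.mem_support_iff] at h ⊢
  exact h

omit [CommGroup F] [CommGroup G] in
lemma mem_support_toPair_snd {z : I ⊕ I →₀ k} {i : I} (h : i ∈ (toPair z).2.support) :
    Sum.inr i ∈ z.support := by
  rw [Finsupp.mem_support_iff] at h ⊢
  exact h

include hΔ hε in
-- The relations are generated by homogeneous ones, and those are supported on `I_T` by
-- `mem_kerT_of_homog`. Support, degrees and colinearity of `ζ` are all proved through this
-- principle.
lemma kerK_induction (hT : D.kerT p ≤ D.C) {Q : (I →₀ k) × (I →₀ k) → Prop} (zero : Q 0)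
    (add : ∀ x y, Q x → Q y → Q (x + y))
    (hom : ∀ x g, x ∈ kerK p → x.1 ∈ Finsupp.supported k k (D.IT (D.kerT p)) →
      x.2 ∈ Finsupp.supported k k (D.IT (D.kerT p)) → (D.VΓ (D.kerT p) hT).IsHomog g x.1 →
      (D.WΓ (D.kerT p) hT).IsHomog g x.2 → Q x) {x} (hx : x ∈ kerK p) : Q x := by
  obtain ⟨z, rfl⟩ := toPair.surjective x
  rw [mem_kerK, ← comb_eq] at hx
  refine comb_induction (Q := fun z => Q (toPair z)) hΔ hε ?_ (fun x y hx hy => ?_)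
    (fun z g ψ hz h => ?_) hx
  · rw [map_zero]; exact zero
  · rw [map_add]; exact add _ _ hx hy
  · have key : ∀ l ∈ z.support, (D.f (idx l), D.g (idx l)) ∈ D.kerT p :=
      fun l hl => mem_kerT_of_homog hT hz h hl
    refine hom _ g ?_ ?_ ?_ ?_ ?_
    · rw [mem_kerK, ← comb_eq, hz]
    · rw [Finsupp.mem_supported]
      exact fun i hi => key (Sum.inl i) (mem_support_toPair_fst hi)
    · rw [Finsupp.mem_supported]
      exact fun i hi => key (Sum.inr i) (mem_support_toPair_snd hi)
    · exact isHomog_diag_of_support fun i hi => (h (Sum.inl i) (mem_support_toPair_fst hi)).1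
    · exact isHomog_diag_of_support fun i hi => (h (Sum.inr i) (mem_support_toPair_snd hi)).1

/-- the projection of the relations in `V ⊕ W` to `V` -/
def kerFst (p : D.Double →ₐ[k] E) : kerK p →ₗ[k] (I →₀ k) := LinearMap.fst k _ _ ∘ₗ (kerK p).subtype

variable {hV hW}

include hW in
-- A relation with trivial `V`-part is an element of `W` that dies in the quotient, hence zero.
lemma kerFst_injective : Function.Injective (kerFst p) := by
  rw [injective_iff_map_eq_zero]
  rintro ⟨⟨x, y⟩, h⟩ h1
  replace h1 : x = 0 := h1
  subst h1
  rw [mem_kerK] at h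
  simp only [map_zero, zero_add] at h
  rw [Subtype.ext_iff]
  exact Prod.ext rfl (hW y h)

variable (hW) in
/-- the map `ζ` of a thin quotient of `𝒟` -/
def kerζ : LinearMap.range (kerFst p) →ₗ[k] (I →₀ k) :=
  -(LinearMap.snd k _ _ ∘ₗ (kerK p).subtype ∘ₗ
    (LinearEquiv.ofInjective (kerFst p) (kerFst_injective (hW := hW))).symm.toLinearMap)

lemma mk_neg_kerζ_mem (z : LinearMap.range (kerFst p)) :
    ((z : I →₀ k), -kerζ hW z) ∈ kerK p := by
  set y := (LinearEquiv.ofInjective (kerFst p) (kerFst_injective (hW := hW))).symm z with hy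
  have h1 : y.1.1 = z := by
    have := (LinearEquiv.ofInjective (kerFst p) (kerFst_injective (hW := hW))).apply_symm_apply z
    exact congrArg Subtype.val this
  have h2 : -kerζ hW z = y.1.2 := by
    rw [kerζ, LinearMap.neg_apply, neg_neg]
    rfl
  rw [h2, ← h1]
  exact y.2

/-- Two relations with the same `V`-part differ by an element of `W` that dies in the quotient, so
the `W`-part is determined by the `V`-part. -/
lemma exists_of_mem_kerK {x : (I →₀ k) × (I →₀ k)} (h : x ∈ kerK p) :
    ∃ hx : x.1 ∈ LinearMap.range (kerFst p), kerζ hW ⟨x.1, hx⟩ = -x.2 := by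
  refine ⟨⟨⟨x, h⟩, rfl⟩, ?_⟩
  have h1 := sub_mem h (mk_neg_kerζ_mem (hW := hW) ⟨x.1, ⟨⟨x, h⟩, rfl⟩⟩)
  rw [mem_kerK, Prod.fst_sub, Prod.snd_sub, sub_self, map_zero, map_zero, zero_add] at h1
  have h2 := hW _ h1
  rw [sub_neg_eq_add] at h2
  exact eq_neg_of_add_eq_zero_right h2

include hΔ hε in
lemma isSubobject_range (hT : D.kerT p ≤ D.C) :
    (D.VΓ (D.kerT p) hT).IsSubobject (LinearMap.range (kerFst p)) where
  act_mem g := by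
    rintro _ ⟨⟨⟨x, y⟩, h⟩, rfl⟩
    exact ⟨⟨_, act_mem_kerK _ hT g h⟩, rfl⟩
  coact_mem := by
    rintro _ ⟨⟨x, h⟩, rfl⟩
    change (D.VΓ (D.kerT p) hT).coact x.1 ∈ _
    refine kerK_induction (Q := fun x => (D.VΓ (D.kerT p) hT).coact x.1 ∈ LinearMap.range
      ((LinearMap.range (kerFst p)).subtype.lTensor _)) hΔ hε hT ?_ (fun x y hx hy => ?_)
      (fun x g hx h1 h2 h3 h4 => ?_) h
    · rw [Prod.fst_zero, map_zero]; exact zero_mem _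
    · rw [Prod.fst_add, map_add]; exact add_mem hx hy
    · rw [h3]
      exact ⟨MonoidAlgebra.single g 1 ⊗ₜ ⟨x.1, ⟨⟨x, hx⟩, rfl⟩⟩, rfl⟩

variable (hV hW) in
/-- the data `T`, `Z`, `ζ` of a thin Hopf algebra quotient of `𝒟` -/
def thinData : D.ThinData where
  T := D.kerT p
  T_le := kerT_le hV
  Z := LinearMap.range (kerFst p)
  Z_le := by
    rintro _ ⟨⟨x, h⟩, rfl⟩
    change x.1 ∈ _
    exact kerK_induction (Q := fun x => x.1 ∈ Finsupp.supported k k (D.IT (D.kerT p))) hΔ hε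
      (kerT_le hV) (zero_mem _) (fun x y hx hy => add_mem hx hy) (fun x g hx h1 h2 h3 h4 => h1) h
  Z_sub := isSubobject_range hΔ hε (kerT_le hV)
  ζ := kerζ hW
  ζ_mem := by
    rintro ⟨_, ⟨x, h⟩, rfl⟩
    obtain ⟨hx, h1⟩ := exists_of_mem_kerK (hW := hW) h
    refine (congrArg (· ∈ Finsupp.supported k k (D.IT (D.kerT p))) h1).mpr (neg_mem ?_)
    exact kerK_induction (Q := fun x => x.2 ∈ Finsupp.supported k k (D.IT (D.kerT p))) hΔ hε
      (kerT_le hV) (zero_mem _) (fun x y hx hy => add_mem hx hy) (fun x g hx h1 h2 h3 h4 => h2) h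
  -- If `ζ(z) = 0`, then `z` itself is a relation in `V`, and `V` survives in the quotient.
  ζ_injective := by
    rw [injective_iff_map_eq_zero]
    intro z hz
    have h1 := mk_neg_kerζ_mem (hW := hW) z
    rw [hz, neg_zero, mem_kerK] at h1
    simp only [map_zero, add_zero] at h1
    exact Subtype.ext (hV _ h1)
  ζ_hom :=
    { act := fun g => LinearMap.ext fun z => by
        have h1 := act_mem_kerK _ (kerT_le hV) g (mk_neg_kerζ_mem (hW := hW) z)
        obtain ⟨hx, h2⟩ := exists_of_mem_kerK (hW := hW) h1
        refine h2.trans ?_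
        rw [map_neg, neg_neg]
        rfl
      coact := LinearMap.ext fun z => by
        obtain ⟨_, ⟨x, h⟩, rfl⟩ := z
        -- Membership in `Z` is carried along so that the induction on relations can be stated for
        -- pairs; for a homogeneous relation both parts have the same degree, which is colinearity.
        have key : ∃ hx : x.1 ∈ LinearMap.range (kerFst p),
            (D.WΓ (D.kerT p) (kerT_le hV)).coact (kerζ hW ⟨x.1, hx⟩) =
              (kerζ hW).lTensor _ (((D.VΓ (D.kerT p) (kerT_le hV)).restrict _
                (isSubobject_range hΔ hε (kerT_le hV))).coact ⟨x.1, hx⟩) := by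
          refine kerK_induction (Q := fun x => ∃ hx : x.1 ∈ LinearMap.range (kerFst p),
            (D.WΓ (D.kerT p) (kerT_le hV)).coact (kerζ hW ⟨x.1, hx⟩) =
              (kerζ hW).lTensor _ (((D.VΓ (D.kerT p) (kerT_le hV)).restrict _
                (isSubobject_range hΔ hε (kerT_le hV))).coact ⟨x.1, hx⟩)) hΔ hε (kerT_le hV)
            ?_ ?_ (fun x g hx h1 h2 h3 h4 => ?_) h
          · refine ⟨zero_mem _, ?_⟩
            have e : (⟨(0 : (I →₀ k) × (I →₀ k)).1, zero_mem _⟩ : LinearMap.range (kerFst p)) = 0 :=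
              rfl
            rw [e, map_zero, map_zero, map_zero, map_zero]
          · rintro x y ⟨hx, h1⟩ ⟨hy, h2⟩
            refine ⟨add_mem hx hy, ?_⟩
            have e : (⟨(x + y).1, add_mem hx hy⟩ : LinearMap.range (kerFst p)) =
              ⟨x.1, hx⟩ + ⟨y.1, hy⟩ := rfl
            rw [e, map_add, map_add, map_add, map_add, h1, h2]
          · obtain ⟨hx', h5⟩ := exists_of_mem_kerK (hW := hW) hx
            refine ⟨hx', ?_⟩
            have h6 : ((D.VΓ (D.kerT p) (kerT_le hV)).restrict _
                (isSubobject_range hΔ hε (kerT_le hV))).coact ⟨x.1, hx'⟩ =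
                  MonoidAlgebra.single g 1 ⊗ₜ ⟨x.1, hx'⟩ := restrict_isHomog h3
            rw [h6, LinearMap.lTensor_tmul, h5, map_neg, h4, TensorProduct.tmul_neg]
        exact key.2 }

lemma mem_thinData_K_iff {x : (I →₀ k) × (I →₀ k)} :
    x ∈ (thinData hΔ hε hV hW).K ↔ x ∈ kerK p := by
  constructor
  · rintro ⟨z, rfl⟩
    exact mk_neg_kerζ_mem (hW := hW) z
  · intro h
    obtain ⟨hx, h1⟩ := exists_of_mem_kerK (hW := hW) h
    refine ⟨⟨x.1, hx⟩, Prod.ext rfl ?_⟩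
    exact (congrArg Neg.neg h1).trans (neg_neg _)

end Bialg

namespace ThinData

variable (P : D.ThinData)

section

variable {E E' : Type*} [Ring E] [Algebra k E] [Ring E'] [Algebra k E'] (p : D.Double →ₐ[k] E)
  (hp : ∀ t ∈ P.T, p (D.grp t) = 1) (f : E →ₐ[k] E')

/-- The comparison map is natural in the target, since it is determined by straightened products. -/
lemma toQuot_comp (hp' : ∀ t ∈ P.T, f.comp p (D.grp t) = 1) (x : P.U.Boson) :
    P.toQuot (f.comp p) hp' x = f (P.toQuot p hp x) := by
  have h1 : D.fromV P.T P.T_le id (f.comp p) hp' = f.comp (D.fromV P.T P.T_le id p hp) :=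
    Boson.algHom_ext (fun v => by simp) fun t => by
      induction t using QuotientGroup.induction_on with
      | H t => simp
  have h2 : D.fromW P.T P.T_le P.incS (f.comp p) hp' = f.comp (D.fromW P.T P.T_le P.incS p hp) :=
    Boson.algHom_ext (fun v => by simp) fun t => by
      induction t using QuotientGroup.induction_on with
      | H t => simp
  induction x using P.link.j_induction P.isHom_equiv with
  | add x y hx hy => simp only [map_add, hx, hy]
  | mul b c => rw [toQuot_mul, toQuot_mul, map_mul, h1, h2]; rfl

end

section

variable {E : Type*} [Ring E] [Bialgebra k E] (p : D.Double →ₐ[k] E)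
  (hp : ∀ t ∈ P.T, p (D.grp t) = 1)
  (hε : ∀ x, Coalgebra.counit (R := k) (p x) = Coalgebra.counit (R := k) x)

include hε in
lemma counit_toQuot (x : P.U.Boson) :
    Coalgebra.counit (R := k) (P.toQuot p hp x) = Coalgebra.counit (R := k) x := by
  have h1 : (Bialgebra.counitAlgHom k E).comp (D.fromV P.T P.T_le id p hp) =
      Bialgebra.counitAlgHom k _ :=
    Boson.algHom_ext (fun v => by simp [hε, DoubleData.v]) fun t => by
      induction t using QuotientGroup.induction_on with
      | H t => simp [hε, counit_grp]
  have h2 : (Bialgebra.counitAlgHom k E).comp (D.fromW P.T P.T_le P.incS p hp) =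
      Bialgebra.counitAlgHom k _ :=
    Boson.algHom_ext (fun v => by simp [hε, DoubleData.w]) fun t => by
      induction t using QuotientGroup.induction_on with
      | H t => simp [hε, counit_grp]
  induction x using P.link.j_induction P.isHom_equiv with
  | add x y hx hy => simp only [map_add, hx, hy]
  | mul b c =>
    have h3 := congr($h1 b)
    have h4 := congr($h2 c)
    simp only [AlgHom.comp_apply, Bialgebra.counitAlgHom_apply] at h3 h4
    rw [toQuot_mul, Bialgebra.counit_mul, h3, h4, Bialgebra.counit_mul,
      CoalgHomClass.counit_comp_apply, CoalgHomClass.counit_comp_apply]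

end

end ThinData

end DoubleData

/-! ### Thin Hopf ideals and the final isomorphism. -/

namespace DoubleData

open YetterDrinfeld

variable {k F G I : Type*} [Field k] [CommGroup F] [CommGroup G] {D : DoubleData k F G I}

lemma chi_ne_one_of_or {i : I} (h : D.τ₀ (D.f i) ≠ 1 ∨ D.τ₀.flip (D.g i) ≠ 1) : D.chi i ≠ 1 := by
  intro h1
  rcases h with h | h
  · refine h (MonoidHom.ext fun g => ?_)
    simpa [chi_apply] using congr($h1 (1, g))
  · refine h (MonoidHom.ext fun f => ?_)
    simpa [chi_apply] using congr($h1 (f, 1))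

lemma exists_thinData {E : Type*} [Ring E] [Bialgebra k E] {p : D.Double →ₐ[k] E}
    (hΔ : ∀ x, Coalgebra.comul (R := k) (p x) =
      Algebra.TensorProduct.map p p (Coalgebra.comul (R := k) x))
    (hε : ∀ x, Coalgebra.counit (R := k) (p x) = Coalgebra.counit (R := k) x)
    (hV : ∀ x, p (D.v x) = 0 → x = 0) (hW : ∀ x, p (D.w x) = 0 → x = 0) :
    ∃ P : D.ThinData, (∀ t, t ∈ P.T ↔ p (D.grp t) = 1) ∧
      ∀ x y, (x, y) ∈ P.K ↔ p (D.v x) + p (D.w y) = 0 :=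
  ⟨thinData hΔ hε hV hW, fun _ => Iff.rfl, fun _ _ => mem_thinData_K_iff hΔ hε⟩

section Ideal

variable {𝔞 : Ideal D.Double} [𝔞.IsTwoSided]

lemma mkₐ_eq_zero {x : D.Double} : Ideal.Quotient.mkₐ k 𝔞 x = 0 ↔ x ∈ 𝔞 :=
  Ideal.Quotient.eq_zero_iff_mem

lemma mkₐ_grp_eq_one {t : F × G} :
    Ideal.Quotient.mkₐ k 𝔞 (D.grp t) = 1 ↔ D.grp t - 1 ∈ 𝔞 := by
  rw [← mkₐ_eq_zero (k := k), map_sub, map_one, sub_eq_zero]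

/-- Thinness speaks of the image of `V` in `𝒟`; injectivity of `V → 𝒟` turns it into a statement
about vectors. -/
lemma IsThin.v_eq_zero (h : D.IsThin 𝔞) {x : I →₀ k} (hx : D.v x ∈ 𝔞) : x = 0 := by
  have : D.v x ∈ LinearMap.range D.v ⊓ 𝔞.restrictScalars k := ⟨⟨x, rfl⟩, hx⟩
  rw [h.1, Submodule.mem_bot] at this
  exact D.v_injective (this.trans (map_zero _).symm)

lemma IsThin.w_eq_zero (h : D.IsThin 𝔞) {x : I →₀ k} (hx : D.w x ∈ 𝔞) : x = 0 := by
  have : D.w x ∈ LinearMap.range D.w ⊓ 𝔞.restrictScalars k := ⟨⟨x, rfl⟩, hx⟩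
  rw [h.2, Submodule.mem_bot] at this
  exact D.w_injective (this.trans (map_zero _).symm)

variable [𝔞.IsHopfIdeal k]

lemma comul_mkₐ (x : D.Double) : Coalgebra.comul (R := k) (Ideal.Quotient.mkₐ k 𝔞 x) =
    Algebra.TensorProduct.map (Ideal.Quotient.mkₐ k 𝔞) (Ideal.Quotient.mkₐ k 𝔞)
      (Coalgebra.comul (R := k) x) := Bialgebra.Quotient.comul_mk 𝔞 x

lemma counit_mkₐ (x : D.Double) : Coalgebra.counit (R := k) (Ideal.Quotient.mkₐ k 𝔞 x) =
    Coalgebra.counit (R := k) x := Bialgebra.Quotient.counit_mk 𝔞 x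

end Ideal

namespace ThinData

variable (P : D.ThinData) {𝔞 : Ideal D.Double} [𝔞.IsTwoSided]

lemma mkₐ_grp (h : P.ideal ≤ 𝔞) : ∀ t ∈ P.T, Ideal.Quotient.mkₐ k 𝔞 (D.grp t) = 1 :=
  fun _ ht => mkₐ_grp_eq_one.2 (h (P.grp_sub_one_mem ht))

lemma mkₐ_v (h : P.ideal ≤ 𝔞) (z : P.Z) :
    Ideal.Quotient.mkₐ k 𝔞 (D.v z) = Ideal.Quotient.mkₐ k 𝔞 (D.w (P.ζ z)) := by
  rw [← sub_eq_zero, ← map_sub, mkₐ_eq_zero]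
  exact h (P.v_sub_w_mem z)

variable [𝔞.IsHopfIdeal k] (hχ : ∀ i, D.chi i ≠ 1) (hle : P.ideal ≤ 𝔞)
  (hT : ∀ t, D.grp t - 1 ∈ 𝔞 → t ∈ P.T) (hK : ∀ x y, D.v x + D.w y ∈ 𝔞 → (x, y) ∈ P.K)

include hχ hT hK in
lemma toQuot_mkₐ_injective :
    Function.Injective (P.toQuot (Ideal.Quotient.mkₐ k 𝔞) (P.mkₐ_grp hle)) :=
  P.toQuot_injective _ (P.mkₐ_grp hle) (P.mkₐ_v hle) comul_mkₐ counit_mkₐ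
    (fun t ht => hT t (mkₐ_grp_eq_one.1 ht))
    (fun x y h => hK x y (by rwa [← mkₐ_eq_zero (k := k), map_add])) hχ

include hχ hle hT hK in
-- The comparison map is onto `𝒟 / 𝔞(T, Z, ζ)`, and its composite with the projection to `𝒟 / 𝔞` is
-- injective. So the projection is injective, without any coalgebra structure on the first quotient.
lemma eq_ideal : 𝔞 = P.ideal := by
  refine le_antisymm (fun x hx => ?_) hle
  obtain ⟨y, hy⟩ := P.toQuot_surjective (Ideal.Quotient.mkₐ k P.ideal) (P.mkₐ_grp le_rfl)
    (P.mkₐ_v le_rfl) (Ideal.Quotient.mkₐ_surjective k _) (Ideal.Quotient.mkₐ k P.ideal x)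
  have h1 := P.toQuot_comp (Ideal.Quotient.mkₐ k P.ideal) (P.mkₐ_grp le_rfl)
    (Ideal.Quotient.factorₐ k hle) (P.mkₐ_grp hle) y
  rw [hy] at h1
  have h2 : P.toQuot (Ideal.Quotient.mkₐ k 𝔞) (P.mkₐ_grp hle) y = 0 :=
    h1.trans (mkₐ_eq_zero.2 hx)
  have h3 := P.toQuot_mkₐ_injective hχ hle hT hK (h2.trans (map_zero _).symm)
  rw [h3, map_zero] at hy
  exact mkₐ_eq_zero.1 hy.symm

/-- The isomorphism of coalgebras `𝔅(U) ⋊ Γ ≅ 𝒟 / 𝔞`. -/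
def quotEquiv : P.U.Boson ≃ₗc[k] D.Double ⧸ 𝔞 :=
  CoalgEquiv.ofBijective (f := ({
      toLinearMap := P.toQuot (Ideal.Quotient.mkₐ k 𝔞) (P.mkₐ_grp hle)
      counit_comp := LinearMap.ext
        (P.counit_toQuot (Ideal.Quotient.mkₐ k 𝔞) (P.mkₐ_grp hle) counit_mkₐ :)
      map_comp_comul := LinearMap.ext
        (P.comul_toQuot (Ideal.Quotient.mkₐ k 𝔞) (P.mkₐ_grp hle) comul_mkₐ :) } :
      P.U.Boson →ₗc[k] D.Double ⧸ 𝔞))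
    ⟨P.toQuot_mkₐ_injective hχ hle hT hK,
      P.toQuot_surjective _ _ (P.mkₐ_v hle) (Ideal.Quotient.mkₐ_surjective k 𝔞)⟩

include hχ hle hT hK in
-- The comparison map is injective and turns the deformed product into the product of `𝒟 / 𝔞`, where
-- the relations are those of `𝒟`.
lemma isLinkingCocycle_σ : P.IsLinkingCocycle P.σ where
  toIsTwoCocycle := P.isTwoCocycle_σ
  linking_ne i j _ _ hij := by
    apply P.toQuot_mkₐ_injective hχ hle hT hK
    rw [map_smul, toQuot_deformedMul, toQuot_deformedMul, P.toQuot_vU _ _ (P.mkₐ_v hle),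
      P.toQuot_wU _ _ (P.mkₐ_v hle)]
    exact wv_ne i j hij
  linking_eq i _ := by
    apply P.toQuot_mkₐ_injective hχ hle hT hK
    rw [map_add, map_smul, map_sub, toQuot_deformedMul, toQuot_deformedMul,
      P.toQuot_vU _ _ (P.mkₐ_v hle), P.toQuot_wU _ _ (P.mkₐ_v hle), toQuot_ofU, toQuot_one]
    exact wv_eq i

end ThinData

end DoubleData

end

theorem theorem5p4 {k F G I : Type*} [Field k] [CommGroup F] [CommGroup G]
    (D : DoubleData k F G I)
    (h : ∀ i, D.τ₀ (D.f i) ≠ 1 ∨ D.τ₀.flip (D.g i) ≠ 1)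
    (𝔞 : Ideal D.Double) [𝔞.IsTwoSided] [𝔞.IsHopfIdeal k] (hthin : D.IsThin 𝔞) :
    (∃ P : D.ThinData, 𝔞 = P.ideal) ∧
    ∀ P : D.ThinData, 𝔞 = P.ideal →
      ∃ σ : (WithConv (P.U.Boson ⊗[k] P.U.Boson →ₗ[k] k))ˣ, P.IsLinkingCocycle σ ∧
        ∃ e : (D.Double ⧸ 𝔞) ≃ₗc[k] P.U.Boson,
          e 1 = 1 ∧ (∀ x y, e (x * y) = deformedMul σ (e x ⊗ₜ e y)) ∧
          (∀ t, e (Ideal.Quotient.mk 𝔞 (D.grp t)) = P.ofU t) ∧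
          (∀ x, e (Ideal.Quotient.mk 𝔞 (D.v x)) = P.vU x) ∧
          (∀ x, e (Ideal.Quotient.mk 𝔞 (D.w x)) = P.wU x) := by
  have hχ : ∀ i, D.chi i ≠ 1 := fun i => DoubleData.chi_ne_one_of_or (h i)
  refine ⟨?_, fun P hP => ?_⟩
  · have hV : ∀ x, Ideal.Quotient.mkₐ k 𝔞 (D.v x) = 0 → x = 0 :=
      fun x hx => hthin.v_eq_zero (DoubleData.mkₐ_eq_zero.1 hx)
    have hW : ∀ x, Ideal.Quotient.mkₐ k 𝔞 (D.w x) = 0 → x = 0 :=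
      fun x hx => hthin.w_eq_zero (DoubleData.mkₐ_eq_zero.1 hx)
    obtain ⟨P, hT, hK⟩ := DoubleData.exists_thinData (p := Ideal.Quotient.mkₐ k 𝔞)
      DoubleData.comul_mkₐ DoubleData.counit_mkₐ hV hW
    refine ⟨P, P.eq_ideal hχ
      (P.ideal_le (fun t ht => DoubleData.mkₐ_grp_eq_one.1 ((hT t).1 ht)) fun z => ?_)
      (fun t ht => (hT t).2 (DoubleData.mkₐ_grp_eq_one.2 ht)) fun x y hxy => (hK x y).2 ?_⟩
    -- The relation space of `P` is exactly the set of pairs that vanish in the quotient, and it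
    -- contains `(z, -ζ(z))`.
    · have h1 := (hK z (-P.ζ z)).1 ⟨z, rfl⟩
      rwa [← map_add, DoubleData.mkₐ_eq_zero, map_neg, ← sub_eq_add_neg] at h1
    · rw [← map_add]
      exact DoubleData.mkₐ_eq_zero.2 hxy
  · have hle : P.ideal ≤ 𝔞 := hP.ge
    -- Here `P` is an arbitrary presentation of `𝔞`, so its `T` and `K` are recovered from the ideal
    -- by the two representations.
    have hT : ∀ t, D.grp t - 1 ∈ 𝔞 → t ∈ P.T := fun t ht => by
      rw [hP] at ht
      exact P.mem_T_of_grp_sub_one_mem ht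
    have hK : ∀ x y, D.v x + D.w y ∈ 𝔞 → (x, y) ∈ P.K := fun x y hxy => by
      rw [hP] at hxy
      exact P.mem_K_of_add_mem hxy
    let j := P.quotEquiv hχ hle hT hK
    -- The isomorphism sought is the inverse of the comparison map, so each required formula is a
    -- formula for the comparison map read backwards.
    have hj : ∀ x y, j x = y → j.symm y = x := fun x y hxy => by rw [← hxy, j.symm_apply_apply]
    refine ⟨P.σ, P.isLinkingCocycle_σ hχ hle hT hK, j.symm, hj _ _ (P.toQuot_one _ _),
      fun x y => hj _ _ ?_, fun t => hj _ _ (P.toQuot_ofU _ _ t),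
      fun x => hj _ _ (P.toQuot_vU _ _ (P.mkₐ_v hle) x),
      fun x => hj _ _ (P.toQuot_wU _ _ (P.mkₐ_v hle) x)⟩
    refine (P.toQuot_deformedMul _ (P.mkₐ_grp hle) _ _).trans ?_
    exact congrArg₂ (· * ·) (j.apply_symm_apply x) (j.apply_symm_apply y)
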